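/- **Proposition 3.2 (short-time estimate).** Let $\mathbb T^3=\mathbb R^3/\mathbb Z^3$, and use the Fourier transforms $\hat u(k)=\int_{\mathbb T^3}u(x)e^{-2\pi i k\cdot x}dx$, $\tilde g(\eta)=\int_{\mathbb R^3}g(v)e^{-2\pi i\eta\cdot v}dv$, $\hat f(k,\eta)=\int_{\mathbb T^3}\int_{\mathbb R^3}f(x,v)e^{-2\pi i(k\cdot x+\eta\cdot v)}dv\,dx$ for $k\in\mathbb Z^3$, $\eta\in\mathbb R^3$. Consider $$\partial_t f+v\cdot\nabla_x f+\tfrac{q}{m}E\cdot\nabla_v f=\nu(\rho f^0-f),\quad E=\nabla W*\rho,\quad \rho(t,x)=\int_{\mathbb R^3}f(t,x,v)\,dv,\quad f(0,\cdot,\cdot)=f_0,$$ with $q\in\mathbb R$, $m>0$. There is a function $C=C(C_0,\delta_0)$ with the following property. For all $0<\lambda<\lambda_0$, $0<\mu<\mu_0$, $\beta>0$, $\gamma>1$ there is $\varepsilon>0$ (depending only on these six numbers), and for all $C_0,\nu_0,m>0$, $q\in\mathbb R$ there is $T>0$ (depending only on all the numbers so far), such that the following holds for all $0<\delta_0\le\varepsilon$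 and all $\nu\in(0,\nu_0]$. Assume that * $W:\mathbb T^3\to\mathbb R$ is integrable, $\hat W(0)=0$ and $|\hat W(k)|\le \frac1{1+|k|^\gamma}$ for all $k$; * $f^0:\mathbb R^3\to[0,\infty)$ is real analytic, $\sup_{\eta}e^{2\pi\lambda_0|\eta|}|\tilde f^0(\eta)|\le C_0$ and $\sum_{n\in\mathbb N_0^3}\frac{\lambda_0^{n}}{n!}\|\nabla_v^nf^0\|_{L^1}\le C_0$, where $\lambda_0^n=\lambda_0^{n_1+n_2+n_3}$ and $n!=n_1!\,n_2!\,n_3!$; * $f_0:\mathbb T^3\times\mathbb R^3\to\mathbb R$ is continuous and $$\sup_{k,\eta}e^{2\pi\lambda_0|\eta|}e^{2\pi\mu_0|k|}\,|\widehat{(f_0-f^0)}(k,\eta)|+\int_{\mathbb T^3}\int_{\mathbb R^3}|f_0-f^0|\,e^{\beta|v|}\,dv\,dx\le\delta_0 .$$ Then the system has an analytic classical solution $f$ on $[0,T]$, and every analytic classical solution $f$ on $[0,T]$ satisfies, for all $t\in(0,T]$, $k\in\mathbb Z^3$, $\eta\in\mathbb R^3$, $$|\hat f(t,k,\eta)-\hat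 f_0(k,\eta)|\le C(C_0,\delta_0)\,e^{-2\pi\lambda|\eta+kt|}e^{-2\pi\mu|k|},$$ $$|\hat\rho(t,k)-\hat\rho_0(k)|\le C(C_0,\delta_0)\,e^{-2\pi(\lambda t+\mu)|k|},\qquad |\hat E(t,k)|\le C(C_0,\delta_0)\,e^{-2\pi\lambda|k|t}e^{-2\pi\mu|k|},$$ where $\hat\rho_0(k)$ are the Fourier coefficients of the constant function $\rho_0=\int_{\mathbb T^3}\int_{\mathbb R^3}f_0\,dv\,dx$. Here an analytic classical solution on $[0,T]$ is a function $f\in C^1([0,T]\times\mathbb T^3\times\mathbb R^3)$, smooth in $(x,v)$ for each $t$, with $f(t,x,\cdot)\in L^1(\mathbb R^3)$ and $W*\rho(t,\cdot)$ differentiable, which satisfies the equation and the initial condition pointwise, and for which there is $\sigma>0$ with $\sup_{0\le t\le T}\sum_{l\in\mathbb Z^3}\sum_{n\in\mathbb N_0^3}\frac{\sigma^{n}}{n!}e^{2\pi\sigma|l|}\|\nabla_v^n\hat f(t,l,v)\|_{L^1(dv)}<\infty$, $\hat f(t,l,v)$ being the Fourier coefficient in $x$. -/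

import Mathlib

open MeasureTheory Set
open scoped ENNReal ContDiff

noncomputable section

namespace WeakVP

/-- Three-dimensional Euclidean space: velocities, dual velocities, and lifts of points of the
torus `ℝ³/ℤ³`.  Functions on the torus are `ℤ³`-periodic functions on `E3`. -/
abbrev E3 : Type := EuclideanSpace ℝ (Fin 3)

/-- The frequency `k ∈ ℤ³`, as a vector of `ℝ³`. -/
def freq (k : Fin 3 → ℤ) : E3 := WithLp.toLp 2 (fun i => (k i : ℝ))

/-- A fundamental domain of the torus `ℝ³/ℤ³`; integrals over the torus are integrals over it. -/
def cell : Set E3 := {x | ∀ i, x i ∈ Ico (0 : ℝ) 1}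

/-- `u` is a function on the torus `ℝ³/ℤ³`. -/
def TorusPeriodic {β : Type*} (u : E3 → β) : Prop :=
  ∀ (x : E3) (k : Fin 3 → ℤ), u (x + freq k) = u x

/-- Fourier coefficient `û(k) = ∫_{𝕋³} u(x) e^{-2πi k·x} dx` of a function on the torus. -/
def torusFourier (u : E3 → ℂ) (k : Fin 3 → ℤ) : ℂ :=
  ∫ x in cell, Complex.exp (-(2 * Real.pi * inner ℝ (freq k) x : ℝ) * Complex.I) * u x

/-- Fourier transform `∫_{ℝ³} g(v) e^{-2πi η·v} dv` of a function of the velocity. -/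
def velFourier (g : E3 → ℂ) (η : E3) : ℂ :=
  ∫ v, Complex.exp (-(2 * Real.pi * inner ℝ η v : ℝ) * Complex.I) * g v

/-- Fourier transform in both variables,
`f̂(k,η) = ∫_{𝕋³} ∫_{ℝ³} f(x,v) e^{-2πi (k·x + η·v)} dv dx`. -/
def phaseFourier (f : E3 → E3 → ℝ) (k : Fin 3 → ℤ) (η : E3) : ℂ :=
  torusFourier (fun x => velFourier (fun v => (f x v : ℂ)) η) k

/-- Fourier coefficient of a vector field on the torus, componentwise, with the Hermitian norm. -/
def fieldFourier (E : E3 → E3) (k : Fin 3 → ℤ) : EuclideanSpace ℂ (Fin 3) :=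
  WithLp.toLp 2 (fun i => torusFourier (fun x => ((E x i : ℝ) : ℂ)) k)

/-- The partial derivative `∂_i g`. -/
def pderiv {F : Type*} [NormedAddCommGroup F] [NormedSpace ℝ F] (i : Fin 3) (g : E3 → F) :
    E3 → F :=
  fun v => fderiv ℝ g v (EuclideanSpace.single i 1)

/-- The mixed derivative `∂^n g = ∂_0^{n_0} ∂_1^{n_1} ∂_2^{n_2} g` for a multi-index `n ∈ ℕ³`. -/
def mderiv {F : Type*} [NormedAddCommGroup F] [NormedSpace ℝ F] (n : Fin 3 → ℕ) (g : E3 → F) :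
    E3 → F :=
  (pderiv 0)^[n 0] ((pderiv 1)^[n 1] ((pderiv 2)^[n 2] g))

/-- The weight `lam^n / n!` of a multi-index: `lam^{n_0+n_1+n_2} / (n_0! n_1! n_2!)`. -/
def weight (lam : ℝ) (n : Fin 3 → ℕ) : ℝ := ∏ i, lam ^ n i / (n i).factorial

/-- The analytic norm `∑_n lam^n/n! ‖∂^n g‖_{L¹}`, with values in `[0,∞]`. -/
def analyticL1Norm {F : Type*} [NormedAddCommGroup F] [NormedSpace ℝ F] (lam : ℝ) (g : E3 → F) :
    ℝ≥0∞ :=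
  ∑' n : Fin 3 → ℕ, ENNReal.ofReal (weight lam n) * ∫⁻ v, ‖mderiv n g v‖ₑ

/-- The hybrid analytic norm `‖f‖_{𝒵^{lam,mu;1}}
= ∑_{l ∈ ℤ³} ∑_{n ∈ ℕ³} lam^n/n! e^{2π mu |l|} ‖∂_v^n f̂(l,v)‖_{L¹(dv)}`,
where `f̂(l,v)` is the Fourier coefficient in `x`. -/
def hybridNorm (lam mu : ℝ) (f : E3 → E3 → ℝ) : ℝ≥0∞ :=
  ∑' l : Fin 3 → ℤ, ENNReal.ofReal (Real.exp (2 * Real.pi * mu * ‖freq l‖)) *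
    analyticL1Norm lam (fun v => torusFourier (fun x => (f x v : ℂ)) l)

/-- The density `ρ(x) = ∫ f(x,v) dv`. -/
def density (f : E3 → E3 → ℝ) (x : E3) : ℝ := ∫ v, f x v

/-- The convolution `W ∗ ρ` on the torus. -/
def potential (W : E3 → ℝ) (f : E3 → E3 → ℝ) (x : E3) : ℝ :=
  ∫ y in cell, W (x - y) * density f y

/-- The field `E = ∇W ∗ ρ = ∇(W ∗ ρ)`. -/
def field (W : E3 → ℝ) (f : E3 → E3 → ℝ) (x : E3) : E3 := gradient (potential W f) x

/-- The Fourier coefficients of the constant function on the torus that equals the total mass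
`∫∫ f dv dx`: the mass at `k = 0`, and `0` at `k ≠ 0`. -/
def meanFourier (f : E3 → E3 → ℝ) (k : Fin 3 → ℤ) : ℂ :=
  torusFourier (fun _ => ((∫ x in cell, density f x : ℝ) : ℂ)) k

/-- The assumptions on the interaction potential `W : 𝕋³ → ℝ`. -/
structure IsPotential (γ : ℝ) (W : E3 → ℝ) : Prop where
  periodic : TorusPeriodic W
  integrable : IntegrableOn W cell
  zero_mode : torusFourier (fun x => (W x : ℂ)) 0 = 0
  decay : ∀ k : Fin 3 → ℤ, ‖torusFourier (fun x => (W x : ℂ)) k‖ ≤ 1 / (1 + ‖freq k‖ ^ γ)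

/-- The assumptions on the analytic velocity profile `f⁰ : ℝ³ → ℝ₊`. -/
structure IsProfile (lam₀ C₀ : ℝ) (p : E3 → ℝ) : Prop where
  nonneg : ∀ v, 0 ≤ p v
  analytic : AnalyticOnNhd ℝ p univ
  fourier_bound : ∀ η : E3,
    Real.exp (2 * Real.pi * lam₀ * ‖η‖) * ‖velFourier (fun v => (p v : ℂ)) η‖ ≤ C₀
  analytic_bound : analyticL1Norm lam₀ p ≤ ENNReal.ofReal C₀

/-- The size of the perturbation `g = f₀ - f⁰` of the profile:
`sup_{k,η} e^{2π lam₀ |η|} e^{2π mu₀ |k|} |ĝ(k,η)| + ∫∫ |g| e^{β|v|} dv dx`, in `[0,∞]`. -/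
def perturbationSize (lam₀ mu₀ β : ℝ) (g : E3 → E3 → ℝ) : ℝ≥0∞ :=
  (⨆ (k : Fin 3 → ℤ) (η : E3),
    ENNReal.ofReal (Real.exp (2 * Real.pi * lam₀ * ‖η‖) * Real.exp (2 * Real.pi * mu₀ * ‖freq k‖) *
      ‖phaseFourier g k η‖)) +
  ∫⁻ x in cell, ∫⁻ v, ENNReal.ofReal (|g x v| * Real.exp (β * ‖v‖))

/-- The initial datum `f₀` is a continuous function on `𝕋³ × ℝ³`, at distance at most `δ₀` from
the profile `p`. -/
structure IsDatum (lam₀ mu₀ β δ₀ : ℝ) (p : E3 → ℝ) (f₀ : E3 → E3 → ℝ) : Prop where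
  periodic : TorusPeriodic f₀
  continuous : Continuous (fun z : E3 × E3 => f₀ z.1 z.2)
  close : perturbationSize lam₀ mu₀ β (fun x v => f₀ x v - p v) ≤ ENNReal.ofReal δ₀

/-- `f` is an analytic classical solution on `[0,T] × 𝕋³ × ℝ³` of
`∂_t f + v·∇_x f + a E·∇_v f = ν (ρ p - f)`, `E = ∇W ∗ ρ`, `ρ = ∫ f dv`, `f(0) = f₀`:
it is `C¹`, smooth in `(x,v)`, satisfies the equation pointwise (with one-sided time derivatives
at the end points), and its analytic norm `𝒵^{σ,σ;1}` is bounded on `[0,T]` for some `σ > 0`. -/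
structure IsAnalyticSolution (a ν T : ℝ) (W : E3 → ℝ) (p : E3 → ℝ) (f₀ : E3 → E3 → ℝ)
    (f : ℝ → E3 → E3 → ℝ) : Prop where
  periodic : ∀ t ∈ Icc 0 T, TorusPeriodic (f t)
  contDiffOn : ContDiffOn ℝ 1 (fun z : ℝ × E3 × E3 => f z.1 z.2.1 z.2.2) (Icc 0 T ×ˢ univ)
  smooth : ∀ t ∈ Icc 0 T, ContDiff ℝ ∞ (fun z : E3 × E3 => f t z.1 z.2)
  analytic : ∃ σ : ℝ, 0 < σ ∧ ∃ M : ℝ, ∀ t ∈ Icc 0 T,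
    hybridNorm σ σ (f t) ≤ ENNReal.ofReal M
  integrable : ∀ t ∈ Icc 0 T, ∀ x, Integrable (f t x)
  potential_diff : ∀ t ∈ Icc 0 T, Differentiable ℝ (potential W (f t))
  equation : ∀ t ∈ Icc 0 T, ∀ x v : E3,
    derivWithin (fun s => f s x v) (Icc 0 T) t
      + inner ℝ v (gradient (fun y => f t y v) x)
      + a * inner ℝ (field W (f t) x) (gradient (f t x) v)
      = ν * (density (f t) x * p v - f t x v)
  initial : ∀ x v, f 0 x v = f₀ x v

end WeakVP

end

namespace WeakVP

/-- The index set `ℤ³` of the Fourier modes of the torus. -/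
abbrev Mode : Type := Fin 3 → ℤ

/-- The unit complex number `e^{2πi r}`. -/
noncomputable def ex (r : ℝ) : ℂ := Complex.exp ((2 * Real.pi * r : ℝ) * Complex.I)

theorem ex_add (r s : ℝ) : ex (r + s) = ex r * ex s := by
  unfold ex; rw [← Complex.exp_add]; congr 1; push_cast; ring

@[simp] theorem ex_zero : ex 0 = 1 := by simp [ex]

@[simp] theorem norm_ex (r : ℝ) : ‖ex r‖ = 1 := Complex.norm_exp_ofReal_mul_I _

theorem ex_int (n : ℤ) : ex n = 1 := by
  unfold ex
  rw [Complex.exp_eq_one_iff]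
  exact ⟨n, by push_cast; ring⟩

theorem conj_ex (r : ℝ) : (starRingEnd ℂ) (ex r) = ex (-r) := by
  unfold ex
  rw [← Complex.exp_conj, map_mul, Complex.conj_ofReal, Complex.conj_I]
  congr 1; push_cast; ring

theorem contDiff_ex {n : WithTop ℕ∞} : ContDiff ℝ n ex := by
  have h : ContDiff ℝ n (fun r : ℝ => ((2 * Real.pi * r : ℝ) : ℂ)) :=
    Complex.ofRealCLM.contDiff.comp (contDiff_const.mul contDiff_id)
  exact Complex.contDiff_exp.comp (h.mul contDiff_const)

@[fun_prop] theorem continuous_ex : Continuous ex := (contDiff_ex (n := 0)).continuous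

theorem hasDerivAt_ex (r : ℝ) : HasDerivAt ex (2 * Real.pi * Complex.I * ex r) r := by
  have h : HasDerivAt (fun r : ℝ => ((2 * Real.pi * r : ℝ) : ℂ) * Complex.I)
      (2 * Real.pi * Complex.I) r := by
    have := ((hasDerivAt_id r).const_mul (2 * Real.pi)).ofReal_comp.mul_const Complex.I
    simpa using this
  have := h.cexp
  rwa [mul_comm (Complex.exp _)] at this

theorem torusFourier_eq (u : E3 → ℂ) (k : Mode) :
    torusFourier u k = ∫ x in cell, ex (-inner ℝ (freq k) x) * u x := by
  unfold torusFourier ex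
  congr with x; congr 3; push_cast; ring

theorem velFourier_eq (g : E3 → ℂ) (η : E3) :
    velFourier g η = ∫ v, ex (-inner ℝ η v) * g v := by
  unfold velFourier ex
  congr with x; congr 3; push_cast; ring

@[simp] theorem freq_apply (k : Mode) (i : Fin 3) : freq k i = k i := rfl

theorem freq_add (k l : Mode) : freq (k + l) = freq k + freq l := by
  ext i; simp

theorem freq_sub (k l : Mode) : freq (k - l) = freq k - freq l := by
  ext i; simp

theorem freq_neg (k : Mode) : freq (-k) = -freq k := by
  ext i; simp

@[simp] theorem freq_zero : freq 0 = 0 := by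
  ext i; simp

theorem inner_freq_freq (k l : Mode) : inner ℝ (freq k) (freq l) = ((∑ i, k i * l i : ℤ) : ℝ) := by
  simp [PiLp.inner_apply, mul_comm]

theorem measurableSet_cell : MeasurableSet cell := by
  have : cell = ⋂ i : Fin 3, (fun x : E3 => x i) ⁻¹' (Ico (0 : ℝ) 1) := by
    ext x; simp [cell]
  rw [this]
  refine MeasurableSet.iInter fun i => ?_
  exact measurableSet_Ico.preimage (by fun_prop)

/-- The torus as a product of circles, each with the Haar probability measure. -/
noncomputable local instance : MeasureSpace UnitAddCircle := ⟨AddCircle.haarAddCircle⟩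

local instance : Measure.IsAddHaarMeasure (volume : Measure UnitAddCircle) :=
  inferInstanceAs (Measure.IsAddHaarMeasure AddCircle.haarAddCircle)

local instance : IsProbabilityMeasure (volume : Measure UnitAddCircle) :=
  inferInstanceAs (IsProbabilityMeasure AddCircle.haarAddCircle)

local instance : Measure.IsNegInvariant (volume : Measure (UnitAddTorus (Fin 3))) := by
  have : Measure.IsNegInvariant (volume : Measure UnitAddCircle) :=
    inferInstanceAs (Measure.IsNegInvariant AddCircle.haarAddCircle)
  exact inferInstanceAs (Measure.IsNegInvariant (Measure.pi fun _ => volume))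

/-- The point of the product of circles represented by a point of `ℝ³`. -/
noncomputable def toTorus (x : E3) : UnitAddTorus (Fin 3) := fun i => (x i : UnitAddCircle)

/-- A representative in `ℝ³` of a point of the product of circles. -/
noncomputable def rep (y : UnitAddTorus (Fin 3)) : E3 :=
  WithLp.toLp 2 fun i => (AddCircle.equivIoc 1 0 (y i)).1

theorem toTorus_rep (y : UnitAddTorus (Fin 3)) : toTorus (rep y) = y := by
  funext i
  simp only [toTorus, rep]
  exact (AddCircle.equivIoc 1 0).symm_apply_apply (y i)

theorem toTorus_add (x y : E3) : toTorus (x + y) = toTorus x + toTorus y := by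
  funext i; simp [toTorus]

theorem toTorus_neg (x : E3) : toTorus (-x) = -toTorus x := by
  funext i; simp [toTorus]

theorem TorusPeriodic.eq_of_toTorus_eq {β : Type*} {u : E3 → β} (hu : TorusPeriodic u) {x y : E3}
    (h : toTorus x = toTorus y) : u x = u y := by
  have h' : ∀ i, ∃ n : ℤ, x i = y i + n := by
    intro i
    have := congrFun h i
    simp only [toTorus] at this
    rw [← sub_eq_zero, ← AddCircle.coe_sub, AddCircle.coe_eq_zero_iff] at this
    obtain ⟨n, hn⟩ := this
    exact ⟨n, by simp at hn; linarith⟩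
  choose k hk using h'
  have : x = y + freq k := by ext i; simp [hk i]
  rw [this, hu]

theorem measurableEmbedding_rep : MeasurableEmbedding rep := by
  have h1 := (UnitAddTorus.measurableEquivPiIoc (0 : Fin 3 → ℝ)).measurableEmbedding
  have h2 : MeasurableSet {x : Fin 3 → ℝ | ∀ i, x i ∈ Ioc ((0 : Fin 3 → ℝ) i) ((0 : Fin 3 → ℝ) i + 1)} :=
    MeasurableSet.univ_pi' (fun i => measurableSet_Ioc)
  have h3 := MeasurableEmbedding.subtype_coe h2
  have h4 := (MeasurableEquiv.toLp 2 (Fin 3 → ℝ)).measurableEmbedding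
  exact h4.comp (h3.comp h1)

theorem cell_ae_eq : (cell : Set E3) =ᵐ[volume]
    (WithLp.ofLp ⁻¹' {x : Fin 3 → ℝ | ∀ i, x i ∈ Ioc ((0 : Fin 3 → ℝ) i) ((0 : Fin 3 → ℝ) i + 1)} :
      Set E3) := by
  have h : {x : Fin 3 → ℝ | ∀ i, x i ∈ Ico (0 : ℝ) 1} =ᵐ[volume]
      {x : Fin 3 → ℝ | ∀ i, x i ∈ Ioc ((0 : Fin 3 → ℝ) i) ((0 : Fin 3 → ℝ) i + 1)} := by
    have h1 := Measure.univ_pi_Ico_ae_eq_Icc (μ := fun _ : Fin 3 => (volume : Measure ℝ))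
      (f := fun _ => 0) (g := fun _ => 1)
    have h2 := Measure.univ_pi_Ioc_ae_eq_Icc (μ := fun _ : Fin 3 => (volume : Measure ℝ))
      (f := fun _ => 0) (g := fun _ => 1)
    have h3 := h1.trans h2.symm
    have e1 : {x : Fin 3 → ℝ | ∀ i, x i ∈ Ico (0 : ℝ) 1} = univ.pi fun _ => Ico 0 1 := by
      ext x; simp
    have e2 : {x : Fin 3 → ℝ | ∀ i, x i ∈ Ioc ((0 : Fin 3 → ℝ) i) ((0 : Fin 3 → ℝ) i + 1)} =
        univ.pi fun _ => Ioc 0 1 := by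
      ext x; simp
    rw [e1, e2]
    exact h3
  exact (PiLp.volume_preserving_ofLp (ι := Fin 3)).quasiMeasurePreserving.preimage_ae_eq h

theorem measurePreserving_rep : MeasurePreserving rep volume (volume.restrict cell) := by
  have h1 := UnitAddTorus.measurePreserving_equivPiIoc (0 : Fin 3 → ℝ)
  have h2 : MeasurableSet {x : Fin 3 → ℝ | ∀ i, x i ∈ Ioc ((0 : Fin 3 → ℝ) i) ((0 : Fin 3 → ℝ) i + 1)} :=
    MeasurableSet.univ_pi' (fun i => measurableSet_Ioc)
  have h3 := measurePreserving_subtype_coe (μa := volume) h2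
  have h4 := (PiLp.volume_preserving_ofLp (ι := Fin 3)).restrict_preimage h2
  have h5 := h4.symm (MeasurableEquiv.toLp 2 (Fin 3 → ℝ)).symm
  rw [Measure.restrict_congr_set cell_ae_eq]
  exact h5.comp (h3.comp h1)

theorem integral_cell {E : Type*} [NormedAddCommGroup E] [NormedSpace ℝ E] (u : E3 → E) :
    ∫ x in cell, u x = ∫ y, u (rep y) :=
  (measurePreserving_rep.integral_comp measurableEmbedding_rep u).symm

theorem integrableOn_cell_iff {E : Type*} [NormedAddCommGroup E] (u : E3 → E) :
    IntegrableOn u cell ↔ Integrable (fun y => u (rep y)) :=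
  (measurePreserving_rep.integrable_comp_emb measurableEmbedding_rep).symm

theorem volume_cell : volume cell = 1 := by
  have := measurePreserving_rep.measure_preimage_emb measurableEmbedding_rep univ
  simpa using this.symm

theorem TorusPeriodic.comp_rep_add {β : Type*} {u : E3 → β} (hu : TorusPeriodic u)
    (y : UnitAddTorus (Fin 3)) (a : E3) : u (rep y + a) = u (rep (y + toTorus a)) :=
  hu.eq_of_toTorus_eq (by simp [toTorus_add, toTorus_rep])

theorem TorusPeriodic.comp_sub_rep {β : Type*} {u : E3 → β} (hu : TorusPeriodic u)
    (y : UnitAddTorus (Fin 3)) (a : E3) : u (a - rep y) = u (rep (toTorus a - y)) :=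
  hu.eq_of_toTorus_eq (by simp [sub_eq_add_neg, toTorus_add, toTorus_rep, toTorus_neg])

theorem TorusPeriodic.integral_add {E : Type*} [NormedAddCommGroup E] [NormedSpace ℝ E]
    {u : E3 → E} (hu : TorusPeriodic u) (a : E3) :
    ∫ x in cell, u (x + a) = ∫ x in cell, u x := by
  rw [integral_cell, integral_cell]
  simp_rw [hu.comp_rep_add]
  exact integral_add_right_eq_self (fun y => u (rep y)) (toTorus a)

theorem TorusPeriodic.integral_sub {E : Type*} [NormedAddCommGroup E] [NormedSpace ℝ E]
    {u : E3 → E} (hu : TorusPeriodic u) (a : E3) :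
    ∫ x in cell, u (a - x) = ∫ x in cell, u x := by
  rw [integral_cell, integral_cell]
  simp_rw [hu.comp_sub_rep]
  exact integral_sub_left_eq_self (fun y => u (rep y)) volume (toTorus a)

theorem TorusPeriodic.integrableOn_sub {E : Type*} [NormedAddCommGroup E]
    {u : E3 → E} (hu : TorusPeriodic u) (h : IntegrableOn u cell) (a : E3) :
    IntegrableOn (fun x => u (a - x)) cell := by
  rw [integrableOn_cell_iff] at h ⊢
  simp_rw [hu.comp_sub_rep]
  exact h.comp_sub_left (toTorus a)

theorem mFourier_toTorus (k : Mode) (x : E3) :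
    UnitAddTorus.mFourier k (toTorus x) = ex (inner ℝ (freq k) x) := by
  simp only [UnitAddTorus.mFourier, ContinuousMap.coe_mk, toTorus, fourier_coe_apply]
  rw [← Complex.exp_sum]
  unfold ex
  congr 1
  simp [PiLp.inner_apply, Finset.mul_sum, Finset.sum_mul]
  refine Finset.sum_congr rfl fun i _ => by ring

theorem periodic_ex (k : Mode) : TorusPeriodic (fun x => ex (inner ℝ (freq k) x)) := by
  intro x l
  simp only [inner_add_right, ex_add, inner_freq_freq, ex_int, mul_one]

theorem periodic_ex_neg (k : Mode) : TorusPeriodic (fun x => ex (-inner ℝ (freq k) x)) := by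
  intro x l
  have := congrArg (starRingEnd ℂ) (periodic_ex k x l)
  simpa only [conj_ex] using this

theorem torusFourier_eq_mFourierCoeff (u : E3 → ℂ) (k : Mode) :
    torusFourier u k = UnitAddTorus.mFourierCoeff (fun y => u (rep y)) k := by
  rw [torusFourier_eq, integral_cell]
  unfold UnitAddTorus.mFourierCoeff
  congr with y
  rw [smul_eq_mul]
  congr 1
  conv_rhs => rw [← toTorus_rep y]
  rw [mFourier_toTorus, freq_neg, inner_neg_left]

theorem continuous_comp_rep {β : Type*} [TopologicalSpace β] {u : E3 → β} (hu : TorusPeriodic u)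
    (hc : Continuous u) : Continuous (fun y => u (rep y)) := by
  have hq : IsOpenQuotientMap (Pi.map fun (_ : Fin 3) (x : ℝ) => (x : UnitAddCircle)) :=
    IsOpenQuotientMap.piMap fun _ => QuotientAddGroup.isOpenQuotientMap_mk
  rw [hq.isQuotientMap.continuous_iff]
  have : (fun y => u (rep y)) ∘ (Pi.map fun (_ : Fin 3) (x : ℝ) => (x : UnitAddCircle)) =
      fun x => u (WithLp.toLp 2 x) := by
    funext x
    exact hu.eq_of_toTorus_eq (by rw [toTorus_rep]; rfl)
  rw [this]
  exact hc.comp (PiLp.continuous_toLp 2 _)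

/-- Fourier inversion on the torus, for continuous functions with summable coefficients. -/
theorem hasSum_torusFourier {u : E3 → ℂ} (hu : TorusPeriodic u) (hc : Continuous u)
    (hs : Summable (torusFourier u)) (x : E3) :
    HasSum (fun k => torusFourier u k * ex (inner ℝ (freq k) x)) (u x) := by
  have h := UnitAddTorus.hasSum_mFourier_series_apply_of_summable
    (f := ⟨fun y => u (rep y), continuous_comp_rep hu hc⟩) (by
      convert hs using 1
      funext k; exact (torusFourier_eq_mFourierCoeff u k).symm) (toTorus x)
  convert h using 1
  · funext k
    rw [mFourier_toTorus, smul_eq_mul, torusFourier_eq_mFourierCoeff]; rfl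
  · exact hu.eq_of_toTorus_eq (by rw [toTorus_rep])

theorem integral_cell_ex (k : Mode) :
    ∫ x in cell, ex (inner ℝ (freq k) x) = if k = 0 then 1 else 0 := by
  have h := orthonormal_iff_ite.mp (UnitAddTorus.orthonormal_mFourier (d := Fin 3)) 0 k
  rw [ContinuousMap.inner_toLp] at h
  rw [integral_cell]
  convert h using 1
  · congr with y
    conv_rhs => rw [← toTorus_rep y]
    simp [mFourier_toTorus]
  · simp [eq_comm]

instance : IsFiniteMeasure (volume.restrict cell) := ⟨by simp [volume_cell]⟩

theorem norm_le_of_mem_cell {x : E3} (hx : x ∈ cell) : ‖x‖ ≤ 2 := by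
  rw [EuclideanSpace.norm_eq, Real.sqrt_le_left (by norm_num)]
  have : ∀ i, ‖x i‖ ^ 2 ≤ 1 := fun i => by
    have := hx i
    rw [Real.norm_eq_abs, sq_abs]
    nlinarith [this.1, this.2]
  calc ∑ i, ‖x i‖ ^ 2 ≤ ∑ i : Fin 3, (1 : ℝ) := Finset.sum_le_sum fun i _ => this i
    _ ≤ 2 ^ 2 := by norm_num

theorem integrableOn_cell {E : Type*} [NormedAddCommGroup E] {u : E3 → E} (hu : Continuous u) :
    IntegrableOn u cell :=
  (hu.continuousOn.integrableOn_compact (isCompact_closedBall (0 : E3) 2)).mono_set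
    fun x hx => by simpa using norm_le_of_mem_cell hx

theorem torusFourier_ex_mul (u : E3 → ℂ) (k l : Mode) :
    torusFourier (fun x => ex (inner ℝ (freq l) x) * u x) k = torusFourier u (k - l) := by
  rw [torusFourier_eq, torusFourier_eq]
  congr with x
  rw [← mul_assoc, ← ex_add, freq_sub, inner_sub_left]
  congr 2; ring

theorem torusFourier_const_mul (u : E3 → ℂ) (c : ℂ) (k : Mode) :
    torusFourier (fun x => c * u x) k = c * torusFourier u k := by
  rw [torusFourier_eq, torusFourier_eq, ← integral_const_mul]
  congr with x; ring

/-- The Fourier coefficients of the product of an absolutely convergent Fourier series and an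
integrable function. -/
theorem hasSum_torusFourier_mul {c : Mode → ℂ} (hc : Summable c) {u : E3 → ℂ}
    (hu : IntegrableOn u cell) {w : E3 → ℂ}
    (hw : ∀ x, HasSum (fun l => c l * ex (inner ℝ (freq l) x)) (w x)) (k : Mode) :
    HasSum (fun l => c l * torusFourier u (k - l)) (torusFourier (fun x => w x * u x) k) := by
  have hm : ∀ l, IntegrableOn (fun x => ex (-inner ℝ (freq k) x) *
      (c l * (ex (inner ℝ (freq l) x) * u x))) cell := by
    intro l
    refine Integrable.bdd_mul (c := 1) (Integrable.const_mul (Integrable.bdd_mul (c := 1) hu ?_ ?_) _) ?_ ?_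
    · exact (Continuous.aestronglyMeasurable (by fun_prop))
    · simp
    · exact (Continuous.aestronglyMeasurable (by fun_prop))
    · simp
  have h := hasSum_integral_of_summable_integral_norm hm (by
    simp only [norm_mul, norm_ex, one_mul, integral_const_mul]
    exact hc.norm.mul_right _)
  have e1 : ∀ l, c l * torusFourier u (k - l) = ∫ x in cell, ex (-inner ℝ (freq k) x) *
      (c l * (ex (inner ℝ (freq l) x) * u x)) := fun l => by
    rw [← torusFourier_ex_mul, ← torusFourier_const_mul, torusFourier_eq]
  have e2 : torusFourier (fun x => w x * u x) k = ∫ x in cell, ∑' l, ex (-inner ℝ (freq k) x) *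
      (c l * (ex (inner ℝ (freq l) x) * u x)) := by
    rw [torusFourier_eq]
    congr with x
    rw [tsum_mul_left]
    congr 1
    rw [← (hw x).tsum_eq, ← tsum_mul_right]
    congr with l; ring
  rw [e2, funext e1]
  exact h

theorem torusFourier_one (k : Mode) : torusFourier (fun _ => 1) k = if k = 0 then 1 else 0 := by
  have := integral_cell_ex (-k)
  simp only [freq_neg, inner_neg_left, neg_eq_zero] at this
  rw [torusFourier_eq]; simpa using this

theorem torusFourier_const (c : ℂ) (k : Mode) :
    torusFourier (fun _ => c) k = if k = 0 then c else 0 := by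
  have := torusFourier_const_mul (fun _ => 1) c k
  simp only [mul_one, torusFourier_one] at this
  rw [this]; split_ifs <;> simp

/-- The coefficients of an absolutely convergent Fourier series are its Fourier coefficients. -/
theorem torusFourier_of_hasSum {c : Mode → ℂ} (hc : Summable c) {w : E3 → ℂ}
    (hw : ∀ x, HasSum (fun l => c l * ex (inner ℝ (freq l) x)) (w x)) (k : Mode) :
    torusFourier w k = c k := by
  have h := hasSum_torusFourier_mul hc (u := fun _ => 1) (integrableOn_cell continuous_const) hw k
  simp only [mul_one, torusFourier_one, sub_eq_zero] at h
  have h2 : HasSum (fun l => c l * if k = l then 1 else 0) (c k) := by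
    convert hasSum_ite_eq k (c k) using 1
    funext l
    by_cases hl : l = k
    · simp [hl]
    · simp [hl, Ne.symm hl]
  exact h.unique h2

/-- Translation of a periodic function multiplies its Fourier coefficients by a phase. -/
theorem torusFourier_comp_add {u : E3 → ℂ} (hu : TorusPeriodic u) (a : E3) (k : Mode) :
    torusFourier (fun x => u (x + a)) k = ex (inner ℝ (freq k) a) * torusFourier u k := by
  have hp : TorusPeriodic (fun x => ex (-inner ℝ (freq k) x) * u x) := fun x l => by
    simp only [hu x l, periodic_ex_neg k x l]
  rw [torusFourier_eq, torusFourier_eq, ← hp.integral_add a, ← integral_const_mul]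
  congr with x
  rw [← mul_assoc, ← ex_add, inner_add_right]
  congr 2; ring

/-- The convolution of a periodic function with a character. -/
theorem integral_cell_sub_mul_ex {W : E3 → ℂ} (hW : TorusPeriodic W) (x : E3) (l : Mode) :
    ∫ y in cell, W (x - y) * ex (inner ℝ (freq l) y) =
      torusFourier W l * ex (inner ℝ (freq l) x) := by
  have hp : TorusPeriodic (fun x => ex (-inner ℝ (freq l) x) * W x) := fun x k => by
    simp only [hW x k, periodic_ex_neg l x k]
  rw [torusFourier_eq, ← hp.integral_sub x, ← integral_mul_const]
  congr with y
  rw [mul_comm, mul_right_comm, ← ex_add, inner_sub_right]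
  congr 2; ring

open scoped FourierTransform

theorem pow_le_exp {c : ℝ} (hc : 0 < c) (n : ℕ) :
    ∃ C : ℝ, 0 < C ∧ ∀ x : ℝ, 0 ≤ x → x ^ n ≤ C * Real.exp (c * x) := by
  refine ⟨n.factorial / c ^ n, by positivity, fun x hx => ?_⟩
  have := Real.pow_div_factorial_le_exp (c * x) (by positivity) n
  rw [div_le_iff₀ (by positivity), mul_pow] at this
  rw [div_mul_eq_mul_div, le_div_iff₀ (by positivity)]
  linarith

theorem integrable_exp_neg_norm {c : ℝ} (hc : 0 < c) :
    Integrable (fun η : E3 => Real.exp (-(c * ‖η‖))) := by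
  obtain ⟨C, hC, h⟩ := pow_le_exp hc 4
  have h1 : Integrable (fun η : E3 => (1 + ‖η‖) ^ (-(4 : ℝ))) :=
    integrable_one_add_norm (by simp; norm_num)
  refine (h1.const_mul (C * Real.exp c)).mono' (by fun_prop) (Filter.Eventually.of_forall fun η => ?_)
  rw [Real.norm_of_nonneg (Real.exp_pos _).le, Real.rpow_neg (by positivity)]
  have h2 := h (1 + ‖η‖) (by positivity)
  rw [show (4 : ℝ) = ((4 : ℕ) : ℝ) by norm_num, Real.rpow_natCast, ← div_eq_mul_inv,
    le_div_iff₀ (by positivity)]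
  calc Real.exp (-(c * ‖η‖)) * (1 + ‖η‖) ^ 4
      ≤ Real.exp (-(c * ‖η‖)) * (C * Real.exp (c * (1 + ‖η‖))) := by gcongr
    _ = C * Real.exp c := by
        rw [mul_left_comm, ← Real.exp_add]; congr 2; ring

/-- Continuous functions of the dual velocity with exponential decay. -/
def ExpDecay (H : E3 → ℂ) : Prop :=
  Continuous H ∧ ∃ c : ℝ, 0 < c ∧ ∃ C : ℝ, ∀ η, ‖H η‖ ≤ C * Real.exp (-(c * ‖η‖))

theorem ExpDecay.integrable {H : E3 → ℂ} (h : ExpDecay H) : Integrable H := by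
  obtain ⟨hc, c, hc0, C, hC⟩ := h
  exact ((integrable_exp_neg_norm hc0).const_mul C).mono' hc.aestronglyMeasurable
    (Filter.Eventually.of_forall hC)

/-- The symbol `2πi η_i` of the partial derivative `∂_i`. -/
noncomputable def dsym (i : Fin 3) (η : E3) : ℂ := 2 * Real.pi * Complex.I * (η i : ℂ)

/-- The symbol `(2πi η)^n` of the mixed derivative `∂^n`. -/
noncomputable def mono (n : Fin 3 → ℕ) (η : E3) : ℂ := ∏ i, dsym i η ^ n i

@[fun_prop] theorem continuous_dsym (i : Fin 3) : Continuous (dsym i) := by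
  unfold dsym; fun_prop

theorem abs_apply_le_norm (η : E3) (i : Fin 3) : |η i| ≤ ‖η‖ := by
  simpa using PiLp.norm_apply_le η i

theorem inner_single_one (η : E3) (i : Fin 3) :
    inner ℝ η (EuclideanSpace.single i (1 : ℝ)) = η i := by
  rw [EuclideanSpace.inner_single_right]; simp

theorem norm_dsym (i : Fin 3) (η : E3) : ‖dsym i η‖ = 2 * Real.pi * |η i| := by
  simp [dsym, abs_of_pos Real.pi_pos]

theorem norm_dsym_le (i : Fin 3) (η : E3) : ‖dsym i η‖ ≤ 2 * Real.pi * ‖η‖ := by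
  rw [norm_dsym]
  have := abs_apply_le_norm η i
  gcongr

theorem ExpDecay.dsym_mul {H : E3 → ℂ} (h : ExpDecay H) (i : Fin 3) :
    ExpDecay (fun η => dsym i η * H η) := by
  obtain ⟨hc, c, hc0, C, hC⟩ := h
  obtain ⟨D, hD, h1⟩ := pow_le_exp (half_pos hc0) 1
  refine ⟨by fun_prop, c / 2, half_pos hc0, 2 * Real.pi * D * C, fun η => ?_⟩
  have h0 : 0 ≤ C * Real.exp (-(c * ‖η‖)) := (norm_nonneg _).trans (hC η)
  have h2 := h1 ‖η‖ (norm_nonneg _)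
  rw [pow_one] at h2
  calc ‖dsym i η * H η‖ ≤ (2 * Real.pi * ‖η‖) * (C * Real.exp (-(c * ‖η‖))) := by
        rw [norm_mul]
        exact mul_le_mul (norm_dsym_le i η) (hC η) (norm_nonneg _) (by positivity)
    _ ≤ (2 * Real.pi * (D * Real.exp (c / 2 * ‖η‖))) * (C * Real.exp (-(c * ‖η‖))) := by gcongr
    _ = 2 * Real.pi * D * C * (Real.exp (c / 2 * ‖η‖) * Real.exp (-(c * ‖η‖))) := by ring
    _ = 2 * Real.pi * D * C * Real.exp (-(c / 2 * ‖η‖)) := by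
        rw [← Real.exp_add]; congr 2; ring

theorem ExpDecay.dsym_pow_mul {H : E3 → ℂ} (h : ExpDecay H) (i : Fin 3) (n : ℕ) :
    ExpDecay (fun η => dsym i η ^ n * H η) := by
  induction n with
  | zero => simpa using h
  | succ n ih =>
    convert! ih.dsym_mul i using 2 with η
    rw [pow_succ]; ring

theorem mono_eq (n : Fin 3 → ℕ) (η : E3) :
    mono n η = dsym 0 η ^ n 0 * (dsym 1 η ^ n 1 * dsym 2 η ^ n 2) := by
  simp [mono, Fin.prod_univ_three, mul_assoc]

theorem ExpDecay.mono_mul {H : E3 → ℂ} (h : ExpDecay H) (n : Fin 3 → ℕ) :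
    ExpDecay (fun η => mono n η * H η) := by
  have := ((h.dsym_pow_mul 2 (n 2)).dsym_pow_mul 1 (n 1)).dsym_pow_mul 0 (n 0)
  convert! this using 2 with η
  rw [mono_eq]; ring

theorem ExpDecay.comp_add {H : E3 → ℂ} (h : ExpDecay H) (a : E3) :
    ExpDecay (fun η => H (η + a)) := by
  obtain ⟨hc, c, hc0, C, hC⟩ := h
  refine ⟨by fun_prop, c, hc0, C * Real.exp (c * ‖a‖), fun η => (hC _).trans ?_⟩
  have h0 : 0 ≤ C := by
    have := (norm_nonneg _).trans (hC 0)
    simpa using this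
  rw [mul_assoc, ← Real.exp_add]
  gcongr
  have := norm_sub_le (η + a) a
  rw [add_sub_cancel_right] at this
  nlinarith

theorem ExpDecay.integrable_pow {H : E3 → ℂ} (h : ExpDecay H) (n : ℕ) :
    Integrable (fun η => ‖η‖ ^ n * ‖H η‖) := by
  obtain ⟨hc, c, hc0, C, hC⟩ := h
  obtain ⟨D, hD, h1⟩ := pow_le_exp (half_pos hc0) n
  refine ((integrable_exp_neg_norm (half_pos hc0)).const_mul (D * C)).mono' (by fun_prop)
    (Filter.Eventually.of_forall fun η => ?_)
  have h0 : 0 ≤ C * Real.exp (-(c * ‖η‖)) := (norm_nonneg _).trans (hC η)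
  rw [Real.norm_of_nonneg (by positivity)]
  calc ‖η‖ ^ n * ‖H η‖ ≤ (D * Real.exp (c / 2 * ‖η‖)) * (C * Real.exp (-(c * ‖η‖))) :=
        mul_le_mul (h1 _ (norm_nonneg _)) (hC η) (norm_nonneg _) (by positivity)
    _ = D * C * (Real.exp (c / 2 * ‖η‖) * Real.exp (-(c * ‖η‖))) := by ring
    _ = D * C * Real.exp (-(c / 2 * ‖η‖)) := by
        rw [← Real.exp_add]; congr 2; ring

/-- The inverse Fourier transform in the velocity. -/
noncomputable def velInv (H : E3 → ℂ) (v : E3) : ℂ := ∫ η, ex (inner ℝ η v) * H η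

theorem velFourier_eq_fourier (g : E3 → ℂ) : velFourier g = 𝓕 g := by
  funext η
  rw [velFourier_eq, Real.fourier_eq']
  congr with v
  rw [smul_eq_mul, ex, real_inner_comm]
  congr 3; ring_nf

theorem velInv_eq_fourierInv (H : E3 → ℂ) : velInv H = 𝓕⁻ H := by
  funext v
  rw [velInv, Real.fourierInv_eq']
  rfl

theorem velInv_eq_velFourier_neg (H : E3 → ℂ) (v : E3) : velInv H v = velFourier H (-v) := by
  rw [velInv_eq_fourierInv, velFourier_eq_fourier, Real.fourierInv_eq_fourier_neg]

theorem norm_velFourier_le (g : E3 → ℂ) (η : E3) : ‖velFourier g η‖ ≤ ∫ v, ‖g v‖ := by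
  rw [velFourier_eq]
  refine (norm_integral_le_integral_norm _).trans (le_of_eq ?_)
  simp

theorem norm_velInv_le (g : E3 → ℂ) (η : E3) : ‖velInv g η‖ ≤ ∫ v, ‖g v‖ := by
  rw [velInv_eq_velFourier_neg]; exact norm_velFourier_le _ _

theorem continuous_velFourier {g : E3 → ℂ} (hg : Integrable g) : Continuous (velFourier g) := by
  rw [velFourier_eq_fourier]
  exact VectorFourier.fourierIntegral_continuous Real.continuous_fourierChar
    (by exact continuous_inner) hg

theorem continuous_velInv {g : E3 → ℂ} (hg : Integrable g) : Continuous (velInv g) := by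
  have := (continuous_velFourier hg).comp continuous_neg
  convert! this using 1
  funext v; exact velInv_eq_velFourier_neg _ _

theorem velInv_velFourier {g : E3 → ℂ} (hc : Continuous g) (hg : Integrable g)
    (hg' : Integrable (velFourier g)) : velInv (velFourier g) = g := by
  rw [velFourier_eq_fourier] at *
  rw [velInv_eq_fourierInv]
  exact hc.fourierInv_fourier_eq hg hg'

theorem velFourier_velInv {H : E3 → ℂ} (hc : Continuous H) (hg : Integrable H)
    (hg' : Integrable (velInv H)) : velFourier (velInv H) = H := by
  have h2 : Integrable (𝓕 H) := by
    have := hg'.comp_neg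
    rw [← velFourier_eq_fourier]
    convert! this using 1
    funext v; rw [velInv_eq_velFourier_neg, neg_neg]
  rw [velFourier_eq_fourier, velInv_eq_fourierInv]
  exact hc.fourier_fourierInv_eq hg h2

theorem integrable_ex_mul {g : E3 → ℂ} (hg : Integrable g) {φ : E3 → ℝ} (hφ : Continuous φ) :
    Integrable (fun v => ex (φ v) * g v) :=
  Integrable.bdd_mul (c := 1) hg (Continuous.aestronglyMeasurable (by fun_prop)) (by simp)

theorem velInv_comp_add (H : E3 → ℂ) (a v : E3) :
    velInv (fun η => H (η + a)) v = ex (-inner ℝ a v) * velInv H v := by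
  unfold velInv
  rw [← integral_const_mul,
    ← integral_add_right_eq_self (fun η => ex (-inner ℝ a v) * (ex (inner ℝ η v) * H η)) a]
  congr with η
  rw [← mul_assoc, ← ex_add, inner_add_left]
  congr 2; ring

theorem velFourier_ex_mul (g : E3 → ℂ) (a η : E3) :
    velFourier (fun v => ex (inner ℝ a v) * g v) η = velFourier g (η - a) := by
  rw [velFourier_eq, velFourier_eq]
  congr with v
  rw [← mul_assoc, ← ex_add, inner_sub_left]
  congr 2; ring

theorem velInv_add {g h : E3 → ℂ} (hg : Integrable g) (hh : Integrable h) (v : E3) :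
    velInv (fun η => g η + h η) v = velInv g v + velInv h v := by
  unfold velInv
  rw [← integral_add (integrable_ex_mul hg (by fun_prop)) (integrable_ex_mul hh (by fun_prop))]
  congr with η; ring

theorem velFourier_add {g h : E3 → ℂ} (hg : Integrable g) (hh : Integrable h) (v : E3) :
    velFourier (fun η => g η + h η) v = velFourier g v + velFourier h v := by
  rw [velFourier_eq, velFourier_eq, velFourier_eq,
    ← integral_add (integrable_ex_mul hg (by fun_prop)) (integrable_ex_mul hh (by fun_prop))]
  congr with η; ring

theorem velFourier_const_mul (g : E3 → ℂ) (c : ℂ) (v : E3) :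
    velFourier (fun η => c * g η) v = c * velFourier g v := by
  rw [velFourier_eq, velFourier_eq, ← integral_const_mul]
  congr with η; ring

theorem ExpDecay.contDiff_velInv {H : E3 → ℂ} (h : ExpDecay H) : ContDiff ℝ ∞ (velInv H) := by
  have : ContDiff ℝ ∞ (𝓕 H) := Real.contDiff_fourier fun n _ => h.integrable_pow n
  have h2 := this.comp contDiff_neg
  convert! h2 using 1
  funext v; rw [velInv_eq_velFourier_neg, velFourier_eq_fourier]; rfl

theorem ExpDecay.pderiv_velInv {H : E3 → ℂ} (h : ExpDecay H) (i : Fin 3) :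
    pderiv i (velInv H) = velInv (fun η => dsym i η * H η) := by
  funext v
  have h1 := Real.hasFDerivAt_fourier h.integrable (by simpa using h.integrable_pow 1) (-v)
  have h2 := h1.comp v (hasFDerivAt_id v).neg
  have e : velInv H = 𝓕 H ∘ fun v => -v := by
    funext v; rw [velInv_eq_velFourier_neg, velFourier_eq_fourier]; rfl
  have hint : Integrable (VectorFourier.fourierSMulRight (innerSL ℝ) H) := by
    refine Integrable.mono' ((h.integrable_pow 1).const_mul (2 * Real.pi * ‖innerSL ℝ (E := E3)‖)) ?_ ?_
    · exact h.integrable.1.fourierSMulRight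
    · refine Filter.Eventually.of_forall fun η => ?_
      refine (VectorFourier.norm_fourierSMulRight_le _ _ _).trans (le_of_eq (by simp; ring))
  unfold pderiv
  rw [e, h2.fderiv]
  simp only [ContinuousLinearMap.comp_apply, neg_apply, ContinuousLinearMap.coe_id', id,
    map_neg]
  rw [Real.fourier_continuousLinearMap_apply hint, velInv_eq_velFourier_neg, velFourier_eq_fourier,
    Real.fourier_eq, Real.fourier_eq, ← integral_neg]
  congr with η
  have hin : (innerSL ℝ η) (EuclideanSpace.single i (1 : ℝ)) = η i := by
    rw [innerSL_apply_apply, inner_single_one]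
  simp only [VectorFourier.fourierSMulRight_apply, dsym, Circle.smul_def, smul_eq_mul, hin]
  simp
  ring

theorem ExpDecay.pderiv_iterate_velInv {H : E3 → ℂ} (h : ExpDecay H) (i : Fin 3) (n : ℕ) :
    (pderiv i)^[n] (velInv H) = velInv (fun η => dsym i η ^ n * H η) := by
  induction n with
  | zero => simp
  | succ n ih =>
    rw [Function.iterate_succ_apply', ih, (h.dsym_pow_mul i n).pderiv_velInv]
    congr with η
    rw [pow_succ]; ring

theorem ExpDecay.mderiv_velInv {H : E3 → ℂ} (h : ExpDecay H) (n : Fin 3 → ℕ) :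
    mderiv n (velInv H) = velInv (fun η => mono n η * H η) := by
  unfold mderiv
  rw [h.pderiv_iterate_velInv, (h.dsym_pow_mul 2 _).pderiv_iterate_velInv,
    ((h.dsym_pow_mul 2 _).dsym_pow_mul 1 _).pderiv_iterate_velInv]
  congr with η
  rw [mono_eq]; ring

section Derivative

theorem ContDiff.pderiv {F : Type*} [NormedAddCommGroup F] [NormedSpace ℝ F] {g : E3 → F}
    (hg : ContDiff ℝ ∞ g) (i : Fin 3) : ContDiff ℝ ∞ (pderiv i g) :=
  (hg.fderiv_right (m := ∞) (by simp)).clm_apply contDiff_const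

theorem ContDiff.pderiv_iterate {F : Type*} [NormedAddCommGroup F] [NormedSpace ℝ F] {g : E3 → F}
    (hg : ContDiff ℝ ∞ g) (i : Fin 3) (n : ℕ) : ContDiff ℝ ∞ ((WeakVP.pderiv i)^[n] g) := by
  induction n with
  | zero => exact hg
  | succ n ih => rw [Function.iterate_succ_apply']; exact ContDiff.pderiv ih i

theorem velFourier_pderiv {g : E3 → ℂ} (hd : Differentiable ℝ g) (hg : Integrable g) {i : Fin 3}
    (hg' : Integrable (pderiv i g)) (η : E3) :
    velFourier (pderiv i g) η = dsym i η * velFourier g η := by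
  have hder : ∀ v : E3, HasFDerivAt (fun v : E3 => ex (-inner ℝ η v))
      ((-(innerSL ℝ η)).smulRight (2 * Real.pi * Complex.I * ex (-inner ℝ η v))) v := fun v => by
    have h1 : HasFDerivAt (fun v : E3 => -inner ℝ η v) (-(innerSL ℝ η)) v :=
      (innerSL ℝ η).hasFDerivAt.neg
    have h2 := (hasDerivAt_ex (-inner ℝ η v)).hasFDerivAt.comp v h1
    convert! h2 using 1
  have key := integral_bilinear_hasLineDerivAt_right_eq_neg_left_of_integrable (μ := volume)
    (f := fun v : E3 => ex (-inner ℝ η v))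
    (f' := fun v => (-(inner ℝ η (EuclideanSpace.single i (1 : ℝ))) : ℝ) •
      (2 * Real.pi * Complex.I * ex (-inner ℝ η v))) (g := g) (g' := pderiv i g)
    (v := EuclideanSpace.single i 1) (B := ContinuousLinearMap.mul ℝ ℂ) ?_ ?_ ?_ ?_ ?_
  · rw [velFourier_eq, velFourier_eq]
    simp only [ContinuousLinearMap.mul_apply'] at key
    rw [key, ← integral_neg, ← integral_const_mul]
    congr with v
    rw [inner_single_one, Complex.real_smul, dsym]
    push_cast
    ring
  · simp only [ContinuousLinearMap.mul_apply']
    have := (integrable_ex_mul hg (φ := fun v => -inner ℝ η v) (by fun_prop)).const_mul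
      ((-(inner ℝ η (EuclideanSpace.single i (1 : ℝ))) : ℝ) * (2 * Real.pi * Complex.I))
    convert this using 2 with v
    rw [Complex.real_smul]; ring
  · exact integrable_ex_mul hg' (by fun_prop)
  · exact integrable_ex_mul hg (by fun_prop)
  · intro v _
    exact (hder v).hasLineDerivAt _
  · intro v _
    exact (hd v).hasFDerivAt.hasLineDerivAt _

theorem velFourier_pderiv_iterate {g : E3 → ℂ} (hd : ContDiff ℝ ∞ g) {i : Fin 3} {n : ℕ}
    (hg : ∀ m ≤ n, Integrable ((pderiv i)^[m] g)) (η : E3) :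
    velFourier ((pderiv i)^[n] g) η = dsym i η ^ n * velFourier g η := by
  induction n with
  | zero => simp
  | succ n ih =>
    have h1 := hg (n + 1) le_rfl
    rw [Function.iterate_succ_apply'] at h1 ⊢
    rw [velFourier_pderiv ((ContDiff.pderiv_iterate hd i n).differentiable (by simp))
      (hg n (by omega)) h1, ih fun m hm => hg m (by omega), pow_succ]
    ring

theorem contDiff_mderiv {F : Type*} [NormedAddCommGroup F] [NormedSpace ℝ F] {g : E3 → F}
    (hg : ContDiff ℝ ∞ g) (n : Fin 3 → ℕ) : ContDiff ℝ ∞ (mderiv n g) :=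
  ContDiff.pderiv_iterate (ContDiff.pderiv_iterate (ContDiff.pderiv_iterate hg _ _) _ _) _ _

theorem velFourier_mderiv {g : E3 → ℂ} (hd : ContDiff ℝ ∞ g)
    (hg : ∀ n, Integrable (mderiv n g)) (n : Fin 3 → ℕ) (η : E3) :
    velFourier (mderiv n g) η = mono n η * velFourier g η := by
  unfold mderiv
  rw [velFourier_pderiv_iterate (ContDiff.pderiv_iterate (ContDiff.pderiv_iterate hd _ _) _ _)
      fun m _ => hg ![m, n 1, n 2],
    velFourier_pderiv_iterate (ContDiff.pderiv_iterate hd _ _) fun m _ => hg ![0, m, n 2],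
    velFourier_pderiv_iterate hd fun m _ => hg ![0, 0, m], mono_eq]
  ring

end Derivative

section AnalyticNorm

theorem weight_pos {lam : ℝ} (h : 0 < lam) (n : Fin 3 → ℕ) : 0 < weight lam n :=
  Finset.prod_pos fun i _ => by positivity

theorem mderiv_zero {F : Type*} [NormedAddCommGroup F] [NormedSpace ℝ F] (g : E3 → F) :
    mderiv 0 g = g := rfl

theorem mderiv_single {F : Type*} [NormedAddCommGroup F] [NormedSpace ℝ F] (i : Fin 3)
    (g : E3 → F) : mderiv (Pi.single i 1) g = pderiv i g := by
  fin_cases i <;> simp [mderiv]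

variable {F : Type*} [NormedAddCommGroup F] [NormedSpace ℝ F]

theorem integrable_mderiv {lam M : ℝ} (hlam : 0 < lam) {g : E3 → F} (hg : ContDiff ℝ ∞ g)
    (h : analyticL1Norm lam g ≤ ENNReal.ofReal M) (n : Fin 3 → ℕ) :
    Integrable (mderiv n g) := by
  refine ⟨(contDiff_mderiv hg n).continuous.aestronglyMeasurable, ?_⟩
  have h1 : ENNReal.ofReal (weight lam n) * ∫⁻ v, ‖mderiv n g v‖ₑ ≤ ENNReal.ofReal M :=
    (ENNReal.le_tsum n).trans h
  rw [hasFiniteIntegral_iff_enorm]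
  by_contra h2
  rw [not_lt, top_le_iff] at h2
  rw [h2, ENNReal.mul_top (by simpa using weight_pos hlam n)] at h1
  simp at h1

theorem sum_weight_mul_integral_le {lam M : ℝ} (hlam : 0 < lam) (hM : 0 ≤ M) {g : E3 → F}
    (hg : ContDiff ℝ ∞ g) (h : analyticL1Norm lam g ≤ ENNReal.ofReal M)
    (s : Finset (Fin 3 → ℕ)) : ∑ n ∈ s, weight lam n * ∫ v, ‖mderiv n g v‖ ≤ M := by
  have h1 := (ENNReal.sum_le_tsum s).trans h
  have h2 : ∀ n, ENNReal.ofReal (weight lam n) * ∫⁻ v, ‖mderiv n g v‖ₑ =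
      ENNReal.ofReal (weight lam n * ∫ v, ‖mderiv n g v‖) := fun n => by
    rw [ENNReal.ofReal_mul (weight_pos hlam n).le,
      ofReal_integral_norm_eq_lintegral_enorm (integrable_mderiv hlam hg h n)]
  simp only [h2] at h1
  rw [← ENNReal.ofReal_sum_of_nonneg] at h1
  · exact (ENNReal.ofReal_le_ofReal_iff hM).1 h1
  · exact fun n _ => mul_nonneg (weight_pos hlam n).le (integral_nonneg fun _ => norm_nonneg _)

theorem integral_mderiv_le {lam M : ℝ} (hlam : 0 < lam) (hM : 0 ≤ M) {g : E3 → F}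
    (hg : ContDiff ℝ ∞ g) (h : analyticL1Norm lam g ≤ ENNReal.ofReal M) (n : Fin 3 → ℕ) :
    ∫ v, ‖mderiv n g v‖ ≤ M * (weight lam n)⁻¹ := by
  have := sum_weight_mul_integral_le hlam hM hg h {n}
  rw [Finset.sum_singleton] at this
  rw [← div_eq_mul_inv, le_div_iff₀ (weight_pos hlam n)]
  linarith

theorem norm_le_sum_abs (η : E3) : ‖η‖ ≤ ∑ i, |η i| := by
  have h : η = ∑ i, EuclideanSpace.single i (η i) := by
    ext j; simp [Finset.sum_apply, Pi.single_apply]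
  calc ‖η‖ = ‖∑ i, EuclideanSpace.single i (η i)‖ := by rw [← h]
    _ ≤ ∑ i, ‖EuclideanSpace.single i (η i)‖ := norm_sum_le _ _
    _ = ∑ i, |η i| := by simp

/-- Exponential decay of the Fourier transform of a function with finite analytic norm. -/
theorem velFourier_le_of_analyticL1Norm {lam M : ℝ} (hlam : 0 < lam) (hM : 0 ≤ M) {g : E3 → ℂ}
    (hg : ContDiff ℝ ∞ g) (h : analyticL1Norm lam g ≤ ENNReal.ofReal M) (η : E3) :
    ‖velFourier g η‖ ≤ M * Real.exp (-(2 * Real.pi * lam * ‖η‖)) := by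
  have hm : ∀ n, ‖mono n η‖ * ‖velFourier g η‖ ≤ ∫ v, ‖mderiv n g v‖ := fun n => by
    rw [← norm_mul, ← velFourier_mderiv hg (integrable_mderiv hlam hg h)]
    exact norm_velFourier_le _ _
  have hN : ∀ N : ℕ, (∏ i, ∑ j ∈ Finset.range N, (2 * Real.pi * lam * |η i|) ^ j / j.factorial) *
      ‖velFourier g η‖ ≤ M := fun N => by
    rw [Finset.prod_univ_sum, Finset.sum_mul]
    refine le_trans (Finset.sum_le_sum fun n _ => ?_) (sum_weight_mul_integral_le hlam hM hg h _)
    have : ∏ i, (2 * Real.pi * lam * |η i|) ^ n i / (n i).factorial = weight lam n * ‖mono n η‖ := by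
      simp only [weight, mono, norm_prod, norm_pow, norm_dsym, ← Finset.prod_mul_distrib]
      refine Finset.prod_congr rfl fun i _ => ?_
      rw [mul_pow, mul_pow, mul_pow, mul_pow]; ring
    rw [this, mul_assoc]
    exact mul_le_mul_of_nonneg_left (hm n) (weight_pos hlam n).le
  have hlim : Filter.Tendsto (fun N : ℕ => (∏ i, ∑ j ∈ Finset.range N,
      (2 * Real.pi * lam * |η i|) ^ j / j.factorial) * ‖velFourier g η‖) Filter.atTop
      (nhds ((∏ i, Real.exp (2 * Real.pi * lam * |η i|)) * ‖velFourier g η‖)) := by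
    refine Filter.Tendsto.mul_const _ (tendsto_finsetProd _ fun i _ => ?_)
    rw [Real.exp_eq_exp_ℝ]
    exact (NormedSpace.expSeries_div_hasSum_exp _).tendsto_sum_nat
  have h1 := le_of_tendsto' hlim hN
  rw [← Real.exp_sum, ← Finset.mul_sum] at h1
  have h2 : Real.exp (2 * Real.pi * lam * ‖η‖) * ‖velFourier g η‖ ≤ M := by
    refine le_trans ?_ h1
    have := norm_le_sum_abs η
    have := Real.pi_pos
    gcongr
  rw [Real.exp_neg, ← div_eq_mul_inv, le_div_iff₀ (Real.exp_pos _)]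
  linarith

end AnalyticNorm

section Lattice

/-- The polynomial weight `(1 + |k|)^4`, whose inverse is summable over `ℤ³`. -/
noncomputable def om (k : Mode) : ℝ := (1 + ‖freq k‖) ^ 4

theorem one_le_om (k : Mode) : 1 ≤ om k := one_le_pow₀ (by linarith [norm_nonneg (freq k)])

theorem om_pos (k : Mode) : 0 < om k := zero_lt_one.trans_le (one_le_om k)

theorem freq_injective : Function.Injective freq := fun k l h => by
  funext i
  have := congrArg (fun x : E3 => x i) h
  simpa using this

theorem summable_inv_om : Summable (fun k => (om k)⁻¹) := by
  let b := (EuclideanSpace.basisFun (Fin 3) ℝ).toBasis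
  let L : Submodule ℤ E3 := Submodule.span ℤ (Set.range b)
  have hmem : ∀ k : Mode, freq k ∈ L := fun k => by
    have : freq k = ∑ i, k i • b i := by
      ext j; simp [b, Finset.sum_apply, Pi.single_apply]
    rw [this]
    exact Submodule.sum_mem _ fun i _ => Submodule.smul_mem _ _ (Submodule.subset_span ⟨i, rfl⟩)
  have hr : Module.finrank ℤ L = 3 := by
    rw [ZLattice.rank ℝ L]; simp
  have h1 : Summable fun z : L => ‖z‖⁻¹ ^ 4 := ZLattice.summable_norm_pow_inv L 4 (by omega)
  have hinj : Function.Injective (fun k : Mode => (⟨freq k, hmem k⟩ : L)) := fun k l h =>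
    freq_injective (congrArg Subtype.val h)
  have h2 := h1.comp_injective hinj
  refine Summable.of_norm_bounded (h2.add (hasSum_ite_eq (0 : Mode) (1 : ℝ)).summable) fun k => ?_
  rw [Real.norm_of_nonneg (inv_nonneg.2 (om_pos k).le)]
  by_cases hk : k = 0
  · subst hk
    simp [om]
  · have h0 : 0 < ‖freq k‖ := norm_pos_iff.2 fun h => hk (freq_injective (by rw [h, freq_zero]))
    simp only [Function.comp_apply, hk, if_false, add_zero, om, inv_pow]
    show ((1 + ‖freq k‖) ^ 4)⁻¹ ≤ (‖freq k‖ ^ 4)⁻¹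
    gcongr
    linarith

theorem om_le_exp {c : ℝ} (hc : 0 < c) : ∃ C : ℝ, 0 < C ∧ ∀ k, om k ≤ C * Real.exp (c * ‖freq k‖) := by
  obtain ⟨C, hC, h⟩ := pow_le_exp hc 4
  refine ⟨C * Real.exp c, by positivity, fun k => (h _ (by positivity)).trans (le_of_eq ?_)⟩
  rw [mul_assoc, ← Real.exp_add]; congr 2; ring

theorem summable_exp_neg_freq {c : ℝ} (hc : 0 < c) :
    Summable (fun k : Mode => Real.exp (-(c * ‖freq k‖))) := by
  obtain ⟨C, hC, h⟩ := om_le_exp hc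
  refine Summable.of_nonneg_of_le (fun _ => (Real.exp_pos _).le) (fun k => ?_)
    (summable_inv_om.mul_left C)
  rw [Real.exp_neg, ← div_eq_mul_inv, inv_le_comm₀ (Real.exp_pos _) (div_pos hC (om_pos k)),
    inv_div, div_le_iff₀ hC]
  linarith [h k]

theorem om_le_add (k l : Mode) : om k ≤ 8 * (om l + om (k - l)) := by
  have h1 : ‖freq k‖ ≤ ‖freq l‖ + ‖freq (k - l)‖ := by
    have := norm_add_le (freq l) (freq (k - l))
    rwa [← freq_add, add_sub_cancel] at this
  have h2 : om k ≤ ((1 + ‖freq l‖) + (1 + ‖freq (k - l)‖)) ^ 4 := by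
    exact pow_le_pow_left₀ (by positivity)
      (by linarith [norm_nonneg (freq l)]) 4
  have h3 := add_pow_le (a := 1 + ‖freq l‖) (b := 1 + ‖freq (k - l)‖) (by positivity)
    (by positivity) 4
  unfold om at *
  norm_num at h3
  linarith

end Lattice

section ParametricIntegral

theorem restrict_closedBall_restrict_cell :
    (volume.restrict cell).restrict (Metric.closedBall (0 : E3) 2) = volume.restrict cell := by
  rw [Measure.restrict_restrict Metric.isClosed_closedBall.measurableSet, inter_eq_self_of_subset_right]
  intro x hx
  simpa using norm_le_of_mem_cell hx

theorem continuous_integral_cell {X F : Type*} [TopologicalSpace X] [FirstCountableTopology X]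
    [LocallyCompactSpace X] [NormedAddCommGroup F] [NormedSpace ℝ F] {G : X → E3 → F}
    (hG : Continuous (Function.uncurry G)) : Continuous (fun v => ∫ x in cell, G v x) := by
  have := continuous_parametric_integral_of_continuous (μ := volume.restrict cell) hG
    (isCompact_closedBall (0 : E3) 2)
  rwa [restrict_closedBall_restrict_cell] at this

theorem hasFDerivAt_integral_cell {F : Type*} [NormedAddCommGroup F] [NormedSpace ℝ F]
    {G : E3 → E3 → F} {G' : E3 → E3 → E3 →L[ℝ] F}
    (hG : Continuous (Function.uncurry G)) (hG' : Continuous (Function.uncurry G'))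
    (h : ∀ x v, HasFDerivAt (G x) (G' x v) v) (v : E3) :
    HasFDerivAt (fun v => ∫ x in cell, G x v) (∫ x in cell, G' x v) v := by
  obtain ⟨C, hC⟩ := ((isCompact_closedBall (0 : E3) 2).prod
    (isCompact_closedBall v 1)).exists_bound_of_continuousOn hG'.continuousOn
  refine hasFDerivAt_integral_of_dominated_of_fderiv_le (F' := fun v x => G' x v)
    (bound := fun _ => C) (s := Metric.ball v 1)
    (Metric.ball_mem_nhds v one_pos) ?_ ?_ ?_ ?_ ?_ ?_
  · exact Filter.Eventually.of_forall fun w =>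
      (Continuous.aestronglyMeasurable (hG.comp (by fun_prop : Continuous fun x : E3 => (x, w))))
  · exact integrableOn_cell (hG.comp (by fun_prop : Continuous fun x : E3 => (x, v)))
  · exact (Continuous.aestronglyMeasurable (hG'.comp (by fun_prop : Continuous fun x : E3 => (x, v))))
  · refine (ae_restrict_iff' measurableSet_cell).2 (Filter.Eventually.of_forall fun x hx w hw => ?_)
    exact hC (x, w) ⟨by simpa using norm_le_of_mem_cell hx, Metric.ball_subset_closedBall hw⟩
  · exact integrable_const _
  · exact Filter.Eventually.of_forall fun x w _ => h x w

theorem fderiv_partial_right {F : Type*} [NormedAddCommGroup F] [NormedSpace ℝ F] {n : WithTop ℕ∞}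
    {G : E3 × E3 → F} (hG : ContDiff ℝ (n + 1) G) :
    ContDiff ℝ n (fun z : E3 × E3 => fderiv ℝ (fun v => G (z.1, v)) z.2) := by
  have h1 : ContDiff ℝ (n + 1) (Function.uncurry fun (z : E3 × E3) (v : E3) => G (z.1, v)) :=
    hG.comp (by fun_prop)
  exact h1.fderiv contDiff_snd le_rfl

theorem contDiff_integral_cell (n : ℕ) : ∀ {F : Type} [NormedAddCommGroup F] [NormedSpace ℝ F]
    {G : E3 × E3 → F}, ContDiff ℝ n G → ContDiff ℝ n (fun v => ∫ x in cell, G (x, v)) := by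
  induction n with
  | zero =>
    intro F _ _ G hG
    simp only [Nat.cast_zero, contDiff_zero] at hG ⊢
    exact continuous_integral_cell (G := fun v x => G (x, v)) (hG.comp continuous_swap)
  | succ n ih =>
    intro F _ _ G hG
    rw [Nat.cast_succ] at hG ⊢
    have h1 := fderiv_partial_right hG
    rw [contDiff_succ_iff_hasFDerivAt]
    refine ⟨fun v => ∫ x in cell, fderiv ℝ (fun v => G (x, v)) v, ih h1, fun v => ?_⟩
    refine hasFDerivAt_integral_cell (G := fun x v => G (x, v))
      (G' := fun x v => fderiv ℝ (fun v => G (x, v)) v) hG.continuous h1.continuous (fun x w => ?_) v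
    exact ((hG.differentiable (by simp)).comp (by fun_prop : Differentiable ℝ fun v : E3 => (x, v))
      w).hasFDerivAt

end ParametricIntegral

section Slice

/-- The Fourier coefficient in `x` of a function on the phase space. -/
noncomputable def fmode (f : E3 → E3 → ℝ) (k : Mode) (v : E3) : ℂ :=
  torusFourier (fun x => (f x v : ℂ)) k

/-- A smooth function on the phase space with finite hybrid analytic norm. -/
structure IsSlice (σ M : ℝ) (f : E3 → E3 → ℝ) : Prop where
  pos : 0 < σ
  nonneg : 0 ≤ M
  periodic : TorusPeriodic f
  smooth : ContDiff ℝ ∞ (fun z : E3 × E3 => f z.1 z.2)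
  bound : hybridNorm σ σ f ≤ ENNReal.ofReal M

variable {σ M : ℝ} {f : E3 → E3 → ℝ}

theorem contDiff_fmode (hf : ContDiff ℝ ∞ (fun z : E3 × E3 => f z.1 z.2)) (k : Mode) :
    ContDiff ℝ ∞ (fmode f k) := by
  rw [contDiff_infty]
  intro n
  have h : ContDiff ℝ n (fun z : E3 × E3 => ex (-inner ℝ (freq k) z.1) * (f z.1 z.2 : ℂ)) := by
    refine ContDiff.mul (contDiff_ex.comp ?_) (Complex.ofRealCLM.contDiff.comp ?_)
    · exact (contDiff_const.inner ℝ contDiff_fst).neg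
    · exact contDiff_infty.1 hf n
  have h2 := contDiff_integral_cell n h
  convert! h2 using 1
  funext v
  exact torusFourier_eq _ _

theorem pderiv_fmode (hf : ContDiff ℝ ∞ (fun z : E3 × E3 => f z.1 z.2)) (k : Mode) (i : Fin 3)
    (v : E3) : pderiv i (fmode f k) v = torusFourier (fun x => ((pderiv i (f x) v : ℝ) : ℂ)) k := by
  have hf' : ContDiff ℝ ∞ (fun z : E3 × E3 => fderiv ℝ (fun v => f z.1 v) z.2) :=
    fderiv_partial_right (G := fun z => f z.1 z.2) (by simpa using hf)
  have hcont : Continuous (fun z : E3 × E3 => (ex (-inner ℝ (freq k) z.1)) •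
      Complex.ofRealCLM.comp (fderiv ℝ (fun v => f z.1 v) z.2)) := by
    have h1 : Continuous (fun z : E3 × E3 => Complex.ofRealCLM.comp (fderiv ℝ (fun v => f z.1 v) z.2)) :=
      (ContinuousLinearMap.postcomp E3 Complex.ofRealCLM).continuous.comp hf'.continuous
    fun_prop
  have h := hasFDerivAt_integral_cell (G := fun x v => ex (-inner ℝ (freq k) x) * (f x v : ℂ))
    (G' := fun x v => (ex (-inner ℝ (freq k) x)) •
      Complex.ofRealCLM.comp (fderiv ℝ (fun v => f x v) v)) ?_ hcont (fun x v => ?_) v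
  · have e : fmode f k = fun v => ∫ x in cell, ex (-inner ℝ (freq k) x) * (f x v : ℂ) := by
      funext v; exact torusFourier_eq _ _
    rw [torusFourier_eq]
    unfold pderiv
    rw [e, h.fderiv, ContinuousLinearMap.integral_apply]
    · rfl
    · have hc2 : Continuous fun x : E3 => (x, v) := by fun_prop
      have hc3 := hcont.comp hc2
      have hc4 := integrableOn_cell hc3
      exact hc4
  · have := hf.continuous
    have h2 : Continuous (fun z : E3 × E3 => (f z.1 z.2 : ℂ)) := Complex.continuous_ofReal.comp this
    unfold Function.uncurry
    fun_prop
  · have h1 : DifferentiableAt ℝ (f x) v := by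
      have := (hf.differentiable (by simp)).comp
        (by fun_prop : Differentiable ℝ fun v : E3 => (x, v))
      exact this v
    have h2 : HasFDerivAt (fun v => (f x v : ℂ)) (Complex.ofRealCLM.comp (fderiv ℝ (f x) v)) v :=
      Complex.ofRealCLM.hasFDerivAt.comp v h1.hasFDerivAt
    exact h2.const_mul _

namespace IsSlice

theorem contDiff (h : IsSlice σ M f) (k : Mode) : ContDiff ℝ ∞ (fmode f k) :=
  contDiff_fmode h.smooth k

theorem sum_analytic (h : IsSlice σ M f) (k : Mode) :
    analyticL1Norm σ (fmode f k) ≤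
      ENNReal.ofReal (M * Real.exp (-(2 * Real.pi * σ * ‖freq k‖))) := by
  have h1 : ENNReal.ofReal (Real.exp (2 * Real.pi * σ * ‖freq k‖)) *
      analyticL1Norm σ (fmode f k) ≤ ENNReal.ofReal M := (ENNReal.le_tsum k).trans h.bound
  rw [mul_comm, ← ENNReal.le_div_iff_mul_le (by simp [Real.exp_pos]) (by simp)] at h1
  rwa [← ENNReal.ofReal_div_of_pos (Real.exp_pos _), div_eq_mul_inv, ← Real.exp_neg] at h1

theorem integrable_mderiv (h : IsSlice σ M f) (k : Mode) (n : Fin 3 → ℕ) :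
    Integrable (mderiv n (fmode f k)) :=
  WeakVP.integrable_mderiv h.pos (h.contDiff k) (h.sum_analytic k) n

theorem integrable_fmode (h : IsSlice σ M f) (k : Mode) : Integrable (fmode f k) :=
  h.integrable_mderiv k 0

theorem integrable_pderiv (h : IsSlice σ M f) (k : Mode) (i : Fin 3) :
    Integrable (pderiv i (fmode f k)) := by
  have := h.integrable_mderiv k (Pi.single i 1)
  rwa [mderiv_single] at this

theorem integral_norm_fmode_le (h : IsSlice σ M f) (k : Mode) :
    ∫ v, ‖fmode f k v‖ ≤ M * Real.exp (-(2 * Real.pi * σ * ‖freq k‖)) := by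
  have := integral_mderiv_le h.pos (mul_nonneg h.nonneg (Real.exp_pos _).le) (h.contDiff k)
    (h.sum_analytic k) 0
  simpa [mderiv_zero, weight] using this

theorem integral_norm_pderiv_le (h : IsSlice σ M f) (k : Mode) (i : Fin 3) :
    ∫ v, ‖pderiv i (fmode f k) v‖ ≤ M * Real.exp (-(2 * Real.pi * σ * ‖freq k‖)) * σ⁻¹ := by
  have := integral_mderiv_le h.pos (mul_nonneg h.nonneg (Real.exp_pos _).le) (h.contDiff k)
    (h.sum_analytic k) (Pi.single i 1)
  have hw : weight σ (Pi.single i 1) = σ := by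
    fin_cases i <;> simp [weight, Fin.prod_univ_three]
  rwa [mderiv_single, hw] at this

theorem velFourier_fmode_le (h : IsSlice σ M f) (k : Mode) (η : E3) :
    ‖velFourier (fmode f k) η‖ ≤ M * Real.exp (-(2 * Real.pi * σ * ‖freq k‖)) *
      Real.exp (-(2 * Real.pi * σ * ‖η‖)) :=
  velFourier_le_of_analyticL1Norm h.pos (mul_nonneg h.nonneg (Real.exp_pos _).le) (h.contDiff k)
    (h.sum_analytic k) η

theorem two_pi_pos (h : IsSlice σ M f) : 0 < 2 * Real.pi * σ := by
  have := h.pos; have := Real.pi_pos; positivity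

theorem expDecay (h : IsSlice σ M f) (k : Mode) : ExpDecay (velFourier (fmode f k)) :=
  ⟨continuous_velFourier (h.integrable_fmode k), _, h.two_pi_pos, _, h.velFourier_fmode_le k⟩

theorem velInv_velFourier (h : IsSlice σ M f) (k : Mode) :
    velInv (velFourier (fmode f k)) = fmode f k :=
  WeakVP.velInv_velFourier (h.contDiff k).continuous (h.integrable_fmode k) (h.expDecay k).integrable

theorem norm_fmode_le (h : IsSlice σ M f) (k : Mode) (v : E3) :
    ‖fmode f k v‖ ≤ (M * ∫ η : E3, Real.exp (-(2 * Real.pi * σ * ‖η‖))) *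
      Real.exp (-(2 * Real.pi * σ * ‖freq k‖)) := by
  rw [← h.velInv_velFourier k]
  refine (norm_velInv_le _ _).trans ?_
  rw [mul_right_comm, ← integral_const_mul]
  refine integral_mono (h.expDecay k).integrable.norm
    ((integrable_exp_neg_norm h.two_pi_pos).const_mul _) (h.velFourier_fmode_le k)

theorem summable_exp (h : IsSlice σ M f) :
    Summable (fun k : Mode => Real.exp (-(2 * Real.pi * σ * ‖freq k‖))) :=
  summable_exp_neg_freq h.two_pi_pos

theorem continuous_apply (h : IsSlice σ M f) (v : E3) : Continuous (fun x => (f x v : ℂ)) :=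
  Complex.continuous_ofReal.comp
    (h.smooth.continuous.comp (by fun_prop : Continuous fun x : E3 => (x, v)))

theorem hasSum_fmode (h : IsSlice σ M f) (x v : E3) :
    HasSum (fun k => fmode f k v * ex (inner ℝ (freq k) x)) (f x v : ℂ) := by
  refine hasSum_torusFourier (u := fun x => (f x v : ℂ)) (fun x k => ?_) (h.continuous_apply v) ?_ x
  · simp only [h.periodic x k]
  · exact Summable.of_norm_bounded (h.summable_exp.mul_left _) (fun k => h.norm_fmode_le k v)

theorem lintegral_le (h : IsSlice σ M f) (x : E3) :
    ∫⁻ v, ‖f x v‖ₑ ≤ ∑' k : Mode, ENNReal.ofReal (M * Real.exp (-(2 * Real.pi * σ * ‖freq k‖))) := by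
  have h1 : ∀ v, ‖f x v‖ₑ ≤ ∑' k, ‖fmode f k v‖ₑ := fun v => by
    have e : ‖f x v‖ₑ = ‖(f x v : ℂ)‖ₑ := by
      rw [← ofReal_norm, ← ofReal_norm, Complex.norm_real]
    rw [e, ← (h.hasSum_fmode x v).tsum_eq]
    refine (enorm_tsum_le_tsum_enorm).trans (le_of_eq ?_)
    congr with k
    rw [enorm_mul, ← ofReal_norm (ex _), norm_ex]; simp
  refine (lintegral_mono h1).trans ?_
  rw [lintegral_tsum fun k => (h.contDiff k).continuous.enorm.aemeasurable]
  refine ENNReal.tsum_le_tsum fun k => ?_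
  rw [← ofReal_integral_norm_eq_lintegral_enorm (h.integrable_fmode k)]
  exact ENNReal.ofReal_le_ofReal (h.integral_norm_fmode_le k)

theorem tsum_lt_top (h : IsSlice σ M f) :
    ∑' k : Mode, ENNReal.ofReal (M * Real.exp (-(2 * Real.pi * σ * ‖freq k‖))) < ⊤ :=
  lt_top_iff_ne_top.2 (h.summable_exp.mul_left M).tsum_ofReal_ne_top

theorem integrable (h : IsSlice σ M f) (x : E3) : Integrable (f x) :=
  ⟨(h.smooth.continuous.comp (by fun_prop : Continuous fun v : E3 => (x, v))).aestronglyMeasurable,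
    (h.lintegral_le x).trans_lt h.tsum_lt_top⟩

theorem integrable_prod (h : IsSlice σ M f) :
    Integrable (fun z : E3 × E3 => (f z.1 z.2 : ℂ)) ((volume.restrict cell).prod volume) := by
  refine ⟨(Complex.continuous_ofReal.comp h.smooth.continuous).aestronglyMeasurable, ?_⟩
  have hc : Continuous (fun z : E3 × E3 => (f z.1 z.2 : ℂ)) :=
    Complex.continuous_ofReal.comp h.smooth.continuous
  rw [hasFiniteIntegral_iff_enorm, lintegral_prod _ hc.enorm.aemeasurable]
  refine lt_of_le_of_lt (lintegral_mono (g := fun _ => ∑' k : Mode,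
    ENNReal.ofReal (M * Real.exp (-(2 * Real.pi * σ * ‖freq k‖)))) fun x => ?_) ?_
  · refine (le_of_eq ?_).trans (h.lintegral_le x)
    congr with v
    rw [← ofReal_norm, ← ofReal_norm, Complex.norm_real]
  · rw [lintegral_const]
    refine ENNReal.mul_lt_top h.tsum_lt_top (by simp [volume_cell])

theorem phaseFourier_eq (h : IsSlice σ M f) (k : Mode) (η : E3) :
    phaseFourier f k η = velFourier (fmode f k) η := by
  have hint : Integrable (Function.uncurry fun x v : E3 => ex (-inner ℝ (freq k) x) *
      (ex (-inner ℝ η v) * (f x v : ℂ))) ((volume.restrict cell).prod volume) := by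
    refine Integrable.bdd_mul (c := 1) (Integrable.bdd_mul (c := 1) h.integrable_prod ?_ ?_) ?_ ?_
    · exact Continuous.aestronglyMeasurable (by fun_prop)
    · simp
    · exact Continuous.aestronglyMeasurable (by fun_prop)
    · simp
  unfold phaseFourier
  rw [torusFourier_eq, velFourier_eq]
  simp only [velFourier_eq, ← integral_const_mul]
  rw [integral_integral_swap hint]
  congr with v
  rw [fmode, torusFourier_eq, ← integral_const_mul]
  congr with x; ring

theorem norm_phaseFourier_le (h : IsSlice σ M f) (k : Mode) (η : E3) :
    ‖phaseFourier f k η‖ ≤ M * Real.exp (-(2 * Real.pi * σ * ‖freq k‖)) *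
      Real.exp (-(2 * Real.pi * σ * ‖η‖)) := by
  rw [h.phaseFourier_eq]; exact h.velFourier_fmode_le k η

theorem hasSum_density (h : IsSlice σ M f) (x : E3) :
    HasSum (fun k => phaseFourier f k 0 * ex (inner ℝ (freq k) x)) (density f x : ℂ) := by
  have h1 := hasSum_integral_of_summable_integral_norm (μ := volume)
    (F := fun k v => fmode f k v * ex (inner ℝ (freq k) x))
    (fun k => (h.integrable_fmode k).mul_const _) (by
      simp only [norm_mul, norm_ex, mul_one]
      exact Summable.of_nonneg_of_le (fun k => integral_nonneg fun _ => norm_nonneg _)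
        h.integral_norm_fmode_le (h.summable_exp.mul_left M))
  have e1 : (density f x : ℂ) = ∫ v, ∑' k, fmode f k v * ex (inner ℝ (freq k) x) := by
    rw [density, ← integral_complex_ofReal]
    congr with v
    rw [(h.hasSum_fmode x v).tsum_eq]
  have e2 : ∀ k, phaseFourier f k 0 * ex (inner ℝ (freq k) x) =
      ∫ v, fmode f k v * ex (inner ℝ (freq k) x) := fun k => by
    rw [integral_mul_const, h.phaseFourier_eq, velFourier_eq]; simp
  rw [e1, funext e2]
  exact h1

theorem norm_rho_le (h : IsSlice σ M f) (k : Mode) :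
    ‖phaseFourier f k 0‖ ≤ M * Real.exp (-(2 * Real.pi * σ * ‖freq k‖)) := by
  simpa using h.norm_phaseFourier_le k 0

theorem summable_rho (h : IsSlice σ M f) : Summable (fun k => phaseFourier f k 0) :=
  Summable.of_norm_bounded (h.summable_exp.mul_left M) h.norm_rho_le

theorem torusFourier_density (h : IsSlice σ M f) (k : Mode) :
    torusFourier (fun x => (density f x : ℂ)) k = phaseFourier f k 0 :=
  torusFourier_of_hasSum h.summable_rho h.hasSum_density k

end IsSlice

end Slice

section Potential

/-- The Fourier coefficients of the interaction potential. -/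
noncomputable def Wc (W : E3 → ℝ) (l : Mode) : ℂ := torusFourier (fun x => (W x : ℂ)) l

theorem one_le_norm_freq {k : Mode} (hk : k ≠ 0) : 1 ≤ ‖freq k‖ := by
  obtain ⟨i, hi⟩ : ∃ i, k i ≠ 0 := by
    by_contra h; push Not at h; exact hk (funext h)
  have h1 := abs_apply_le_norm (freq k) i
  have h2 : (1 : ℝ) ≤ |(k i : ℝ)| := by
    have := Int.one_le_abs hi
    exact_mod_cast this
  exact h2.trans h1

variable {γ : ℝ} {W : E3 → ℝ}

theorem IsPotential.norm_freq_mul_Wc_le (hW : IsPotential γ W) (hγ : 1 < γ) (l : Mode) :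
    ‖freq l‖ * ‖Wc W l‖ ≤ 1 := by
  by_cases hl : l = 0
  · simp [hl]
  have h1 := one_le_norm_freq hl
  have h2 : ‖freq l‖ ≤ ‖freq l‖ ^ γ := by
    simpa using Real.rpow_le_rpow_of_exponent_le h1 hγ.le
  calc ‖freq l‖ * ‖Wc W l‖ ≤ ‖freq l‖ * (1 / (1 + ‖freq l‖ ^ γ)) := by
        gcongr; exact hW.decay l
    _ ≤ 1 := by rw [mul_one_div, div_le_one (by positivity)]; linarith

/-- The Fourier coefficients of the components of the field `∇W ∗ ρ`. -/
noncomputable def fco (W : E3 → ℝ) (f : E3 → E3 → ℝ) (i : Fin 3) (l : Mode) : ℂ :=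
  dsym i (freq l) * (Wc W l * phaseFourier f l 0)

theorem IsPotential.norm_fco_le (hW : IsPotential γ W) (hγ : 1 < γ) (f : E3 → E3 → ℝ) (i : Fin 3)
    (l : Mode) : ‖fco W f i l‖ ≤ 2 * Real.pi * ‖phaseFourier f l 0‖ := by
  unfold fco
  rw [norm_mul, norm_mul, ← mul_assoc]
  refine mul_le_mul_of_nonneg_right ?_ (norm_nonneg _)
  calc ‖dsym i (freq l)‖ * ‖Wc W l‖ ≤ (2 * Real.pi * ‖freq l‖) * ‖Wc W l‖ := by
        gcongr; exact norm_dsym_le i _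
    _ = 2 * Real.pi * (‖freq l‖ * ‖Wc W l‖) := by ring
    _ ≤ 2 * Real.pi * 1 := by
        have := hW.norm_freq_mul_Wc_le hγ l
        gcongr
    _ = 2 * Real.pi := mul_one _

theorem torusFourier_finsetSum {ι : Type*} [Fintype ι] {u : ι → E3 → ℂ}
    (hu : ∀ i, Continuous (u i)) (k : Mode) :
    torusFourier (fun x => ∑ i, u i x) k = ∑ i, torusFourier (u i) k := by
  simp only [torusFourier_eq]
  rw [← integral_finsetSum]
  · congr with x
    rw [Finset.mul_sum]
  · intro i _
    have := hu i
    have h5 : Continuous fun x => ex (-inner ℝ (freq k) x) * u i x := by fun_prop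
    exact integrableOn_cell h5

/-- The derivative of the character `x ↦ e^{2πi a·x}`. -/
noncomputable def chderiv (a x : E3) : E3 →L[ℝ] ℂ :=
  (innerSL ℝ a).smulRight (2 * Real.pi * Complex.I * ex (inner ℝ a x))

theorem chderiv_apply (a x w : E3) :
    chderiv a x w = inner ℝ a w * (2 * Real.pi * Complex.I * ex (inner ℝ a x)) := by
  simp [chderiv]

theorem norm_chderiv (a x : E3) : ‖chderiv a x‖ = 2 * Real.pi * ‖a‖ := by
  rw [chderiv, ContinuousLinearMap.norm_smulRight_apply, innerSL_apply_norm]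
  simp only [norm_mul, norm_ex, mul_one, Complex.norm_I, Complex.norm_real, Complex.norm_ofNat,
      Real.norm_of_nonneg Real.pi_pos.le]
  ring

theorem hasFDerivAt_ex_inner (a x : E3) :
    HasFDerivAt (fun y : E3 => ex (inner ℝ a y)) (chderiv a x) x := by
  have h1 : HasFDerivAt (fun y : E3 => inner ℝ a y) (innerSL ℝ a) x :=
    (innerSL ℝ a).hasFDerivAt
  have h2 := (hasDerivAt_ex (inner ℝ a x)).hasFDerivAt.comp x h1
  convert! h2 using 1

namespace IsSlice

variable {σ M : ℝ} {f : E3 → E3 → ℝ}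

theorem hasSum_potential (h : IsSlice σ M f) (hW : IsPotential γ W) (x : E3) :
    HasSum (fun l => (Wc W l * phaseFourier f l 0) * ex (inner ℝ (freq l) x))
      (potential W f x : ℂ) := by
  have hper : TorusPeriodic (fun x => (W x : ℂ)) := fun x k => by simp only [hW.periodic x k]
  have hWi : IntegrableOn (fun y => (W (x - y) : ℂ)) cell :=
    hper.integrableOn_sub (Integrable.ofReal hW.integrable) x
  have h1 := hasSum_integral_of_summable_integral_norm (μ := volume.restrict cell)
    (F := fun l y => phaseFourier f l 0 * (ex (inner ℝ (freq l) y) * (W (x - y) : ℂ)))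
    (fun l => (Integrable.bdd_mul (c := 1) hWi
      (Continuous.aestronglyMeasurable (by fun_prop)) (by simp)).const_mul _) (by
      simp only [norm_mul, norm_ex, one_mul, integral_const_mul]
      exact h.summable_rho.norm.mul_right _)
  have e1 : (potential W f x : ℂ) = ∫ y in cell, ∑' l, phaseFourier f l 0 *
      (ex (inner ℝ (freq l) y) * (W (x - y) : ℂ)) := by
    rw [potential, ← integral_complex_ofReal]
    congr with y
    rw [Complex.ofReal_mul, ← (h.hasSum_density y).tsum_eq, ← tsum_mul_left]
    congr with l; ring
  have e2 : ∀ l, (Wc W l * phaseFourier f l 0) * ex (inner ℝ (freq l) x) =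
      ∫ y in cell, phaseFourier f l 0 * (ex (inner ℝ (freq l) y) * (W (x - y) : ℂ)) := fun l => by
    rw [integral_const_mul, mul_right_comm, Wc, ← integral_cell_sub_mul_ex hper, mul_comm]
    congr with y; ring
  rw [e1, funext e2]
  exact h1

theorem summable_fco (h : IsSlice σ M f) (hW : IsPotential γ W) (hγ : 1 < γ) (i : Fin 3) :
    Summable (fco W f i) :=
  Summable.of_norm_bounded (h.summable_rho.norm.mul_left _) (hW.norm_fco_le hγ f i)

theorem hasFDerivAt_potential (h : IsSlice σ M f) (hW : IsPotential γ W) (hγ : 1 < γ) (x : E3) :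
    HasFDerivAt (fun x => (potential W f x : ℂ)) (∑' l, (Wc W l * phaseFourier f l 0) •
      chderiv (freq l) x) x ∧
    Summable fun l => (Wc W l * phaseFourier f l 0) • chderiv (freq l) x := by
  have hb : ∀ (l : Mode) (x : E3), ‖(Wc W l * phaseFourier f l 0) • chderiv (freq l) x‖ ≤
      2 * Real.pi * ‖phaseFourier f l 0‖ := fun l x => by
    rw [norm_smul, norm_chderiv, norm_mul]
    calc _ = 2 * Real.pi * (‖freq l‖ * ‖Wc W l‖) * ‖phaseFourier f l 0‖ := by ring
      _ ≤ 2 * Real.pi * 1 * ‖phaseFourier f l 0‖ := by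
          have := hW.norm_freq_mul_Wc_le hγ l
          have := Real.pi_pos
          gcongr
      _ = _ := by ring
  have hs := h.summable_rho.norm.mul_left (2 * Real.pi)
  refine ⟨?_, Summable.of_norm_bounded hs fun l => hb l x⟩
  have e : (fun x => (potential W f x : ℂ)) = fun x => ∑' l, (Wc W l * phaseFourier f l 0) *
      ex (inner ℝ (freq l) x) := funext fun x => (h.hasSum_potential hW x).tsum_eq.symm
  rw [e]
  exact hasFDerivAt_tsum (x₀ := 0) hs
    (fun l y => (hasFDerivAt_ex_inner (freq l) y).const_mul (Wc W l * phaseFourier f l 0)) hb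
    (h.hasSum_potential hW 0).summable x

theorem differentiable_potential (h : IsSlice σ M f) (hW : IsPotential γ W) (hγ : 1 < γ) :
    Differentiable ℝ (potential W f) := fun x => by
  have := Complex.reCLM.differentiableAt.comp x (h.hasFDerivAt_potential hW hγ x).1.differentiableAt
  exact this

theorem hasSum_field (h : IsSlice σ M f) (hW : IsPotential γ W) (hγ : 1 < γ) (i : Fin 3) (x : E3) :
    HasSum (fun l => fco W f i l * ex (inner ℝ (freq l) x)) ((field W f x i : ℝ) : ℂ) := by
  obtain ⟨h1, h2⟩ := h.hasFDerivAt_potential hW hγ x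
  have h3 : HasFDerivAt (fun x => (potential W f x : ℂ))
      (Complex.ofRealCLM.comp (fderiv ℝ (potential W f) x)) x :=
    Complex.ofRealCLM.hasFDerivAt.comp x (h.differentiable_potential hW hγ x).hasFDerivAt
  have h4 := h1.unique h3
  have h5 : ((field W f x i : ℝ) : ℂ) = (Complex.ofRealCLM.comp (fderiv ℝ (potential W f) x))
      (EuclideanSpace.single i 1) := by
    rw [← inner_single_one (field W f x) i, field, inner_gradient_left]
    rfl
  rw [h5, ← h4]
  have h6 := h2.hasSum.mapL (ContinuousLinearMap.apply ℝ ℂ (EuclideanSpace.single i (1 : ℝ)))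
  have e : ∀ l, fco W f i l * ex (inner ℝ (freq l) x) =
      ContinuousLinearMap.apply ℝ ℂ (EuclideanSpace.single i (1 : ℝ))
        ((Wc W l * phaseFourier f l 0) • chderiv (freq l) x) := fun l => by
    rw [ContinuousLinearMap.apply_apply, _root_.smul_apply, chderiv_apply,
      inner_single_one, fco, dsym, smul_eq_mul]
    ring
  rw [funext e]
  exact h6

theorem fieldFourier_apply (h : IsSlice σ M f) (hW : IsPotential γ W) (hγ : 1 < γ) (i : Fin 3)
    (k : Mode) : fieldFourier (field W f) k i = fco W f i k :=
  torusFourier_of_hasSum (h.summable_fco hW hγ i) (h.hasSum_field hW hγ i) k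

theorem continuous_pderiv (h : IsSlice σ M f) (i : Fin 3) (v : E3) :
    Continuous (fun x => pderiv i (f x) v) := by
  have hf' : ContDiff ℝ ∞ (fun z : E3 × E3 => fderiv ℝ (fun v => f z.1 v) z.2) :=
    fderiv_partial_right (G := fun z => f z.1 z.2) (by simpa using h.smooth)
  have h1 : Continuous fun x : E3 => (x, v) := by fun_prop
  exact (hf'.continuous.comp h1).clm_apply continuous_const

theorem inner_field_gradient (f : E3 → E3 → ℝ) (g : E3 → E3) (x v : E3)  :
    inner ℝ (g x) (gradient (f x) v) = ∑ i, g x i * pderiv i (f x) v := by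
  rw [PiLp.inner_apply]
  refine Finset.sum_congr rfl fun i _ => ?_
  have : gradient (f x) v i = pderiv i (f x) v := by
    rw [← inner_single_one (gradient (f x) v) i, inner_gradient_left]; rfl
  rw [this]
  simp [mul_comm]

/-- The Fourier coefficients of the nonlinear term `E·∇_v f`. -/
theorem hasSum_torusFourier_force (h : IsSlice σ M f) (hW : IsPotential γ W) (hγ : 1 < γ)
    (k : Mode) (v : E3) :
    HasSum (fun l => ∑ i, fco W f i l * pderiv i (fmode f (k - l)) v)
      (torusFourier (fun x => ((inner ℝ (field W f x) (gradient (f x) v) : ℝ) : ℂ)) k) := by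
  have hc : ∀ i, Continuous fun x => ((pderiv i (f x) v : ℝ) : ℂ) := fun i =>
    Complex.continuous_ofReal.comp (h.continuous_pderiv i v)
  have h1 : ∀ i, HasSum (fun l => fco W f i l * pderiv i (fmode f (k - l)) v)
      (torusFourier (fun x => ((field W f x i : ℝ) : ℂ) * ((pderiv i (f x) v : ℝ) : ℂ)) k) := fun i => by
    simp only [pderiv_fmode h.smooth]
    exact hasSum_torusFourier_mul (h.summable_fco hW hγ i) (integrableOn_cell (hc i))
      (h.hasSum_field hW hγ i) k
  have hfc : ∀ i, Continuous fun x => ((field W f x i : ℝ) : ℂ) := fun i => by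
    have : (fun x => ((field W f x i : ℝ) : ℂ)) = fun x => ∑' l, fco W f i l * ex (inner ℝ (freq l) x) :=
      funext fun x => (h.hasSum_field hW hγ i x).tsum_eq.symm
    rw [this]
    refine continuous_tsum (fun l => by fun_prop) (h.summable_fco hW hγ i).norm fun l x => ?_
    simp
  have h2 := hasSum_sum (s := Finset.univ) fun i _ => h1 i
  convert! h2 using 1
  have hm : ∀ i, Continuous fun x => ((field W f x i : ℝ) : ℂ) * ((pderiv i (f x) v : ℝ) : ℂ) :=
    fun i => (hfc i).mul (hc i)
  rw [← torusFourier_finsetSum hm]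
  congr with x
  rw [inner_field_gradient, Complex.ofReal_sum]
  simp only [Complex.ofReal_mul]

end IsSlice

end Potential

section FourierEquation

/-- The envelope `e^{-(θ|η| + κ|k|)} / (1+|k|)^4`. -/
noncomputable def env (θ κ : ℝ) (k : Mode) (η : E3) : ℝ :=
  Real.exp (-(θ * ‖η‖ + κ * ‖freq k‖)) * (om k)⁻¹

theorem env_pos (θ κ : ℝ) (k : Mode) (η : E3) : 0 < env θ κ k η :=
  mul_pos (Real.exp_pos _) (inv_pos.2 (om_pos k))

theorem env_anti {θ θ' κ κ' : ℝ} (h1 : θ ≤ θ') (h2 : κ ≤ κ') (k : Mode) (η : E3) :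
    env θ' κ' k η ≤ env θ κ k η := by
  unfold env
  have := (om_pos k).le
  gcongr

theorem env_sub (θ κ r : ℝ) (k : Mode) (η : E3) :
    env (θ - r) (κ - r) k η = env θ κ k η * Real.exp (r * (‖η‖ + ‖freq k‖)) := by
  unfold env
  rw [mul_right_comm, ← Real.exp_add]; congr 2; ring

/-- The weights of the discrete convolution. -/
noncomputable def cw (k l : Mode) : ℝ := 8 * ((om l)⁻¹ + (om (k - l))⁻¹)

/-- The sum of the weights of the discrete convolution. -/
noncomputable def cwSum : ℝ := 16 * ∑' k : Mode, (om k)⁻¹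

theorem hasSum_cw (k : Mode) : HasSum (cw k) cwSum := by
  have h1 := summable_inv_om.hasSum
  have h2 : HasSum (fun l => (om (k - l))⁻¹) (∑' k : Mode, (om k)⁻¹) :=
    (Equiv.subLeft k).hasSum_iff.2 h1
  have := (h1.add h2).mul_left 8
  convert! this using 1
  unfold cwSum; ring

theorem cw_nonneg (k l : Mode) : 0 ≤ cw k l := by
  have h1 := (om_pos l).le
  have h2 := (om_pos (k - l)).le
  unfold cw; positivity

theorem cwSum_nonneg : 0 ≤ cwSum := (hasSum_cw 0).nonneg (cw_nonneg 0)

theorem inv_om_mul_le (k l : Mode) : (om l)⁻¹ * (om (k - l))⁻¹ ≤ (om k)⁻¹ * cw k l := by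
  have h1 := om_pos k
  have h2 := om_pos l
  have h3 := om_pos (k - l)
  have h4 := om_le_add k l
  unfold cw
  calc (om l)⁻¹ * (om (k - l))⁻¹ = (om k)⁻¹ * (om k * ((om l)⁻¹ * (om (k - l))⁻¹)) := by field_simp
    _ ≤ (om k)⁻¹ * ((8 * (om l + om (k - l))) * ((om l)⁻¹ * (om (k - l))⁻¹)) := by gcongr
    _ = (om k)⁻¹ * (8 * ((om l)⁻¹ + (om (k - l))⁻¹)) := by field_simp; ring

theorem norm_smul_freq {s : ℝ} (hs : 0 ≤ s) (l : Mode) : ‖s • freq l‖ = s * ‖freq l‖ := by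
  rw [norm_smul, Real.norm_of_nonneg hs]

theorem norm_freq_le_add (k l : Mode) : ‖freq k‖ ≤ ‖freq l‖ + ‖freq (k - l)‖ := by
  have := norm_add_le (freq l) (freq (k - l))
  rwa [← freq_add, add_sub_cancel] at this

theorem norm_le_add_sub (η a : E3) : ‖η‖ ≤ ‖a‖ + ‖η - a‖ := by
  simpa using norm_add_le a (η - a)

theorem env_mul_env_le {θ κ s : ℝ} (hθ : 0 ≤ θ) (hκ : 0 ≤ κ) (k l : Mode) (η : E3) :
    env θ κ l (s • freq l) * env θ κ (k - l) (η - s • freq l) ≤ env θ κ k η * cw k l := by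
  unfold env
  rw [mul_mul_mul_comm, ← Real.exp_add, mul_assoc]
  refine mul_le_mul (Real.exp_le_exp.2 ?_) (inv_om_mul_le k l) ?_ (Real.exp_pos _).le
  · have h1 := mul_le_mul_of_nonneg_left (norm_le_add_sub η (s • freq l)) hθ
    have h2 := mul_le_mul_of_nonneg_left (norm_freq_le_add k l) hκ
    linarith
  · have h1 := om_pos l
    have h2 := om_pos (k - l)
    positivity

variable (a ν : ℝ) (Wh : Mode → ℂ) (P : E3 → ℂ)

/-- A term of the bilinear convolution of the Fourier-transformed equation. -/
noncomputable def bilTerm (F G : Mode → E3 → ℂ) (s : ℝ) (k : Mode) (η : E3) (l : Mode) : ℂ :=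
  (inner ℝ (freq l) (η - s • freq k) : ℝ) * Wh l * F l (s • freq l) * G (k - l) (η - s • freq l)

/-- The right-hand side of the Fourier-transformed equation along free transport. -/
noncomputable def nl (F : Mode → E3 → ℂ) (s : ℝ) (k : Mode) (η : E3) : ℂ :=
  4 * Real.pi ^ 2 * a * (∑' l, bilTerm Wh F F s k η l) +
    ν * (F k (s • freq k) * P (η - s • freq k) - F k η)

variable {a ν Wh P}

theorem norm_bilTerm_le (hW : ∀ l, ‖freq l‖ * ‖Wh l‖ ≤ 1) {F G : Mode → E3 → ℂ} {A B θ κ s : ℝ}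
    (hθ : 0 ≤ θ) (hκ : 0 ≤ κ) (hs : 0 ≤ s) (hs1 : s ≤ 1)
    (hF : ∀ k η, ‖F k η‖ ≤ A * env θ κ k η)
    (hG : ∀ k η, ‖G k η‖ ≤ B * env θ κ k η) (k : Mode) (η : E3) (l : Mode) :
    ‖bilTerm Wh F G s k η l‖ ≤ (‖η‖ + ‖freq k‖) * (A * B) * env θ κ k η * cw k l := by
  have hA : 0 ≤ A := by
    have := (norm_nonneg _).trans (hF 0 0)
    exact nonneg_of_mul_nonneg_left this (env_pos _ _ _ _)
  have hB : 0 ≤ B := by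
    have := (norm_nonneg _).trans (hG 0 0)
    exact nonneg_of_mul_nonneg_left this (env_pos _ _ _ _)
  have h1 : ‖η - s • freq k‖ ≤ ‖η‖ + ‖freq k‖ := by
    refine (norm_sub_le _ _).trans ?_
    rw [norm_smul_freq hs]
    have := norm_nonneg (freq k)
    nlinarith
  have h2 : ‖((inner ℝ (freq l) (η - s • freq k) : ℝ) : ℂ) * Wh l‖ ≤ ‖η‖ + ‖freq k‖ := by
    rw [norm_mul, Complex.norm_real]
    calc ‖inner ℝ (freq l) (η - s • freq k)‖ * ‖Wh l‖
        ≤ (‖freq l‖ * ‖η - s • freq k‖) * ‖Wh l‖ := by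
          gcongr; exact norm_inner_le_norm _ _
      _ = (‖freq l‖ * ‖Wh l‖) * ‖η - s • freq k‖ := by ring
      _ ≤ 1 * (‖η‖ + ‖freq k‖) := by gcongr; exact hW l
      _ = _ := one_mul _
  unfold bilTerm
  rw [norm_mul, norm_mul]
  calc _ ≤ (‖η‖ + ‖freq k‖) * (A * env θ κ l (s • freq l)) *
        (B * env θ κ (k - l) (η - s • freq l)) := by
        exact mul_le_mul (mul_le_mul h2 (hF _ _) (norm_nonneg _) (by positivity)) (hG _ _)
          (norm_nonneg _) (mul_nonneg (by positivity) (mul_nonneg hA (env_pos _ _ _ _).le))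
    _ = (‖η‖ + ‖freq k‖) * (A * B) *
        (env θ κ l (s • freq l) * env θ κ (k - l) (η - s • freq l)) := by ring
    _ ≤ (‖η‖ + ‖freq k‖) * (A * B) * (env θ κ k η * cw k l) := by
        exact mul_le_mul_of_nonneg_left (env_mul_env_le hθ hκ k l η) (by positivity)
    _ = _ := by ring

theorem summable_bilTerm (hW : ∀ l, ‖freq l‖ * ‖Wh l‖ ≤ 1) {F G : Mode → E3 → ℂ} {A B θ κ s : ℝ}
    (hθ : 0 ≤ θ) (hκ : 0 ≤ κ) (hs : 0 ≤ s) (hs1 : s ≤ 1)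
    (hF : ∀ k η, ‖F k η‖ ≤ A * env θ κ k η)
    (hG : ∀ k η, ‖G k η‖ ≤ B * env θ κ k η) (k : Mode) (η : E3) :
    Summable (bilTerm Wh F G s k η) :=
  Summable.of_norm_bounded ((hasSum_cw k).summable.mul_left _)
    (norm_bilTerm_le hW hθ hκ hs hs1 hF hG k η)

theorem norm_tsum_bilTerm_le (hW : ∀ l, ‖freq l‖ * ‖Wh l‖ ≤ 1) {F G : Mode → E3 → ℂ}
    {A B θ κ s : ℝ} (hθ : 0 ≤ θ) (hκ : 0 ≤ κ) (hs : 0 ≤ s) (hs1 : s ≤ 1)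
    (hF : ∀ k η, ‖F k η‖ ≤ A * env θ κ k η)
    (hG : ∀ k η, ‖G k η‖ ≤ B * env θ κ k η) (k : Mode) (η : E3) :
    ‖∑' l, bilTerm Wh F G s k η l‖ ≤ (‖η‖ + ‖freq k‖) * (A * B) * env θ κ k η * cwSum :=
  tsum_of_norm_bounded ((hasSum_cw k).mul_left _) (norm_bilTerm_le hW hθ hκ hs hs1 hF hG k η)

theorem env_mul_exp_le {θ κ s : ℝ} (hθ : 0 ≤ θ) (k : Mode) (η : E3) :
    env θ κ k (s • freq k) * Real.exp (-(θ * ‖η - s • freq k‖)) ≤ env θ κ k η := by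
  unfold env
  rw [mul_right_comm, ← Real.exp_add]
  have h1 := mul_le_mul_of_nonneg_left (norm_le_add_sub η (s • freq k)) hθ
  have h2 := (om_pos k).le
  gcongr
  linarith

/-- The constant of the bilinear part of the Fourier-transformed equation. -/
noncomputable def bilConst (a A : ℝ) : ℝ := 4 * Real.pi ^ 2 * |a| * (2 * A) * cwSum

theorem bilConst_nonneg {A : ℝ} (a : ℝ) (hA : 0 ≤ A) : 0 ≤ bilConst a A := by
  have := cwSum_nonneg
  unfold bilConst; positivity

theorem norm_nl_sub_nl_le (hW : ∀ l, ‖freq l‖ * ‖Wh l‖ ≤ 1) {F G : Mode → E3 → ℂ}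
    {A D C₀ θ κ s : ℝ} (hθ : 0 ≤ θ) (hκ : 0 ≤ κ) (hs : 0 ≤ s) (hs1 : s ≤ 1)
    (hP : ∀ η, ‖P η‖ ≤ C₀ * Real.exp (-(θ * ‖η‖)))
    (hF : ∀ k η, ‖F k η‖ ≤ A * env θ κ k η) (hG : ∀ k η, ‖G k η‖ ≤ A * env θ κ k η)
    (hD : ∀ k η, ‖F k η - G k η‖ ≤ D * env θ κ k η) (k : Mode) (η : E3) :
    ‖nl a ν Wh P F s k η - nl a ν Wh P G s k η‖ ≤
      (bilConst a A * (‖η‖ + ‖freq k‖) + |ν| * (C₀ + 1)) * (D * env θ κ k η) := by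
  have hD0 : 0 ≤ D := by
    have := (norm_nonneg _).trans (hD 0 0)
    exact nonneg_of_mul_nonneg_left this (env_pos _ _ _ _)
  have hC0 : 0 ≤ C₀ := by
    have := (norm_nonneg _).trans (hP 0)
    exact nonneg_of_mul_nonneg_left this (Real.exp_pos _)
  have e1 : (∑' l, bilTerm Wh F F s k η l) - ∑' l, bilTerm Wh G G s k η l =
      (∑' l, bilTerm Wh F (fun k η => F k η - G k η) s k η l) +
        ∑' l, bilTerm Wh (fun k η => F k η - G k η) G s k η l := by
    rw [← (summable_bilTerm hW hθ hκ hs hs1 hF hF k η).tsum_sub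
        (summable_bilTerm hW hθ hκ hs hs1 hG hG k η),
      ← (summable_bilTerm hW hθ hκ hs hs1 hF hD k η).tsum_add
        (summable_bilTerm hW hθ hκ hs hs1 hD hG k η)]
    congr with l
    unfold bilTerm; ring
  have e2 : nl a ν Wh P F s k η - nl a ν Wh P G s k η =
      4 * Real.pi ^ 2 * a * ((∑' l, bilTerm Wh F (fun k η => F k η - G k η) s k η l) +
        ∑' l, bilTerm Wh (fun k η => F k η - G k η) G s k η l) +
      ν * ((F k (s • freq k) - G k (s • freq k)) * P (η - s • freq k) - (F k η - G k η)) := by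
    rw [← e1]; unfold nl; ring
  have h1 := norm_tsum_bilTerm_le hW hθ hκ hs hs1 hF hD k η
  have h2 := norm_tsum_bilTerm_le hW hθ hκ hs hs1 hD hG k η
  have h3 : ‖(F k (s • freq k) - G k (s • freq k)) * P (η - s • freq k)‖ ≤
      C₀ * (D * env θ κ k η) := by
    rw [norm_mul]
    calc _ ≤ (D * env θ κ k (s • freq k)) * (C₀ * Real.exp (-(θ * ‖η - s • freq k‖))) :=
          mul_le_mul (hD _ _) (hP _) (norm_nonneg _) (mul_nonneg hD0 (env_pos _ _ _ _).le)
      _ = C₀ * (D * (env θ κ k (s • freq k) * Real.exp (-(θ * ‖η - s • freq k‖)))) := by ring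
      _ ≤ _ := by gcongr; exact env_mul_exp_le hθ k η
  have h4 := hD k η
  rw [e2]
  refine (norm_add_le _ _).trans ?_
  have h5 : ‖(4 * Real.pi ^ 2 * a : ℂ)‖ = 4 * Real.pi ^ 2 * |a| := by
    simp [abs_of_pos Real.pi_pos]
  rw [norm_mul (4 * (Real.pi : ℂ) ^ 2 * a) _, norm_mul (ν : ℂ) _, h5, Complex.norm_real,
    Real.norm_eq_abs]
  have h6 : ‖(∑' l, bilTerm Wh F (fun k η => F k η - G k η) s k η l) +
        ∑' l, bilTerm Wh (fun k η => F k η - G k η) G s k η l‖ ≤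
        2 * ((‖η‖ + ‖freq k‖) * (A * D) * env θ κ k η * cwSum) :=
    (norm_add_le _ _).trans (by linarith)
  have h7 := (norm_sub_le ((F k (s • freq k) - G k (s • freq k)) * P (η - s • freq k))
    (F k η - G k η)).trans (add_le_add h3 h4)
  calc _ ≤ 4 * Real.pi ^ 2 * |a| * (2 * ((‖η‖ + ‖freq k‖) * (A * D) * env θ κ k η * cwSum)) +
        |ν| * (C₀ * (D * env θ κ k η) + D * env θ κ k η) := by gcongr
    _ = _ := by unfold bilConst; ring

theorem nl_zero (s : ℝ) (k : Mode) (η : E3) : nl a ν Wh P (fun _ _ => 0) s k η = 0 := by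
  simp [nl, bilTerm]

theorem norm_nl_le (hW : ∀ l, ‖freq l‖ * ‖Wh l‖ ≤ 1) {F : Mode → E3 → ℂ}
    {A C₀ θ κ s : ℝ} (hθ : 0 ≤ θ) (hκ : 0 ≤ κ) (hs : 0 ≤ s) (hs1 : s ≤ 1)
    (hP : ∀ η, ‖P η‖ ≤ C₀ * Real.exp (-(θ * ‖η‖)))
    (hF : ∀ k η, ‖F k η‖ ≤ A * env θ κ k η) (k : Mode) (η : E3) :
    ‖nl a ν Wh P F s k η‖ ≤
      (bilConst a A * (‖η‖ + ‖freq k‖) + |ν| * (C₀ + 1)) * (A * env θ κ k η) := by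
  have := norm_nl_sub_nl_le (a := a) (ν := ν) hW hθ hκ hs hs1 hP hF (G := fun _ _ => 0)
    (fun k η => by simpa using (norm_nonneg _).trans (hF k η)) (D := A) (by simpa using hF) k η
  rwa [nl_zero, sub_zero] at this

theorem integral_mul_exp (K X t₀ t : ℝ) (hK : 0 < K) :
    ∫ s in t₀..t, X * Real.exp (K * (s - t₀) * X) = (Real.exp (K * (t - t₀) * X) - 1) / K := by
  have h : ∀ s ∈ uIcc t₀ t, HasDerivAt (fun s => Real.exp (K * (s - t₀) * X) / K)
      (X * Real.exp (K * (s - t₀) * X)) s := fun s _ => by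
    have h1 : HasDerivAt (fun s => K * (s - t₀) * X) (K * X) s := by
      have := (((hasDerivAt_id s).sub_const t₀).const_mul K).mul_const X
      simpa using this
    have := h1.exp.div_const K
    convert! this using 1
    field_simp
  rw [intervalIntegral.integral_eq_sub_of_hasDerivAt h
    (Continuous.intervalIntegrable (by fun_prop) _ _)]
  simp [sub_div]

theorem norm_integral_le_exp {Φ : ℝ → ℂ} {c₁ c₂ K X t₀ t : ℝ} (hc₁ : 0 ≤ c₁) (hc₂ : 0 ≤ c₂)
    (hK : 0 < K) (hX : 0 ≤ X) (ht : t₀ ≤ t)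
    (h : ∀ s, t₀ ≤ s → s ≤ t → ‖Φ s‖ ≤ (c₁ * X + c₂) * Real.exp (K * (s - t₀) * X)) :
    ‖∫ s in t₀..t, Φ s‖ ≤ (c₁ / K + c₂ * (t - t₀)) * Real.exp (K * (t - t₀) * X) := by
  have h1 : ∀ s ∈ Ioc t₀ t, ‖Φ s‖ ≤ c₁ * (X * Real.exp (K * (s - t₀) * X)) +
      c₂ * Real.exp (K * (t - t₀) * X) := fun s hs => by
    refine (h s hs.1.le hs.2).trans ?_
    have : Real.exp (K * (s - t₀) * X) ≤ Real.exp (K * (t - t₀) * X) := by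
      have := hs.2
      gcongr
    nlinarith
  refine (intervalIntegral.norm_integral_le_of_norm_le ht (Filter.Eventually.of_forall h1)
    (Continuous.intervalIntegrable (by fun_prop) _ _)).trans ?_
  rw [intervalIntegral.integral_add (Continuous.intervalIntegrable (by fun_prop) _ _)
    (Continuous.intervalIntegrable (by fun_prop) _ _), intervalIntegral.integral_const_mul,
    integral_mul_exp K X t₀ t hK, intervalIntegral.integral_const, smul_eq_mul]
  have h2 : c₁ * ((Real.exp (K * (t - t₀) * X) - 1) / K) ≤
      c₁ / K * Real.exp (K * (t - t₀) * X) := by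
    rw [mul_div_assoc', div_mul_eq_mul_div]
    gcongr
    linarith
  linarith

end FourierEquation

section Uniqueness

/-- Solutions of the Fourier-transformed equation, integrated in time. -/
structure IsFourierSol (a ν T : ℝ) (Wh : Mode → ℂ) (P : E3 → ℂ) (F₀ : Mode → E3 → ℂ)
    (F : ℝ → Mode → E3 → ℂ) : Prop where
  integrable : ∀ k η, IntervalIntegrable (fun s => nl a ν Wh P (F s) s k η) volume 0 T
  eq : ∀ t ∈ Icc 0 T, ∀ k η, F t k η = F₀ k η + ∫ s in (0 : ℝ)..t, nl a ν Wh P (F s) s k η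

variable {a ν T : ℝ} {Wh : Mode → ℂ} {P : E3 → ℂ} {F₀ : Mode → E3 → ℂ}

theorem IsFourierSol.sub_eq {F G : ℝ → Mode → E3 → ℂ} (hF : IsFourierSol a ν T Wh P F₀ F)
    (hG : IsFourierSol a ν T Wh P F₀ G) {t₀ t : ℝ} (h0 : 0 ≤ t₀) (ht : t₀ ≤ t) (htT : t ≤ T)
    (h : ∀ s ∈ Icc 0 t₀, ∀ k η, F s k η = G s k η) (k : Mode) (η : E3) :
    F t k η - G t k η =
      ∫ s in t₀..t, (nl a ν Wh P (F s) s k η - nl a ν Wh P (G s) s k η) := by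
  have hmem : t ∈ Icc 0 T := ⟨h0.trans ht, htT⟩
  have hsub : ∀ {H : ℝ → Mode → E3 → ℂ}, IsFourierSol a ν T Wh P F₀ H → ∀ r s, 0 ≤ r → r ≤ s → s ≤ T →
      IntervalIntegrable (fun s => nl a ν Wh P (H s) s k η) volume r s := fun hH r s h1 h2 h3 =>
    (hH.integrable k η).mono_set (by
      rw [uIcc_of_le h2, uIcc_of_le (h1.trans (h2.trans h3))]
      exact Icc_subset_Icc h1 h3)
  rw [hF.eq t hmem, hG.eq t hmem, add_sub_add_left_eq_sub,
    ← intervalIntegral.integral_sub (hsub hF 0 t le_rfl hmem.1 htT) (hsub hG 0 t le_rfl hmem.1 htT),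
    ← intervalIntegral.integral_add_adjacent_intervals (b := t₀)
      ((hsub hF 0 t₀ le_rfl h0 (ht.trans htT)).sub (hsub hG 0 t₀ le_rfl h0 (ht.trans htT)))
      ((hsub hF t₀ t h0 ht htT).sub (hsub hG t₀ t h0 ht htT))]
  have : ∫ s in (0 : ℝ)..t₀, (nl a ν Wh P (F s) s k η - nl a ν Wh P (G s) s k η) = 0 := by
    rw [intervalIntegral.integral_congr (g := fun _ => 0)]
    · simp
    · intro s hs
      rw [uIcc_of_le h0] at hs
      have : F s = G s := by funext k η; exact h s hs k η
      simp [this]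
  rw [this, zero_add]

/-- Solutions of the Fourier-transformed equation with exponential decay are unique. -/
theorem IsFourierSol.unique {F G : ℝ → Mode → E3 → ℂ} (hF : IsFourierSol a ν T Wh P F₀ F)
    (hG : IsFourierSol a ν T Wh P F₀ G) (hT1 : T ≤ 1)
    (hW : ∀ l, ‖freq l‖ * ‖Wh l‖ ≤ 1) {A C₀ θ κ : ℝ} (hθ : 0 < θ) (hκ : 0 < κ)
    (hP : ∀ η, ‖P η‖ ≤ C₀ * Real.exp (-(θ * ‖η‖)))
    (hFb : ∀ t ∈ Icc 0 T, ∀ k η, ‖F t k η‖ ≤ A * env θ κ k η)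
    (hGb : ∀ t ∈ Icc 0 T, ∀ k η, ‖G t k η‖ ≤ A * env θ κ k η) :
    ∀ t ∈ Icc 0 T, ∀ k η, F t k η = G t k η := by
  by_cases hT0 : 0 ≤ T
  swap
  · intro t ht; exact absurd (ht.1.trans ht.2) hT0
  have hA : 0 ≤ A := by
    have := (norm_nonneg _).trans (hFb 0 ⟨le_rfl, hT0⟩ 0 0)
    exact nonneg_of_mul_nonneg_left this (env_pos _ _ _ _)
  have hC0 : 0 ≤ C₀ := by
    have := (norm_nonneg _).trans (hP 0)
    exact nonneg_of_mul_nonneg_left this (Real.exp_pos _)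
  have hc₁ := bilConst_nonneg a hA
  set c₁ := bilConst a A with hc₁'
  set c₂ := |ν| * (C₀ + 1) with hc₂'
  have hc₂ : 0 ≤ c₂ := by positivity
  set K := 4 * c₁ + 1 with hK'
  have hK : 0 < K := by positivity
  obtain ⟨τ, hτ, hτ1, hτ2, hτ3⟩ : ∃ τ : ℝ, 0 < τ ∧ c₂ * τ ≤ 1 / 4 ∧ K * τ ≤ θ ∧ K * τ ≤ κ := by
    refine ⟨min (1 / (4 * (c₂ + 1))) (min (θ / K) (κ / K)), by positivity, ?_, ?_, ?_⟩
    · calc c₂ * min (1 / (4 * (c₂ + 1))) (min (θ / K) (κ / K)) ≤ c₂ * (1 / (4 * (c₂ + 1))) := by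
            gcongr; exact min_le_left _ _
        _ ≤ 1 / 4 := by
            rw [mul_one_div, div_le_div_iff₀ (by positivity) (by norm_num)]; linarith
    · calc _ ≤ K * (θ / K) := by gcongr; exact (min_le_right _ _).trans (min_le_left _ _)
        _ = θ := by field_simp
    · calc _ ≤ K * (κ / K) := by gcongr; exact (min_le_right _ _).trans (min_le_right _ _)
        _ = κ := by field_simp
  have step : ∀ t₀, 0 ≤ t₀ → t₀ ≤ T → (∀ s ∈ Icc 0 t₀, ∀ k η, F s k η = G s k η) →
      ∀ t, t₀ ≤ t → t ≤ t₀ + τ → t ≤ T → ∀ k η, F t k η = G t k η := by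
    intro t₀ h0 h0T hprev
    have hm : ∀ m : ℕ, ∀ t, t₀ ≤ t → t ≤ t₀ + τ → t ≤ T → ∀ k η, ‖F t k η - G t k η‖ ≤
        (2 * A / 2 ^ m) * env (θ - K * (t - t₀)) (κ - K * (t - t₀)) k η := by
      intro m
      induction m with
      | zero =>
        intro t h1 h2 h3 k η
        have hmem : t ∈ Icc 0 T := ⟨h0.trans h1, h3⟩
        have hle : env θ κ k η ≤ env (θ - K * (t - t₀)) (κ - K * (t - t₀)) k η :=
          env_anti (by nlinarith) (by nlinarith) k η
        calc _ ≤ A * env θ κ k η + A * env θ κ k η :=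
              (norm_sub_le _ _).trans (add_le_add (hFb t hmem k η) (hGb t hmem k η))
          _ = 2 * A / 2 ^ 0 * env θ κ k η := by ring
          _ ≤ _ := by gcongr
      | succ m ih =>
        intro t h1 h2 h3 k η
        rw [hF.sub_eq hG h0 h1 h3 hprev k η]
        have hX : 0 ≤ ‖η‖ + ‖freq k‖ := by positivity
        have hD : 0 ≤ 2 * A / 2 ^ m := by positivity
        have key := norm_integral_le_exp (Φ := fun s => nl a ν Wh P (F s) s k η -
          nl a ν Wh P (G s) s k η) (c₁ := c₁ * (2 * A / 2 ^ m * env θ κ k η))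
          (c₂ := c₂ * (2 * A / 2 ^ m * env θ κ k η)) (K := K) (X := ‖η‖ + ‖freq k‖) (t₀ := t₀) (t := t)
          (mul_nonneg hc₁ (mul_nonneg hD (env_pos _ _ _ _).le))
          (mul_nonneg hc₂ (mul_nonneg hD (env_pos _ _ _ _).le)) hK hX h1 (by
            intro s hs1 hs2
            have hmem : s ∈ Icc 0 T := ⟨h0.trans hs1, hs2.trans h3⟩
            have hθs : 0 ≤ θ - K * (s - t₀) := by nlinarith
            have hκs : 0 ≤ κ - K * (s - t₀) := by nlinarith
            have hle : ∀ k η, env θ κ k η ≤ env (θ - K * (s - t₀)) (κ - K * (s - t₀)) k η :=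
              env_anti (by nlinarith) (by nlinarith)
            have := norm_nl_sub_nl_le (a := a) (ν := ν) (Wh := Wh) (P := P) hW hθs hκs hmem.1 (hmem.2.trans hT1)
              (C₀ := C₀) (fun η => (hP η).trans (by
                have : θ - K * (s - t₀) ≤ θ := by nlinarith
                gcongr))
              (fun k η => (hFb s hmem k η).trans (mul_le_mul_of_nonneg_left (hle k η) hA))
              (fun k η => (hGb s hmem k η).trans (mul_le_mul_of_nonneg_left (hle k η) hA))
              (ih s hs1 (hs2.trans h2) hmem.2) k η
            refine this.trans (le_of_eq ?_)
            rw [env_sub]; ring)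
        refine key.trans ?_
        rw [env_sub]
        have h5 : c₁ / K ≤ 1 / 4 := by rw [div_le_iff₀ hK]; linarith
        have h6 : c₂ * (t - t₀) ≤ 1 / 4 := (mul_le_mul_of_nonneg_left (by linarith) hc₂).trans hτ1
        have h7 : 0 ≤ 2 * A / 2 ^ m * env θ κ k η * Real.exp (K * (t - t₀) * (‖η‖ + ‖freq k‖)) :=
          mul_nonneg (mul_nonneg hD (env_pos _ _ _ _).le) (Real.exp_pos _).le
        calc _ = (c₁ / K + c₂ * (t - t₀)) *
              (2 * A / 2 ^ m * env θ κ k η * Real.exp (K * (t - t₀) * (‖η‖ + ‖freq k‖))) := by ring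
          _ ≤ (1 / 2) * (2 * A / 2 ^ m * env θ κ k η * Real.exp (K * (t - t₀) * (‖η‖ + ‖freq k‖))) := by
              gcongr; linarith
          _ = _ := by rw [pow_succ]; field_simp
    intro t h1 h2 h3 k η
    rw [← sub_eq_zero, ← norm_le_zero_iff]
    have hlim : Filter.Tendsto (fun m : ℕ => (2 * A / 2 ^ m) *
        env (θ - K * (t - t₀)) (κ - K * (t - t₀)) k η) Filter.atTop (nhds (0 * env (θ - K * (t - t₀)) (κ - K * (t - t₀)) k η)) := by
      refine Filter.Tendsto.mul_const _ ?_
      have := (tendsto_pow_atTop_nhds_zero_of_lt_one (r := (1 / 2 : ℝ)) (by norm_num)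
        (by norm_num)).const_mul (2 * A)
      simpa [div_eq_mul_inv] using this
    rw [zero_mul] at hlim
    exact ge_of_tendsto' hlim fun m => hm m t h1 h2 h3 k η
  have hn : ∀ n : ℕ, ∀ t ∈ Icc 0 T, t ≤ n * τ → ∀ k η, F t k η = G t k η := by
    intro n
    induction n with
    | zero =>
      intro t ht h k η
      have : t = 0 := le_antisymm (by simpa using h) ht.1
      subst this
      rw [hF.eq 0 ht, hG.eq 0 ht]; simp
    | succ n ih =>
      intro t ht h
      by_cases h1 : t ≤ n * τ
      · exact ih t ht h1
      · push Not at h1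
        refine step (n * τ) (by positivity) (h1.le.trans ht.2) (fun s hs => ih s
          ⟨hs.1, hs.2.trans (h1.le.trans ht.2)⟩ hs.2) t h1.le ?_ ht.2
        push_cast at h; linarith
  intro t ht
  obtain ⟨n, hn'⟩ := exists_nat_ge (t / τ)
  exact hn n t ht (by rwa [div_le_iff₀ hτ] at hn')

end Uniqueness

section Collision

variable {σ M γ : ℝ} {f : E3 → E3 → ℝ} {W : E3 → ℝ}

/-- The right-hand side of the equation along free transport. -/
noncomputable def physRhs (a ν : ℝ) (W p : E3 → ℝ) (f : E3 → E3 → ℝ) (x v : E3) : ℝ :=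
  -(a * inner ℝ (field W f x) (gradient (f x) v)) + ν * (density f x * p v - f x v)

/-- The Fourier transform of the right-hand side of the equation. -/
noncomputable def fourierRhs (a ν : ℝ) (W p : E3 → ℝ) (f : E3 → E3 → ℝ) (k : Mode) (ζ : E3) : ℂ :=
  4 * Real.pi ^ 2 * a * (∑' l, (inner ℝ (freq l) ζ : ℝ) * Wc W l * phaseFourier f l 0 *
      phaseFourier f (k - l) ζ) +
    ν * (phaseFourier f k 0 * velFourier (fun v => (p v : ℂ)) ζ - phaseFourier f k ζ)

theorem nl_phaseFourier (a ν : ℝ) (W p : E3 → ℝ) (f : E3 → E3 → ℝ) (s : ℝ) (k : Mode) (η : E3) :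
    nl a ν (Wc W) (velFourier fun v => (p v : ℂ))
      (fun k η => phaseFourier f k (η - s • freq k)) s k η =
      fourierRhs a ν W p f k (η - s • freq k) := by
  unfold nl fourierRhs bilTerm
  have h : ∀ l, η - s • freq l - s • freq (k - l) = η - s • freq k := fun l => by
    rw [freq_sub, smul_sub]; abel
  simp only [h, sub_self]

theorem torusFourier_add' {u w : E3 → ℂ} (hu : Continuous u) (hw : Continuous w) (k : Mode) :
    torusFourier (fun x => u x + w x) k = torusFourier u k + torusFourier w k := by
  have h1 : Continuous fun x => ex (-inner ℝ (freq k) x) * u x := by fun_prop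
  have h2 : Continuous fun x => ex (-inner ℝ (freq k) x) * w x := by fun_prop
  rw [torusFourier_eq, torusFourier_eq, torusFourier_eq,
    ← integral_add (integrableOn_cell h1) (integrableOn_cell h2)]
  congr with x; ring

theorem sum_dsym_mul_dsym (l : Mode) (ζ : E3) :
    ∑ i, dsym i (freq l) * dsym i ζ = -(4 * Real.pi ^ 2) * (inner ℝ (freq l) ζ : ℝ) := by
  rw [PiLp.inner_apply, Complex.ofReal_sum, Finset.mul_sum]
  refine Finset.sum_congr rfl fun i _ => ?_
  have : Complex.I ^ 2 = -1 := Complex.I_sq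
  simp only [dsym, RCLike.inner_apply, conj_trivial, Complex.ofReal_mul]
  linear_combination (4 * Real.pi ^ 2 * (freq l i : ℂ) * (ζ i : ℂ)) * this

namespace IsSlice

theorem continuous_density (h : IsSlice σ M f) : Continuous fun x => (density f x : ℂ) := by
  have : (fun x => (density f x : ℂ)) = fun x => ∑' k, phaseFourier f k 0 * ex (inner ℝ (freq k) x) :=
    funext fun x => (h.hasSum_density x).tsum_eq.symm
  rw [this]
  refine continuous_tsum (fun l => by fun_prop) h.summable_rho.norm fun l x => ?_
  simp

theorem continuous_field (h : IsSlice σ M f) (hW : IsPotential γ W) (hγ : 1 < γ) (i : Fin 3) :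
    Continuous fun x => ((field W f x i : ℝ) : ℂ) := by
  have : (fun x => ((field W f x i : ℝ) : ℂ)) = fun x => ∑' l, fco W f i l * ex (inner ℝ (freq l) x) :=
    funext fun x => (h.hasSum_field hW hγ i x).tsum_eq.symm
  rw [this]
  refine continuous_tsum (fun l => by fun_prop) (h.summable_fco hW hγ i).norm fun l x => ?_
  simp

theorem continuous_force (h : IsSlice σ M f) (hW : IsPotential γ W) (hγ : 1 < γ) (v : E3) :
    Continuous fun x => ((inner ℝ (field W f x) (gradient (f x) v) : ℝ) : ℂ) := by
  simp only [inner_field_gradient, Complex.ofReal_sum, Complex.ofReal_mul]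
  exact continuous_finsetSum _ fun i _ => (h.continuous_field hW hγ i).mul
    (Complex.continuous_ofReal.comp (h.continuous_pderiv i v))

theorem torusFourier_physRhs (h : IsSlice σ M f) (hW : IsPotential γ W) (hγ : 1 < γ) (a ν : ℝ)
    (p : E3 → ℝ) (k : Mode) (v : E3) :
    torusFourier (fun x => (physRhs a ν W p f x v : ℂ)) k =
      -a * (∑' l, ∑ i, fco W f i l * pderiv i (fmode f (k - l)) v) +
        ν * (phaseFourier f k 0 * p v - fmode f k v) := by
  have h1 := h.continuous_force hW hγ v
  have h2 := h.continuous_density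
  have h3 := h.continuous_apply v
  have e : (fun x => (physRhs a ν W p f x v : ℂ)) = fun x =>
      (-a : ℂ) * ((inner ℝ (field W f x) (gradient (f x) v) : ℝ) : ℂ) +
        ((ν * p v : ℂ) * density f x + (-ν : ℂ) * f x v) := by
    funext x; unfold physRhs; push_cast; ring
  rw [e, torusFourier_add' (by fun_prop) (by fun_prop), torusFourier_add' (by fun_prop) (by fun_prop),
    torusFourier_const_mul, torusFourier_const_mul, torusFourier_const_mul,
    ← (h.hasSum_torusFourier_force hW hγ k v).tsum_eq, h.torusFourier_density]
  unfold fmode; ring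

/-- A bound for the mass of the Fourier modes of the force term. -/
theorem norm_fco_mul_pderiv_le (h : IsSlice σ M f) (hW : IsPotential γ W) (hγ : 1 < γ)
    (k l : Mode) (i : Fin 3) : ∫ v, ‖fco W f i l * pderiv i (fmode f (k - l)) v‖ ≤
      2 * Real.pi * M * (M * σ⁻¹) * Real.exp (-(2 * Real.pi * σ * ‖freq l‖)) := by
  have hσ := h.pos
  have hM := h.nonneg
  have h0 := h.two_pi_pos
  simp only [norm_mul]
  rw [integral_const_mul]
  have h1 := (hW.norm_fco_le hγ f i l).trans
    (mul_le_mul_of_nonneg_left (h.norm_rho_le l) (by positivity))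
  have h2 := h.integral_norm_pderiv_le (k - l) i
  have h3 : M * Real.exp (-(2 * Real.pi * σ * ‖freq (k - l)‖)) * σ⁻¹ ≤ M * σ⁻¹ := by
    have : Real.exp (-(2 * Real.pi * σ * ‖freq (k - l)‖)) ≤ 1 := Real.exp_le_one_iff.2 (by
      have : 0 ≤ 2 * Real.pi * σ * ‖freq (k - l)‖ := by positivity
      linarith)
    gcongr
    nlinarith
  calc _ ≤ (2 * Real.pi * (M * Real.exp (-(2 * Real.pi * σ * ‖freq l‖)))) * (M * σ⁻¹) :=
        mul_le_mul h1 (h2.trans h3) (integral_nonneg fun _ => norm_nonneg _) (by positivity)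
    _ = _ := by ring

/-- The velocity profile of the Fourier modes of the right-hand side. -/
theorem modeRhs_spec (h : IsSlice σ M f) (hW : IsPotential γ W) (hγ : 1 < γ) (a ν : ℝ)
    {p : E3 → ℝ} (hp : Integrable p) (k : Mode) :
    Integrable (fun v => torusFourier (fun x => (physRhs a ν W p f x v : ℂ)) k) ∧
    (∫ v, ‖torusFourier (fun x => (physRhs a ν W p f x v : ℂ)) k‖ ≤
      |a| * ∑' l, 3 * (2 * Real.pi * M * (M * σ⁻¹) * Real.exp (-(2 * Real.pi * σ * ‖freq l‖)))
        + |ν| * (M * ∫ v, ‖p v‖) + |ν| * M) ∧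
    ∀ ζ, velFourier (fun v => torusFourier (fun x => (physRhs a ν W p f x v : ℂ)) k) ζ =
      fourierRhs a ν W p f k ζ := by
  have hM := h.nonneg
  simp only [h.torusFourier_physRhs hW hγ]
  have hint : ∀ l i, Integrable fun v => fco W f i l * pderiv i (fmode f (k - l)) v :=
    fun l i => (h.integrable_pderiv (k - l) i).const_mul _
  have hint' : ∀ l, Integrable fun v => ∑ i, fco W f i l * pderiv i (fmode f (k - l)) v :=
    fun l => integrable_finsetSum _ fun i _ => hint l i
  have hb : ∀ l, ∫ v, ‖∑ i, fco W f i l * pderiv i (fmode f (k - l)) v‖ ≤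
      3 * (2 * Real.pi * M * (M * σ⁻¹) * Real.exp (-(2 * Real.pi * σ * ‖freq l‖))) := fun l => by
    calc _ ≤ ∫ v, ∑ i, ‖fco W f i l * pderiv i (fmode f (k - l)) v‖ :=
          integral_mono (hint' l).norm (integrable_finsetSum _ fun i _ => (hint l i).norm)
            fun v => norm_sum_le _ _
      _ = ∑ i, ∫ v, ‖fco W f i l * pderiv i (fmode f (k - l)) v‖ :=
          integral_finsetSum _ fun i _ => (hint l i).norm
      _ ≤ ∑ i : Fin 3, 2 * Real.pi * M * (M * σ⁻¹) * Real.exp (-(2 * Real.pi * σ * ‖freq l‖)) :=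
          Finset.sum_le_sum fun i _ => h.norm_fco_mul_pderiv_le hW hγ k l i
      _ = _ := by simp
  have hs : Summable fun l : Mode =>
      3 * (2 * Real.pi * M * (M * σ⁻¹) * Real.exp (-(2 * Real.pi * σ * ‖freq l‖))) :=
    (h.summable_exp.mul_left _).mul_left _
  have hs' : Summable fun l => ∫ v, ‖∑ i, fco W f i l * pderiv i (fmode f (k - l)) v‖ :=
    Summable.of_nonneg_of_le (fun l => integral_nonneg fun _ => norm_nonneg _) hb hs
  have hlin : ∫⁻ v, ‖∑' l, ∑ i, fco W f i l * pderiv i (fmode f (k - l)) v‖ₑ ≤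
      ∑' l : Mode, ENNReal.ofReal
        (3 * (2 * Real.pi * M * (M * σ⁻¹) * Real.exp (-(2 * Real.pi * σ * ‖freq l‖)))) := by
    refine (lintegral_mono fun v => enorm_tsum_le_tsum_enorm).trans ?_
    rw [lintegral_tsum fun l => (hint' l).aestronglyMeasurable.enorm]
    refine ENNReal.tsum_le_tsum fun l => ?_
    rw [← ofReal_integral_norm_eq_lintegral_enorm (hint' l)]
    exact ENNReal.ofReal_le_ofReal (hb l)
  have hmeas : AEStronglyMeasurable (fun v => ∑' l, ∑ i, fco W f i l * pderiv i (fmode f (k - l)) v)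
      volume := by
    have e : (fun v => ∑' l, ∑ i, fco W f i l * pderiv i (fmode f (k - l)) v) = fun v =>
        torusFourier (fun x => ((inner ℝ (field W f x) (gradient (f x) v) : ℝ) : ℂ)) k :=
      funext fun v => (h.hasSum_torusFourier_force hW hγ k v).tsum_eq
    have hms : ∀ v, HasSum (fun l => ∑ i, fco W f i l * pderiv i (fmode f (k - l)) v)
      (torusFourier (fun x => ((inner ℝ (field W f x) (gradient (f x) v) : ℝ) : ℂ)) k) :=
      h.hasSum_torusFourier_force hW hγ k
    rw [e]
    have hcont : ∀ l, Measurable fun v => ∑ i, fco W f i l * pderiv i (fmode f (k - l)) v := fun l =>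
      Continuous.measurable (continuous_finsetSum _ fun i _ => continuous_const.mul
        (ContDiff.pderiv (h.contDiff (k - l)) i).continuous)
    exact (measurable_of_tendsto_metrizable' (f := fun (s : Finset Mode) v =>
      ∑ l ∈ s, ∑ i, fco W f i l * pderiv i (fmode f (k - l)) v) Filter.atTop
      (fun s => Finset.measurable_sum _ fun l _ => hcont l)
      (tendsto_pi_nhds.2 fun v => hms v)).aestronglyMeasurable
  have hi1 : Integrable fun v => ∑' l, ∑ i, fco W f i l * pderiv i (fmode f (k - l)) v :=
    ⟨hmeas, hlin.trans_lt (lt_top_iff_ne_top.2 hs.tsum_ofReal_ne_top)⟩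
  have hp' : Integrable fun v => (p v : ℂ) := hp.ofReal
  have hi2 : Integrable fun v => (phaseFourier f k 0 * p v - fmode f k v) :=
    (hp'.const_mul _).sub (h.integrable_fmode k)
  have hnn : ∀ l : Mode, 0 ≤
      3 * (2 * Real.pi * M * (M * σ⁻¹) * Real.exp (-(2 * Real.pi * σ * ‖freq l‖))) := fun l => by
    have := h.pos
    have := Real.pi_pos
    positivity
  refine ⟨(hi1.const_mul _).add (hi2.const_mul _), ?_, fun ζ => ?_⟩
  · have b1 : ∫ v, ‖∑' l, ∑ i, fco W f i l * pderiv i (fmode f (k - l)) v‖ ≤ ∑' l : Mode,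
        3 * (2 * Real.pi * M * (M * σ⁻¹) * Real.exp (-(2 * Real.pi * σ * ‖freq l‖))) := by
      rw [integral_norm_eq_lintegral_enorm hi1.1]
      refine (ENNReal.toReal_mono hs.tsum_ofReal_ne_top hlin).trans (le_of_eq ?_)
      rw [← ENNReal.ofReal_tsum_of_nonneg hnn hs, ENNReal.toReal_ofReal (tsum_nonneg hnn)]
    have b2 : ∫ v, ‖phaseFourier f k 0 * p v - fmode f k v‖ ≤ M * (∫ v, ‖p v‖) + M := by
      calc _ ≤ ∫ v, (‖phaseFourier f k 0‖ * ‖p v‖ + ‖fmode f k v‖) := by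
            refine integral_mono hi2.norm ((hp.norm.const_mul _).add (h.integrable_fmode k).norm)
              fun v => (norm_sub_le _ _).trans (le_of_eq ?_)
            rw [norm_mul, Complex.norm_real]
        _ = ‖phaseFourier f k 0‖ * (∫ v, ‖p v‖) + ∫ v, ‖fmode f k v‖ := by
            rw [integral_add (hp.norm.const_mul _) (h.integrable_fmode k).norm, integral_const_mul]
        _ ≤ _ := by
            have e1 : Real.exp (-(2 * Real.pi * σ * ‖freq k‖)) ≤ 1 := Real.exp_le_one_iff.2 (by
              have h0 := h.two_pi_pos
              have : 0 ≤ 2 * Real.pi * σ * ‖freq k‖ := by positivity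
              linarith)
            have e2 := h.norm_rho_le k
            have e3 := h.integral_norm_fmode_le k
            have e4 : M * Real.exp (-(2 * Real.pi * σ * ‖freq k‖)) ≤ M := by nlinarith
            have e5 : 0 ≤ ∫ v, ‖p v‖ := integral_nonneg fun _ => norm_nonneg _
            have e6 := e2.trans e4
            have e7 := e3.trans e4
            gcongr
    calc _ ≤ ∫ v, (|a| * ‖∑' l, ∑ i, fco W f i l * pderiv i (fmode f (k - l)) v‖ +
            |ν| * ‖phaseFourier f k 0 * p v - fmode f k v‖) := by
          refine integral_mono ((hi1.const_mul _).add (hi2.const_mul _)).norm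
            ((hi1.norm.const_mul _).add (hi2.norm.const_mul _)) fun v => ?_
          refine (norm_add_le _ _).trans (le_of_eq ?_)
          simp only [norm_mul, norm_neg, Complex.norm_real, Real.norm_eq_abs]
      _ = |a| * (∫ v, ‖∑' l, ∑ i, fco W f i l * pderiv i (fmode f (k - l)) v‖) +
            |ν| * ∫ v, ‖phaseFourier f k 0 * p v - fmode f k v‖ := by
          rw [integral_add (hi1.norm.const_mul _) (hi2.norm.const_mul _), integral_const_mul,
            integral_const_mul]
      _ ≤ |a| * (∑' l : Mode,
            3 * (2 * Real.pi * M * (M * σ⁻¹) * Real.exp (-(2 * Real.pi * σ * ‖freq l‖)))) +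
            |ν| * (M * (∫ v, ‖p v‖) + M) := by gcongr
      _ = _ := by ring
  · rw [velFourier_add (hi1.const_mul _) (hi2.const_mul _), velFourier_const_mul,
      velFourier_const_mul]
    have e1 : velFourier (fun v => ∑' l, ∑ i, fco W f i l * pderiv i (fmode f (k - l)) v) ζ =
        ∑' l, velFourier (fun v => ∑ i, fco W f i l * pderiv i (fmode f (k - l)) v) ζ := by
      simp only [velFourier_eq, ← tsum_mul_left]
      rw [← integral_tsum_of_summable_integral_norm]
      · exact fun l => integrable_ex_mul (hint' l) (by fun_prop)
      · simpa only [norm_mul, norm_ex, one_mul] using hs'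
    have e2 : ∀ l, velFourier (fun v => ∑ i, fco W f i l * pderiv i (fmode f (k - l)) v) ζ =
        -(4 * Real.pi ^ 2) * ((inner ℝ (freq l) ζ : ℝ) * Wc W l * phaseFourier f l 0 *
          phaseFourier f (k - l) ζ) := fun l => by
      have : velFourier (fun v => ∑ i, fco W f i l * pderiv i (fmode f (k - l)) v) ζ =
          ∑ i, fco W f i l * velFourier (pderiv i (fmode f (k - l))) ζ := by
        simp only [velFourier_eq, Finset.mul_sum]
        rw [integral_finsetSum _ fun i _ => integrable_ex_mul (hint l i) (by fun_prop)]
        refine Finset.sum_congr rfl fun i _ => ?_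
        rw [← integral_const_mul]
        congr with v; ring
      rw [this]
      have h4 : ∀ i, fco W f i l * velFourier (pderiv i (fmode f (k - l))) ζ =
          dsym i (freq l) * dsym i ζ * (Wc W l * phaseFourier f l 0 * phaseFourier f (k - l) ζ) :=
        fun i => by
        rw [velFourier_pderiv ((h.contDiff (k - l)).differentiable (by simp))
          (h.integrable_fmode _) (h.integrable_pderiv _ i), h.phaseFourier_eq (k - l), fco]
        ring
      rw [Finset.sum_congr rfl fun i _ => h4 i, ← Finset.sum_mul, sum_dsym_mul_dsym]
      ring
    have e3 : velFourier (fun v => phaseFourier f k 0 * p v - fmode f k v) ζ =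
        phaseFourier f k 0 * velFourier (fun v => (p v : ℂ)) ζ - phaseFourier f k ζ := by
      have := velFourier_add (hp'.const_mul (phaseFourier f k 0))
        ((h.integrable_fmode k).const_mul (-1)) ζ
      rw [velFourier_const_mul, velFourier_const_mul, ← h.phaseFourier_eq] at this
      rw [show (fun v => phaseFourier f k 0 * p v - fmode f k v) = fun v =>
        phaseFourier f k 0 * p v + (-1) * fmode f k v by funext v; ring, this]
      ring
    rw [e1, tsum_congr e2, tsum_mul_left, e3]
    unfold fourierRhs
    ring

end IsSlice

end Collision

section Solution

variable {a ν T γ : ℝ} {W p : E3 → ℝ} {f₀ : E3 → E3 → ℝ} {f : ℝ → E3 → E3 → ℝ}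

theorem IsAnalyticSolution.exists_isSlice (hf : IsAnalyticSolution a ν T W p f₀ f) :
    ∃ σ M, ∀ t ∈ Icc 0 T, IsSlice σ M (f t) := by
  obtain ⟨σ, hσ, M, hM⟩ := hf.analytic
  exact ⟨σ, max M 0, fun t ht => ⟨hσ, le_max_right _ _, hf.periodic t ht, hf.smooth t ht,
    (hM t ht).trans (ENNReal.ofReal_le_ofReal (le_max_left _ _))⟩⟩

/-- The derivative of a solution in the direction of free transport. -/
noncomputable def transportDeriv (T : ℝ) (f : ℝ → E3 → E3 → ℝ) (s : ℝ) (x v : E3) : ℝ :=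
  fderivWithin ℝ (fun z : ℝ × E3 × E3 => f z.1 z.2.1 z.2.2) (Icc 0 T ×ˢ univ) (s, x, v) (1, v, 0)

theorem uniqueDiffOn_slab (hT : 0 < T) : UniqueDiffOn ℝ (Icc 0 T ×ˢ (univ : Set (E3 × E3))) :=
  (uniqueDiffOn_Icc hT).prod uniqueDiffOn_univ

theorem IsAnalyticSolution.continuousOn_transportDeriv (hf : IsAnalyticSolution a ν T W p f₀ f)
    (hT : 0 < T) :
    ContinuousOn (fun z : ℝ × E3 × E3 => transportDeriv T f z.1 z.2.1 z.2.2) (Icc 0 T ×ˢ univ) := by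
  have h1 := hf.contDiffOn.continuousOn_fderivWithin (uniqueDiffOn_slab hT) le_rfl
  have h2 : Continuous fun z : ℝ × E3 × E3 => ((1, z.2.2, 0) : ℝ × E3 × E3) := by fun_prop
  exact h1.clm_apply h2.continuousOn

theorem IsAnalyticSolution.hasDerivWithinAt_transport (hf : IsAnalyticSolution a ν T W p f₀ f)
    (x v : E3) {s : ℝ} (hs : s ∈ Icc 0 T) :
    HasDerivWithinAt (fun s => f s (x + s • v) v) (transportDeriv T f s (x + s • v) v) (Icc 0 T) s := by
  have h1 : HasFDerivWithinAt (fun z : ℝ × E3 × E3 => f z.1 z.2.1 z.2.2)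
      (fderivWithin ℝ (fun z : ℝ × E3 × E3 => f z.1 z.2.1 z.2.2) (Icc 0 T ×ˢ univ) (s, x + s • v, v))
      (Icc 0 T ×ˢ univ) (s, x + s • v, v) :=
    (hf.contDiffOn.differentiableOn (by simp) _ ⟨hs, mem_univ _⟩).hasFDerivWithinAt
  have h2 : HasDerivWithinAt (fun s : ℝ => ((s, x + s • v, v) : ℝ × E3 × E3)) (1, v, 0) (Icc 0 T) s := by
    refine (hasDerivWithinAt_id _ _).prodMk (HasDerivWithinAt.prodMk ?_ (hasDerivWithinAt_const _ _ _))
    have := ((hasDerivAt_id s).smul_const v).const_add x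
    simpa using this.hasDerivWithinAt
  exact h1.comp_hasDerivWithinAt s h2 (fun r hr => mk_mem_prod hr (mem_univ _))

theorem IsAnalyticSolution.transportDeriv_eq (hf : IsAnalyticSolution a ν T W p f₀ f) (hT : 0 < T)
    {s : ℝ} (hs : s ∈ Icc 0 T) (x v : E3) :
    transportDeriv T f s x v = physRhs a ν W p (f s) x v := by
  have h1 : HasFDerivWithinAt (fun z : ℝ × E3 × E3 => f z.1 z.2.1 z.2.2)
      (fderivWithin ℝ (fun z : ℝ × E3 × E3 => f z.1 z.2.1 z.2.2) (Icc 0 T ×ˢ univ) (s, x, v))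
      (Icc 0 T ×ˢ univ) (s, x, v) :=
    (hf.contDiffOn.differentiableOn (by simp) _ ⟨hs, mem_univ _⟩).hasFDerivWithinAt
  have h2 : HasDerivWithinAt (fun s : ℝ => ((s, x, v) : ℝ × E3 × E3)) (1, 0, 0) (Icc 0 T) s :=
    (hasDerivWithinAt_id _ _).prodMk (hasDerivWithinAt_const _ _ _)
  have h3 := (h1.comp_hasDerivWithinAt s h2 (fun r hr => mk_mem_prod hr (mem_univ _))).derivWithin
    (uniqueDiffOn_Icc hT s hs)
  have h4 : HasFDerivAt (fun y : E3 => ((s, y, v) : ℝ × E3 × E3))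
      ((ContinuousLinearMap.inr ℝ ℝ (E3 × E3)).comp (ContinuousLinearMap.inl ℝ E3 E3)) x := by
    have h5 := ((ContinuousLinearMap.inr ℝ ℝ (E3 × E3)).comp
      (ContinuousLinearMap.inl ℝ E3 E3)).hasFDerivAt (x := x)
    have h6 := h5.const_add ((s, 0, v) : ℝ × E3 × E3)
    convert! h6 using 1
    funext y; simp
  have h7 : HasFDerivAt (fun y => f s y v) ((fderivWithin ℝ (fun z : ℝ × E3 × E3 =>
      f z.1 z.2.1 z.2.2) (Icc 0 T ×ˢ univ) (s, x, v)).comp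
      ((ContinuousLinearMap.inr ℝ ℝ (E3 × E3)).comp (ContinuousLinearMap.inl ℝ E3 E3))) x := by
    have := h1.comp (s := univ) x h4.hasFDerivWithinAt (fun y _ => mk_mem_prod hs (mem_univ _))
    rw [hasFDerivWithinAt_univ] at this
    exact this
  have h8 : inner ℝ v (gradient (fun y => f s y v) x) =
      fderivWithin ℝ (fun z : ℝ × E3 × E3 => f z.1 z.2.1 z.2.2) (Icc 0 T ×ˢ univ) (s, x, v)
        (0, v, 0) := by
    rw [inner_gradient_right, h7.fderiv]
    simp
  have h9 := hf.equation s hs x v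
  rw [h8] at h9
  have h10 : transportDeriv T f s x v = derivWithin (fun s => f s x v) (Icc 0 T) s +
      fderivWithin ℝ (fun z : ℝ × E3 × E3 => f z.1 z.2.1 z.2.2) (Icc 0 T ×ˢ univ) (s, x, v)
        (0, v, 0) := by
    have h11 : derivWithin (fun s => f s x v) (Icc 0 T) s = _ := h3
    rw [h11, transportDeriv, ← map_add]
    simp
  rw [h10]
  unfold physRhs
  linarith

/-- The Fourier modes of the right-hand side, as a jointly continuous function. -/
noncomputable def clampedMode (T : ℝ) (hT : 0 < T) (f : ℝ → E3 → E3 → ℝ) (k : Mode) (z : ℝ × E3) :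
    ℂ :=
  ex (z.1 * inner ℝ (freq k) z.2) * torusFourier (fun x =>
    (transportDeriv T f (projIcc 0 T hT.le z.1) x z.2 : ℂ)) k

theorem IsAnalyticSolution.continuous_transportDeriv (hf : IsAnalyticSolution a ν T W p f₀ f)
    (hT : 0 < T) : Continuous fun z : ℝ × E3 × E3 =>
      transportDeriv T f (projIcc 0 T hT.le z.1) z.2.1 z.2.2 := by
  have h1 : Continuous fun z : ℝ × E3 × E3 =>
      (((projIcc 0 T hT.le z.1 : ℝ), z.2.1, z.2.2) : ℝ × E3 × E3) :=
    (continuous_subtype_val.comp (continuous_projIcc.comp continuous_fst)).prodMk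
      (by fun_prop)
  exact (hf.continuousOn_transportDeriv hT).comp_continuous h1
    fun z => ⟨Subtype.coe_prop _, mem_univ _⟩

theorem IsAnalyticSolution.continuous_clampedMode (hf : IsAnalyticSolution a ν T W p f₀ f)
    (hT : 0 < T) (k : Mode) : Continuous (clampedMode T hT f k) := by
  have h1 := hf.continuous_transportDeriv hT
  have h2 : Continuous (Function.uncurry fun (z : ℝ × E3) (x : E3) => ex (-inner ℝ (freq k) x) *
      (transportDeriv T f (projIcc 0 T hT.le z.1) x z.2 : ℂ)) := by
    have h3 : Continuous fun y : (ℝ × E3) × E3 =>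
        (transportDeriv T f (projIcc 0 T hT.le y.1.1) y.2 y.1.2 : ℂ) :=
      Complex.continuous_ofReal.comp (h1.comp
        (by fun_prop : Continuous fun y : (ℝ × E3) × E3 => (y.1.1, y.2, y.1.2)))
    have h4 : Continuous fun y : (ℝ × E3) × E3 => ex (-inner ℝ (freq k) y.2) := by fun_prop
    exact h4.mul h3
  have h5 := continuous_integral_cell h2
  have h6 : Continuous fun z : ℝ × E3 => ex (z.1 * inner ℝ (freq k) z.2) := by fun_prop
  have e : clampedMode T hT f k = fun z => ex (z.1 * inner ℝ (freq k) z.2) *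
      ∫ x in cell, ex (-inner ℝ (freq k) x) *
        (transportDeriv T f (projIcc 0 T hT.le z.1) x z.2 : ℂ) := by
    funext z; rw [clampedMode, torusFourier_eq]
  rw [e]
  exact h6.mul h5

theorem IsAnalyticSolution.fmode_eq (hf : IsAnalyticSolution a ν T W p f₀ f) (hT : 0 < T)
    {t : ℝ} (ht : t ∈ Icc 0 T) (k : Mode) (v : E3) :
    ex (t * inner ℝ (freq k) v) * fmode (f t) k v =
      fmode f₀ k v + ∫ s in (0 : ℝ)..t, clampedMode T hT f k (s, v) := by
  have hR := hf.continuous_transportDeriv hT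
  have hproj : ∀ s ∈ Icc 0 t, ((projIcc 0 T hT.le s : Icc 0 T) : ℝ) = s := fun s hs => by
    rw [projIcc_of_mem hT.le ⟨hs.1, hs.2.trans ht.2⟩]
  have hG : Continuous fun y : ℝ × E3 =>
      (transportDeriv T f (projIcc 0 T hT.le y.1) (y.2 + y.1 • v) v : ℂ) :=
    Complex.continuous_ofReal.comp (hR.comp
      (by fun_prop : Continuous fun y : ℝ × E3 => (y.1, y.2 + y.1 • v, v)))
  have ftc : ∀ x, (f t (x + t • v) v : ℂ) = f₀ x v +
      ∫ s in (0 : ℝ)..t, (transportDeriv T f (projIcc 0 T hT.le s) (x + s • v) v : ℂ) := fun x => by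
    have h1 := intervalIntegral.integral_eq_sub_of_hasDeriv_right_of_le (a := 0) (b := t)
      (f := fun s => f s (x + s • v) v)
      (f' := fun s => transportDeriv T f (projIcc 0 T hT.le s) (x + s • v) v) ht.1 ?_ ?_ ?_
    · rw [intervalIntegral.integral_ofReal, h1, ← hf.initial]
      simp
    · intro s hs
      exact ((hf.hasDerivWithinAt_transport x v ⟨hs.1, hs.2.trans ht.2⟩).continuousWithinAt).mono
        (Icc_subset_Icc_right ht.2)
    · intro s hs
      rw [hproj s ⟨hs.1.le, hs.2.le⟩]
      have h2 := hf.hasDerivWithinAt_transport x v (s := s) ⟨hs.1.le, hs.2.le.trans ht.2⟩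
      exact (h2.hasDerivAt (Icc_mem_nhds hs.1 (hs.2.trans_le ht.2))).hasDerivWithinAt
    · have : Continuous fun s : ℝ => transportDeriv T f (projIcc 0 T hT.le s) (x + s • v) v :=
        hR.comp (by fun_prop : Continuous fun s : ℝ => (s, x + s • v, v))
      exact this.intervalIntegrable _ _
  have hper : ∀ s ∈ Icc 0 T, TorusPeriodic fun x => (transportDeriv T f s x v : ℂ) := by
    intro s hs x l
    have h1 : ∀ x, HasDerivWithinAt (fun r => f r (x - s • v + r • v) v) (transportDeriv T f s x v)
        (Icc 0 T) s := fun x => by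
      have := hf.hasDerivWithinAt_transport (x - s • v) v hs
      rwa [sub_add_cancel] at this
    have h2 := (h1 (x + freq l)).derivWithin (uniqueDiffOn_Icc hT s hs)
    have h3 := (h1 x).derivWithin (uniqueDiffOn_Icc hT s hs)
    have h4 : EqOn (fun r => f r (x + freq l - s • v + r • v) v) (fun r => f r (x - s • v + r • v) v)
        (Icc 0 T) := fun r hr => by
      have : x + freq l - s • v + r • v = (x - s • v + r • v) + freq l := by abel
      simp only [this]
      exact congrFun (hf.periodic r hr _ l) v
    rw [derivWithin_congr h4 (h4 hs), h3] at h2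
    simp only [h2]
  have e1 : fmode (f t) k v * ex (inner ℝ (freq k) (t • v)) =
      torusFourier (fun x => (f t (x + t • v) v : ℂ)) k := by
    have hp : TorusPeriodic fun x => (f t x v : ℂ) := fun x l => by simp only [hf.periodic t ht x l]
    rw [torusFourier_comp_add hp]; simp only [fmode, mul_comm]
  have hf0 : Continuous fun x => (f₀ x v : ℂ) := by
    have : Continuous fun x => f 0 x v := (hf.smooth 0 ⟨le_rfl, hT.le⟩).continuous.comp
      (by fun_prop : Continuous fun x : E3 => (x, v))
    refine Complex.continuous_ofReal.comp ?_
    simpa only [hf.initial] using this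
  have hint : Continuous fun x => ∫ s in (0 : ℝ)..t,
      (transportDeriv T f (projIcc 0 T hT.le s) (x + s • v) v : ℂ) := by
    refine intervalIntegral.continuous_parametric_intervalIntegral_of_continuous' ?_ _ _
    exact hG.comp continuous_swap
  rw [mul_comm (ex _), show t * inner ℝ (freq k) v = inner ℝ (freq k) (t • v) by
    rw [inner_smul_right], e1, funext ftc, torusFourier_add' hf0 hint]
  congr 1
  rw [torusFourier_eq]
  have e2 : ∀ x, ex (-inner ℝ (freq k) x) * (∫ s in (0 : ℝ)..t,
      (transportDeriv T f (projIcc 0 T hT.le s) (x + s • v) v : ℂ)) =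
      ∫ s in (0 : ℝ)..t, ex (-inner ℝ (freq k) x) *
        (transportDeriv T f (projIcc 0 T hT.le s) (x + s • v) v : ℂ) := fun x => by
    rw [intervalIntegral.integral_const_mul]
  simp only [e2]
  simp only [intervalIntegral.integral_of_le ht.1]
  rw [integral_integral_swap]
  · refine setIntegral_congr_fun measurableSet_Ioc fun s hs => ?_
    have hs' : s ∈ Icc 0 T := ⟨hs.1.le, hs.2.trans ht.2⟩
    simp only [clampedMode]
    rw [← torusFourier_eq (fun x => (transportDeriv T f (projIcc 0 T hT.le s) (x + s • v) v : ℂ)),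
      hproj s ⟨hs.1.le, hs.2⟩, torusFourier_comp_add (hper s hs')]
    rw [inner_smul_right]
  · have h1 : Continuous (Function.uncurry fun (x : E3) (s : ℝ) => ex (-inner ℝ (freq k) x) *
        (transportDeriv T f (projIcc 0 T hT.le s) (x + s • v) v : ℂ)) :=
      (by fun_prop : Continuous fun y : E3 × ℝ => ex (-inner ℝ (freq k) y.1)).mul
        (hG.comp continuous_swap)
    have h2 : IntegrableOn (Function.uncurry fun (x : E3) (s : ℝ) => ex (-inner ℝ (freq k) x) *
        (transportDeriv T f (projIcc 0 T hT.le s) (x + s • v) v : ℂ))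
        (Metric.closedBall (0 : E3) 2 ×ˢ Icc 0 t) (volume.prod volume) :=
      h1.continuousOn.integrableOn_compact ((isCompact_closedBall _ _).prod isCompact_Icc)
    have h3 := h2.mono_set (prod_mono (fun x hx => by simpa using norm_le_of_mem_cell hx)
      (Ioc_subset_Icc_self : Ioc 0 t ⊆ Icc 0 t) : cell ×ˢ Ioc 0 t ⊆ _)
    rwa [IntegrableOn, ← Measure.prod_restrict] at h3

/-- The Fourier transform of an analytic solution, in the frame of free transport. -/
noncomputable def freeFourier (f : ℝ → E3 → E3 → ℝ) (t : ℝ) (k : Mode) (η : E3) : ℂ :=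
  phaseFourier (f t) k (η - t • freq k)

theorem IsAnalyticSolution.isFourierSol (hf : IsAnalyticSolution a ν T W p f₀ f) (hT : 0 < T)
    (hW : IsPotential γ W) (hγ : 1 < γ) (hp : Integrable p) :
    IsFourierSol a ν T (Wc W) (velFourier fun v => (p v : ℂ)) (phaseFourier f₀) (freeFourier f) := by
  obtain ⟨σ, M, hs⟩ := hf.exists_isSlice
  have hf0 : f 0 = f₀ := by funext x v; exact hf.initial x v
  have hproj : ∀ s ∈ Icc 0 T, ((projIcc 0 T hT.le s : Icc 0 T) : ℝ) = s := fun s hs => by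
    rw [projIcc_of_mem hT.le hs]
  have hphys : ∀ s ∈ Icc 0 T, ∀ k v, clampedMode T hT f k (s, v) = ex (s * inner ℝ (freq k) v) *
      torusFourier (fun x => (physRhs a ν W p (f s) x v : ℂ)) k := fun s hs' k v => by
    simp only [clampedMode, hproj s hs', hf.transportDeriv_eq hT hs']
  have hInt : ∀ t ∈ Icc 0 T, ∀ k η, Integrable (Function.uncurry fun (v : E3) (s : ℝ) =>
      ex (-inner ℝ η v) * clampedMode T hT f k (s, v))
      (volume.prod (volume.restrict (Ioc 0 t))) := by
    intro t ht k η
    refine Integrable.bdd_mul (c := 1) ?_ (Continuous.aestronglyMeasurable (by fun_prop)) (by simp)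
    have hm : AEStronglyMeasurable (fun z : ℝ × E3 => clampedMode T hT f k z)
        ((volume.restrict (Ioc 0 t)).prod volume) :=
      (hf.continuous_clampedMode hT k).aestronglyMeasurable
    have h1 : Integrable (fun z : ℝ × E3 => clampedMode T hT f k z)
        ((volume.restrict (Ioc 0 t)).prod volume) := by
      rw [integrable_prod_iff hm]
      constructor
      · refine (ae_restrict_iff' measurableSet_Ioc).2 (Filter.Eventually.of_forall fun s hs' => ?_)
        have hs'' : s ∈ Icc 0 T := ⟨hs'.1.le, hs'.2.trans ht.2⟩
        simp only [hphys s hs'']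
        exact integrable_ex_mul ((hs s hs'').modeRhs_spec hW hγ a ν hp k).1 (by fun_prop)
      · refine Integrable.of_bound hm.norm.integral_prod_right'
          (C := |a| * ∑' l, 3 * (2 * Real.pi * M * (M * σ⁻¹) * Real.exp (-(2 * Real.pi * σ * ‖freq l‖)))
            + |ν| * (M * ∫ v, ‖p v‖) + |ν| * M) ?_
        refine (ae_restrict_iff' measurableSet_Ioc).2 (Filter.Eventually.of_forall fun s hs' => ?_)
        have hs'' : s ∈ Icc 0 T := ⟨hs'.1.le, hs'.2.trans ht.2⟩
        rw [Real.norm_of_nonneg (integral_nonneg fun _ => norm_nonneg _)]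
        simp only [hphys s hs'', norm_mul, norm_ex, one_mul]
        exact ((hs s hs'').modeRhs_spec hW hγ a ν hp k).2.1
    exact h1.swap
  have hinner : ∀ s ∈ Icc 0 T, ∀ k η, ∫ v, ex (-inner ℝ η v) * clampedMode T hT f k (s, v) =
      nl a ν (Wc W) (velFourier fun v => (p v : ℂ)) (freeFourier f s) s k η := by
    intro s hs' k η
    unfold freeFourier
    rw [nl_phaseFourier, ← ((hs s hs').modeRhs_spec hW hγ a ν hp k).2.2, velFourier_eq]
    congr with v
    rw [hphys s hs', ← mul_assoc, ← ex_add]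
    congr 2
    rw [inner_sub_left, inner_smul_left]; simp; ring
  refine ⟨fun k η => ?_, fun t ht k η => ?_⟩
  · rw [intervalIntegrable_iff_integrableOn_Ioc_of_le hT.le]
    have := (hInt T ⟨hT.le, le_rfl⟩ k η).integral_prod_right
    refine IntegrableOn.congr_fun this (fun s hs' => ?_) measurableSet_Ioc
    exact hinner s ⟨hs'.1.le, hs'.2⟩ k η
  · have h0 := hs 0 ⟨le_rfl, hT.le⟩
    rw [hf0] at h0
    have h1 : freeFourier f t k η = ∫ v, ex (-inner ℝ η v) *
        (fmode f₀ k v + ∫ s in (0 : ℝ)..t, clampedMode T hT f k (s, v)) := by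
      rw [freeFourier, (hs t ht).phaseFourier_eq, velFourier_eq]
      congr with v
      rw [← hf.fmode_eq hT ht, ← mul_assoc, ← ex_add]
      congr 2
      rw [inner_sub_left, inner_smul_left]; simp; ring
    have hI := hInt t ht k η
    have h2 : ∀ v, ex (-inner ℝ η v) *
        (fmode f₀ k v + ∫ s in (0 : ℝ)..t, clampedMode T hT f k (s, v)) =
        ex (-inner ℝ η v) * fmode f₀ k v +
          ∫ s in Ioc 0 t, ex (-inner ℝ η v) * clampedMode T hT f k (s, v) := fun v => by
      rw [mul_add, intervalIntegral.integral_of_le ht.1, integral_const_mul]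
    have h3 : Integrable fun v => ∫ s in Ioc 0 t, ex (-inner ℝ η v) * clampedMode T hT f k (s, v) :=
      hI.integral_prod_left
    rw [h1]
    simp only [h2]
    rw [integral_add (integrable_ex_mul (h0.integrable_fmode k) (by fun_prop)) h3, ← velFourier_eq,
      ← h0.phaseFourier_eq, integral_integral_swap hI, intervalIntegral.integral_of_le ht.1]
    congr 1
    exact setIntegral_congr_fun measurableSet_Ioc fun s hs' =>
      hinner s ⟨hs'.1.le, hs'.2.trans ht.2⟩ k η

end Solution

section Dual

theorem ExpDecay.bounded {H : E3 → ℂ} (h : ExpDecay H) : ∃ C, ∀ η, ‖H η‖ ≤ C := by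
  obtain ⟨hc, c, hc0, C, hC⟩ := h
  refine ⟨C, fun η => (hC η).trans ?_⟩
  have h0 : 0 ≤ C := by
    have := (norm_nonneg _).trans (hC η)
    exact nonneg_of_mul_nonneg_left this (Real.exp_pos _)
  have : Real.exp (-(c * ‖η‖)) ≤ 1 := Real.exp_le_one_iff.2 (by
    have : 0 ≤ c * ‖η‖ := by positivity
    linarith)
  nlinarith

theorem ExpDecay.integrable_mul {H ψ : E3 → ℂ} (h : ExpDecay H) (hψ : Integrable ψ) :
    Integrable (fun η => H η * ψ η) := by
  obtain ⟨C, hC⟩ := h.bounded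
  exact hψ.bdd_mul (c := C) h.1.aestronglyMeasurable (Filter.Eventually.of_forall hC)

theorem integral_velFourier_mul {g ψ : E3 → ℂ} (hg : Integrable g) (hψ : Integrable ψ) :
    ∫ η, velFourier g η * ψ η = ∫ v, g v * velFourier ψ v := by
  have := VectorFourier.integral_fourierIntegral_smul_eq_flip (L := innerₗ E3)
    Real.continuous_fourierChar (by exact continuous_inner) hg hψ
  simp only [flip_innerₗ] at this
  rw [velFourier_eq_fourier, velFourier_eq_fourier]
  exact this

/-- The inverse Fourier transform of `H` has mass at most `c`, tested against the Fourier
transforms of integrable functions. -/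
def DualBound (H : E3 → ℂ) (c : ℝ) : Prop :=
  ∀ ψ : E3 → ℂ, Integrable ψ → (∀ v, ‖velFourier ψ v‖ ≤ 1) → ‖∫ η, H η * ψ η‖ ≤ c

theorem DualBound.nonneg {H : E3 → ℂ} {c : ℝ} (h : DualBound H c) : 0 ≤ c := by
  have := h (fun _ => 0) (integrable_zero _ _ _) (fun v => by simp [velFourier])
  simpa using this

theorem DualBound.mono {H : E3 → ℂ} {c c' : ℝ} (h : DualBound H c) (hc : c ≤ c') : DualBound H c' :=
  fun ψ h1 h2 => (h ψ h1 h2).trans hc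

theorem dualBound_velFourier {g : E3 → ℂ} (hg : Integrable g) :
    DualBound (velFourier g) (∫ v, ‖g v‖) := by
  intro ψ hψ hb
  rw [integral_velFourier_mul hg hψ]
  refine norm_integral_le_of_norm_le hg.norm (Filter.Eventually.of_forall fun v => ?_)
  rw [norm_mul]
  have := hb v
  have := norm_nonneg (g v)
  nlinarith

theorem DualBound.add {H G : E3 → ℂ} {c d : ℝ} (hH : DualBound H c) (hG : DualBound G d)
    (h1 : ExpDecay H) (h2 : ExpDecay G) : DualBound (fun η => H η + G η) (c + d) := by
  intro ψ hψ hb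
  simp only [add_mul]
  rw [integral_add (h1.integrable_mul hψ) (h2.integrable_mul hψ)]
  exact (norm_add_le _ _).trans (add_le_add (hH ψ hψ hb) (hG ψ hψ hb))

theorem DualBound.const_mul {H : E3 → ℂ} {c : ℝ} (hH : DualBound H c) (b : ℂ) :
    DualBound (fun η => b * H η) (‖b‖ * c) := by
  intro ψ hψ hb
  simp only [mul_assoc]
  rw [integral_const_mul, norm_mul]
  exact mul_le_mul_of_nonneg_left (hH ψ hψ hb) (norm_nonneg _)

/-- Modulations do not change the dual bound. -/
theorem DualBound.ex_mul {H : E3 → ℂ} {c : ℝ} (hH : DualBound H c) (x : E3) :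
    DualBound (fun η => ex (inner ℝ x η) * H η) c := by
  intro ψ hψ hb
  have h1 : Integrable fun η => ex (inner ℝ x η) * ψ η := integrable_ex_mul hψ (by fun_prop)
  have := hH _ h1 fun v => by rw [velFourier_ex_mul]; exact hb _
  convert! this using 3
  funext η; ring

theorem DualBound.tsum {ι : Type*} [Countable ι] {H : ι → E3 → ℂ} {c b : ι → ℝ} (hH : ∀ l, DualBound (H l) (c l))
    (hcont : ∀ l, Continuous (H l)) (hb : ∀ l η, ‖H l η‖ ≤ b l) (hs : Summable b) {C : ℝ}
    (hc : HasSum c C) : DualBound (fun η => ∑' l, H l η) C := by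
  intro ψ hψ hb'
  have hint : ∀ l, Integrable fun η => H l η * ψ η := fun l =>
    hψ.bdd_mul (c := b l) (hcont l).aestronglyMeasurable (Filter.Eventually.of_forall (hb l))
  have e : ∫ η, (∑' l, H l η) * ψ η = ∑' l, ∫ η, H l η * ψ η := by
    simp only [← tsum_mul_right]
    rw [← integral_tsum_of_summable_integral_norm hint]
    · refine Summable.of_nonneg_of_le (fun l => integral_nonneg fun _ => norm_nonneg _) (fun l => ?_)
        (hs.mul_right (∫ η, ‖ψ η‖))
      rw [← integral_const_mul]
      refine integral_mono (hint l).norm (hψ.norm.const_mul _) fun η => ?_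
      rw [norm_mul]
      exact mul_le_mul_of_nonneg_right (hb l η) (norm_nonneg _)
  rw [e]
  exact tsum_of_norm_bounded hc fun l => hH l ψ hψ hb'

theorem DualBound.integral {H : ℝ → E3 → ℂ} {c : ℝ → ℝ} {t B : ℝ} (ht : 0 ≤ t)
    (hH : ∀ s ∈ Icc 0 t, DualBound (H s) (c s)) (hcont : Continuous (Function.uncurry H))
    (hb : ∀ s ∈ Icc 0 t, ∀ η, ‖H s η‖ ≤ B) (hc : Continuous c) :
    DualBound (fun η => ∫ s in (0 : ℝ)..t, H s η) (∫ s in (0 : ℝ)..t, c s) := by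
  intro ψ hψ hb'
  have hI : Integrable (Function.uncurry fun (s : ℝ) (η : E3) => H s η * ψ η)
      ((volume.restrict (Ioc 0 t)).prod volume) := by
    have h1 : Integrable (fun z : ℝ × E3 => ψ z.2) ((volume.restrict (Ioc 0 t)).prod volume) :=
      hψ.comp_snd _
    refine h1.bdd_mul (c := B) hcont.aestronglyMeasurable ?_
    have : ∀ᵐ s ∂(volume.restrict (Ioc 0 t)), ∀ η, ‖H s η‖ ≤ B :=
      (ae_restrict_iff' measurableSet_Ioc).2 (Filter.Eventually.of_forall fun s hs =>
        hb s ⟨hs.1.le, hs.2⟩)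
    have h2 := Measure.ae_prod_iff_ae_ae (μ := volume.restrict (Ioc 0 t)) (ν := (volume : Measure E3))
      (p := fun z => ‖Function.uncurry H z‖ ≤ B)
      (measurableSet_le hcont.norm.measurable measurable_const)
    exact h2.2 (this.mono fun s hs => Filter.Eventually.of_forall hs)
  have e : ∫ η, (∫ s in (0 : ℝ)..t, H s η) * ψ η = ∫ s in (0 : ℝ)..t, ∫ η, H s η * ψ η := by
    simp only [intervalIntegral.integral_of_le ht]
    rw [integral_integral_swap hI]
    congr with η; rw [integral_mul_const]
  rw [e]
  refine intervalIntegral.norm_integral_le_of_norm_le ht (Filter.Eventually.of_forall fun s hs => ?_)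
    (hc.intervalIntegrable _ _)
  exact hH s ⟨hs.1.le, hs.2⟩ ψ hψ hb'

/-- The symbol of a product of directional derivatives. -/
noncomputable def dprod (y : ℕ → E3) (S : Finset ℕ) (η : E3) : ℂ :=
  ∏ i ∈ S, (2 * Real.pi * Complex.I * (inner ℝ (y i) η : ℝ))

@[fun_prop] theorem continuous_dprod (y : ℕ → E3) (S : Finset ℕ) : Continuous (dprod y S) := by
  unfold dprod; fun_prop

theorem norm_dir_le {y : E3} (hy : ‖y‖ ≤ 1) (η : E3) :
    ‖(2 * Real.pi * Complex.I * (inner ℝ y η : ℝ) : ℂ)‖ ≤ 2 * Real.pi * ‖η‖ := by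
  have h1 := abs_real_inner_le_norm y η
  have h2 : ‖y‖ * ‖η‖ ≤ ‖η‖ := by nlinarith [norm_nonneg η]
  have h3 : ‖(2 * Real.pi * Complex.I * (inner ℝ y η : ℝ) : ℂ)‖ = 2 * Real.pi * |inner ℝ y η| := by
    simp [abs_of_pos Real.pi_pos]
  rw [h3]
  have := h1.trans h2
  gcongr

theorem norm_dprod_le {y : ℕ → E3} (hy : ∀ i, ‖y i‖ ≤ 1) (S : Finset ℕ) (η : E3) :
    ‖dprod y S η‖ ≤ (2 * Real.pi * ‖η‖) ^ S.card := by
  unfold dprod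
  rw [norm_prod]
  refine (Finset.prod_le_prod (fun _ _ => norm_nonneg _) fun i _ => norm_dir_le (hy i) η).trans ?_
  simp

theorem dprod_add (y : ℕ → E3) (S : Finset ℕ) (η b : E3) :
    dprod y S (η + b) = ∑ A ∈ S.powerset, dprod y A η * dprod y (S \ A) b := by
  unfold dprod
  rw [← Finset.prod_add]
  refine Finset.prod_congr rfl fun i _ => ?_
  rw [inner_add_right]; push_cast; ring

theorem ExpDecay.pow_mul_of_norm_le {H m : E3 → ℂ} (h : ExpDecay H) (hm : Continuous m) (n : ℕ)
    {D : ℝ} (hD : ∀ η, ‖m η‖ ≤ D * ‖η‖ ^ n) : ExpDecay (fun η => m η * H η) := by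
  obtain ⟨hc, c, hc0, C, hC⟩ := h
  obtain ⟨E, hE, h1⟩ := pow_le_exp (half_pos hc0) n
  have hC0 : 0 ≤ C := by
    have := (norm_nonneg _).trans (hC 0)
    exact nonneg_of_mul_nonneg_left this (Real.exp_pos _)
  refine ⟨by fun_prop, c / 2, half_pos hc0, |D| * E * C, fun η => ?_⟩
  rw [norm_mul]
  calc ‖m η‖ * ‖H η‖ ≤ (|D| * (E * Real.exp (c / 2 * ‖η‖))) * (C * Real.exp (-(c * ‖η‖))) := by
        refine mul_le_mul ((hD η).trans ?_) (hC η) (norm_nonneg _) (by positivity)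
        exact (mul_le_mul_of_nonneg_right (le_abs_self D) (by positivity)).trans
          (mul_le_mul_of_nonneg_left (h1 _ (norm_nonneg _)) (abs_nonneg _))
    _ = |D| * E * C * (Real.exp (c / 2 * ‖η‖) * Real.exp (-(c * ‖η‖))) := by ring
    _ = _ := by rw [← Real.exp_add]; congr 2; ring

theorem ExpDecay.dprod_mul {H : E3 → ℂ} (h : ExpDecay H) {y : ℕ → E3} (hy : ∀ i, ‖y i‖ ≤ 1)
    (S : Finset ℕ) : ExpDecay (fun η => dprod y S η * H η) :=
  h.pow_mul_of_norm_le (continuous_dprod y S) S.card (D := (2 * Real.pi) ^ S.card) fun η =>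
    (norm_dprod_le hy S η).trans (le_of_eq (mul_pow _ _ _))

/-- All products of `N` directional derivatives of the inverse Fourier transform of `H` have mass
at most `w N * N! / σ^N`. -/
def AnBound (σ : ℝ) (w : ℕ → ℝ) (H : E3 → ℂ) : Prop :=
  ∀ y : ℕ → E3, (∀ i, ‖y i‖ ≤ 1) → ∀ S : Finset ℕ,
    DualBound (fun η => dprod y S η * H η) (w S.card * (S.card.factorial * σ⁻¹ ^ S.card))

theorem AnBound.add {σ : ℝ} {w w' : ℕ → ℝ} {H G : E3 → ℂ} (hH : AnBound σ w H) (hG : AnBound σ w' G)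
    (h1 : ExpDecay H) (h2 : ExpDecay G) :
    AnBound σ (fun N => w N + w' N) (fun η => H η + G η) := by
  intro y hy S
  have := (hH y hy S).add (hG y hy S) (h1.dprod_mul hy S) (h2.dprod_mul hy S)
  rw [← add_mul] at this
  convert! this using 2 with η
  rw [mul_add]

theorem AnBound.const_mul {σ : ℝ} {w : ℕ → ℝ} {H : E3 → ℂ} (hH : AnBound σ w H) (b : ℂ) :
    AnBound σ (fun N => ‖b‖ * w N) (fun η => b * H η) := by
  intro y hy S
  have := (hH y hy S).const_mul b
  rw [← mul_assoc] at this
  convert! this using 2 with η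
  ring

theorem AnBound.mono {σ : ℝ} {w w' : ℕ → ℝ} {H : E3 → ℂ} (hσ : 0 < σ) (hH : AnBound σ w H)
    (h : ∀ N, w N ≤ w' N) : AnBound σ w' H := fun y hy S =>
  (hH y hy S).mono (mul_le_mul_of_nonneg_right (h _) (by positivity))

theorem AnBound.mono_radius {σ σ' c : ℝ} {H : E3 → ℂ} (hσ : 0 < σ) (hc : 0 ≤ c)
    (hH : AnBound σ' (fun _ => c) H) (h : σ ≤ σ') : AnBound σ (fun _ => c) H := fun y hy S =>
  (hH y hy S).mono (by
    have : σ'⁻¹ ≤ σ⁻¹ := inv_anti₀ hσ h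
    have h2 : 0 ≤ σ'⁻¹ := inv_nonneg.2 (hσ.le.trans h)
    gcongr)

theorem sum_choose_le {σ β : ℝ} (hσ : 0 < σ) (hβ : 0 ≤ β) (N : ℕ) :
    ∑ m ∈ Finset.range (N + 1), (N.choose m : ℝ) * (β ^ (N - m) * (m.factorial * σ⁻¹ ^ m)) ≤
      Real.exp (β * σ) * (N.factorial * σ⁻¹ ^ N) := by
  have e : ∀ m ∈ Finset.range (N + 1), (N.choose m : ℝ) * (β ^ (N - m) * (m.factorial * σ⁻¹ ^ m)) =
      ((β * σ) ^ (N - m) / (N - m).factorial) * (N.factorial * σ⁻¹ ^ N) := fun m hm => by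
    have hm' : m ≤ N := Nat.lt_succ_iff.1 (Finset.mem_range.1 hm)
    have h1 : (N.choose m : ℝ) * m.factorial * (N - m).factorial = N.factorial := by
      exact_mod_cast Nat.choose_mul_factorial_mul_factorial hm'
    have h2 : σ⁻¹ ^ m = σ ^ (N - m) * σ⁻¹ ^ N := by
      have : σ⁻¹ ^ N = σ⁻¹ ^ (N - m) * σ⁻¹ ^ m := by rw [← pow_add]; congr 1; omega
      rw [this, ← mul_assoc, ← mul_pow, mul_inv_cancel₀ hσ.ne', one_pow, one_mul]
    have h3 : ((N - m).factorial : ℝ) ≠ 0 := by positivity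
    rw [← h1, h2, mul_pow]
    field_simp
  rw [Finset.sum_congr rfl e, ← Finset.sum_mul]
  refine mul_le_mul_of_nonneg_right ?_ (by positivity)
  have := Finset.sum_range_reflect (fun j => (β * σ) ^ j / (j.factorial : ℝ)) (N + 1)
  simp only [Nat.add_sub_cancel] at this
  rw [this]
  exact Real.sum_le_exp_of_nonneg (by positivity) _

/-- Translations of the dual variable. -/
theorem AnBound.comp_sub {σ c : ℝ} {H : E3 → ℂ} (hσ : 0 < σ) (hH : AnBound σ (fun _ => c) H)
    (h1 : ExpDecay H) (b : E3) :
    AnBound σ (fun _ => c * Real.exp (2 * Real.pi * ‖b‖ * σ)) (fun η => H (η - b)) := by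
  intro y hy S ψ hψ hb
  have hc : 0 ≤ c := by
    have := (hH y hy ∅).nonneg
    simpa using this
  have hψ' : Integrable fun η => ψ (η + b) := hψ.comp_add_right b
  have hb' : ∀ v, ‖velFourier (fun η => ψ (η + b)) v‖ ≤ 1 := fun v => by
    have e : velFourier (fun η => ψ (η + b)) v = ex (inner ℝ v b) * velFourier ψ v := by
      rw [velFourier_eq, velFourier_eq, ← integral_const_mul,
        ← integral_add_right_eq_self (fun η => ex (inner ℝ v b) * (ex (-inner ℝ v η) * ψ η)) b]
      congr with η
      rw [← mul_assoc, ← ex_add, inner_add_right]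
      congr 2; ring
    rw [e, norm_mul, norm_ex, one_mul]; exact hb v
  have e : ∫ η, dprod y S η * H (η - b) * ψ η =
      ∑ A ∈ S.powerset, dprod y (S \ A) b * ∫ η, dprod y A η * H η * ψ (η + b) := by
    rw [← integral_add_right_eq_self _ b]
    simp only [add_sub_cancel_right, dprod_add, Finset.sum_mul, ← integral_const_mul]
    rw [integral_finsetSum]
    · refine Finset.sum_congr rfl fun A _ => ?_
      congr with η; ring
    · intro A _
      have := ((h1.dprod_mul hy A).integrable_mul hψ').const_mul (dprod y (S \ A) b)
      refine this.congr (Filter.Eventually.of_forall fun η => ?_)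
      simp only; ring
  rw [e]
  refine (norm_sum_le _ _).trans ?_
  have h2 : ∀ A ∈ S.powerset, ‖dprod y (S \ A) b * ∫ η, dprod y A η * H η * ψ (η + b)‖ ≤
      (2 * Real.pi * ‖b‖) ^ (S.card - A.card) * (c * (A.card.factorial * σ⁻¹ ^ A.card)) := by
    intro A hA
    rw [norm_mul, ← Finset.card_sdiff_of_subset (Finset.mem_powerset.1 hA)]
    exact mul_le_mul (norm_dprod_le hy _ b) (hH y hy A _ hψ' hb') (norm_nonneg _) (by positivity)
  refine (Finset.sum_le_sum h2).trans ?_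
  rw [Finset.sum_powerset_apply_card (f := fun m => (2 * Real.pi * ‖b‖) ^ (S.card - m) *
    (c * (m.factorial * σ⁻¹ ^ m)))]
  have := mul_le_mul_of_nonneg_left (sum_choose_le hσ (β := 2 * Real.pi * ‖b‖) (by positivity) S.card) hc
  calc _ = c * ∑ m ∈ Finset.range (S.card + 1), ((S.card.choose m : ℝ) *
        ((2 * Real.pi * ‖b‖) ^ (S.card - m) * (m.factorial * σ⁻¹ ^ m))) := by
        rw [Finset.mul_sum]
        refine Finset.sum_congr rfl fun m _ => ?_
        rw [nsmul_eq_mul]; ring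
    _ ≤ _ := this.trans (le_of_eq (by ring))

/-- Multiplication by a linear function of the dual variable. -/
theorem AnBound.inner_mul {σ c : ℝ} {H : E3 → ℂ} (hσ : 0 < σ) (hH : AnBound σ (fun _ => c) H)
    (b : E3) : AnBound σ (fun N => ‖b‖ * (c * ((N + 1) * σ⁻¹) / (2 * Real.pi)))
      (fun η => (inner ℝ b η : ℝ) * H η) := by
  intro y hy S
  have hpi := Real.pi_pos
  obtain ⟨j, hj⟩ := Infinite.exists_notMem_finset S
  by_cases hb : b = 0
  · subst hb
    intro ψ _ _
    simp
  have hb0 : ‖b‖ ≠ 0 := norm_ne_zero_iff.2 hb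
  set y' := Function.update y j (‖b‖⁻¹ • b) with hy'
  have hy1 : ∀ i, ‖y' i‖ ≤ 1 := fun i => by
    by_cases hi : i = j
    · subst hi
      rw [hy', Function.update_self, norm_smul, norm_inv, norm_norm, inv_mul_cancel₀ hb0]
    · rw [hy', Function.update_of_ne hi]; exact hy i
  have h1 := (hH y' hy1 (insert j S)).const_mul ((‖b‖ / (2 * Real.pi * Complex.I) : ℂ))
  rw [Finset.card_insert_of_notMem hj] at h1
  have e : ∀ η, dprod y S η * ((inner ℝ b η : ℝ) * H η) =
      (‖b‖ / (2 * Real.pi * Complex.I) : ℂ) * (dprod y' (insert j S) η * H η) := fun η => by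
    have e1 : dprod y' (insert j S) η =
        (2 * Real.pi * Complex.I * (inner ℝ (‖b‖⁻¹ • b) η : ℝ)) * dprod y S η := by
      unfold dprod
      rw [Finset.prod_insert hj, hy', Function.update_self]
      congr 1
      refine Finset.prod_congr rfl fun i hi => ?_
      rw [Function.update_of_ne (fun h : i = j => hj (h ▸ hi))]
    rw [e1, inner_smul_left]
    have : (‖b‖ : ℂ) ≠ 0 := by exact_mod_cast hb0
    have h2 : (Real.pi : ℂ) ≠ 0 := by exact_mod_cast hpi.ne'
    simp only [conj_trivial, Complex.ofReal_mul, Complex.ofReal_inv]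
    field_simp
  simp only [e]
  refine h1.mono (le_of_eq ?_)
  rw [Nat.factorial_succ, pow_succ]
  have : ‖(‖b‖ / (2 * Real.pi * Complex.I) : ℂ)‖ = ‖b‖ / (2 * Real.pi) := by
    simp [abs_of_pos hpi]
  rw [this]
  push_cast
  field_simp

end Dual

section DualConverse

open FourierTransform in
/-- Smooth compactly supported functions are Fourier transforms of integrable functions. -/
theorem integrable_velInv_of_compactSupport {φ : E3 → ℂ} (hφ : ContDiff ℝ ∞ φ)
    (hs : HasCompactSupport φ) : Integrable (velInv φ) ∧ velFourier (velInv φ) = φ := by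
  let Φ : SchwartzMap E3 ℂ := hs.toSchwartzMap hφ
  have h : velInv φ = (𝓕⁻ Φ : SchwartzMap E3 ℂ) := by
    rw [velInv_eq_fourierInv, SchwartzMap.fourierInv_coe]; rfl
  rw [h]
  refine ⟨(𝓕⁻ Φ : SchwartzMap E3 ℂ).integrable, ?_⟩
  rw [velFourier_eq_fourier, ← SchwartzMap.fourier_coe]
  simp only [fourier_fourierInv_eq]
  rfl

/-- A bound by duality of the mass of the inverse Fourier transform. -/
theorem lintegral_velInv_le {H : E3 → ℂ} (hH : ExpDecay H) {c : ℝ} (hc : DualBound H c) :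
    ∫⁻ v, ‖velInv H v‖ₑ ≤ ENNReal.ofReal c := by
  set f := velInv H with hf
  have hfc : Continuous f := hH.contDiff_velInv.continuous
  have key : ∀ R : ℕ, ∀ ε : ℝ, 0 < ε →
      ∫ v in Metric.closedBall (0 : E3) (R + 1), ‖f v‖ ^ 2 / √(‖f v‖ ^ 2 + ε) ≤ c := by
    intro R ε hε
    let χ : ContDiffBump (0 : E3) := ⟨R + 1, R + 2, by positivity, by linarith⟩
    set q : E3 → ℝ := fun v => χ v / √(‖f v‖ ^ 2 + ε) with hq
    have hpos : ∀ v, 0 < ‖f v‖ ^ 2 + ε := fun v => by positivity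
    have hqs : ContDiff ℝ ∞ q := by
      refine χ.contDiff.div ?_ fun v => (Real.sqrt_pos.2 (hpos v)).ne'
      exact ((hH.contDiff_velInv.norm_sq ℝ).add contDiff_const).sqrt fun v => (hpos v).ne'
    have hφs : ContDiff ℝ ∞ fun v => (q v : ℂ) * (starRingEnd ℂ) (f v) :=
      (Complex.ofRealCLM.contDiff.comp hqs).mul
        ((Complex.conjCLE : ℂ →L[ℝ] ℂ).contDiff.comp hH.contDiff_velInv)
    have hcs : HasCompactSupport fun v => (q v : ℂ) * (starRingEnd ℂ) (f v) := by
      refine χ.hasCompactSupport.mono fun v hv => ?_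
      rw [Function.mem_support] at hv ⊢
      intro h0
      apply hv
      simp [hq, h0]
    obtain ⟨hψ, hψe⟩ := integrable_velInv_of_compactSupport hφs hcs
    have hqf : ∀ v, q v * ‖f v‖ ≤ 1 := fun v => by
      have h1 : ‖f v‖ ≤ √(‖f v‖ ^ 2 + ε) := Real.le_sqrt_of_sq_le (by linarith)
      have h2 := Real.sqrt_pos.2 (hpos v)
      rw [hq, div_mul_eq_mul_div, div_le_one h2]
      have := χ.le_one (x := v)
      have := norm_nonneg (f v)
      nlinarith
    have hq0 : ∀ v, 0 ≤ q v := fun v => div_nonneg χ.nonneg (Real.sqrt_nonneg _)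
    have h1 := hc _ hψ fun v => by
      rw [hψe, norm_mul, Complex.norm_real, RCLike.norm_conj, Real.norm_of_nonneg (hq0 _)]
      exact hqf _
    have h2 : ∫ η, H η * velInv (fun v => (q v : ℂ) * (starRingEnd ℂ) (f v)) η =
        ∫ v, ((q v * ‖f v‖ ^ 2 : ℝ) : ℂ) := by
      have h3 := integral_velFourier_mul
        (hφs.continuous.integrable_of_hasCompactSupport hcs) hH.integrable.comp_neg
      have e1 : velFourier (fun η => H (-η)) = f := by
        funext v
        rw [hf, velInv_eq_velFourier_neg, velFourier_eq, velFourier_eq, ← integral_neg_eq_self]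
        simp
      rw [e1] at h3
      rw [← integral_neg_eq_self]
      simp only [velInv_eq_velFourier_neg (fun v => (q v : ℂ) * (starRingEnd ℂ) (f v)), neg_neg]
      simp only [mul_comm (H _)]
      rw [h3]
      congr with v
      rw [mul_assoc, Complex.conj_mul']
      push_cast; rfl
    rw [h2, integral_complex_ofReal, Complex.norm_real, Real.norm_eq_abs] at h1
    have hint : Integrable fun v => q v * ‖f v‖ ^ 2 := by
      refine Continuous.integrable_of_hasCompactSupport (by
        have := hqs.continuous
        fun_prop) ?_
      refine χ.hasCompactSupport.mono fun v hv => ?_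
      rw [Function.mem_support] at hv ⊢
      intro h0
      apply hv
      simp [hq, h0]
    calc _ = ∫ v in Metric.closedBall (0 : E3) (R + 1), q v * ‖f v‖ ^ 2 := by
          refine setIntegral_congr_fun Metric.isClosed_closedBall.measurableSet fun v hv => ?_
          have : χ v = 1 := χ.one_of_mem_closedBall hv
          simp only [hq, this]
          ring
      _ ≤ ∫ v, q v * ‖f v‖ ^ 2 := setIntegral_le_integral hint
          (Filter.Eventually.of_forall fun v => mul_nonneg (hq0 v) (by positivity))
      _ ≤ c := (le_abs_self _).trans h1
  have key2 : ∀ R : ℕ, ∫ v in Metric.closedBall (0 : E3) (R + 1), ‖f v‖ ≤ c := by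
    intro R
    have hpt : ∀ ε : ℝ, 0 < ε → ∀ v, ‖f v‖ ≤ ‖f v‖ ^ 2 / √(‖f v‖ ^ 2 + ε) + √ε := by
      intro ε hε v
      have hp : 0 < ‖f v‖ ^ 2 + ε := by positivity
      have h2 := Real.sqrt_pos.2 hp
      have h1 : √(‖f v‖ ^ 2 + ε) ≤ ‖f v‖ + √ε := by
        rw [Real.sqrt_le_left (by positivity)]
        nlinarith [Real.sq_sqrt hε.le, norm_nonneg (f v), Real.sqrt_nonneg ε,
          mul_nonneg (norm_nonneg (f v)) (Real.sqrt_nonneg ε)]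
      rw [← sub_le_iff_le_add, le_div_iff₀ h2]
      by_cases h3 : ‖f v‖ - √ε ≤ 0
      · exact (mul_nonpos_of_nonpos_of_nonneg h3 h2.le).trans (by positivity)
      · push Not at h3
        nlinarith [Real.sq_sqrt hε.le, Real.sqrt_nonneg ε]
    have hb : ∀ ε : ℝ, 0 < ε → ∫ v in Metric.closedBall (0 : E3) (R + 1), ‖f v‖ ≤
        c + √ε * volume.real (Metric.closedBall (0 : E3) (R + 1)) := by
      intro ε hε
      have i1 : IntegrableOn (fun v => ‖f v‖ ^ 2 / √(‖f v‖ ^ 2 + ε))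
          (Metric.closedBall (0 : E3) (R + 1)) := by
        refine ContinuousOn.integrableOn_compact (isCompact_closedBall _ _) (Continuous.continuousOn ?_)
        refine Continuous.div (by fun_prop) (by fun_prop) fun v => ?_
        have hp : 0 < ‖f v‖ ^ 2 + ε := by positivity
        exact (Real.sqrt_pos.2 hp).ne'
      have i2 : IntegrableOn (fun _ : E3 => √ε) (Metric.closedBall (0 : E3) (R + 1)) :=
        continuousOn_const.integrableOn_compact (isCompact_closedBall _ _)
      calc _ ≤ ∫ v in Metric.closedBall (0 : E3) (R + 1), (‖f v‖ ^ 2 / √(‖f v‖ ^ 2 + ε) + √ε) :=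
            integral_mono (hfc.norm.continuousOn.integrableOn_compact (isCompact_closedBall _ _))
              (Integrable.add i1 i2) (hpt ε hε)
        _ = (∫ v in Metric.closedBall (0 : E3) (R + 1), ‖f v‖ ^ 2 / √(‖f v‖ ^ 2 + ε)) +
            √ε * volume.real (Metric.closedBall (0 : E3) (R + 1)) := by
            rw [integral_add i1 i2, setIntegral_const, smul_eq_mul, mul_comm]
        _ ≤ _ := by gcongr; exact key R ε hε
    have hlim : Filter.Tendsto (fun ε : ℝ => c + √ε * volume.real (Metric.closedBall (0 : E3) (R + 1)))
        (nhdsWithin 0 (Ioi 0)) (nhds (c + √0 * volume.real (Metric.closedBall (0 : E3) (R + 1)))) :=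
      (Continuous.tendsto (by fun_prop) 0).mono_left nhdsWithin_le_nhds
    rw [Real.sqrt_zero, zero_mul, add_zero] at hlim
    exact ge_of_tendsto hlim (eventually_mem_nhdsWithin.mono fun ε hε => hb ε hε)
  have hU : (univ : Set E3) = ⋃ R : ℕ, Metric.closedBall (0 : E3) (R + 1) := by
    refine (eq_univ_of_forall fun v => ?_).symm
    obtain ⟨n, hn⟩ := exists_nat_ge ‖v‖
    exact mem_iUnion.2 ⟨n, by simpa using hn.trans (by linarith)⟩
  have hmono : Monotone fun R : ℕ => Metric.closedBall (0 : E3) (R + 1) := fun R S h =>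
    Metric.closedBall_subset_closedBall (by
      have : (R : ℝ) ≤ S := by exact_mod_cast h
      linarith)
  rw [← setLIntegral_univ, hU, setLIntegral_iUnion_of_directed _ hmono.directed_le]
  refine iSup_le fun R => ?_
  have i1 : IntegrableOn f (Metric.closedBall (0 : E3) (R + 1)) :=
    hfc.continuousOn.integrableOn_compact (isCompact_closedBall _ _)
  rw [← ofReal_integral_norm_eq_lintegral_enorm i1]
  exact ENNReal.ofReal_le_ofReal (key2 R)

end DualConverse

section Existence

/-- The clamp of a time to `[0,T]`. -/
noncomputable def cl (T t : ℝ) : ℝ := max 0 (min t T)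

theorem continuous_cl (T : ℝ) : Continuous (cl T) := by unfold cl; fun_prop

theorem cl_mem {T : ℝ} (hT : 0 ≤ T) (t : ℝ) : cl T t ∈ Icc 0 T :=
  ⟨le_max_left _ _, max_le hT (min_le_right _ _)⟩

theorem cl_of_mem {T t : ℝ} (ht : t ∈ Icc 0 T) : cl T t = t := by
  unfold cl; rw [min_eq_left ht.2, max_eq_right ht.1]

/-- Coefficients, weights and datum for the Fourier-transformed equation. -/
structure FourierData where
  (a ν T C₀ A K θ κ σ κB R CP : ℝ)
  (Wh : Mode → ℂ)
  (P : E3 → ℂ)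
  (F₀ : Mode → E3 → ℂ)
  T_pos : 0 < T
  T_le : T ≤ 1
  K_pos : 0 < K
  KT_le : K * T ≤ 1
  KT_θ : K * T < θ
  KT_κB : K * T ≤ κB
  σ_pos : 0 < σ
  κB_le : κB + 2 * Real.pi * σ ≤ κ
  A_nonneg : 0 ≤ A
  R_nonneg : 0 ≤ R
  CP_nonneg : 0 ≤ CP
  C₀_nonneg : 0 ≤ C₀
  hW : ∀ l, ‖freq l‖ * ‖Wh l‖ ≤ 1
  hWs : ∀ l, Wh (-l) = (starRingEnd ℂ) (Wh l)
  hPc : Continuous P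
  hP : ∀ η, ‖P η‖ ≤ C₀ * Real.exp (-(θ * ‖η‖))
  hPs : ∀ η, P (-η) = (starRingEnd ℂ) (P η)
  hPan : AnBound σ (fun _ => CP) P
  hFc : ∀ k, Continuous (F₀ k)
  hF : ∀ k η, ‖F₀ k η‖ ≤ A * env θ κ k η
  hFs : ∀ k η, F₀ (-k) (-η) = (starRingEnd ℂ) (F₀ k η)
  hFan : ∀ k, AnBound σ (fun _ => R * (Real.exp (-(κB * ‖freq k‖)) * (om k)⁻¹)) (F₀ k)
  small₁ : bilConst a (2 * A) / K + |ν| * (C₀ + 1) * T ≤ 1 / 2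
  small₂ : 3 * (4 * Real.pi ^ 2 * |a| * (2 * A) * (2 * R) * cwSum * ((2 * Real.pi * σ)⁻¹ + 1) / K +
    |ν| * (2 * A * CP + 2 * R) * T) ≤ R

namespace FourierData

variable (D : FourierData)

/-- The set of admissible functions, in the frame of free transport. -/
structure Adm (F : ℝ → Mode → E3 → ℂ) : Prop where
  cont : ∀ k, Continuous fun z : ℝ × E3 => F z.1 k z.2
  bound : ∀ t ∈ Icc 0 D.T, ∀ k η, ‖F t k η‖ ≤ 2 * D.A * env (D.θ - D.K * t) (D.κ - D.K * t) k η
  symm : ∀ t ∈ Icc 0 D.T, ∀ k η, F t (-k) (-η) = (starRingEnd ℂ) (F t k η)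
  an : ∀ t ∈ Icc 0 D.T, ∀ k, AnBound (D.σ * Real.exp (-(D.K * t)))
    (fun _ => 2 * D.R * (Real.exp (-((D.κB - D.K * t) * ‖freq k‖)) * (om k)⁻¹)) (F t k)

/-- The integrand of the fixed point equation. -/
noncomputable def rhs (F : ℝ → Mode → E3 → ℂ) (s : ℝ) (k : Mode) (η : E3) : ℂ :=
  nl D.a D.ν D.Wh D.P (F (cl D.T s)) (cl D.T s) k η

/-- The map of the fixed point equation. -/
noncomputable def step (F : ℝ → Mode → E3 → ℂ) (t : ℝ) (k : Mode) (η : E3) : ℂ :=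
  D.F₀ k η + ∫ s in (0 : ℝ)..t, D.rhs F s k η

variable {D}

theorem θ_pos {t : ℝ} (ht : t ∈ Icc 0 D.T) : 0 < D.θ - D.K * t := by
  have h1 := D.KT_θ
  have h2 := mul_le_mul_of_nonneg_left ht.2 D.K_pos.le
  linarith

theorem κB_nonneg {t : ℝ} (ht : t ∈ Icc 0 D.T) : 0 ≤ D.κB - D.K * t := by
  have h1 := D.KT_κB
  have h2 := mul_le_mul_of_nonneg_left ht.2 D.K_pos.le
  linarith

theorem κ_nonneg {t : ℝ} (ht : t ∈ Icc 0 D.T) : 0 ≤ D.κ - D.K * t := by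
  have h1 := κB_nonneg ht
  have h2 := D.κB_le
  have h3 := D.σ_pos
  have h4 : 0 < 2 * Real.pi * D.σ := by positivity
  linarith

theorem hP' {t : ℝ} (ht : t ∈ Icc 0 D.T) (η : E3) :
    ‖D.P η‖ ≤ D.C₀ * Real.exp (-((D.θ - D.K * t) * ‖η‖)) := by
  refine (D.hP η).trans ?_
  have h1 := D.C₀_nonneg
  have h2 : 0 ≤ D.K * t := mul_nonneg D.K_pos.le ht.1
  have h3 : D.θ - D.K * t ≤ D.θ := by linarith
  gcongr

theorem cl_mem' (D : FourierData) (t : ℝ) : cl D.T t ∈ Icc 0 D.T := cl_mem D.T_pos.le t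

theorem env_le_exp (θ κ : ℝ) (hκ : 0 ≤ κ) (k : Mode) (η : E3) :
    env θ κ k η ≤ Real.exp (-(θ * ‖η‖)) := by
  unfold env
  have h1 : (om k)⁻¹ ≤ 1 := inv_le_one_of_one_le₀ (one_le_om k)
  have h2 : Real.exp (-(θ * ‖η‖ + κ * ‖freq k‖)) ≤ Real.exp (-(θ * ‖η‖)) := by
    have : 0 ≤ κ * ‖freq k‖ := by positivity
    apply Real.exp_le_exp.2; linarith
  calc _ ≤ Real.exp (-(θ * ‖η‖)) * 1 :=
        mul_le_mul h2 h1 (inv_nonneg.2 (om_pos k).le) (Real.exp_pos _).le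
    _ = _ := mul_one _

theorem Adm.expDecay {F : ℝ → Mode → E3 → ℂ} (hF : D.Adm F) {t : ℝ} (ht : t ∈ Icc 0 D.T) (k : Mode) :
    ExpDecay (F t k) := by
  refine ⟨(hF.cont k).comp (by fun_prop : Continuous fun η : E3 => (t, η)), _, θ_pos ht, 2 * D.A,
    fun η => (hF.bound t ht k η).trans ?_⟩
  exact mul_le_mul_of_nonneg_left (env_le_exp _ _ (κ_nonneg ht) k η)
    (mul_nonneg (by norm_num) D.A_nonneg)

/-- `X e^{-cX}` is bounded. -/
theorem mul_exp_neg_le {c : ℝ} (hc : 0 < c) (x : ℝ) : x * Real.exp (-(c * x)) ≤ c⁻¹ := by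
  have h1 := Real.add_one_le_exp (c * x)
  rw [Real.exp_neg, ← div_eq_mul_inv, div_le_iff₀ (Real.exp_pos _), inv_mul_eq_div, le_div_iff₀ hc]
  linarith

theorem norm_add_mul_env_le {θ κ θ₀ : ℝ} (hθ₀ : 0 < θ₀) (hθ : θ₀ ≤ θ) (hκ : 0 ≤ κ) (k : Mode)
    (η : E3) : (‖η‖ + ‖freq k‖) * env θ κ k η ≤ θ₀⁻¹ + ‖freq k‖ := by
  have h1 := (env_anti hθ le_rfl k η).trans (env_le_exp θ₀ κ hκ k η)
  have h2 := mul_exp_neg_le hθ₀ ‖η‖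
  have h3 : Real.exp (-(θ₀ * ‖η‖)) ≤ 1 := Real.exp_le_one_iff.2 (by
    have : 0 ≤ θ₀ * ‖η‖ := by positivity
    linarith)
  have h4 := norm_nonneg (freq k)
  calc _ ≤ (‖η‖ + ‖freq k‖) * Real.exp (-(θ₀ * ‖η‖)) := by gcongr
    _ = ‖η‖ * Real.exp (-(θ₀ * ‖η‖)) + ‖freq k‖ * Real.exp (-(θ₀ * ‖η‖)) := by ring
    _ ≤ _ := by nlinarith

theorem Adm.continuous_comp {F : ℝ → Mode → E3 → ℂ} (hF : D.Adm F) (l : Mode) {g : ℝ × E3 → E3}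
    (hg : Continuous g) : Continuous fun z : ℝ × E3 => F (cl D.T z.1) l (g z) :=
  (hF.cont l).comp (((continuous_cl D.T).comp continuous_fst).prodMk hg)

theorem Adm.continuous_bilSum {F : ℝ → Mode → E3 → ℂ} (hF : D.Adm F) (k : Mode) :
    Continuous fun z : ℝ × E3 =>
      ∑' l, bilTerm D.Wh (F (cl D.T z.1)) (F (cl D.T z.1)) (cl D.T z.1) k z.2 l := by
  have hcl : Continuous fun z : ℝ × E3 => cl D.T z.1 := (continuous_cl D.T).comp continuous_fst
  refine continuous_tsum (u := fun l => (2 * D.A * (2 * D.A)) * ((D.θ - D.K * D.T)⁻¹ + ‖freq k‖) * cw k l)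
    (fun l => ?_) ((hasSum_cw k).summable.mul_left _) fun l z => ?_
  · unfold bilTerm
    refine ((Continuous.mul ?_ continuous_const).mul (hF.continuous_comp l (by fun_prop))).mul
      (hF.continuous_comp _ (by fun_prop))
    exact Complex.continuous_ofReal.comp (by fun_prop)
  · have hm := D.cl_mem' z.1
    have h1 := norm_bilTerm_le D.hW (θ_pos hm).le (κ_nonneg hm) hm.1 (hm.2.trans D.T_le)
      (hF.bound _ hm) (hF.bound _ hm) k z.2 l
    refine h1.trans ?_
    have h2 := norm_add_mul_env_le (θ₀ := D.θ - D.K * D.T) (by linarith [D.KT_θ])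
      (θ := D.θ - D.K * cl D.T z.1) (by nlinarith [D.K_pos, hm.2]) (κ_nonneg hm) k z.2
    have h3 := cw_nonneg k l
    have h4 := D.A_nonneg
    calc _ = (2 * D.A * (2 * D.A)) * ((‖z.2‖ + ‖freq k‖) *
          env (D.θ - D.K * cl D.T z.1) (D.κ - D.K * cl D.T z.1) k z.2) * cw k l := by ring
      _ ≤ _ := by gcongr

theorem Adm.continuous_rhs {F : ℝ → Mode → E3 → ℂ} (hF : D.Adm F) (k : Mode) :
    Continuous fun z : ℝ × E3 => D.rhs F z.1 k z.2 := by
  have hcl : Continuous fun z : ℝ × E3 => cl D.T z.1 := (continuous_cl D.T).comp continuous_fst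
  have hP := D.hPc
  have h1 := hF.continuous_comp k (g := fun z => cl D.T z.1 • freq k) (by fun_prop)
  have h2 := hF.continuous_comp k (g := fun z => z.2) (by fun_prop)
  have h3 : Continuous fun z : ℝ × E3 => D.P (z.2 - cl D.T z.1 • freq k) := hP.comp (by fun_prop)
  unfold rhs nl
  exact (continuous_const.mul (hF.continuous_bilSum k)).add (continuous_const.mul ((h1.mul h3).sub h2))

theorem Adm.intervalIntegrable_rhs {F : ℝ → Mode → E3 → ℂ} (hF : D.Adm F) (k : Mode) (η : E3)
    (r t : ℝ) : IntervalIntegrable (fun s => D.rhs F s k η) volume r t :=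
  Continuous.intervalIntegrable ((hF.continuous_rhs k).comp
    (by fun_prop : Continuous fun s : ℝ => (s, η))) _ _

theorem continuous_primitive {Φ : ℝ × E3 → ℂ} (hΦ : Continuous Φ) :
    Continuous fun z : ℝ × E3 => ∫ s in (0 : ℝ)..z.1, Φ (s, z.2) := by
  have hc : Continuous (Function.uncurry fun (z : ℝ × E3) (s : ℝ) => Φ (s, z.2)) :=
    hΦ.comp (continuous_snd.prodMk (continuous_snd.comp continuous_fst))
  exact intervalIntegral.continuous_parametric_intervalIntegral_of_continuous (μ := volume)
    (a₀ := 0) hc continuous_fst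

theorem Adm.continuous_step {F : ℝ → Mode → E3 → ℂ} (hF : D.Adm F) (k : Mode) :
    Continuous fun z : ℝ × E3 => D.step F z.1 k z.2 :=
  ((D.hFc k).comp continuous_snd).add (continuous_primitive (hF.continuous_rhs k))

/-- The estimate for differences, with the time-dependent envelope. -/
theorem norm_integral_sub_le {F G : ℝ → Mode → E3 → ℂ} {d : ℝ} (hd : 0 ≤ d)
    (hF : ∀ t ∈ Icc 0 D.T, ∀ k η, ‖F t k η‖ ≤ 2 * D.A * env (D.θ - D.K * t) (D.κ - D.K * t) k η)
    (hG : ∀ t ∈ Icc 0 D.T, ∀ k η, ‖G t k η‖ ≤ 2 * D.A * env (D.θ - D.K * t) (D.κ - D.K * t) k η)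
    (h : ∀ t ∈ Icc 0 D.T, ∀ k η, ‖F t k η - G t k η‖ ≤ d * env (D.θ - D.K * t) (D.κ - D.K * t) k η)
    {t : ℝ} (ht : t ∈ Icc 0 D.T) (k : Mode) (η : E3) :
    ‖∫ s in (0 : ℝ)..t, (D.rhs F s k η - D.rhs G s k η)‖ ≤
      (bilConst D.a (2 * D.A) / D.K + |D.ν| * (D.C₀ + 1) * D.T) * d *
        env (D.θ - D.K * t) (D.κ - D.K * t) k η := by
  have hA := D.A_nonneg
  have hC := D.C₀_nonneg
  have hK := D.K_pos
  have hc₁ := bilConst_nonneg D.a (A := 2 * D.A) (by positivity)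
  have he : 0 ≤ d * env D.θ D.κ k η := mul_nonneg hd (env_pos _ _ _ _).le
  have key := norm_integral_le_exp (Φ := fun s => D.rhs F s k η - D.rhs G s k η)
    (c₁ := bilConst D.a (2 * D.A) * (d * env D.θ D.κ k η))
    (c₂ := |D.ν| * (D.C₀ + 1) * (d * env D.θ D.κ k η)) (K := D.K) (X := ‖η‖ + ‖freq k‖) (t₀ := 0)
    (t := t) (by positivity) (by positivity) hK (by positivity) ht.1 (fun s hs1 hs2 => by
      have hs : s ∈ Icc 0 D.T := ⟨hs1, hs2.trans ht.2⟩
      have := norm_nl_sub_nl_le (a := D.a) (ν := D.ν) D.hW (θ_pos hs).le (κ_nonneg hs) hs.1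
        (hs.2.trans D.T_le) (hP' hs) (hF s hs) (hG s hs) (h s hs) k η
      unfold rhs
      rw [cl_of_mem hs]
      refine this.trans (le_of_eq ?_)
      rw [env_sub, sub_zero]; ring)
  refine key.trans ?_
  rw [env_sub, sub_zero]
  have h1 : 0 ≤ d * env D.θ D.κ k η * Real.exp (D.K * t * (‖η‖ + ‖freq k‖)) :=
    mul_nonneg he (Real.exp_pos _).le
  have h2 : |D.ν| * (D.C₀ + 1) * t ≤ |D.ν| * (D.C₀ + 1) * D.T := by
    have := ht.2
    gcongr
  calc _ = (bilConst D.a (2 * D.A) / D.K + |D.ν| * (D.C₀ + 1) * t) *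
        (d * env D.θ D.κ k η * Real.exp (D.K * t * (‖η‖ + ‖freq k‖))) := by ring
    _ ≤ (bilConst D.a (2 * D.A) / D.K + |D.ν| * (D.C₀ + 1) * D.T) *
        (d * env D.θ D.κ k η * Real.exp (D.K * t * (‖η‖ + ‖freq k‖))) := by gcongr
    _ = _ := by ring

theorem rhs_zero (s : ℝ) (k : Mode) (η : E3) : D.rhs (fun _ _ _ => 0) s k η = 0 := nl_zero _ _ _

theorem norm_integral_rhs_le {F : ℝ → Mode → E3 → ℂ}
    (hF : ∀ t ∈ Icc 0 D.T, ∀ k η, ‖F t k η‖ ≤ 2 * D.A * env (D.θ - D.K * t) (D.κ - D.K * t) k η)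
    {t : ℝ} (ht : t ∈ Icc 0 D.T) (k : Mode) (η : E3) :
    ‖∫ s in (0 : ℝ)..t, D.rhs F s k η‖ ≤
      (bilConst D.a (2 * D.A) / D.K + |D.ν| * (D.C₀ + 1) * D.T) * (2 * D.A) *
        env (D.θ - D.K * t) (D.κ - D.K * t) k η := by
  have hA := D.A_nonneg
  have := norm_integral_sub_le (G := fun _ _ _ => 0) (d := 2 * D.A) (by positivity) hF
    (fun t ht k η => by
      rw [norm_zero]; exact mul_nonneg (by positivity) (env_pos _ _ _ _).le)
    (fun t ht k η => by simpa using hF t ht k η) ht k η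
  simpa only [rhs_zero, sub_zero] using this

theorem Adm.norm_step_le {F : ℝ → Mode → E3 → ℂ} (hF : D.Adm F) {t : ℝ} (ht : t ∈ Icc 0 D.T)
    (k : Mode) (η : E3) :
    ‖D.step F t k η‖ ≤ 2 * D.A * env (D.θ - D.K * t) (D.κ - D.K * t) k η := by
  have h1 := norm_integral_rhs_le hF.bound ht k η
  have hA := D.A_nonneg
  have h2 : ‖D.F₀ k η‖ ≤ D.A * env (D.θ - D.K * t) (D.κ - D.K * t) k η := by
    refine (D.hF k η).trans (mul_le_mul_of_nonneg_left (env_anti ?_ ?_ k η) hA) <;>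
    · have := mul_nonneg D.K_pos.le ht.1
      linarith
  have h3 := D.small₁
  have h4 := env_pos (D.θ - D.K * t) (D.κ - D.K * t) k η
  have h5 : 0 ≤ (2 * D.A) * env (D.θ - D.K * t) (D.κ - D.K * t) k η := by positivity
  refine (norm_add_le _ _).trans ?_
  nlinarith

theorem nl_symm {F : Mode → E3 → ℂ} (hF : ∀ k η, F (-k) (-η) = (starRingEnd ℂ) (F k η)) (s : ℝ)
    (k : Mode) (η : E3) : nl D.a D.ν D.Wh D.P F s (-k) (-η) =
      (starRingEnd ℂ) (nl D.a D.ν D.Wh D.P F s k η) := by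
  have h1 : ∑' l, bilTerm D.Wh F F s (-k) (-η) l = (starRingEnd ℂ) (∑' l, bilTerm D.Wh F F s k η l) := by
    rw [← (Equiv.neg Mode).tsum_eq, Complex.conj_tsum]
    refine tsum_congr fun l => ?_
    simp only [Equiv.neg_apply, bilTerm, map_mul, Complex.conj_ofReal, ← hF, ← D.hWs]
    have e1 : inner ℝ (freq (-l)) (-η - s • freq (-k)) = inner ℝ (freq l) (η - s • freq k) := by
      rw [freq_neg, freq_neg, smul_neg, show -η - -(s • freq k) = -(η - s • freq k) by abel,
        inner_neg_neg]
    have e2 : s • freq (-l) = -(s • freq l) := by rw [freq_neg, smul_neg]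
    have e3 : -k - -l = -(k - l) := by abel
    have e4 : -η - -(s • freq l) = -(η - s • freq l) := by abel
    rw [e1, e2, e3, e4]
  unfold nl
  rw [h1]
  have e2 : s • freq (-k) = -(s • freq k) := by rw [freq_neg, smul_neg]
  have e4 : -η - -(s • freq k) = -(η - s • freq k) := by abel
  simp only [map_add, map_sub, map_mul, Complex.conj_ofReal, ← hF, e2, e4, D.hPs, map_pow, map_ofNat]

theorem Adm.step_symm {F : ℝ → Mode → E3 → ℂ} (hF : D.Adm F) (t : ℝ) (k : Mode) (η : E3) :
    D.step F t (-k) (-η) = (starRingEnd ℂ) (D.step F t k η) := by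
  unfold step
  rw [map_add, D.hFs]
  congr 1
  simp only [intervalIntegral, map_sub, ← integral_conj]
  simp only [rhs, nl_symm (hF.symm _ (D.cl_mem' _))]

end FourierData

end Existence

theorem ExpDecay.const_mul {H : E3 → ℂ} (h : ExpDecay H) (b : ℂ) : ExpDecay (fun η => b * H η) :=
  h.pow_mul_of_norm_le (m := fun _ => b) continuous_const 0 (D := ‖b‖) (by simp)

theorem ExpDecay.add {H G : E3 → ℂ} (hH : ExpDecay H) (hG : ExpDecay G) :
    ExpDecay (fun η => H η + G η) := by
  obtain ⟨ha, c, hc, C, h⟩ := hH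
  obtain ⟨ha', c', hc', C', h'⟩ := hG
  refine ⟨ha.add ha', min c c', lt_min hc hc', C + C', fun η => ?_⟩
  have hC : 0 ≤ C := by
    have := (norm_nonneg _).trans (h 0)
    exact nonneg_of_mul_nonneg_left this (Real.exp_pos _)
  have hC' : 0 ≤ C' := by
    have := (norm_nonneg _).trans (h' 0)
    exact nonneg_of_mul_nonneg_left this (Real.exp_pos _)
  refine (norm_add_le _ _).trans ((add_le_add (h η) (h' η)).trans ?_)
  rw [add_mul]
  have hn := norm_nonneg η
  have e1 : min c c' ≤ c := min_le_left _ _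
  have e2 : min c c' ≤ c' := min_le_right _ _
  gcongr

namespace FourierData

section Analytic

variable {D : FourierData}

theorem exists_pow_mul_exp_le {θ : ℝ} (hθ : 0 < θ) (N : ℕ) (b : ℝ) (hb : 0 ≤ b) : ∃ C : ℝ, 0 ≤ C ∧
    ∀ x : ℝ, 0 ≤ x → (2 * Real.pi * x) ^ N * (x + b) * Real.exp (-(θ * x)) ≤ C := by
  obtain ⟨C₁, hC₁, h1⟩ := pow_le_exp hθ (N + 1)
  obtain ⟨C₂, hC₂, h2⟩ := pow_le_exp hθ N
  refine ⟨(2 * Real.pi) ^ N * (C₁ + b * C₂), by positivity, fun x hx => ?_⟩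
  rw [Real.exp_neg, ← div_eq_mul_inv, div_le_iff₀ (Real.exp_pos _)]
  have e1 := h1 x hx
  have e2 := mul_le_mul_of_nonneg_left (h2 x hx) hb
  calc _ = (2 * Real.pi) ^ N * (x ^ (N + 1) + b * x ^ N) := by rw [mul_pow, pow_succ]; ring
    _ ≤ (2 * Real.pi) ^ N * (C₁ * Real.exp (θ * x) + b * (C₂ * Real.exp (θ * x))) := by gcongr
    _ = _ := by ring

/-- The decay in the frequency of the analytic norms. -/
noncomputable def eB (D : FourierData) (s : ℝ) (k : Mode) : ℝ :=
  Real.exp (-((D.κB - D.K * s) * ‖freq k‖)) * (om k)⁻¹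

theorem eB_nonneg (s : ℝ) (k : Mode) : 0 ≤ D.eB s k :=
  mul_nonneg (Real.exp_pos _).le (inv_nonneg.2 (om_pos k).le)

theorem eB_eq (s : ℝ) (k : Mode) : D.eB s k = D.eB 0 k * Real.exp (D.K * s * ‖freq k‖) := by
  unfold eB
  rw [mul_right_comm, ← Real.exp_add]; congr 2; ring

theorem eB_mul_le {s : ℝ} (hs : s ∈ Icc 0 D.T) (k l : Mode) :
    D.eB s l * D.eB s (k - l) ≤ D.eB s k * cw k l := by
  unfold eB
  rw [mul_mul_mul_comm, ← Real.exp_add, mul_assoc]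
  have h1 := mul_le_mul_of_nonneg_left (norm_freq_le_add k l) (κB_nonneg hs)
  refine mul_le_mul (Real.exp_le_exp.2 (by linarith)) (inv_om_mul_le k l) ?_ (Real.exp_pos _).le
  have h1 := om_pos l
  have h2 := om_pos (k - l)
  positivity

theorem radius_pos (D : FourierData) (s : ℝ) : 0 < D.σ * Real.exp (-(D.K * s)) :=
  mul_pos D.σ_pos (Real.exp_pos _)

theorem radius_le {s : ℝ} (hs : s ∈ Icc 0 D.T) : D.σ * Real.exp (-(D.K * s)) ≤ D.σ := by
  have : Real.exp (-(D.K * s)) ≤ 1 := Real.exp_le_one_iff.2 (by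
    have := mul_nonneg D.K_pos.le hs.1
    linarith)
  nlinarith [D.σ_pos]

/-- The modes at the resonant frequencies absorb the translations. -/
theorem Adm.norm_mul_exp_le {F : ℝ → Mode → E3 → ℂ} (hF : D.Adm F) {s : ℝ} (hs : s ∈ Icc 0 D.T)
    (l : Mode) : ‖F s l (s • freq l)‖ *
      Real.exp (2 * Real.pi * ‖s • freq l‖ * (D.σ * Real.exp (-(D.K * s)))) ≤
      2 * D.A * D.eB s l := by
  have h1 := hF.bound s hs l (s • freq l)
  have hA := D.A_nonneg
  have hn := norm_nonneg (freq l)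
  have h2 : 2 * Real.pi * ‖s • freq l‖ * (D.σ * Real.exp (-(D.K * s))) ≤
      2 * Real.pi * D.σ * ‖freq l‖ := by
    have h3 : ‖s • freq l‖ ≤ ‖freq l‖ := by
      rw [norm_smul_freq hs.1]
      have := hs.2.trans D.T_le
      nlinarith
    have h4 := radius_le hs
    have h5 := (radius_pos D s).le
    calc _ ≤ 2 * Real.pi * ‖freq l‖ * D.σ := by gcongr
      _ = _ := by ring
  have h0 := env_pos (D.θ - D.K * s) (D.κ - D.K * s) l (s • freq l)
  calc _ ≤ 2 * D.A * env (D.θ - D.K * s) (D.κ - D.K * s) l (s • freq l) *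
        Real.exp (2 * Real.pi * D.σ * ‖freq l‖) := by gcongr
    _ ≤ _ := by
      rw [mul_assoc]
      refine mul_le_mul_of_nonneg_left ?_ (by positivity)
      unfold env eB
      rw [mul_right_comm, ← Real.exp_add]
      refine mul_le_mul_of_nonneg_right (Real.exp_le_exp.2 ?_) (inv_nonneg.2 (om_pos l).le)
      have h6 := mul_nonneg (θ_pos hs).le (norm_nonneg (s • freq l))
      have h7 := mul_le_mul_of_nonneg_right D.κB_le hn
      linarith

theorem Adm.anBound_bilTerm {F : ℝ → Mode → E3 → ℂ} (hF : D.Adm F) {s : ℝ} (hs : s ∈ Icc 0 D.T)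
    (k l : Mode) : AnBound (D.σ * Real.exp (-(D.K * s)))
      (fun N => 2 * D.A * (2 * D.R) * D.eB s k *
        ((N + 1) * (D.σ * Real.exp (-(D.K * s)))⁻¹ / (2 * Real.pi) + ‖freq k‖) * cw k l)
      (fun η => bilTerm D.Wh (F s) (F s) s k η l) := by
  have hpi := Real.pi_pos
  have hA := D.A_nonneg
  have hR := D.R_nonneg
  have hσ := radius_pos D s
  have hT := (hF.an s hs (k - l)).comp_sub hσ (hF.expDecay hs _) (s • freq l)
  have hTd : ExpDecay (fun η => F s (k - l) (η - s • freq l)) := by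
    simpa [sub_eq_add_neg] using (hF.expDecay hs (k - l)).comp_add (-(s • freq l))
  have hd1 : ExpDecay (fun η => (inner ℝ (freq l) η : ℝ) * F s (k - l) (η - s • freq l)) :=
    hTd.pow_mul_of_norm_le (m := fun η => ((inner ℝ (freq l) η : ℝ) : ℂ)) (by fun_prop) 1
      (D := ‖freq l‖) (fun η => by
        rw [Complex.norm_real, pow_one]; exact norm_inner_le_norm _ _)
  have hd2 : ExpDecay (fun η => ((-(s * inner ℝ (freq l) (freq k)) : ℝ) : ℂ) *
      F s (k - l) (η - s • freq l)) :=
    hTd.pow_mul_of_norm_le (m := fun _ => ((-(s * inner ℝ (freq l) (freq k)) : ℝ) : ℂ))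
      (by fun_prop) 0 (D := ‖((-(s * inner ℝ (freq l) (freq k)) : ℝ) : ℂ)‖) (fun η => by simp)
  have h1 := ((hT.inner_mul hσ (freq l)).add
    (hT.const_mul ((-(s * inner ℝ (freq l) (freq k)) : ℝ) : ℂ)) hd1 hd2).const_mul
      (D.Wh l * F s l (s • freq l))
  have e : (fun η => bilTerm D.Wh (F s) (F s) s k η l) = fun η => (D.Wh l * F s l (s • freq l)) *
      ((inner ℝ (freq l) η : ℝ) * F s (k - l) (η - s • freq l) +
        ((-(s * inner ℝ (freq l) (freq k)) : ℝ) : ℂ) * F s (k - l) (η - s • freq l)) := by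
    funext η
    unfold bilTerm
    rw [inner_sub_right, inner_smul_right]
    push_cast; ring
  rw [e]
  refine h1.mono hσ fun N => ?_
  set σs := D.σ * Real.exp (-(D.K * s)) with hσs
  set E := Real.exp (2 * Real.pi * ‖s • freq l‖ * σs) with hE
  have hE0 : 0 < E := Real.exp_pos _
  have hin : ‖((-(s * inner ℝ (freq l) (freq k)) : ℝ) : ℂ)‖ ≤ ‖freq l‖ * ‖freq k‖ := by
    rw [Complex.norm_real, norm_neg, norm_mul, Real.norm_of_nonneg hs.1]
    have h2 := norm_inner_le_norm (𝕜 := ℝ) (freq l) (freq k)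
    have h3 := hs.2.trans D.T_le
    have := norm_nonneg (inner ℝ (freq l) (freq k))
    nlinarith [hs.1]
  have hq := hF.norm_mul_exp_le hs l
  have hw := D.hW l
  have hb := eB_mul_le hs k l
  have hQ : 0 ≤ (N + 1) * σs⁻¹ / (2 * Real.pi) + ‖freq k‖ := by positivity
  have hb1 := D.eB_nonneg s l
  have hb2 := D.eB_nonneg s (k - l)
  change ‖D.Wh l * F s l (s • freq l)‖ * (‖freq l‖ * (2 * D.R * D.eB s (k - l) * E *
    ((N + 1) * σs⁻¹) / (2 * Real.pi)) + ‖((-(s * inner ℝ (freq l) (freq k)) : ℝ) : ℂ)‖ *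
      (2 * D.R * D.eB s (k - l) * E)) ≤ _
  calc _ ≤ ‖D.Wh l * F s l (s • freq l)‖ * (‖freq l‖ * (2 * D.R * D.eB s (k - l) * E *
        ((N + 1) * σs⁻¹) / (2 * Real.pi)) + ‖freq l‖ * ‖freq k‖ *
          (2 * D.R * D.eB s (k - l) * E)) := by gcongr
    _ = (‖freq l‖ * ‖D.Wh l‖) * (‖F s l (s • freq l)‖ * E) * (2 * D.R * D.eB s (k - l)) *
        ((N + 1) * σs⁻¹ / (2 * Real.pi) + ‖freq k‖) := by rw [norm_mul]; ring
    _ ≤ 1 * (2 * D.A * D.eB s l) * (2 * D.R * D.eB s (k - l)) *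
        ((N + 1) * σs⁻¹ / (2 * Real.pi) + ‖freq k‖) := by gcongr
    _ = 2 * D.A * (2 * D.R) * (D.eB s l * D.eB s (k - l)) *
        ((N + 1) * σs⁻¹ / (2 * Real.pi) + ‖freq k‖) := by ring
    _ ≤ 2 * D.A * (2 * D.R) * (D.eB s k * cw k l) *
        ((N + 1) * σs⁻¹ / (2 * Real.pi) + ‖freq k‖) := by gcongr
    _ = _ := by ring

theorem Adm.continuous_bilTerm {F : ℝ → Mode → E3 → ℂ} (hF : D.Adm F) {s : ℝ} (hs : s ∈ Icc 0 D.T)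
    (k l : Mode) : Continuous fun η => bilTerm D.Wh (F s) (F s) s k η l := by
  have h1 : Continuous fun η => F s (k - l) (η - s • freq l) :=
    (hF.expDecay hs (k - l)).1.comp (by fun_prop)
  have h2 : Continuous fun η : E3 => ((inner ℝ (freq l) (η - s • freq k) : ℝ) : ℂ) := by fun_prop
  unfold bilTerm
  exact ((h2.mul continuous_const).mul continuous_const).mul h1

theorem env_le_exp_min {s : ℝ} (hs : s ∈ Icc 0 D.T) (k : Mode) (η : E3) :
    env (D.θ - D.K * s) (D.κ - D.K * s) k η ≤ Real.exp (-((D.θ - D.K * D.T) * ‖η‖)) := by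
  refine (env_le_exp _ _ (κ_nonneg hs) k η).trans (Real.exp_le_exp.2 ?_)
  have h1 := mul_le_mul_of_nonneg_left hs.2 D.K_pos.le
  have h2 := mul_le_mul_of_nonneg_right h1 (norm_nonneg η)
  linarith

theorem Adm.dualBound_tsum {F : ℝ → Mode → E3 → ℂ} (hF : D.Adm F) {s : ℝ} (hs : s ∈ Icc 0 D.T)
    (k : Mode) : AnBound (D.σ * Real.exp (-(D.K * s)))
      (fun N => 2 * D.A * (2 * D.R) * D.eB s k *
        ((N + 1) * (D.σ * Real.exp (-(D.K * s)))⁻¹ / (2 * Real.pi) + ‖freq k‖) * cwSum)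
      (fun η => ∑' l, bilTerm D.Wh (F s) (F s) s k η l) := by
  intro y hy S
  have hA := D.A_nonneg
  obtain ⟨C, hC0, hC⟩ := exists_pow_mul_exp_le (θ := D.θ - D.K * D.T) (by linarith [D.KT_θ]) S.card
    ‖freq k‖ (norm_nonneg _)
  have h := DualBound.tsum (H := fun l η => dprod y S η * bilTerm D.Wh (F s) (F s) s k η l)
    (fun l => hF.anBound_bilTerm hs k l y hy S)
    (fun l => (continuous_dprod y S).mul (hF.continuous_bilTerm hs k l))
    (b := fun l => 2 * D.A * (2 * D.A) * C * cw k l) (fun l η => ?_)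
    ((hasSum_cw k).summable.mul_left _) (((hasSum_cw k).mul_left (2 * D.A * (2 * D.R) * D.eB s k *
        (((S.card : ℝ) + 1) * (D.σ * Real.exp (-(D.K * s)))⁻¹ / (2 * Real.pi) + ‖freq k‖))).mul_right
        (S.card.factorial * (D.σ * Real.exp (-(D.K * s)))⁻¹ ^ S.card))
  · simpa only [tsum_mul_left] using h
  · have h1 := norm_bilTerm_le D.hW (θ_pos hs).le (κ_nonneg hs) hs.1 (hs.2.trans D.T_le)
      (hF.bound s hs) (hF.bound s hs) k η l
    have h2 := norm_dprod_le hy S η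
    have h3 := hC ‖η‖ (norm_nonneg _)
    have h4 := cw_nonneg k l
    have h5 := env_le_exp_min hs k η
    have h6 := env_pos (D.θ - D.K * s) (D.κ - D.K * s) k η
    rw [norm_mul]
    calc _ ≤ (2 * Real.pi * ‖η‖) ^ S.card * ((‖η‖ + ‖freq k‖) * (2 * D.A * (2 * D.A)) *
          env (D.θ - D.K * s) (D.κ - D.K * s) k η * cw k l) := by gcongr
      _ ≤ (2 * Real.pi * ‖η‖) ^ S.card * ((‖η‖ + ‖freq k‖) * (2 * D.A * (2 * D.A)) *
          Real.exp (-((D.θ - D.K * D.T) * ‖η‖)) * cw k l) := by gcongr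
      _ = 2 * D.A * (2 * D.A) * ((2 * Real.pi * ‖η‖) ^ S.card * (‖η‖ + ‖freq k‖) *
          Real.exp (-((D.θ - D.K * D.T) * ‖η‖))) * cw k l := by ring
      _ ≤ _ := by gcongr

theorem Adm.expDecay_tsum {F : ℝ → Mode → E3 → ℂ} (hF : D.Adm F) {s : ℝ} (hs : s ∈ Icc 0 D.T)
    (k : Mode) : ExpDecay (fun η => ∑' l, bilTerm D.Wh (F s) (F s) s k η l) := by
  have hθ := θ_pos hs
  have hc : Continuous fun η => ∑' l, bilTerm D.Wh (F s) (F s) s k η l := by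
    have := (hF.continuous_bilSum k).comp (by fun_prop : Continuous fun η : E3 => (s, η))
    simpa only [Function.comp_def, cl_of_mem hs] using this
  refine ⟨hc, (D.θ - D.K * s) / 2, half_pos hθ,
    2 * D.A * (2 * D.A) * (((D.θ - D.K * s) / 2)⁻¹ + ‖freq k‖) * cwSum, fun η => ?_⟩
  have h1 := norm_tsum_bilTerm_le D.hW hθ.le (κ_nonneg hs) hs.1 (hs.2.trans D.T_le)
    (hF.bound s hs) (hF.bound s hs) k η
  have h2 := mul_exp_neg_le (half_pos hθ) ‖η‖
  have h3 := env_le_exp (D.θ - D.K * s) (D.κ - D.K * s) (κ_nonneg hs) k η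
  have h4 : Real.exp (-((D.θ - D.K * s) * ‖η‖)) =
      Real.exp (-((D.θ - D.K * s) / 2 * ‖η‖)) * Real.exp (-((D.θ - D.K * s) / 2 * ‖η‖)) := by
    rw [← Real.exp_add]; congr 1; ring
  have h5 : Real.exp (-((D.θ - D.K * s) / 2 * ‖η‖)) ≤ 1 := Real.exp_le_one_iff.2 (by
    have := mul_nonneg (half_pos hθ).le (norm_nonneg η)
    linarith)
  have hA := D.A_nonneg
  have hS := cwSum_nonneg
  have h6 := norm_nonneg (freq k)
  have h7 := Real.exp_pos (-((D.θ - D.K * s) / 2 * ‖η‖))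
  refine h1.trans ?_
  rw [h4] at h3
  calc _ ≤ (‖η‖ + ‖freq k‖) * (2 * D.A * (2 * D.A)) * (Real.exp (-((D.θ - D.K * s) / 2 * ‖η‖)) *
        Real.exp (-((D.θ - D.K * s) / 2 * ‖η‖))) * cwSum := by gcongr
    _ = 2 * D.A * (2 * D.A) * (‖η‖ * Real.exp (-((D.θ - D.K * s) / 2 * ‖η‖)) +
          ‖freq k‖ * Real.exp (-((D.θ - D.K * s) / 2 * ‖η‖))) * cwSum *
          Real.exp (-((D.θ - D.K * s) / 2 * ‖η‖)) := by ring
    _ ≤ 2 * D.A * (2 * D.A) * (((D.θ - D.K * s) / 2)⁻¹ + ‖freq k‖ * 1) * cwSum *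
          Real.exp (-((D.θ - D.K * s) / 2 * ‖η‖)) := by gcongr
    _ = _ := by rw [mul_one]

/-- The constants in the estimate of the analytic norm of the right-hand side. -/
noncomputable def c₁ (D : FourierData) : ℝ :=
  4 * Real.pi ^ 2 * |D.a| * (2 * D.A) * (2 * D.R) * cwSum * ((2 * Real.pi * D.σ)⁻¹ + 1)

/-- The constants in the estimate of the analytic norm of the right-hand side. -/
noncomputable def c₂ (D : FourierData) : ℝ := |D.ν| * (2 * D.A * D.CP + 2 * D.R)

theorem c₁_nonneg : 0 ≤ D.c₁ := by
  have := D.A_nonneg; have := D.R_nonneg; have := D.σ_pos; have := cwSum_nonneg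
  unfold c₁; positivity

theorem c₂_nonneg : 0 ≤ D.c₂ := by
  have := D.A_nonneg; have := D.R_nonneg; have := D.CP_nonneg
  unfold c₂; positivity

theorem Adm.anBound_rhs {F : ℝ → Mode → E3 → ℂ} (hF : D.Adm F) {s : ℝ} (hs : s ∈ Icc 0 D.T)
    (k : Mode) : AnBound (D.σ * Real.exp (-(D.K * s)))
      (fun N => D.eB s k * ((D.c₁ * (N + 1 + ‖freq k‖) + D.c₂) * Real.exp (D.K * s)))
      (D.rhs F s k) := by
  have hσ := radius_pos D s
  have hA := D.A_nonneg
  have hR := D.R_nonneg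
  have hCP := D.CP_nonneg
  have hS := cwSum_nonneg
  have hFd := hF.expDecay hs k
  have hPd : ExpDecay D.P := ⟨D.hPc, D.θ, by linarith [D.KT_θ, mul_pos D.K_pos D.T_pos], _, D.hP⟩
  have hPd' : ExpDecay (fun η => D.P (η - s • freq k)) := by
    simpa [sub_eq_add_neg] using hPd.comp_add (-(s • freq k))
  have h2 := ((D.hPan.mono_radius hσ D.CP_nonneg (radius_le hs)).comp_sub hσ hPd
    (s • freq k)).const_mul (F s k (s • freq k))
  have h23 := (h2.add ((hF.an s hs k).const_mul (-1)) (hPd'.const_mul _)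
    (hFd.const_mul _)).const_mul (D.ν : ℂ)
  have h := ((hF.dualBound_tsum hs k).const_mul (4 * Real.pi ^ 2 * D.a : ℂ)).add h23
    ((hF.expDecay_tsum hs k).const_mul _) (((hPd'.const_mul _).add (hFd.const_mul _)).const_mul _)
  have e : D.rhs F s k = fun η => (4 * Real.pi ^ 2 * D.a : ℂ) *
      (∑' l, bilTerm D.Wh (F s) (F s) s k η l) +
      (D.ν : ℂ) * (F s k (s • freq k) * D.P (η - s • freq k) + (-1) * F s k η) := by
    funext η
    unfold rhs nl
    rw [cl_of_mem hs]; ring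
  rw [e]
  refine h.mono hσ fun N => ?_
  have h5 : ‖(4 * Real.pi ^ 2 * D.a : ℂ)‖ = 4 * Real.pi ^ 2 * |D.a| := by
    simp [abs_of_pos Real.pi_pos]
  have hq := hF.norm_mul_exp_le hs k
  have hb := D.eB_nonneg s k
  have hE : 1 ≤ Real.exp (D.K * s) := Real.one_le_exp (mul_nonneg D.K_pos.le hs.1)
  have hinv : (D.σ * Real.exp (-(D.K * s)))⁻¹ = D.σ⁻¹ * Real.exp (D.K * s) := by
    rw [mul_inv, Real.exp_neg, inv_inv]
  have hσ0 := D.σ_pos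
  have hpi := Real.pi_pos
  have hk := norm_nonneg (freq k)
  have t1 : (N + 1 : ℝ) * (D.σ * Real.exp (-(D.K * s)))⁻¹ / (2 * Real.pi) + ‖freq k‖ ≤
      ((2 * Real.pi * D.σ)⁻¹ + 1) * (N + 1 + ‖freq k‖) * Real.exp (D.K * s) := by
    rw [hinv]
    have e1 : (N + 1 : ℝ) * (D.σ⁻¹ * Real.exp (D.K * s)) / (2 * Real.pi) =
        (2 * Real.pi * D.σ)⁻¹ * (N + 1) * Real.exp (D.K * s) := by field_simp
    have e2 : 0 ≤ (2 * Real.pi * D.σ)⁻¹ * ‖freq k‖ * Real.exp (D.K * s) := by positivity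
    have e3 : ‖freq k‖ ≤ (N + 1 + ‖freq k‖) * Real.exp (D.K * s) := by
      have : (0 : ℝ) ≤ N := Nat.cast_nonneg N
      nlinarith
    rw [e1]
    nlinarith
  rw [h5, Complex.norm_real, Real.norm_eq_abs, norm_neg, norm_one, one_mul]
  have t2 : ‖F s k (s • freq k)‖ * (D.CP * Real.exp (2 * Real.pi * ‖s • freq k‖ *
      (D.σ * Real.exp (-(D.K * s))))) ≤ 2 * D.A * D.CP * D.eB s k := by
    have := mul_le_mul_of_nonneg_left hq hCP
    linarith
  calc _ ≤ 4 * Real.pi ^ 2 * |D.a| * (2 * D.A * (2 * D.R) * D.eB s k *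
        (((2 * Real.pi * D.σ)⁻¹ + 1) * (N + 1 + ‖freq k‖) * Real.exp (D.K * s)) * cwSum) +
        |D.ν| * (2 * D.A * D.CP * D.eB s k + 2 * D.R * D.eB s k) := by
        gcongr
        exact le_rfl
    _ = D.eB s k * (D.c₁ * (N + 1 + ‖freq k‖) * Real.exp (D.K * s) + D.c₂) := by
        unfold c₁ c₂; ring
    _ ≤ _ := by
        have := D.c₂_nonneg
        refine mul_le_mul_of_nonneg_left ?_ hb
        nlinarith

theorem Adm.anBound_step {F : ℝ → Mode → E3 → ℂ} (hF : D.Adm F) {t : ℝ} (ht : t ∈ Icc 0 D.T)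
    (k : Mode) : AnBound (D.σ * Real.exp (-(D.K * t))) (fun _ => 2 * D.R * D.eB t k)
      (D.step F t k) := by
  intro y hy S
  have hA := D.A_nonneg
  have hR := D.R_nonneg
  have hK := D.K_pos
  have hσ0 := D.σ_pos
  have hc₁ := D.c₁_nonneg
  have hc₂ := D.c₂_nonneg
  have hC := D.C₀_nonneg
  set N := S.card with hN
  set X : ℝ := N + 1 + ‖freq k‖ with hX
  set Q : ℝ := D.eB 0 k * (N.factorial * D.σ⁻¹ ^ N) with hQ
  have hb0 := D.eB_nonneg 0 k
  have hQ0 : 0 ≤ Q := by positivity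
  have hX0 : 0 ≤ X := by positivity
  have hscale : ∀ s, D.eB s k * (N.factorial * (D.σ * Real.exp (-(D.K * s)))⁻¹ ^ N) *
      Real.exp (D.K * s) = Q * Real.exp (D.K * s * X) := fun s => by
    rw [eB_eq, mul_inv, Real.exp_neg, inv_inv, mul_pow, ← Real.exp_nat_mul, hQ]
    have : Real.exp (D.K * s * X) = Real.exp (D.K * s * ‖freq k‖) * Real.exp (N * (D.K * s)) *
        Real.exp (D.K * s) := by
      rw [← Real.exp_add, ← Real.exp_add]; congr 1; rw [hX]; ring
    rw [this]; ring
  have hdual : ∀ s ∈ Icc 0 t, DualBound (fun η => dprod y S η * D.rhs F s k η)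
      ((D.c₁ * Q * X + D.c₂ * Q) * Real.exp (D.K * (s - 0) * X)) := fun s hs => by
    refine (hF.anBound_rhs ⟨hs.1, hs.2.trans ht.2⟩ k y hy S).mono (le_of_eq ?_)
    have := hscale s
    rw [sub_zero]
    linear_combination (D.c₁ * X + D.c₂) * this
  obtain ⟨B, hB⟩ : ∃ B, ∀ s ∈ Icc 0 t, ∀ η, ‖dprod y S η * D.rhs F s k η‖ ≤ B := by
    obtain ⟨C, hC0, hC⟩ := exists_pow_mul_exp_le (θ := D.θ - D.K * D.T) (by linarith [D.KT_θ]) N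
      (‖freq k‖ + 1) (by positivity)
    refine ⟨(bilConst D.a (2 * D.A) + |D.ν| * (D.C₀ + 1)) * (2 * D.A) * C, fun s hs η => ?_⟩
    have hs' : s ∈ Icc 0 D.T := ⟨hs.1, hs.2.trans ht.2⟩
    have h1 := norm_nl_le (a := D.a) (ν := D.ν) D.hW (θ_pos hs').le (κ_nonneg hs') hs'.1
      (hs'.2.trans D.T_le) (hP' hs') (hF.bound s hs') k η
    have h2 := norm_dprod_le hy S η
    have h3 := env_le_exp_min hs' k η
    have h4 := bilConst_nonneg D.a (A := 2 * D.A) (by positivity)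
    have h5 : 0 ≤ |D.ν| * (D.C₀ + 1) := by positivity
    have h6 := norm_nonneg η
    have h7 := norm_nonneg (freq k)
    have h8 := hC ‖η‖ h6
    have h9 := env_pos (D.θ - D.K * s) (D.κ - D.K * s) k η
    rw [norm_mul]
    unfold rhs
    rw [cl_of_mem hs']
    calc _ ≤ (2 * Real.pi * ‖η‖) ^ N * ((bilConst D.a (2 * D.A) * (‖η‖ + ‖freq k‖) +
          |D.ν| * (D.C₀ + 1)) * (2 * D.A * env (D.θ - D.K * s) (D.κ - D.K * s) k η)) := by gcongr
      _ ≤ (2 * Real.pi * ‖η‖) ^ N * (((bilConst D.a (2 * D.A) + |D.ν| * (D.C₀ + 1)) *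
          (‖η‖ + (‖freq k‖ + 1))) * (2 * D.A * Real.exp (-((D.θ - D.K * D.T) * ‖η‖)))) := by
          gcongr
          nlinarith [mul_nonneg h5 h6, mul_nonneg h5 h7]
      _ = (bilConst D.a (2 * D.A) + |D.ν| * (D.C₀ + 1)) * (2 * D.A) *
          ((2 * Real.pi * ‖η‖) ^ N * (‖η‖ + (‖freq k‖ + 1)) *
            Real.exp (-((D.θ - D.K * D.T) * ‖η‖))) := by ring
      _ ≤ _ := by gcongr
  have hcont : Continuous (Function.uncurry fun (s : ℝ) (η : E3) => dprod y S η * D.rhs F s k η) := by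
    have h1 := hF.continuous_rhs k
    have h2 : Continuous fun z : ℝ × E3 => dprod y S z.2 := by fun_prop
    exact h2.mul h1
  have hint := DualBound.integral ht.1 hdual hcont hB (by fun_prop)
  have hval : ∫ s in (0 : ℝ)..t, (D.c₁ * Q * X + D.c₂ * Q) * Real.exp (D.K * (s - 0) * X) ≤
      (D.c₁ * Q / D.K + D.c₂ * Q * (t - 0)) * Real.exp (D.K * (t - 0) * X) := by
    have := norm_integral_le_exp (Φ := fun s =>
      (((D.c₁ * Q * X + D.c₂ * Q) * Real.exp (D.K * (s - 0) * X) : ℝ) : ℂ)) (c₁ := D.c₁ * Q)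
      (c₂ := D.c₂ * Q) (t₀ := 0) (t := t) (by positivity) (by positivity) hK hX0 ht.1
      (fun s _ _ => by
        rw [Complex.norm_real, Real.norm_of_nonneg (by positivity)])
    rw [intervalIntegral.integral_ofReal, Complex.norm_real] at this
    exact (le_abs_self _).trans this
  have hIc : Continuous fun η => ∫ s in (0 : ℝ)..t, D.rhs F s k η :=
    (continuous_primitive (hF.continuous_rhs k)).comp (by fun_prop : Continuous fun η : E3 => (t, η))
  have hId : ExpDecay fun η => ∫ s in (0 : ℝ)..t, D.rhs F s k η := by
    refine ⟨hIc, _, θ_pos ht, (bilConst D.a (2 * D.A) / D.K + |D.ν| * (D.C₀ + 1) * D.T) * (2 * D.A),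
      fun η => (norm_integral_rhs_le hF.bound ht k η).trans ?_⟩
    have h4 := bilConst_nonneg D.a (A := 2 * D.A) (by positivity)
    have h5 := D.T_pos
    exact mul_le_mul_of_nonneg_left (env_le_exp _ _ (κ_nonneg ht) k η) (by positivity)
  have hF0d : ExpDecay (D.F₀ k) := by
    have h0 : (0 : ℝ) ∈ Icc 0 D.T := ⟨le_rfl, D.T_pos.le⟩
    have hκ := κ_nonneg h0
    have hθ := θ_pos h0
    rw [mul_zero, sub_zero] at hκ hθ
    exact ⟨D.hFc k, D.θ, hθ, D.A, fun η => (D.hF k η).trans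
      (mul_le_mul_of_nonneg_left (env_le_exp _ _ hκ k η) hA)⟩
  have hsum := (D.hFan k y hy S).add (hint.mono hval) (hF0d.dprod_mul hy S) (by
    simp only [intervalIntegral.integral_const_mul]
    exact hId.dprod_mul hy S)
  simp only [intervalIntegral.integral_const_mul, ← mul_add] at hsum
  refine DualBound.mono (H := fun η => dprod y S η * D.step F t k η) hsum ?_
  rw [← hN]
  have e1 : D.R * (Real.exp (-(D.κB * ‖freq k‖)) * (om k)⁻¹) * (N.factorial * D.σ⁻¹ ^ N) = D.R * Q := by
    rw [hQ, eB, mul_zero, sub_zero]; ring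
  have hKt : D.K * t ≤ 1 := (mul_le_mul_of_nonneg_left ht.2 hK.le).trans D.KT_le
  have hKt0 : 0 ≤ D.K * t := mul_nonneg hK.le ht.1
  have e2 : Real.exp (D.K * t) ≤ 3 := (Real.exp_le_exp.2 hKt).trans (Real.exp_one_lt_three.le)
  have e3 : 1 ≤ Real.exp (D.K * t * X - D.K * t) := Real.one_le_exp (by
    have : (0 : ℝ) ≤ N := Nat.cast_nonneg N
    have : 1 ≤ X := by rw [hX]; linarith [norm_nonneg (freq k)]
    nlinarith)
  set Z := Real.exp (D.K * t * X - D.K * t) with hZ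
  have e4 : Real.exp (D.K * t * X) = Z * Real.exp (D.K * t) := by
    rw [hZ, ← Real.exp_add]; congr 1; ring
  have e5 : D.eB t k * (N.factorial * (D.σ * Real.exp (-(D.K * t)))⁻¹ ^ N) = Q * Z := by
    have := hscale t
    rw [e4, ← mul_assoc] at this
    exact mul_right_cancel₀ (Real.exp_pos (D.K * t)).ne' (by linear_combination this)
  have e6 := D.small₂
  have e7 : 3 * (D.c₁ / D.K + D.c₂ * D.T) ≤ D.R := e6
  have e8 : D.c₂ * t ≤ D.c₂ * D.T := mul_le_mul_of_nonneg_left ht.2 hc₂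
  have e9 : 0 ≤ D.c₁ / D.K + D.c₂ * t := by
    have := ht.1
    positivity
  have hZ0 : 0 ≤ Z := zero_le_one.trans e3
  rw [e1, mul_assoc (2 * D.R), e5, sub_zero, e4]
  calc _ = D.R * Q * 1 + (D.c₁ / D.K + D.c₂ * t) * Real.exp (D.K * t) * (Q * Z) := by ring
    _ ≤ D.R * Q * Z + (D.c₁ / D.K + D.c₂ * t) * 3 * (Q * Z) := by gcongr
    _ ≤ D.R * Q * Z + D.R * (Q * Z) := by
        gcongr
        linarith
    _ = _ := by ring

theorem Adm.step {F : ℝ → Mode → E3 → ℂ} (hF : D.Adm F) : D.Adm (D.step F) where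
  cont := hF.continuous_step
  bound _ ht := hF.norm_step_le ht
  symm t _ := hF.step_symm t
  an _ ht := hF.anBound_step ht

theorem adm_initial : D.Adm (fun _ => D.F₀) where
  cont k := (D.hFc k).comp continuous_snd
  bound t ht k η := by
    have hK := mul_nonneg D.K_pos.le ht.1
    refine (D.hF k η).trans ?_
    have h1 := env_anti (θ' := D.θ) (κ' := D.κ) (θ := D.θ - D.K * t) (κ := D.κ - D.K * t)
      (by linarith) (by linarith) k η
    have h2 := env_pos (D.θ - D.K * t) (D.κ - D.K * t) k η
    nlinarith [D.A_nonneg]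
  symm _ _ := D.hFs
  an t ht k := by
    have hR := D.R_nonneg
    have hb := D.eB_nonneg 0 k
    have e : D.eB 0 k = Real.exp (-(D.κB * ‖freq k‖)) * (om k)⁻¹ := by
      rw [eB, mul_zero, sub_zero]
    refine ((D.hFan k).mono_radius (radius_pos D t) (by rw [← e]; positivity)
      (radius_le ht)).mono (radius_pos D t) fun N => ?_
    rw [← e]
    change D.R * D.eB 0 k ≤ 2 * D.R * D.eB t k
    have h1 : D.eB 0 k ≤ D.eB t k := by
      rw [eB_eq t k]
      have := Real.one_le_exp (x := D.K * t * ‖freq k‖) (mul_nonneg (mul_nonneg D.K_pos.le ht.1)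
        (norm_nonneg _))
      nlinarith
    nlinarith

end Analytic

end FourierData

namespace FourierData

section Limit

variable {D : FourierData}

/-- The iterates of the fixed point map. -/
noncomputable def iter (D : FourierData) (n : ℕ) : ℝ → Mode → E3 → ℂ := D.step^[n] (fun _ => D.F₀)

theorem iter_succ (n : ℕ) : D.iter (n + 1) = D.step (D.iter n) := Function.iterate_succ_apply' _ _ _

theorem adm_iter (n : ℕ) : D.Adm (D.iter n) := by
  induction n with
  | zero => exact adm_initial
  | succ n ih => rw [iter_succ]; exact ih.step

theorem norm_iter_succ_sub_le (n : ℕ) {t : ℝ} (ht : t ∈ Icc 0 D.T) (k : Mode) (η : E3) :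
    ‖D.iter (n + 1) t k η - D.iter n t k η‖ ≤
      D.A * env (D.θ - D.K * t) (D.κ - D.K * t) k η * (1 / 2) ^ n := by
  have hA := D.A_nonneg
  have hsm := D.small₁
  induction n generalizing t k η with
  | zero =>
    have h1 := norm_integral_rhs_le (D := D) (F := D.iter 0) (adm_iter 0).bound ht k η
    have e : D.iter 1 t k η - D.iter 0 t k η = ∫ s in (0 : ℝ)..t, D.rhs (D.iter 0) s k η := by
      rw [iter_succ]; unfold step iter; simp
    rw [e, pow_zero, mul_one]
    refine h1.trans ?_
    have h4 := env_pos (D.θ - D.K * t) (D.κ - D.K * t) k η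
    have h5 : 0 ≤ (2 * D.A) * env (D.θ - D.K * t) (D.κ - D.K * t) k η := by positivity
    nlinarith
  | succ n ih =>
    have h1 := norm_integral_sub_le (D := D) (d := D.A * (1 / 2) ^ n) (by positivity)
      (adm_iter (n + 1)).bound (adm_iter n).bound
      (fun t ht k η => (ih ht k η).trans (le_of_eq (by ring))) ht k η
    have e : D.iter (n + 1 + 1) t k η - D.iter (n + 1) t k η =
        ∫ s in (0 : ℝ)..t, (D.rhs (D.iter (n + 1)) s k η - D.rhs (D.iter n) s k η) := by
      have e1 : D.iter (n + 1 + 1) t k η = D.step (D.iter (n + 1)) t k η := by rw [iter_succ (n + 1)]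
      have e2 : D.iter (n + 1) t k η = D.step (D.iter n) t k η := by rw [iter_succ n]
      rw [e1, e2, intervalIntegral.integral_sub
        ((adm_iter (n + 1)).intervalIntegrable_rhs k η 0 t) ((adm_iter n).intervalIntegrable_rhs k η 0 t)]
      unfold step; ring
    rw [e]
    refine h1.trans ?_
    have h4 := env_pos (D.θ - D.K * t) (D.κ - D.K * t) k η
    have h5 : 0 ≤ D.A * (1 / 2) ^ n * env (D.θ - D.K * t) (D.κ - D.K * t) k η := by positivity
    rw [pow_succ]
    nlinarith

theorem exists_limit (D : FourierData) : ∃ G : ℝ → Mode → E3 → ℂ, ∀ t k η,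
    Filter.Tendsto (fun n => D.iter n (cl D.T t) k η) Filter.atTop (nhds (G t k η)) := by
  have h : ∀ t k η, ∃ g, Filter.Tendsto (fun n => D.iter n (cl D.T t) k η) Filter.atTop (nhds g) := by
    intro t k η
    refine cauchySeq_tendsto_of_complete (cauchySeq_of_le_geometric (1 / 2)
      (D.A * env (D.θ - D.K * cl D.T t) (D.κ - D.K * cl D.T t) k η) (by norm_num) fun n => ?_)
    rw [dist_comm, dist_eq_norm]
    exact norm_iter_succ_sub_le n (D.cl_mem' t) k η
  choose G hG using h
  exact ⟨G, hG⟩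

theorem norm_iter_sub_limit_le {G : ℝ → Mode → E3 → ℂ} (hG : ∀ t k η,
    Filter.Tendsto (fun n => D.iter n (cl D.T t) k η) Filter.atTop (nhds (G t k η))) (n : ℕ) (t : ℝ)
    (k : Mode) (η : E3) : ‖D.iter n (cl D.T t) k η - G t k η‖ ≤
      2 * D.A * (1 / 2) ^ n * env (D.θ - D.K * cl D.T t) (D.κ - D.K * cl D.T t) k η := by
  have := dist_le_of_le_geometric_of_tendsto (1 / 2)
    (D.A * env (D.θ - D.K * cl D.T t) (D.κ - D.K * cl D.T t) k η) (by norm_num) (fun n => by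
      rw [dist_comm, dist_eq_norm]
      exact norm_iter_succ_sub_le n (D.cl_mem' t) k η) (hG t k η) n
  rw [dist_eq_norm] at this
  refine this.trans (le_of_eq ?_)
  norm_num; ring

theorem adm_limit {G : ℝ → Mode → E3 → ℂ} (hG : ∀ t k η,
    Filter.Tendsto (fun n => D.iter n (cl D.T t) k η) Filter.atTop (nhds (G t k η))) : D.Adm G := by
  have hA := D.A_nonneg
  have hlim : ∀ t ∈ Icc 0 D.T, ∀ k η,
      Filter.Tendsto (fun n => D.iter n t k η) Filter.atTop (nhds (G t k η)) := fun t ht k η => by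
    simpa only [cl_of_mem ht] using hG t k η
  have hcont : ∀ k, Continuous fun z : ℝ × E3 => G z.1 k z.2 := by
    intro k
    have hu : TendstoUniformly (fun n (z : ℝ × E3) => D.iter n (cl D.T z.1) k z.2)
        (fun z : ℝ × E3 => G z.1 k z.2) Filter.atTop := by
      rw [Metric.tendstoUniformly_iff]
      intro ε hε
      have h1 : Filter.Tendsto (fun n : ℕ => 2 * D.A * (1 / 2 : ℝ) ^ n) Filter.atTop (nhds (2 * D.A * 0)) :=
        (tendsto_pow_atTop_nhds_zero_of_lt_one (by norm_num) (by norm_num)).const_mul _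
      rw [mul_zero] at h1
      filter_upwards [h1.eventually (gt_mem_nhds hε)] with n hn z
      rw [dist_comm, dist_eq_norm]
      refine (norm_iter_sub_limit_le hG n z.1 k z.2).trans_lt (lt_of_le_of_lt ?_ hn)
      have hm := D.cl_mem' z.1
      have h2 := (env_le_exp (D.θ - D.K * cl D.T z.1) (D.κ - D.K * cl D.T z.1) (κ_nonneg hm) k z.2).trans
        (Real.exp_le_one_iff.2 (by
          have := mul_nonneg (θ_pos hm).le (norm_nonneg z.2)
          linarith))
      exact mul_le_of_le_one_right (by positivity) h2
    exact hu.continuous (Filter.Eventually.frequently (Filter.Eventually.of_forall fun n =>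
      (adm_iter n).continuous_comp k continuous_snd))
  refine ⟨hcont, fun t ht k η => ?_, fun t ht k η => ?_, fun t ht k y hy S ψ hψ hb => ?_⟩
  · exact le_of_tendsto' (hlim t ht k η).norm fun n => (adm_iter n).bound t ht k η
  · refine tendsto_nhds_unique (hlim t ht (-k) (-η)) ?_
    have h1 := (Complex.continuous_conj.tendsto _).comp (hlim t ht k η)
    refine h1.congr fun n => ?_
    exact ((adm_iter n).symm t ht k η).symm
  · obtain ⟨C, hC0, hC⟩ := exists_pow_mul_exp_le (θ := D.θ - D.K * D.T) (by linarith [D.KT_θ]) S.card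
      1 zero_le_one
    have hbd : ∀ n η, ‖dprod y S η * D.iter n t k η * ψ η‖ ≤ 2 * D.A * C * ‖ψ η‖ := fun n η => by
      have h1 := (adm_iter n).bound t ht k η
      have h2 := norm_dprod_le hy S η
      have h3 := env_le_exp_min ht k η
      have h4 := hC ‖η‖ (norm_nonneg _)
      have h5 := norm_nonneg η
      have hpi := Real.pi_pos
      rw [norm_mul, norm_mul]
      refine mul_le_mul_of_nonneg_right ?_ (norm_nonneg _)
      calc _ ≤ (2 * Real.pi * ‖η‖) ^ S.card * (2 * D.A *
            Real.exp (-((D.θ - D.K * D.T) * ‖η‖))) := by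
            gcongr
            exact h1.trans (by gcongr)
        _ = 2 * D.A * ((2 * Real.pi * ‖η‖) ^ S.card * 1 *
            Real.exp (-((D.θ - D.K * D.T) * ‖η‖))) := by ring
        _ ≤ 2 * D.A * ((2 * Real.pi * ‖η‖) ^ S.card * (‖η‖ + 1) *
            Real.exp (-((D.θ - D.K * D.T) * ‖η‖))) := by gcongr; linarith
        _ ≤ _ := by gcongr
    have hconv := tendsto_integral_of_dominated_convergence (μ := volume)
      (F := fun n η => dprod y S η * D.iter n t k η * ψ η)
      (f := fun η => dprod y S η * G t k η * ψ η) (fun η => 2 * D.A * C * ‖ψ η‖)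
      (fun n => (((adm_iter n).expDecay ht k).dprod_mul hy S).1.aestronglyMeasurable.mul hψ.1)
      (hψ.norm.const_mul _) (fun n => Filter.Eventually.of_forall (hbd n))
      (Filter.Eventually.of_forall fun η => ((hlim t ht k η).const_mul _).mul_const _)
    exact le_of_tendsto' hconv.norm fun n => (adm_iter n).an t ht k y hy S ψ hψ hb

/-- The Fourier-transformed equation has a solution. -/
theorem exists_fixedPoint (D : FourierData) : ∃ F : ℝ → Mode → E3 → ℂ, D.Adm F ∧ D.step F = F := by
  obtain ⟨G, hG⟩ := D.exists_limit
  have hGa := adm_limit hG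
  have hfix : ∀ t ∈ Icc 0 D.T, D.step G t = G t := by
    intro t ht
    funext k η
    have hA := D.A_nonneg
    have h1 : ∀ n, ‖D.iter (n + 1) t k η - D.step G t k η‖ ≤
        (bilConst D.a (2 * D.A) / D.K + |D.ν| * (D.C₀ + 1) * D.T) * (2 * D.A * (1 / 2) ^ n) *
          env (D.θ - D.K * t) (D.κ - D.K * t) k η := fun n => by
      have h2 := norm_integral_sub_le (D := D) (d := 2 * D.A * (1 / 2) ^ n) (by positivity)
        (adm_iter n).bound hGa.bound (fun s hs k η => by
          have := norm_iter_sub_limit_le hG n s k η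
          rwa [cl_of_mem hs] at this) ht k η
      have e : D.iter (n + 1) t k η - D.step G t k η =
          ∫ s in (0 : ℝ)..t, (D.rhs (D.iter n) s k η - D.rhs G s k η) := by
        rw [iter_succ n, intervalIntegral.integral_sub
          ((adm_iter n).intervalIntegrable_rhs k η 0 t) (hGa.intervalIntegrable_rhs k η 0 t)]
        unfold step; ring
      rwa [e]
    have h2 : Filter.Tendsto (fun n => D.iter (n + 1) t k η) Filter.atTop (nhds (D.step G t k η)) := by
      rw [tendsto_iff_norm_sub_tendsto_zero]
      refine squeeze_zero (fun _ => norm_nonneg _) h1 ?_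
      have h3 : Filter.Tendsto (fun n : ℕ => (1 / 2 : ℝ) ^ n) Filter.atTop (nhds 0) :=
        tendsto_pow_atTop_nhds_zero_of_lt_one (by norm_num) (by norm_num)
      have h4 := (((h3.const_mul (2 * D.A)).const_mul
        (bilConst D.a (2 * D.A) / D.K + |D.ν| * (D.C₀ + 1) * D.T)).mul_const
          (env (D.θ - D.K * t) (D.κ - D.K * t) k η))
      simpa using h4
    have h3 := hG t k η
    simp only [cl_of_mem ht] at h3
    exact tendsto_nhds_unique h2 (h3.comp (Filter.tendsto_add_atTop_nat 1))
  have hrhs : D.rhs (D.step G) = D.rhs G := by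
    funext s k η
    unfold rhs
    rw [hfix _ (D.cl_mem' s)]
  refine ⟨D.step G, hGa.step, ?_⟩
  funext t k η
  rw [step, hrhs, ← step]

end Limit

end FourierData

section Tube

/-- The square trick: a bound at the centre of a square from bounds on one side. -/
theorem norm_pow_four_le_of_square {h : ℂ → ℂ} {M m : ℝ}
    (hd : ∀ z : ℂ, 0 ≤ z.im → z.im ≤ 2 → DifferentiableAt ℂ h z)
    (hM : ∀ z : ℂ, 0 ≤ z.im → z.im ≤ 2 → ‖h z‖ ≤ M)
    (hm : ∀ x : ℝ, |x| ≤ 1 → ‖h x‖ ≤ m) : ‖h Complex.I‖ ^ 4 ≤ M ^ 3 * m := by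
  have hM0 : 0 ≤ M := (norm_nonneg _).trans (hM 0 (by simp) (by simp))
  have hm0 : 0 ≤ m := (norm_nonneg _).trans (hm 0 (by simp))
  set I := Complex.I with hI
  set U : Set ℂ := Ioo (-1 : ℝ) 1 ×ℂ Ioo (-1 : ℝ) 1 with hU
  have hcl : closure U = Icc (-1 : ℝ) 1 ×ℂ Icc (-1 : ℝ) 1 := by
    rw [hU, Complex.closure_reProdIm, closure_Ioo (by norm_num)]
  have hb : Bornology.IsBounded U := by
    refine (Metric.isBounded_Icc (-1 : ℝ) 1).reProdIm (Metric.isBounded_Icc (-1 : ℝ) 1) |>.subset ?_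
    rw [← hcl]; exact subset_closure
  set P : ℂ → ℂ := fun w => h (I + w) * h (I + I * w) * (h (I - w) * h (I - I * w)) with hP
  have hmem : ∀ w ∈ closure U, -1 ≤ w.re ∧ w.re ≤ 1 ∧ -1 ≤ w.im ∧ w.im ≤ 1 := fun w hw => by
    rw [hcl] at hw
    exact ⟨hw.1.1, hw.1.2, hw.2.1, hw.2.2⟩
  have him : ∀ w ∈ closure U, (0 ≤ (I + w).im ∧ (I + w).im ≤ 2) ∧
      (0 ≤ (I + I * w).im ∧ (I + I * w).im ≤ 2) ∧ (0 ≤ (I - w).im ∧ (I - w).im ≤ 2) ∧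
      (0 ≤ (I - I * w).im ∧ (I - I * w).im ≤ 2) := fun w hw => by
    obtain ⟨h1, h2, h3, h4⟩ := hmem w hw
    simp only [hI, Complex.add_im, Complex.sub_im, Complex.mul_im, Complex.I_re, Complex.I_im]
    refine ⟨⟨?_, ?_⟩, ⟨?_, ?_⟩, ⟨?_, ?_⟩, ?_, ?_⟩ <;> linarith
  have hdiff : DiffContOnCl ℂ P U := by
    refine DifferentiableOn.diffContOnCl fun w hw => ?_
    obtain ⟨⟨a1, a2⟩, ⟨b1, b2⟩, ⟨c1, c2⟩, d1, d2⟩ := him w hw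
    refine DifferentiableAt.differentiableWithinAt ?_
    have e1 : DifferentiableAt ℂ (fun w => h (I + w)) w := (hd _ a1 a2).comp w (by fun_prop)
    have e2 : DifferentiableAt ℂ (fun w => h (I + I * w)) w := (hd _ b1 b2).comp w (by fun_prop)
    have e3 : DifferentiableAt ℂ (fun w => h (I - w)) w := (hd _ c1 c2).comp w (by fun_prop)
    have e4 : DifferentiableAt ℂ (fun w => h (I - I * w)) w := (hd _ d1 d2).comp w (by fun_prop)
    exact (e1.mul e2).mul (e3.mul e4)
  have hfr : ∀ w ∈ frontier U, ‖P w‖ ≤ M ^ 3 * m := by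
    intro w hw
    have hwc : w ∈ closure U := frontier_subset_closure hw
    obtain ⟨h1, h2, h3, h4⟩ := hmem w hwc
    obtain ⟨⟨a1, a2⟩, ⟨b1, b2⟩, ⟨c1, c2⟩, d1, d2⟩ := him w hwc
    have hnot : w ∉ U := fun h => by
      have ho : IsOpen U := isOpen_Ioo.reProdIm isOpen_Ioo
      rw [ho.frontier_eq] at hw
      exact hw.2 h
    have A := hM _ a1 a2
    have B := hM _ b1 b2
    have C := hM _ c1 c2
    have E := hM _ d1 d2
    have side : ∀ z : ℂ, z.im = 0 → |z.re| ≤ 1 → ‖h z‖ ≤ m := fun z h0 h1 => by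
      have : z = (z.re : ℂ) := Complex.ext (by simp) (by simp [h0])
      rw [this]; exact hm _ h1
    have hn1 := norm_nonneg (h (I + w))
    have hn2 := norm_nonneg (h (I + I * w))
    have hn3 := norm_nonneg (h (I - w))
    have hn4 := norm_nonneg (h (I - I * w))
    have hcase : w.re = -1 ∨ w.re = 1 ∨ w.im = -1 ∨ w.im = 1 := by
      by_contra hcon
      push Not at hcon
      obtain ⟨k1, k2, k3, k4⟩ := hcon
      exact hnot ⟨⟨lt_of_le_of_ne h1 (Ne.symm k1), lt_of_le_of_ne h2 k2⟩,
        ⟨lt_of_le_of_ne h3 (Ne.symm k3), lt_of_le_of_ne h4 k4⟩⟩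
    have hP' : ‖P w‖ = ‖h (I + w)‖ * ‖h (I + I * w)‖ * (‖h (I - w)‖ * ‖h (I - I * w)‖) := by
      simp only [hP, norm_mul]
    rw [hP']
    rcases hcase with hc | hc | hc | hc
    · have := side (I + I * w) (by simp [hI, hc]) (by simpa [hI, abs_le] using ⟨by linarith, by linarith⟩)
      calc _ ≤ M * m * (M * M) := by gcongr
        _ = _ := by ring
    · have := side (I - I * w) (by simp [hI, hc]) (by simpa [hI, abs_le] using ⟨by linarith, by linarith⟩)
      calc _ ≤ M * M * (M * m) := by gcongr
        _ = _ := by ring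
    · have := side (I + w) (by simp [hI, hc]) (by simpa [hI, abs_le] using ⟨by linarith, by linarith⟩)
      calc _ ≤ m * M * (M * M) := by gcongr
        _ = _ := by ring
    · have := side (I - w) (by simp [hI, hc]) (by simpa [hI, abs_le] using ⟨by linarith, by linarith⟩)
      calc _ ≤ M * M * (m * M) := by gcongr
        _ = _ := by ring
  have h0 : (0 : ℂ) ∈ closure U := subset_closure ⟨⟨by simp, by simp⟩, by simp, by simp⟩
  have := Complex.norm_le_of_forall_mem_frontier_norm_le hb hdiff hfr h0
  have e : P 0 = h I ^ 4 := by simp only [hP, mul_zero, add_zero, sub_zero]; ring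
  rwa [e, norm_pow] at this

variable {H : E3 → ℂ} {A lam : ℝ}

/-- The analytic extension of the inverse Fourier transform along a line. -/
noncomputable def lineExt (H : E3 → ℂ) (v y : E3) (z : ℂ) : ℂ :=
  ∫ η, Complex.exp (2 * Real.pi * Complex.I * ((inner ℝ η v : ℝ) + z * (inner ℝ η y : ℝ))) * H η

theorem lineExt_ofReal (H : E3 → ℂ) (v y : E3) (x : ℝ) :
    lineExt H v y x = velInv H (v + x • y) := by
  unfold lineExt velInv ex
  congr with η
  rw [inner_add_right, inner_smul_right]
  congr 2; push_cast; ring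

theorem lineExt_I (H : E3 → ℂ) (v y : E3) :
    lineExt H v y Complex.I =
      velInv (fun η => (Real.exp (-(2 * Real.pi * inner ℝ y η)) : ℂ) * H η) v := by
  unfold lineExt velInv ex
  congr with η
  rw [← mul_assoc, Complex.ofReal_exp, ← Complex.exp_add, real_inner_comm y η]
  congr 2
  have := Complex.I_mul_I
  push_cast
  linear_combination (2 * Real.pi * (inner ℝ y η : ℂ)) * this

theorem norm_exp_line_le {v y η : E3} {z : ℂ} {b : ℝ} (hz : |z.im| * ‖y‖ ≤ b) :
    ‖Complex.exp (2 * Real.pi * Complex.I * ((inner ℝ η v : ℝ) + z * (inner ℝ η y : ℝ)))‖ ≤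
      Real.exp (2 * Real.pi * b * ‖η‖) := by
  rw [Complex.norm_exp]
  refine Real.exp_le_exp.2 ?_
  have e : (2 * Real.pi * Complex.I * ((inner ℝ η v : ℝ) + z * (inner ℝ η y : ℝ))).re =
      2 * Real.pi * (-(z.im * inner ℝ η y)) := by
    simp
  rw [e]
  have h1 := abs_real_inner_le_norm η y
  have h2 : -(z.im * inner ℝ η y) ≤ |z.im| * (‖η‖ * ‖y‖) := by
    calc _ ≤ |z.im * inner ℝ η y| := neg_le_abs _
      _ = |z.im| * |inner ℝ η y| := abs_mul _ _
      _ ≤ _ := by gcongr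
  have h3 : |z.im| * (‖η‖ * ‖y‖) ≤ b * ‖η‖ := by
    have := mul_le_mul_of_nonneg_right hz (norm_nonneg η)
    linarith
  have := Real.pi_pos
  nlinarith

theorem norm_lineExt_le (hlam : 0 < lam) (hH : ∀ η, ‖H η‖ ≤ A * Real.exp (-(2 * Real.pi * lam * ‖η‖)))
    {v y : E3} (hy : ‖y‖ ≤ lam / 4) {z : ℂ} (hz : |z.im| ≤ 2) :
    ‖lineExt H v y z‖ ≤ A * ∫ η : E3, Real.exp (-(Real.pi * lam * ‖η‖)) := by
  have hpi := Real.pi_pos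
  unfold lineExt
  rw [← integral_const_mul]
  refine norm_integral_le_of_norm_le ((integrable_exp_neg_norm (by positivity)).const_mul A)
    (Filter.Eventually.of_forall fun η => ?_)
  rw [norm_mul]
  have hA : 0 ≤ A := by
    have := (norm_nonneg _).trans (hH 0)
    exact nonneg_of_mul_nonneg_left this (Real.exp_pos _)
  calc _ ≤ Real.exp (2 * Real.pi * (lam / 2) * ‖η‖) * (A * Real.exp (-(2 * Real.pi * lam * ‖η‖))) := by
        gcongr
        · refine norm_exp_line_le ?_
          calc |z.im| * ‖y‖ ≤ 2 * (lam / 4) := by gcongr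
            _ = _ := by ring
        · exact hH η
    _ = A * (Real.exp (2 * Real.pi * (lam / 2) * ‖η‖) * Real.exp (-(2 * Real.pi * lam * ‖η‖))) := by ring
    _ = _ := by rw [← Real.exp_add]; congr 2; ring

theorem differentiableAt_lineExt (hlam : 0 < lam) (hc : Continuous H)
    (hH : ∀ η, ‖H η‖ ≤ A * Real.exp (-(2 * Real.pi * lam * ‖η‖)))
    {v y : E3} (hy : ‖y‖ ≤ lam / 4) {z : ℂ} (hz : |z.im| ≤ 2) :
    DifferentiableAt ℂ (lineExt H v y) z := by
  have hpi := Real.pi_pos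
  have hA : 0 ≤ A := by
    have := (norm_nonneg _).trans (hH 0)
    exact nonneg_of_mul_nonneg_left this (Real.exp_pos _)
  obtain ⟨C, hC, hCb⟩ := pow_le_exp (c := 2 * Real.pi * (lam / 8)) (by positivity) 1
  have hcont : ∀ z : ℂ, Continuous fun η : E3 =>
      Complex.exp (2 * Real.pi * Complex.I * ((inner ℝ η v : ℝ) + z * (inner ℝ η y : ℝ))) * H η :=
    fun z => by fun_prop
  have him : ∀ w ∈ Metric.ball z 1, |w.im| ≤ 3 := fun w hw => by
    have h1 := Complex.abs_im_le_norm (w - z)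
    rw [mem_ball_iff_norm] at hw
    have h2 : |w.im| ≤ |z.im| + |(w - z).im| := by
      rw [Complex.sub_im]
      calc |w.im| = |z.im + (w.im - z.im)| := by ring_nf
        _ ≤ _ := abs_add_le _ _
    linarith
  have key := hasDerivAt_integral_of_dominated_loc_of_deriv_le (μ := (volume : Measure E3))
    (F := fun (z : ℂ) η => Complex.exp (2 * Real.pi * Complex.I *
      ((inner ℝ η v : ℝ) + z * (inner ℝ η y : ℝ))) * H η)
    (F' := fun (z : ℂ) η => Complex.exp (2 * Real.pi * Complex.I *
      ((inner ℝ η v : ℝ) + z * (inner ℝ η y : ℝ))) * (2 * Real.pi * Complex.I * (inner ℝ η y : ℝ)) * H η)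
    (x₀ := z) (s := Metric.ball z 1) (Metric.ball_mem_nhds z one_pos)
    (bound := fun η => A * (2 * Real.pi * ‖y‖ * C) * Real.exp (-(2 * Real.pi * (lam / 8) * ‖η‖)))
    (Filter.Eventually.of_forall fun w => (hcont w).aestronglyMeasurable) ?_ ?_ ?_ ?_ ?_
  · exact key.2.differentiableAt
  · refine ((integrable_exp_neg_norm (c := Real.pi * lam) (by positivity)).const_mul A).mono'
      (hcont z).aestronglyMeasurable (Filter.Eventually.of_forall fun η => ?_)
    rw [norm_mul]
    calc _ ≤ Real.exp (2 * Real.pi * (lam / 2) * ‖η‖) * (A * Real.exp (-(2 * Real.pi * lam * ‖η‖))) := by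
          gcongr
          · refine norm_exp_line_le ?_
            calc |z.im| * ‖y‖ ≤ 2 * (lam / 4) := by gcongr
              _ = _ := by ring
          · exact hH η
      _ = A * (Real.exp (2 * Real.pi * (lam / 2) * ‖η‖) * Real.exp (-(2 * Real.pi * lam * ‖η‖))) := by
          ring
      _ = _ := by rw [← Real.exp_add]; congr 2; ring
  · exact Continuous.aestronglyMeasurable (by fun_prop)
  · refine Filter.Eventually.of_forall fun η w hw => ?_
    have h1 := hCb ‖η‖ (norm_nonneg _)
    rw [pow_one] at h1
    have h2 : ‖(2 * Real.pi * Complex.I * (inner ℝ η y : ℝ) : ℂ)‖ ≤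
        2 * Real.pi * ‖y‖ * (C * Real.exp (2 * Real.pi * (lam / 8) * ‖η‖)) := by
      have e : ‖(2 * Real.pi * Complex.I * (inner ℝ η y : ℝ) : ℂ)‖ = 2 * Real.pi * |inner ℝ η y| := by
        simp [abs_of_pos hpi]
      rw [e]
      have h3 := abs_real_inner_le_norm η y
      calc _ ≤ 2 * Real.pi * (‖η‖ * ‖y‖) := by gcongr
        _ = 2 * Real.pi * ‖y‖ * ‖η‖ := by ring
        _ ≤ _ := by gcongr
    rw [norm_mul, norm_mul]
    calc _ ≤ Real.exp (2 * Real.pi * (3 * lam / 4) * ‖η‖) *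
          (2 * Real.pi * ‖y‖ * (C * Real.exp (2 * Real.pi * (lam / 8) * ‖η‖))) *
          (A * Real.exp (-(2 * Real.pi * lam * ‖η‖))) := by
          gcongr
          · refine norm_exp_line_le ?_
            calc |w.im| * ‖y‖ ≤ 3 * (lam / 4) := by
                  have := him w hw
                  gcongr
              _ = _ := by ring
          · exact hH η
      _ = A * (2 * Real.pi * ‖y‖ * C) * (Real.exp (2 * Real.pi * (3 * lam / 4) * ‖η‖) *
          Real.exp (2 * Real.pi * (lam / 8) * ‖η‖) * Real.exp (-(2 * Real.pi * lam * ‖η‖))) := by ring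
      _ = _ := by rw [← Real.exp_add, ← Real.exp_add]; congr 2; ring
  · exact (integrable_exp_neg_norm (by positivity)).const_mul _
  · refine Filter.Eventually.of_forall fun η w _ => ?_
    have h1 : HasDerivAt (fun w : ℂ => 2 * Real.pi * Complex.I *
        ((inner ℝ η v : ℝ) + w * (inner ℝ η y : ℝ))) (2 * Real.pi * Complex.I * (inner ℝ η y : ℝ)) w := by
      have := (((hasDerivAt_id w).mul_const ((inner ℝ η y : ℝ) : ℂ)).const_add
        ((inner ℝ η v : ℝ) : ℂ)).const_mul (2 * Real.pi * Complex.I)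
      simpa using this
    exact h1.cexp.mul_const _

/-- Decay of the inverse Fourier transform on the real space gives decay in a tube. -/
theorem norm_velInv_exp_pow_le (hlam : 0 < lam) (hc : Continuous H)
    (hH : ∀ η, ‖H η‖ ≤ A * Real.exp (-(2 * Real.pi * lam * ‖η‖)))
    {y : E3} (hy : ‖y‖ ≤ lam / 4) {m : E3 → ℝ} {v : E3}
    (hm : ∀ u, ‖u - v‖ ≤ lam / 4 → ‖velInv H u‖ ≤ m v) :
    ‖velInv (fun η => (Real.exp (-(2 * Real.pi * inner ℝ y η)) : ℂ) * H η) v‖ ^ 4 ≤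
      (A * ∫ η : E3, Real.exp (-(Real.pi * lam * ‖η‖))) ^ 3 * m v := by
  rw [← lineExt_I]
  have habs : ∀ z : ℂ, 0 ≤ z.im → z.im ≤ 2 → |z.im| ≤ 2 := fun z h1 h2 => by rwa [abs_of_nonneg h1]
  refine norm_pow_four_le_of_square (fun z h1 h2 => differentiableAt_lineExt hlam hc hH hy (habs z h1 h2))
    (fun z h1 h2 => norm_lineExt_le hlam hH hy (habs z h1 h2)) fun x hx => ?_
  rw [lineExt_ofReal]
  refine hm _ ?_
  rw [add_sub_cancel_left, norm_smul, Real.norm_eq_abs]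
  nlinarith [norm_nonneg y]

end Tube

section TubeDecay

theorem norm_ex_sub_ex_le (a b : ℝ) : ‖ex a - ex b‖ ≤ 2 * Real.pi * |a - b| := by
  have := Convex.norm_image_sub_le_of_norm_hasDerivWithin_le (f := ex) (s := univ) (x := b) (y := a)
    (C := 2 * Real.pi) (fun x _ => (hasDerivAt_ex x).hasDerivWithinAt) (fun x _ => by
      simp [abs_of_pos Real.pi_pos]) convex_univ (mem_univ _) (mem_univ _)
  simpa using this

/-- A Lipschitz function with an exponential moment decays exponentially. -/
theorem exists_exp_decay_of_lipschitz {L β : ℝ} (hL : 0 < L) (hβ : 0 < β) : ∃ c : ℝ, 1 ≤ c ∧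
    ∀ g : E3 → ℂ, (∀ u v, ‖g u - g v‖ ≤ L * ‖u - v‖) → (∀ v, ‖g v‖ ≤ L) →
      ∫⁻ v, ‖g v‖ₑ * ENNReal.ofReal (Real.exp (β * ‖v‖)) ≤ 1 →
      ∀ v, ‖g v‖ ≤ c * Real.exp (-(β / 4 * ‖v‖)) := by
  set κ := (volume (Metric.ball (0 : E3) 1)).toReal with hκ
  have hκ0 : 0 < κ := ENNReal.toReal_pos (Metric.measure_ball_pos _ _ one_pos).ne'
    measure_ball_lt_top.ne
  set C := 16 * L ^ 3 / κ * Real.exp β with hC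
  have hC0 : 0 < C := by positivity
  refine ⟨max 1 C, le_max_left _ _, fun g hg hgL hint v => ?_⟩
  have h4 : ‖g v‖ ^ 4 ≤ C * Real.exp (-(β * ‖v‖)) := by
    by_cases h0 : ‖g v‖ = 0
    · rw [h0]; simp only [ne_eq, OfNat.ofNat_ne_zero, not_false_eq_true, zero_pow]; positivity
    have hpos : 0 < ‖g v‖ := lt_of_le_of_ne (norm_nonneg _) (Ne.symm h0)
    set ρ := ‖g v‖ / (2 * L) with hρ
    have hρ0 : 0 < ρ := by positivity
    have hρ1 : ρ ≤ 1 := by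
      rw [hρ, div_le_one (by positivity)]
      linarith [hgL v]
    have hlow : ∀ u ∈ Metric.ball v ρ, ENNReal.ofReal (‖g v‖ / 2 * Real.exp (β * (‖v‖ - 1))) ≤
        ‖g u‖ₑ * ENNReal.ofReal (Real.exp (β * ‖u‖)) := by
      intro u hu
      rw [mem_ball_iff_norm] at hu
      rw [← ofReal_norm, ← ENNReal.ofReal_mul (norm_nonneg _)]
      refine ENNReal.ofReal_le_ofReal ?_
      have h1 := hg v u
      rw [norm_sub_rev v u] at h1
      have h2 : L * ‖u - v‖ ≤ ‖g v‖ / 2 := by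
        calc _ ≤ L * ρ := by gcongr
          _ = _ := by rw [hρ]; field_simp
      have h3 : ‖g v‖ ≤ ‖g u‖ + ‖g v - g u‖ := by
        calc ‖g v‖ = ‖g u + (g v - g u)‖ := by rw [add_sub_cancel]
          _ ≤ _ := norm_add_le _ _
      have h5 : ‖v‖ - 1 ≤ ‖u‖ := by
        have : ‖v‖ ≤ ‖u‖ + ‖u - v‖ := by
          rw [norm_sub_rev]
          calc ‖v‖ = ‖u + (v - u)‖ := by rw [add_sub_cancel]
            _ ≤ _ := norm_add_le _ _
        linarith
      have h6 : ‖g v‖ / 2 ≤ ‖g u‖ := by linarith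
      gcongr
    have h5 : ENNReal.ofReal (‖g v‖ / 2 * Real.exp (β * (‖v‖ - 1))) * volume (Metric.ball v ρ) ≤ 1 := by
      rw [← setLIntegral_const]
      refine le_trans ?_ ((setLIntegral_le_lintegral (Metric.ball v ρ) _).trans hint)
      exact setLIntegral_mono' Metric.isOpen_ball.measurableSet hlow
    have hvol : volume (Metric.ball v ρ) = ENNReal.ofReal (ρ ^ 3 * κ) := by
      rw [Measure.addHaar_ball volume v hρ0.le, ENNReal.ofReal_mul (by positivity), hκ,
        ENNReal.ofReal_toReal measure_ball_lt_top.ne]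
      simp
    rw [hvol, ← ENNReal.ofReal_mul (by positivity), ENNReal.ofReal_le_one] at h5
    have h6 : Real.exp (β * (‖v‖ - 1)) = Real.exp (β * ‖v‖) * (Real.exp β)⁻¹ := by
      rw [← Real.exp_neg, ← Real.exp_add]; congr 1; ring
    rw [h6, hρ] at h5
    rw [Real.exp_neg, ← div_eq_mul_inv, le_div_iff₀ (Real.exp_pos _)]
    have h7 : ‖g v‖ / 2 * (Real.exp (β * ‖v‖) * (Real.exp β)⁻¹) * ((‖g v‖ / (2 * L)) ^ 3 * κ) =
        ‖g v‖ ^ 4 * Real.exp (β * ‖v‖) / C := by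
      rw [hC]; field_simp; ring
    rw [h7, div_le_one hC0] at h5
    exact h5
  have h5 : ‖g v‖ ^ 4 ≤ (max 1 C * Real.exp (-(β / 4 * ‖v‖))) ^ 4 := by
    refine h4.trans ?_
    rw [mul_pow, ← Real.exp_nat_mul]
    have e1 : C ≤ max 1 C ^ 4 := (le_max_right _ _).trans (le_self_pow₀ (le_max_left _ _) (by norm_num))
    have e2 : ((4 : ℕ) : ℝ) * -(β / 4 * ‖v‖) = -(β * ‖v‖) := by push_cast; ring
    rw [e2]
    gcongr
  exact (pow_le_pow_iff_left₀ (norm_nonneg _) (by positivity) (by norm_num)).1 h5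

/-- Bounds in a tube for the Fourier transform of a function with an exponential moment. -/
theorem exists_dualBound_tube {lam β : ℝ} (hlam : 0 < lam) (hβ : 0 < β) : ∃ c : ℝ, 0 < c ∧
    ∀ (g : E3 → ℂ) (a : ℝ), 0 ≤ a → a ≤ 1 → Continuous g → Integrable g →
      (∀ η, ‖velFourier g η‖ ≤ a ^ 2 * Real.exp (-(2 * Real.pi * lam * ‖η‖))) →
      ∫⁻ v, ‖g v‖ₑ * ENNReal.ofReal (Real.exp (β * ‖v‖)) ≤ 1 →
      ∀ y : E3, ‖y‖ ≤ lam / 4 →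
        DualBound (fun η => (Real.exp (-(2 * Real.pi * inner ℝ y η)) : ℂ) * velFourier g η) (c * a) := by
  have hpi := Real.pi_pos
  have hl2 : 0 < 2 * Real.pi * lam := by positivity
  set J := ∫ η : E3, Real.exp (-(Real.pi * lam * ‖η‖)) with hJ
  set J' := ∫ η : E3, Real.exp (-(2 * Real.pi * lam * ‖η‖)) with hJ'
  have hJ0 : 0 ≤ J := integral_nonneg fun _ => (Real.exp_pos _).le
  have hJ0' : 0 ≤ J' := integral_nonneg fun _ => (Real.exp_pos _).le
  obtain ⟨C, hC, hCb⟩ := pow_le_exp (c := Real.pi * lam) (by positivity) 1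
  set L := 2 * Real.pi * C * J + J' + 1 with hL
  have hL0 : 0 < L := by positivity
  obtain ⟨c₁, hc₁, hdec⟩ := exists_exp_decay_of_lipschitz hL0 hβ
  set B := max 1 (J ^ 3 * (c₁ * Real.exp (β / 4 * (lam / 4)))) with hB
  have hB1 : 1 ≤ B := le_max_left _ _
  have hB0 : 0 < B := zero_lt_one.trans_le hB1
  set J₂ := ∫ v : E3, Real.exp (-(β / 16 * ‖v‖)) with hJ₂
  have hJ₂0 : 0 ≤ J₂ := integral_nonneg fun _ => (Real.exp_pos _).le
  refine ⟨B * J₂ + 1, by positivity, fun g a ha ha1 hgc hgi hg hint y hy => ?_⟩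
  have ha2 : a ^ 2 ≤ 1 := pow_le_one₀ ha ha1
  have hgd : ExpDecay (velFourier g) := ⟨continuous_velFourier hgi, _, hl2, _, hg⟩
  have hginv : velInv (velFourier g) = g := velInv_velFourier hgc hgi hgd.integrable
  have hg1 : ∀ η, ‖velFourier g η‖ ≤ Real.exp (-(2 * Real.pi * lam * ‖η‖)) := fun η =>
    (hg η).trans (mul_le_of_le_one_left (Real.exp_pos _).le ha2)
  have hgL : ∀ v, ‖g v‖ ≤ L := fun v => by
    rw [← hginv]
    refine (norm_velInv_le _ _).trans ?_
    calc _ ≤ J' := integral_mono hgd.integrable.norm (integrable_exp_neg_norm hl2) hg1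
      _ ≤ _ := by rw [hL]; have : 0 ≤ 2 * Real.pi * C * J := by positivity
                  linarith
  have hlip : ∀ u v, ‖g u - g v‖ ≤ L * ‖u - v‖ := fun u v => by
    have e : g u - g v = ∫ η, (ex (inner ℝ η u) - ex (inner ℝ η v)) * velFourier g η := by
      have hu : ∀ w, g w = ∫ η, ex (inner ℝ η w) * velFourier g η := fun w => (congrFun hginv w).symm
      rw [hu u, hu v, ← integral_sub (integrable_ex_mul hgd.integrable (by fun_prop))
        (integrable_ex_mul hgd.integrable (by fun_prop))]
      congr with η; ring
    have h1 : ‖g u - g v‖ ≤ ∫ η : E3, (2 * Real.pi * C * ‖u - v‖) * Real.exp (-(Real.pi * lam * ‖η‖)) := by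
      rw [e]
      refine norm_integral_le_of_norm_le ((integrable_exp_neg_norm (by positivity)).const_mul _)
        (Filter.Eventually.of_forall fun η => ?_)
      have h2 := norm_ex_sub_ex_le (inner ℝ η u) (inner ℝ η v)
      rw [← inner_sub_right] at h2
      have h3 := abs_real_inner_le_norm η (u - v)
      have h4 := hCb ‖η‖ (norm_nonneg _)
      rw [pow_one] at h4
      rw [norm_mul]
      calc _ ≤ (2 * Real.pi * (C * Real.exp (Real.pi * lam * ‖η‖) * ‖u - v‖)) *
            Real.exp (-(2 * Real.pi * lam * ‖η‖)) := by
            refine mul_le_mul (h2.trans ?_) (hg1 η) (norm_nonneg _) (by positivity)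
            gcongr
            exact h3.trans (by gcongr)
        _ = (2 * Real.pi * C * ‖u - v‖) * (Real.exp (Real.pi * lam * ‖η‖) *
              Real.exp (-(2 * Real.pi * lam * ‖η‖))) := by ring
        _ = _ := by rw [← Real.exp_add]; congr 2; ring
    rw [integral_const_mul] at h1
    refine h1.trans ?_
    rw [hL]
    have := norm_nonneg (u - v)
    nlinarith
  have hgdec := hdec g hlip hgL hint
  set G := fun η => (Real.exp (-(2 * Real.pi * inner ℝ y η)) : ℂ) * velFourier g η with hG
  have hGd : ExpDecay G := by
    refine ⟨(Continuous.mul (by fun_prop) hgd.1), Real.pi * lam, by positivity, 1, fun η => ?_⟩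
    rw [hG]
    simp only [norm_mul, Complex.norm_real, Real.norm_eq_abs, Real.abs_exp, one_mul]
    have h1 := abs_real_inner_le_norm y η
    calc _ ≤ Real.exp (2 * Real.pi * (lam / 4 * ‖η‖)) * Real.exp (-(2 * Real.pi * lam * ‖η‖)) := by
          refine mul_le_mul (Real.exp_le_exp.2 ?_) (hg1 η) (norm_nonneg _) (Real.exp_pos _).le
          have h2 : ‖y‖ * ‖η‖ ≤ lam / 4 * ‖η‖ := by gcongr
          have h3 := neg_abs_le (inner ℝ y η)
          nlinarith
      _ ≤ _ := by
          rw [← Real.exp_add]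
          refine Real.exp_le_exp.2 ?_
          have : 0 ≤ Real.pi * lam * ‖η‖ := by positivity
          nlinarith
  have hGdec : ∀ v, ‖velInv G v‖ ≤ B * a * Real.exp (-(β / 16 * ‖v‖)) := by
    intro v
    have h1 := norm_velInv_exp_pow_le hlam hgd.1 hg hy (v := v)
      (m := fun v => c₁ * Real.exp (β / 4 * (lam / 4)) * Real.exp (-(β / 4 * ‖v‖))) (fun u hu => by
        rw [hginv]
        refine (hgdec u).trans ?_
        rw [mul_assoc, ← Real.exp_add]
        have h2 : ‖v‖ ≤ ‖u‖ + ‖u - v‖ := by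
          rw [norm_sub_rev]
          calc ‖v‖ = ‖u + (v - u)‖ := by rw [add_sub_cancel]
            _ ≤ _ := norm_add_le _ _
        gcongr
        nlinarith)
    have h2 : ‖velInv G v‖ ^ 4 ≤ (B * a * Real.exp (-(β / 16 * ‖v‖))) ^ 4 := by
      refine h1.trans ?_
      rw [mul_pow (B * a), ← Real.exp_nat_mul, mul_pow B]
      have e2 : ((4 : ℕ) : ℝ) * -(β / 16 * ‖v‖) = -(β / 4 * ‖v‖) := by push_cast; ring
      rw [e2]
      have e3 : J ^ 3 * (c₁ * Real.exp (β / 4 * (lam / 4))) ≤ B ^ 4 :=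
        (le_max_right _ _).trans (le_self_pow₀ hB1 (by norm_num))
      have e4 : a ^ 6 ≤ a ^ 4 := pow_le_pow_of_le_one ha ha1 (by norm_num)
      calc _ = (J ^ 3 * (c₁ * Real.exp (β / 4 * (lam / 4)))) * a ^ 6 * Real.exp (-(β / 4 * ‖v‖)) := by
            ring
        _ ≤ _ := by gcongr
    exact (pow_le_pow_iff_left₀ (norm_nonneg _) (by positivity) (by norm_num)).1 h2
  have hGint : Integrable (velInv G) :=
    ((integrable_exp_neg_norm (c := β / 16) (by positivity)).const_mul (B * a)).mono'
      (continuous_velInv hGd.integrable).aestronglyMeasurable (Filter.Eventually.of_forall hGdec)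
  have h1 := dualBound_velFourier hGint
  rw [velFourier_velInv hGd.1 hGd.integrable hGint] at h1
  refine h1.mono ?_
  calc _ ≤ ∫ v : E3, B * a * Real.exp (-(β / 16 * ‖v‖)) :=
        integral_mono hGint.norm ((integrable_exp_neg_norm (by positivity)).const_mul _) hGdec
    _ = B * J₂ * a := by rw [integral_const_mul]; ring
    _ ≤ _ := by nlinarith

/-- Cauchy's formula for a linear factor. -/
theorem integral_exp_circle {ρ : ℝ} (hρ : 0 < ρ) (ζ : ℂ) :
    ∫ θ in (0 : ℝ)..2 * Real.pi, Complex.exp (ζ * (ρ * Complex.exp (θ * Complex.I))) *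
      Complex.exp (-(θ * Complex.I)) = 2 * Real.pi * ρ * ζ := by
  have h1 := DiffContOnCl.deriv_eq_smul_circleIntegral (f := fun z => Complex.exp (ζ * z)) (c := 0) hρ
    (Differentiable.diffContOnCl (by fun_prop))
  have h2 : deriv (fun z => Complex.exp (ζ * z)) 0 = ζ := by
    have : HasDerivAt (fun z => Complex.exp (ζ * z)) (Complex.exp (ζ * 0) * (ζ * 1)) 0 :=
      ((hasDerivAt_id (0 : ℂ)).const_mul ζ).cexp
    rw [this.deriv]; simp
  have hρ' : (ρ : ℂ) ≠ 0 := by exact_mod_cast hρ.ne'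
  rw [h2, circleIntegral] at h1
  have h3 : ∀ θ : ℝ, deriv (circleMap 0 ρ) θ • (1 / (circleMap 0 ρ θ - 0) ^ 2) •
      Complex.exp (ζ * circleMap 0 ρ θ) = Complex.I / ρ *
        (Complex.exp (ζ * (ρ * Complex.exp (θ * Complex.I))) * Complex.exp (-(θ * Complex.I))) := by
    intro θ
    rw [deriv_circleMap, circleMap, Complex.exp_neg]
    simp only [zero_add, sub_zero, smul_eq_mul]
    field_simp
  simp only [smul_eq_mul] at h1 h3
  simp only [h3, intervalIntegral.integral_const_mul] at h1
  have hI := Complex.I_ne_zero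
  have hπ : (Real.pi : ℂ) ≠ 0 := by exact_mod_cast Real.pi_ne_zero
  have h4 : Complex.I / (ρ : ℂ) ≠ 0 := div_ne_zero hI hρ'
  refine mul_left_cancel₀ h4 ?_
  rw [h1]
  field_simp

end TubeDecay

section Cauchy

theorem ex_mul_exp_eq (ρ u θ : ℝ) :
    Complex.exp ((2 * Real.pi * Complex.I * (u : ℝ)) * (ρ * Complex.exp (θ * Complex.I))) =
      ex (ρ * Real.cos θ * u) * (Real.exp (-(2 * Real.pi * (ρ * Real.sin θ * u))) : ℂ) := by
  rw [ex, Complex.ofReal_exp, ← Complex.exp_add, Complex.exp_mul_I]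
  congr 1
  push_cast
  linear_combination (2 * (Real.pi : ℂ) * u * ρ * Complex.sin θ) * Complex.I_sq

/-- Cauchy estimates: tube bounds control products of directional derivatives. -/
theorem dualBound_dprod_of_tube {lam A c ρ : ℝ} (hlam : 0 < lam) (hρ : 0 < ρ) {H : E3 → ℂ}
    (hHc : Continuous H) (hH : ∀ η, ‖H η‖ ≤ A * Real.exp (-(2 * Real.pi * lam * ‖η‖)))
    (htube : ∀ y : E3, ‖y‖ ≤ lam / 4 →
      DualBound (fun η => (Real.exp (-(2 * Real.pi * inner ℝ y η)) : ℂ) * H η) c)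
    {y : ℕ → E3} (hy : ∀ i, ‖y i‖ ≤ 1) (S : Finset ℕ) :
    ∀ w : E3, ‖w‖ + S.card * ρ ≤ lam / 4 →
      DualBound (fun η => dprod y S η * ((Real.exp (-(2 * Real.pi * inner ℝ w η)) : ℂ) * H η))
        (c * ρ⁻¹ ^ S.card) := by
  have hpi := Real.pi_pos
  induction S using Finset.induction_on with
  | empty =>
    intro w hw
    simpa [dprod] using htube w (by simpa using hw)
  | insert i S hi ih =>
    intro w hw
    rw [Finset.card_insert_of_notMem hi] at hw ⊢
    push_cast at hw
    have hA : 0 ≤ A := by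
      have := (norm_nonneg _).trans (hH 0)
      exact nonneg_of_mul_nonneg_left this (Real.exp_pos _)
    have hwθ : ∀ θ : ℝ, ‖w + (ρ * Real.sin θ) • y i‖ + S.card * ρ ≤ lam / 4 := fun θ => by
      have h1 := norm_add_le w ((ρ * Real.sin θ) • y i)
      rw [norm_smul, Real.norm_eq_abs, abs_mul, abs_of_pos hρ] at h1
      have h2 : ρ * |Real.sin θ| * ‖y i‖ ≤ ρ * 1 * 1 := by
        gcongr
        · exact Real.abs_sin_le_one θ
        · exact hy i
      nlinarith
    set Φ : ℝ → E3 → ℂ := fun θ η => Complex.exp (-(θ * Complex.I)) *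
      (ex (inner ℝ ((ρ * Real.cos θ) • y i) η) * (dprod y S η *
        ((Real.exp (-(2 * Real.pi * inner ℝ (w + (ρ * Real.sin θ) • y i) η)) : ℂ) * H η))) with hΦ
    have hΦd : ∀ θ, DualBound (Φ θ) (c * ρ⁻¹ ^ S.card) := fun θ => by
      have h1 := ((ih _ (hwθ θ)).ex_mul ((ρ * Real.cos θ) • y i)).const_mul
        (Complex.exp (-(θ * Complex.I)))
      have h2 : ‖Complex.exp (-(θ * Complex.I))‖ = 1 := by
        rw [← neg_mul, ← Complex.ofReal_neg]; exact Complex.norm_exp_ofReal_mul_I _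
      rwa [h2, one_mul] at h1
    obtain ⟨C, hC, hCb⟩ := pow_le_exp (c := lam) hlam S.card
    have hΦb : ∀ θ η, ‖Φ θ η‖ ≤ (2 * Real.pi) ^ S.card * C * A := fun θ η => by
      have h2 : ‖Complex.exp (-(θ * Complex.I))‖ = 1 := by
        rw [← neg_mul, ← Complex.ofReal_neg]; exact Complex.norm_exp_ofReal_mul_I _
      rw [hΦ]
      simp only [norm_mul, h2, norm_ex, one_mul, Complex.norm_real, Real.norm_eq_abs, Real.abs_exp]
      have h3 := norm_dprod_le hy S η
      have h4 : -(lam / 4 * ‖η‖) ≤ inner ℝ (w + (ρ * Real.sin θ) • y i) η := by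
        have h5 := abs_real_inner_le_norm (w + (ρ * Real.sin θ) • y i) η
        have h6 : ‖w + (ρ * Real.sin θ) • y i‖ ≤ lam / 4 := by
          have := hwθ θ
          have : 0 ≤ (S.card : ℝ) * ρ := by positivity
          linarith
        have h7 : ‖w + (ρ * Real.sin θ) • y i‖ * ‖η‖ ≤ lam / 4 * ‖η‖ := by gcongr
        linarith [neg_abs_le (inner ℝ (w + (ρ * Real.sin θ) • y i) η)]
      calc _ ≤ ((2 * Real.pi) ^ S.card * (C * Real.exp (lam * ‖η‖))) *
            (Real.exp (2 * Real.pi * (lam / 4 * ‖η‖)) * (A * Real.exp (-(2 * Real.pi * lam * ‖η‖)))) := by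
            refine mul_le_mul ?_ ?_ (by positivity) (by positivity)
            · refine h3.trans ?_
              rw [mul_pow]
              gcongr
              exact hCb _ (norm_nonneg _)
            · refine mul_le_mul (Real.exp_le_exp.2 ?_) (hH η) (norm_nonneg _) (Real.exp_pos _).le
              nlinarith
        _ = (2 * Real.pi) ^ S.card * C * A * (Real.exp (lam * ‖η‖) *
            (Real.exp (2 * Real.pi * (lam / 4 * ‖η‖)) * Real.exp (-(2 * Real.pi * lam * ‖η‖)))) := by ring
        _ ≤ (2 * Real.pi) ^ S.card * C * A * 1 := by
            rw [← Real.exp_add, ← Real.exp_add]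
            gcongr
            rw [Real.exp_le_one_iff]
            have : 0 ≤ lam * ‖η‖ := by positivity
            nlinarith [Real.pi_gt_three]
        _ = _ := mul_one _
    have hΦc : Continuous (Function.uncurry Φ) := by
      rw [hΦ]
      unfold Function.uncurry
      have hHc' : Continuous fun z : ℝ × E3 => H z.2 := hHc.comp continuous_snd
      have hdc : Continuous fun z : ℝ × E3 => dprod y S z.2 := (continuous_dprod y S).comp continuous_snd
      have hec : Continuous fun z : ℝ × E3 => ex (inner ℝ ((ρ * Real.cos z.1) • y i) z.2) :=
        continuous_ex.comp (by fun_prop)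
      simp only
      fun_prop
    have h1 := (DualBound.integral (t := 2 * Real.pi) (by positivity) (fun θ _ => hΦd θ) hΦc
      (fun θ _ η => hΦb θ η) continuous_const).const_mul ((2 * Real.pi * ρ : ℂ)⁻¹)
    have e : ∀ η, (2 * Real.pi * ρ : ℂ)⁻¹ * ∫ θ in (0 : ℝ)..2 * Real.pi, Φ θ η =
        dprod y (insert i S) η * ((Real.exp (-(2 * Real.pi * inner ℝ w η)) : ℂ) * H η) := by
      intro η
      have e1 : ∀ θ, Φ θ η = (Complex.exp ((2 * Real.pi * Complex.I * (inner ℝ (y i) η : ℝ)) *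
          (ρ * Complex.exp (θ * Complex.I))) * Complex.exp (-(θ * Complex.I))) *
          (dprod y S η * ((Real.exp (-(2 * Real.pi * inner ℝ w η)) : ℂ) * H η)) := by
        intro θ
        rw [hΦ, ex_mul_exp_eq]
        simp only [inner_smul_left, inner_add_left, conj_trivial]
        rw [mul_add, neg_add, Real.exp_add]
        push_cast
        ring
      simp only [e1]
      rw [intervalIntegral.integral_mul_const, integral_exp_circle hρ, dprod, dprod,
        Finset.prod_insert hi]
      have : (ρ : ℂ) ≠ 0 := by exact_mod_cast hρ.ne'
      have h2 : (Real.pi : ℂ) ≠ 0 := by exact_mod_cast hpi.ne'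
      field_simp
    simp only [e] at h1
    refine h1.mono (le_of_eq ?_)
    rw [intervalIntegral.integral_const, norm_inv, pow_succ]
    simp only [norm_mul, Complex.norm_real, Real.norm_eq_abs, abs_of_pos hpi, abs_of_pos hρ,
      Complex.norm_ofNat, smul_eq_mul, sub_zero]
    field_simp

theorem anBound_of_tube {lam A c : ℝ} (hlam : 0 < lam) {H : E3 → ℂ}
    (hHc : Continuous H) (hH : ∀ η, ‖H η‖ ≤ A * Real.exp (-(2 * Real.pi * lam * ‖η‖)))
    (htube : ∀ y : E3, ‖y‖ ≤ lam / 4 →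
      DualBound (fun η => (Real.exp (-(2 * Real.pi * inner ℝ y η)) : ℂ) * H η) c) :
    AnBound (lam / 12) (fun _ => c) H := by
  intro y hy S
  have hc : 0 ≤ c := (htube 0 (by rw [norm_zero]; positivity)).nonneg
  rcases Nat.eq_zero_or_pos S.card with h0 | h0
  · have h1 := htube 0 (by rw [norm_zero]; positivity)
    rw [Finset.card_eq_zero] at h0
    subst h0
    simpa [dprod] using h1
  have hN : (0 : ℝ) < S.card := by exact_mod_cast h0
  have h1 := dualBound_dprod_of_tube hlam (ρ := lam / 4 / S.card) (by positivity) hHc hH htube hy S 0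
    (by rw [norm_zero, zero_add, mul_div_cancel₀ _ hN.ne'])
  have e : (fun η => dprod y S η * ((Real.exp (-(2 * Real.pi * inner ℝ (0 : E3) η)) : ℂ) * H η)) =
      fun η => dprod y S η * H η := by
    funext η; simp
  rw [e] at h1
  refine h1.mono (mul_le_mul_of_nonneg_left ?_ hc)
  have h2 : (S.card : ℝ) ^ S.card / S.card.factorial ≤ Real.exp S.card :=
    Real.pow_div_factorial_le_exp _ hN.le _
  have h3 : Real.exp (S.card : ℝ) ≤ 3 ^ S.card := by
    have : Real.exp (S.card : ℝ) = Real.exp 1 ^ S.card := by rw [← Real.exp_nat_mul, mul_one]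
    rw [this]
    gcongr
    linarith [Real.exp_one_lt_d9]
  rw [div_le_iff₀ (by positivity)] at h2
  calc (lam / 4 / S.card)⁻¹ ^ S.card = (S.card : ℝ) ^ S.card * (lam / 4)⁻¹ ^ S.card := by
        rw [← mul_pow]; congr 1; field_simp
    _ ≤ (3 ^ S.card * S.card.factorial) * (lam / 4)⁻¹ ^ S.card := by
        gcongr
        exact h2.trans (by gcongr)
    _ = S.card.factorial * (lam / 12)⁻¹ ^ S.card := by
        have : (lam / 12)⁻¹ = 3 * (lam / 4)⁻¹ := by field_simp; norm_num
        rw [this, mul_pow]; ring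

end Cauchy

section Profile

theorem pderiv_ofReal {g : E3 → ℝ} (hg : Differentiable ℝ g) (i : Fin 3) :
    pderiv i (fun v => (g v : ℂ)) = fun v => ((pderiv i g v : ℝ) : ℂ) := by
  funext v
  have h := (Complex.ofRealCLM.hasFDerivAt (x := g v)).comp v (hg v).hasFDerivAt
  have h2 : HasFDerivAt (fun v => (g v : ℂ)) (Complex.ofRealCLM.comp (fderiv ℝ g v)) v := h
  simp [pderiv, h2.fderiv]

theorem pderiv_iterate_ofReal {g : E3 → ℝ} (hg : ContDiff ℝ ∞ g) (i : Fin 3) (n : ℕ) :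
    (pderiv i)^[n] (fun v => (g v : ℂ)) = fun v => (((pderiv i)^[n] g v : ℝ) : ℂ) := by
  induction n with
  | zero => rfl
  | succ n ih =>
    rw [Function.iterate_succ_apply', Function.iterate_succ_apply', ih,
      pderiv_ofReal ((ContDiff.pderiv_iterate hg i n).differentiable (by simp))]

theorem mderiv_ofReal {g : E3 → ℝ} (hg : ContDiff ℝ ∞ g) (n : Fin 3 → ℕ) :
    mderiv n (fun v => (g v : ℂ)) = fun v => ((mderiv n g v : ℝ) : ℂ) := by
  unfold mderiv
  rw [pderiv_iterate_ofReal hg, pderiv_iterate_ofReal (ContDiff.pderiv_iterate hg _ _),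
    pderiv_iterate_ofReal (ContDiff.pderiv_iterate (ContDiff.pderiv_iterate hg _ _) _ _)]

theorem analyticL1Norm_ofReal {g : E3 → ℝ} (hg : ContDiff ℝ ∞ g) (lam : ℝ) :
    analyticL1Norm lam (fun v => (g v : ℂ)) = analyticL1Norm lam g := by
  unfold analyticL1Norm
  simp only [mderiv_ofReal hg]
  congr with n
  congr 1
  refine lintegral_congr fun v => ?_
  rw [← ofReal_norm, ← ofReal_norm, Complex.norm_real]

theorem inv_weight_le {lam : ℝ} (hlam : 0 < lam) (n : Fin 3 → ℕ) :
    (weight lam n)⁻¹ ≤ ((∑ i, n i).factorial : ℝ) * lam⁻¹ ^ ∑ i, n i := by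
  have h1 : ((∏ i, (n i).factorial : ℕ) : ℝ) ≤ ((∑ i, n i).factorial : ℝ) := by
    exact_mod_cast Nat.le_of_dvd (Nat.factorial_pos _) (Nat.prod_factorial_dvd_factorial_sum _ _)
  have h2 : (weight lam n)⁻¹ = ((∏ i, (n i).factorial : ℕ) : ℝ) * lam⁻¹ ^ ∑ i, n i := by
    unfold weight
    rw [← Finset.prod_inv_distrib, ← Finset.prod_pow_eq_pow_sum, Nat.cast_prod,
      ← Finset.prod_mul_distrib]
    refine Finset.prod_congr rfl fun i _ => ?_
    rw [inv_div, inv_pow, div_eq_mul_inv]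
  rw [h2]
  gcongr

theorem mono_add_single (n : Fin 3 → ℕ) (j : Fin 3) (η : E3) :
    mono (n + Pi.single j 1) η = dsym j η * mono n η := by
  unfold mono
  simp only [Pi.add_apply, pow_add, Finset.prod_mul_distrib]
  have : ∏ i, dsym i η ^ (Pi.single (M := fun _ => ℕ) j 1) i = dsym j η := by
    rw [Finset.prod_eq_single j]
    · simp
    · intro b _ hb; simp [hb]
    · simp
  rw [this, mul_comm]

theorem dir_eq_sum (y η : E3) :
    2 * Real.pi * Complex.I * (inner ℝ y η : ℝ) = ∑ j, (y j : ℂ) * dsym j η := by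
  rw [PiLp.inner_apply]
  simp only [dsym, RCLike.inner_apply, conj_trivial, Complex.ofReal_sum, Complex.ofReal_mul,
    Finset.mul_sum]
  refine Finset.sum_congr rfl fun j _ => ?_
  ring

theorem anBound_velFourier {lam M : ℝ} (hlam : 0 < lam) (hM : 0 ≤ M) {g : E3 → ℂ}
    (hg : ContDiff ℝ ∞ g) (h : analyticL1Norm lam g ≤ ENNReal.ofReal M) :
    AnBound (lam / 3) (fun _ => M) (velFourier g) := by
  intro y hy S
  have hgi : Integrable g := integrable_mderiv hlam hg h 0
  have hd : ExpDecay (velFourier g) := ⟨continuous_velFourier hgi, 2 * Real.pi * lam, by positivity, M,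
    velFourier_le_of_analyticL1Norm hlam hM hg h⟩
  have key : ∀ S : Finset ℕ, ∀ n : Fin 3 → ℕ,
      DualBound (fun η => dprod y S η * (mono n η * velFourier g η))
        (M * 3 ^ S.card * (((S.card + ∑ i, n i).factorial : ℝ) * lam⁻¹ ^ (S.card + ∑ i, n i))) := by
    intro S
    induction S using Finset.induction_on with
    | empty =>
      intro n
      have h1 := dualBound_velFourier (integrable_mderiv hlam hg h n)
      have e : velFourier (mderiv n g) = fun η => mono n η * velFourier g η :=
        funext fun η => velFourier_mderiv hg (integrable_mderiv hlam hg h) n η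
      rw [e] at h1
      have h2 := h1.mono ((integral_mderiv_le hlam hM hg h n).trans
        (mul_le_mul_of_nonneg_left (inv_weight_le hlam n) hM))
      simpa [dprod] using h2
    | insert i S hi ih =>
      intro n
      have hsum : ∀ j : Fin 3, ∑ i, (n + Pi.single j 1 : Fin 3 → ℕ) i = (∑ i, n i) + 1 := fun j => by
        simp [Finset.sum_add_distrib]
      have hb : ∀ j : Fin 3, DualBound (fun η => (y i j : ℂ) *
          (dprod y S η * (mono (n + Pi.single j 1) η * velFourier g η)))
          (M * 3 ^ S.card * (((S.card + 1 + ∑ i, n i).factorial : ℝ) * lam⁻¹ ^ (S.card + 1 + ∑ i, n i))) := by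
        intro j
        have h1 := ih (n + Pi.single j 1)
        rw [hsum] at h1
        have e : S.card + ((∑ i, n i) + 1) = S.card + 1 + ∑ i, n i := by ring
        rw [e] at h1
        refine (h1.const_mul (y i j)).mono (mul_le_of_le_one_left (by positivity) ?_)
        rw [Complex.norm_real, Real.norm_eq_abs]
        exact (abs_apply_le_norm _ _).trans (hy i)
      have hbd : ∀ j : Fin 3, ExpDecay (fun η => (y i j : ℂ) *
          (dprod y S η * (mono (n + Pi.single j 1) η * velFourier g η))) := fun j =>
        ((hd.mono_mul _).dprod_mul hy S).const_mul _
      have h3 := ((hb 0).add (hb 1) (hbd 0) (hbd 1)).add (hb 2) ((hbd 0).add (hbd 1)) (hbd 2)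
      rw [Finset.card_insert_of_notMem hi]
      have e : (fun η => dprod y (insert i S) η * (mono n η * velFourier g η)) = fun η =>
          (y i 0 : ℂ) * (dprod y S η * (mono (n + Pi.single 0 1) η * velFourier g η)) +
          (y i 1 : ℂ) * (dprod y S η * (mono (n + Pi.single 1 1) η * velFourier g η)) +
          (y i 2 : ℂ) * (dprod y S η * (mono (n + Pi.single 2 1) η * velFourier g η)) := by
        funext η
        rw [dprod, Finset.prod_insert hi, dir_eq_sum, Fin.sum_univ_three]
        simp only [mono_add_single, dprod]
        ring
      rw [e]
      refine h3.mono (le_of_eq ?_)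
      rw [pow_succ]; ring
  have h1 := key S 0
  have e : (fun η => dprod y S η * (mono 0 η * velFourier g η)) =
      fun η => dprod y S η * velFourier g η := by
    funext η; simp [mono]
  rw [e] at h1
  refine h1.mono (le_of_eq ?_)
  have e2 : (lam / 3)⁻¹ = 3 * lam⁻¹ := by rw [inv_div, div_eq_mul_inv]
  rw [e2, mul_pow]
  simp only [Pi.zero_apply, Finset.sum_const_zero, add_zero]
  ring

theorem IsProfile.contDiff {lam₀ C₀ : ℝ} {p : E3 → ℝ} (hp : IsProfile lam₀ C₀ p) :
    ContDiff ℝ ∞ p := by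
  rw [← contDiffOn_univ]
  exact hp.analytic.contDiffOn uniqueDiffOn_univ

theorem IsProfile.contDiff_ofReal {lam₀ C₀ : ℝ} {p : E3 → ℝ} (hp : IsProfile lam₀ C₀ p) :
    ContDiff ℝ ∞ fun v => (p v : ℂ) :=
  Complex.ofRealCLM.contDiff.comp hp.contDiff

theorem IsProfile.integrable {lam₀ C₀ : ℝ} {p : E3 → ℝ} (hlam : 0 < lam₀)
    (hp : IsProfile lam₀ C₀ p) : Integrable p :=
  integrable_mderiv hlam hp.contDiff hp.analytic_bound 0

theorem IsProfile.norm_velFourier_le {lam₀ C₀ : ℝ} {p : E3 → ℝ}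
    (hp : IsProfile lam₀ C₀ p) (η : E3) :
    ‖velFourier (fun v => (p v : ℂ)) η‖ ≤ C₀ * Real.exp (-(2 * Real.pi * lam₀ * ‖η‖)) := by
  have := hp.fourier_bound η
  rw [Real.exp_neg, ← div_eq_mul_inv, le_div_iff₀ (Real.exp_pos _)]
  linarith

theorem IsProfile.anBound {lam₀ C₀ : ℝ} {p : E3 → ℝ} (hlam : 0 < lam₀) (hC : 0 ≤ C₀)
    (hp : IsProfile lam₀ C₀ p) :
    AnBound (lam₀ / 3) (fun _ => C₀) (velFourier fun v => (p v : ℂ)) :=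
  anBound_velFourier hlam hC hp.contDiff_ofReal
    ((analyticL1Norm_ofReal hp.contDiff lam₀).le.trans hp.analytic_bound)

theorem velFourier_ofReal_neg (g : E3 → ℝ) (η : E3) :
    velFourier (fun v => (g v : ℂ)) (-η) = (starRingEnd ℂ) (velFourier (fun v => (g v : ℂ)) η) := by
  rw [velFourier_eq, velFourier_eq, ← integral_conj]
  congr with v
  rw [map_mul, Complex.conj_ofReal, conj_ex, inner_neg_left]

end Profile

section Perturbation

variable {lam₀ mu₀ β δ : ℝ} {g : E3 → E3 → ℝ}

theorem norm_phaseFourier_le_of_perturbationSize (hδ : 0 ≤ δ)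
    (h : perturbationSize lam₀ mu₀ β g ≤ ENNReal.ofReal δ) (k : Mode) (η : E3) :
    ‖phaseFourier g k η‖ ≤ δ * Real.exp (-(2 * Real.pi * lam₀ * ‖η‖)) *
      Real.exp (-(2 * Real.pi * mu₀ * ‖freq k‖)) := by
  have h1 : ENNReal.ofReal (Real.exp (2 * Real.pi * lam₀ * ‖η‖) *
      Real.exp (2 * Real.pi * mu₀ * ‖freq k‖) * ‖phaseFourier g k η‖) ≤ ENNReal.ofReal δ :=
    ((le_iSup₂ (f := fun (k : Fin 3 → ℤ) (η : E3) => ENNReal.ofReal (Real.exp (2 * Real.pi * lam₀ * ‖η‖) *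
      Real.exp (2 * Real.pi * mu₀ * ‖freq k‖) * ‖phaseFourier g k η‖)) k η).trans le_self_add).trans h
  rw [ENNReal.ofReal_le_ofReal_iff hδ] at h1
  rw [Real.exp_neg, Real.exp_neg, ← div_eq_mul_inv, ← div_eq_mul_inv, div_div,
    le_div_iff₀ (by positivity)]
  linarith

theorem lintegral_le_of_perturbationSize
    (h : perturbationSize lam₀ mu₀ β g ≤ ENNReal.ofReal δ) :
    ∫⁻ x in cell, ∫⁻ v, ‖g x v‖ₑ * ENNReal.ofReal (Real.exp (β * ‖v‖)) ≤ ENNReal.ofReal δ := by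
  refine le_trans (le_of_eq ?_) (le_add_self.trans h)
  refine lintegral_congr fun x => lintegral_congr fun v => ?_
  rw [← ofReal_norm, Real.norm_eq_abs, ENNReal.ofReal_mul (abs_nonneg _)]

theorem lintegral_fmode_le (hc : Continuous fun z : E3 × E3 => g z.1 z.2)
    (h : perturbationSize lam₀ mu₀ β g ≤ ENNReal.ofReal δ) (k : Mode) :
    ∫⁻ v, ‖fmode g k v‖ₑ * ENNReal.ofReal (Real.exp (β * ‖v‖)) ≤ ENNReal.ofReal δ := by
  refine le_trans ?_ (lintegral_le_of_perturbationSize h)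
  have hm : Measurable fun z : E3 × E3 => ‖g z.1 z.2‖ₑ * ENNReal.ofReal (Real.exp (β * ‖z.2‖)) :=
    hc.enorm.measurable.mul (by fun_prop)
  rw [lintegral_lintegral_swap hm.aemeasurable]
  refine lintegral_mono fun v => ?_
  have hm2 : Measurable fun x : E3 => ‖g x v‖ₑ :=
    (hc.comp (by fun_prop : Continuous fun x : E3 => (x, v))).enorm.measurable
  rw [lintegral_mul_const _ hm2]
  gcongr
  rw [fmode, torusFourier_eq]
  refine (enorm_integral_le_lintegral_enorm _).trans (lintegral_mono fun x => le_of_eq ?_)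
  rw [← ofReal_norm, ← ofReal_norm, norm_mul, norm_ex, one_mul, Complex.norm_real]

theorem integrable_prod_of_perturbationSize (hβ : 0 < β) (hc : Continuous fun z : E3 × E3 => g z.1 z.2)
    (h : perturbationSize lam₀ mu₀ β g ≤ ENNReal.ofReal δ) :
    Integrable (fun z : E3 × E3 => (g z.1 z.2 : ℂ)) ((volume.restrict cell).prod volume) := by
  refine ⟨(Complex.continuous_ofReal.comp hc).aestronglyMeasurable, ?_⟩
  rw [hasFiniteIntegral_iff_enorm]
  have hm : Measurable fun z : E3 × E3 => ‖(g z.1 z.2 : ℂ)‖ₑ :=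
    (Complex.continuous_ofReal.comp hc).enorm.measurable
  rw [lintegral_prod _ hm.aemeasurable]
  refine lt_of_le_of_lt ?_ ((lintegral_le_of_perturbationSize h).trans_lt ENNReal.ofReal_lt_top)
  refine lintegral_mono fun x => lintegral_mono fun v => ?_
  rw [← ofReal_norm, ← ofReal_norm, Complex.norm_real]
  refine le_mul_of_one_le_right zero_le ?_
  rw [ENNReal.one_le_ofReal]
  exact Real.one_le_exp (by positivity)

theorem continuous_fmode (hc : Continuous fun z : E3 × E3 => g z.1 z.2) (k : Mode) :
    Continuous (fmode g k) := by
  unfold fmode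
  simp only [torusFourier_eq]
  refine continuous_integral_cell (G := fun v x => ex (-inner ℝ (freq k) x) * (g x v : ℂ)) ?_
  have h1 : Continuous fun z : E3 × E3 => (g z.2 z.1 : ℂ) :=
    Complex.continuous_ofReal.comp (hc.comp (continuous_snd.prodMk continuous_fst))
  have h2 : Continuous fun z : E3 × E3 => ex (-inner ℝ (freq k) z.2) := continuous_ex.comp (by fun_prop)
  exact h2.mul h1

theorem integrable_fmode (hβ : 0 < β) (hc : Continuous fun z : E3 × E3 => g z.1 z.2)
    (h : perturbationSize lam₀ mu₀ β g ≤ ENNReal.ofReal δ) (k : Mode) : Integrable (fmode g k) := by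
  refine ⟨(continuous_fmode hc k).aestronglyMeasurable, ?_⟩
  rw [hasFiniteIntegral_iff_enorm]
  refine lt_of_le_of_lt ?_ ((lintegral_fmode_le hc h k).trans_lt ENNReal.ofReal_lt_top)
  refine lintegral_mono fun v => le_mul_of_one_le_right zero_le ?_
  rw [ENNReal.one_le_ofReal]
  exact Real.one_le_exp (by positivity)

theorem phaseFourier_eq_velFourier_fmode
    (hi : Integrable (fun z : E3 × E3 => (g z.1 z.2 : ℂ)) ((volume.restrict cell).prod volume))
    (k : Mode) (η : E3) : phaseFourier g k η = velFourier (fmode g k) η := by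
  unfold phaseFourier fmode
  simp only [torusFourier_eq, velFourier_eq, ← integral_const_mul]
  rw [integral_integral_swap]
  · congr with v
    congr with x; ring
  · have hm : Continuous fun z : E3 × E3 => ex (-inner ℝ (freq k) z.1) * ex (-inner ℝ η z.2) :=
      (continuous_ex.comp (by fun_prop)).mul (continuous_ex.comp (by fun_prop))
    refine (hi.bdd_mul (c := 1) hm.aestronglyMeasurable
      (Filter.Eventually.of_forall fun z => by simp)).congr (Filter.Eventually.of_forall fun z => ?_)
    simp only [Function.uncurry]; ring

end Perturbation

section Datum

variable {lam₀ mu₀ β δ C₀ : ℝ} {p : E3 → ℝ} {f₀ : E3 → E3 → ℝ}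

/-- The Fourier transform of the initial datum. -/
noncomputable def datumFourier (p : E3 → ℝ) (f₀ : E3 → E3 → ℝ) (k : Mode) (η : E3) : ℂ :=
  velFourier (fmode (fun x v => f₀ x v - p v) k) η +
    if k = 0 then velFourier (fun v => (p v : ℂ)) η else 0

theorem IsDatum.continuous_sub (h : IsDatum lam₀ mu₀ β δ p f₀) (hp : Continuous p) :
    Continuous fun z : E3 × E3 => f₀ z.1 z.2 - p z.2 :=
  h.continuous.sub (hp.comp continuous_snd)

theorem IsDatum.integrable_prod (h : IsDatum lam₀ mu₀ β δ p f₀) (hβ : 0 < β) (hp : Continuous p) :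
    Integrable (fun z : E3 × E3 => ((f₀ z.1 z.2 - p z.2 : ℝ) : ℂ)) ((volume.restrict cell).prod volume) :=
  integrable_prod_of_perturbationSize (g := fun x v => f₀ x v - p v) hβ (h.continuous_sub hp) h.close

theorem IsDatum.fmode_eq (h : IsDatum lam₀ mu₀ β δ p f₀) (k : Mode) (v : E3) :
    fmode f₀ k v = fmode (fun x v => f₀ x v - p v) k v + if k = 0 then (p v : ℂ) else 0 := by
  have hc : Continuous fun x => f₀ x v :=
    h.continuous.comp (by fun_prop : Continuous fun x : E3 => (x, v))
  have hc1 : Continuous fun x => ((f₀ x v - p v : ℝ) : ℂ) :=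
    Complex.continuous_ofReal.comp (hc.sub continuous_const)
  have h1 := torusFourier_const (p v : ℂ) k
  rw [← h1, fmode, fmode, torusFourier_eq, torusFourier_eq, torusFourier_eq, ← integral_add]
  · congr with x; push_cast; ring
  · exact integrableOn_cell (by fun_prop)
  · exact integrableOn_cell (by fun_prop)

theorem IsDatum.phaseFourier_eq (h : IsDatum lam₀ mu₀ β δ p f₀) (hβ : 0 < β) (hp : Continuous p)
    (hpi : Integrable p) (k : Mode) (η : E3) : phaseFourier f₀ k η = datumFourier p f₀ k η := by
  have hi := h.integrable_prod hβ hp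
  rw [datumFourier, ← phaseFourier_eq_velFourier_fmode hi,
    ← torusFourier_const (velFourier (fun v => (p v : ℂ)) η) k]
  unfold phaseFourier
  rw [torusFourier_eq, torusFourier_eq, torusFourier_eq, ← integral_add]
  · refine integral_congr_ae ?_
    filter_upwards [hi.prod_right_ae] with x hx
    rw [← mul_add, velFourier_eq, velFourier_eq, velFourier_eq, ← integral_add]
    · congr with v
      push_cast; ring
    · exact integrable_ex_mul hx (by fun_prop)
    · exact integrable_ex_mul hpi.ofReal (by fun_prop)
  · have hm : Continuous fun z : E3 × E3 => ex (-inner ℝ (freq k) z.1) * ex (-inner ℝ η z.2) :=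
      (continuous_ex.comp (by fun_prop)).mul (continuous_ex.comp (by fun_prop))
    have h1 := (hi.bdd_mul (c := 1) hm.aestronglyMeasurable
      (Filter.Eventually.of_forall fun z => by simp)).integral_prod_left
    refine h1.congr (Filter.Eventually.of_forall fun x => ?_)
    simp only [velFourier_eq, ← integral_const_mul, mul_assoc]
  · exact integrableOn_cell (by fun_prop)

theorem IsDatum.norm_velFourier_fmode_le (h : IsDatum lam₀ mu₀ β δ p f₀) (hδ : 0 ≤ δ) (hβ : 0 < β)
    (hp : Continuous p) (k : Mode) (η : E3) :
    ‖velFourier (fmode (fun x v => f₀ x v - p v) k) η‖ ≤ δ * Real.exp (-(2 * Real.pi * lam₀ * ‖η‖)) *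
      Real.exp (-(2 * Real.pi * mu₀ * ‖freq k‖)) := by
  rw [← phaseFourier_eq_velFourier_fmode (h.integrable_prod hβ hp)]
  exact norm_phaseFourier_le_of_perturbationSize hδ h.close k η

theorem IsDatum.norm_datumFourier_le (h : IsDatum lam₀ mu₀ β δ p f₀) (hδ : 0 ≤ δ) (hβ : 0 < β)
    (hC₀ : 0 ≤ C₀) (hp : IsProfile lam₀ C₀ p) (k : Mode) (η : E3) :
    ‖datumFourier p f₀ k η‖ ≤ (C₀ + δ) * Real.exp (-(2 * Real.pi * lam₀ * ‖η‖)) *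
      Real.exp (-(2 * Real.pi * mu₀ * ‖freq k‖)) := by
  refine (norm_add_le _ _).trans ?_
  have h1 := h.norm_velFourier_fmode_le hδ hβ hp.contDiff.continuous k η
  have h2 : ‖if k = 0 then velFourier (fun v => (p v : ℂ)) η else 0‖ ≤
      C₀ * Real.exp (-(2 * Real.pi * lam₀ * ‖η‖)) * Real.exp (-(2 * Real.pi * mu₀ * ‖freq k‖)) := by
    split_ifs with hk
    · subst hk
      simpa using hp.norm_velFourier_le η
    · rw [norm_zero]; positivity
  linarith

theorem IsDatum.continuous_datumFourier (h : IsDatum lam₀ mu₀ β δ p f₀) (hβ : 0 < β)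
    (hp : Continuous p) (hpi : Integrable p) (k : Mode) : Continuous (datumFourier p f₀ k) := by
  refine (continuous_velFourier (integrable_fmode hβ (h.continuous_sub hp) h.close k)).add ?_
  split_ifs
  · exact continuous_velFourier hpi.ofReal
  · exact continuous_const

theorem fmode_neg (g : E3 → E3 → ℝ) (k : Mode) (v : E3) :
    fmode g (-k) v = (starRingEnd ℂ) (fmode g k v) := by
  rw [fmode, fmode, torusFourier_eq, torusFourier_eq, ← integral_conj]
  congr with x
  rw [map_mul, Complex.conj_ofReal, conj_ex, freq_neg, inner_neg_left]

theorem velFourier_conj (g : E3 → ℂ) (η : E3) :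
    velFourier (fun v => (starRingEnd ℂ) (g v)) (-η) = (starRingEnd ℂ) (velFourier g η) := by
  rw [velFourier_eq, velFourier_eq, ← integral_conj]
  congr with v
  rw [map_mul, conj_ex, inner_neg_left]

theorem datumFourier_neg (p : E3 → ℝ) (f₀ : E3 → E3 → ℝ) (k : Mode) (η : E3) :
    datumFourier p f₀ (-k) (-η) = (starRingEnd ℂ) (datumFourier p f₀ k η) := by
  unfold datumFourier
  rw [map_add, ← velFourier_conj]
  congr 1
  · congr 1
    funext v; exact fmode_neg _ _ _
  · by_cases hk : k = 0
    · simp [hk, velFourier_ofReal_neg]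
    · simp [hk]

theorem IsDatum.velInv_datumFourier (h : IsDatum lam₀ mu₀ β δ p f₀) (hlam : 0 < lam₀) (hδ : 0 ≤ δ)
    (hβ : 0 < β) (hp : IsProfile lam₀ C₀ p) (k : Mode) (v : E3) :
    velInv (datumFourier p f₀ k) v = fmode f₀ k v := by
  have hpi := Real.pi_pos
  have hpc := hp.contDiff.continuous
  have hi := integrable_fmode hβ (h.continuous_sub hpc) h.close k
  have hd : ExpDecay (velFourier (fmode (fun x v => f₀ x v - p v) k)) :=
    ⟨continuous_velFourier hi, 2 * Real.pi * lam₀, by positivity,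
      δ * Real.exp (-(2 * Real.pi * mu₀ * ‖freq k‖)), fun η =>
      (h.norm_velFourier_fmode_le hδ hβ hpc k η).trans (le_of_eq (by ring))⟩
  have hdp : ExpDecay (velFourier fun v => (p v : ℂ)) :=
    ⟨continuous_velFourier (hp.integrable hlam).ofReal, 2 * Real.pi * lam₀, by positivity,
      C₀, hp.norm_velFourier_le⟩
  rw [h.fmode_eq]
  have h1 := congrFun (velInv_velFourier (continuous_fmode (h.continuous_sub hpc) k) hi hd.integrable) v
  have h2 := congrFun (velInv_velFourier (Complex.continuous_ofReal.comp hpc)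
    (hp.integrable hlam).ofReal hdp.integrable) v
  by_cases hk : k = 0
  · have e : datumFourier p f₀ k = fun η => velFourier (fmode (fun x v => f₀ x v - p v) k) η +
        velFourier (fun v => (p v : ℂ)) η := by
      funext η; simp [datumFourier, hk]
    rw [e, velInv_add hd.integrable hdp.integrable, h1, if_pos hk]
    congr 1
  · have e : datumFourier p f₀ k = velFourier (fmode (fun x v => f₀ x v - p v) k) := by
      funext η; simp [datumFourier, hk]
    rw [e, h1, if_neg hk, add_zero]

theorem IsDatum.hasSum (h : IsDatum lam₀ mu₀ β δ p f₀) (hlam : 0 < lam₀) (hmu : 0 < mu₀) (hδ : 0 ≤ δ)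
    (hβ : 0 < β) (hC₀ : 0 ≤ C₀) (hp : IsProfile lam₀ C₀ p) (x v : E3) :
    HasSum (fun k => velInv (datumFourier p f₀ k) v * ex (inner ℝ (freq k) x)) (f₀ x v : ℂ) := by
  have hpi := Real.pi_pos
  have e : ∀ k, velInv (datumFourier p f₀ k) v = torusFourier (fun x => (f₀ x v : ℂ)) k := fun k =>
    h.velInv_datumFourier hlam hδ hβ hp k v
  simp only [e]
  refine hasSum_torusFourier (u := fun x => (f₀ x v : ℂ)) (fun x k => by simp only [h.periodic x k])
    (Complex.continuous_ofReal.comp (h.continuous.comp (by fun_prop : Continuous fun x : E3 => (x, v)))) ?_ x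
  have hJ : Integrable fun η : E3 => Real.exp (-(2 * Real.pi * lam₀ * ‖η‖)) :=
    integrable_exp_neg_norm (by positivity)
  refine Summable.of_norm_bounded (g := fun k => ((C₀ + δ) * ∫ η : E3, Real.exp (-(2 * Real.pi * lam₀ * ‖η‖))) *
    Real.exp (-(2 * Real.pi * mu₀ * ‖freq k‖)))
    ((summable_exp_neg_freq (c := 2 * Real.pi * mu₀) (by positivity)).mul_left _) fun k => ?_
  rw [← e k]
  refine (norm_velInv_le _ _).trans ?_
  have hd := h.norm_datumFourier_le hδ hβ hC₀ hp k
  rw [mul_assoc, mul_comm (∫ η : E3, _), ← mul_assoc, ← integral_const_mul]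
  refine integral_mono_of_nonneg (Filter.Eventually.of_forall fun _ => norm_nonneg _) (hJ.const_mul _)
    (Filter.Eventually.of_forall fun η => (hd η).trans (le_of_eq (by ring)))

/-- The derivatives of the inverse Fourier transform of the datum. -/
theorem exists_anBound_datumFourier (hlam : 0 < lam₀) (hmu : 0 < mu₀) (hβ : 0 < β) (hC₀ : 0 ≤ C₀) :
    ∃ c : ℝ, 0 < c ∧ ∀ (p : E3 → ℝ) (f₀ : E3 → E3 → ℝ) (δ : ℝ), 0 ≤ δ → δ ≤ 1 →
      IsProfile lam₀ C₀ p → IsDatum lam₀ mu₀ β δ p f₀ → ∀ k,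
      AnBound (lam₀ / 12) (fun _ => c * Real.exp (-(Real.pi * mu₀ * ‖freq k‖)))
        (datumFourier p f₀ k) := by
  have hpi := Real.pi_pos
  obtain ⟨c, hc, htube⟩ := exists_dualBound_tube hlam hβ
  refine ⟨c + C₀, by positivity, fun p f₀ δ hδ hδ1 hp h k => ?_⟩
  have hpc := hp.contDiff.continuous
  have hi := integrable_fmode hβ (h.continuous_sub hpc) h.close k
  have hb := h.norm_velFourier_fmode_le hδ hβ hpc k
  have hd : ExpDecay (velFourier (fmode (fun x v => f₀ x v - p v) k)) :=
    ⟨continuous_velFourier hi, 2 * Real.pi * lam₀, by positivity,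
      δ * Real.exp (-(2 * Real.pi * mu₀ * ‖freq k‖)), fun η =>
      (hb η).trans (le_of_eq (by ring))⟩
  have hdp : ExpDecay (velFourier fun v => (p v : ℂ)) :=
    ⟨continuous_velFourier (hp.integrable hlam).ofReal, 2 * Real.pi * lam₀, by positivity,
      C₀, hp.norm_velFourier_le⟩
  have h1 := htube (fmode (fun x v => f₀ x v - p v) k) (Real.exp (-(Real.pi * mu₀ * ‖freq k‖)))
    (Real.exp_pos _).le (Real.exp_le_one_iff.2 (neg_nonpos.2 (by positivity)))
    (continuous_fmode (h.continuous_sub hpc) k) hi (fun η => (hb η).trans (by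
      rw [← Real.exp_nat_mul]
      have e : ((2 : ℕ) : ℝ) * -(Real.pi * mu₀ * ‖freq k‖) = -(2 * Real.pi * mu₀ * ‖freq k‖) := by
        push_cast; ring
      rw [e]
      have h3 := Real.exp_pos (-(2 * Real.pi * mu₀ * ‖freq k‖))
      have h4 := Real.exp_pos (-(2 * Real.pi * lam₀ * ‖η‖))
      have h5 := mul_pos h3 h4
      nlinarith))
    ((lintegral_fmode_le (h.continuous_sub hpc) h.close k).trans
      (ENNReal.ofReal_le_one.2 hδ1))
  have h2 := anBound_of_tube hlam (A := δ * Real.exp (-(2 * Real.pi * mu₀ * ‖freq k‖))) hd.1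
    (fun η => (hb η).trans (le_of_eq (by ring))) h1
  by_cases hk : k = 0
  · have e : datumFourier p f₀ k = fun η => velFourier (fmode (fun x v => f₀ x v - p v) k) η +
        velFourier (fun v => (p v : ℂ)) η := by
      funext η; simp [datumFourier, hk]
    rw [e]
    have h3 := (hp.anBound hlam hC₀).mono_radius (σ := lam₀ / 12) (by positivity) hC₀ (by linarith)
    refine (h2.add h3 hd hdp).mono (by positivity) fun _ => ?_
    simp [hk]
  · have e : datumFourier p f₀ k = velFourier (fmode (fun x v => f₀ x v - p v) k) := by
      funext η; simp [datumFourier, hk]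
    rw [e]
    refine h2.mono (by positivity) fun _ => ?_
    gcongr
    linarith

end Datum

section Synthesis

/-- The counting measure on the modes times the Lebesgue measure on the dual velocities. -/
noncomputable abbrev modeMeasure : Measure (Mode × E3) := Measure.count.prod volume

/-- Fourier synthesis on the phase space. -/
noncomputable def synth (c : Mode → E3 → ℂ) (y v : E3) : ℂ :=
  ∫ z : Mode × E3, ex (inner ℝ (freq z.1) y + inner ℝ z.2 v) * c z.1 z.2 ∂modeMeasure

theorem integrable_mode_exp {θ κ : ℝ} (hθ : 0 < θ) (hκ : 0 < κ) :
    Integrable (fun z : Mode × E3 => Real.exp (-(θ * ‖z.2‖ + κ * ‖freq z.1‖))) modeMeasure := by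
  have h1 : Integrable (fun k : Mode => Real.exp (-(κ * ‖freq k‖))) Measure.count :=
    integrable_count_iff.2 (summable_exp_neg_freq hκ).norm
  refine (h1.mul_prod (integrable_exp_neg_norm hθ)).congr (Filter.Eventually.of_forall fun z => ?_)
  simp only
  rw [← Real.exp_add]; congr 1; ring

theorem continuous_mode {X : Type*} [TopologicalSpace X] {f : Mode × E3 → X}
    (h : ∀ k, Continuous fun η => f (k, η)) : Continuous f :=
  continuous_prod_of_discrete_left.2 h

theorem integrable_mode {θ κ B : ℝ} (hθ : 0 < θ) (hκ : 0 < κ) {c : Mode → E3 → ℂ}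
    (hc : ∀ k, Continuous (c k)) (hb : ∀ k η, ‖c k η‖ ≤ B * Real.exp (-(θ * ‖η‖ + κ * ‖freq k‖))) :
    Integrable (fun z : Mode × E3 => c z.1 z.2) modeMeasure :=
  ((integrable_mode_exp hθ hκ).const_mul B).mono' (continuous_mode hc).aestronglyMeasurable
    (Filter.Eventually.of_forall fun z => hb z.1 z.2)

theorem hasSum_synth {θ κ B : ℝ} (hθ : 0 < θ) (hκ : 0 < κ) {c : Mode → E3 → ℂ}
    (hc : ∀ k, Continuous (c k)) (hb : ∀ k η, ‖c k η‖ ≤ B * Real.exp (-(θ * ‖η‖ + κ * ‖freq k‖)))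
    (y v : E3) : HasSum (fun k => velInv (c k) v * ex (inner ℝ (freq k) y)) (synth c y v) := by
  have hm : Continuous fun z : Mode × E3 => ex (inner ℝ (freq z.1) y + inner ℝ z.2 v) :=
    continuous_mode fun k => continuous_ex.comp (by fun_prop)
  have h1 : Integrable (fun z : Mode × E3 => ex (inner ℝ (freq z.1) y + inner ℝ z.2 v) * c z.1 z.2)
      modeMeasure := (integrable_mode hθ hκ hc hb).bdd_mul (c := 1) hm.aestronglyMeasurable
        (Filter.Eventually.of_forall fun z => by simp)
  have h2 := h1.integral_prod_left
  have e : ∀ k, ∫ η : E3, ex (inner ℝ (freq k) y + inner ℝ η v) * c k η =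
      velInv (c k) v * ex (inner ℝ (freq k) y) := fun k => by
    rw [velInv, ← integral_mul_const]
    congr with η
    rw [ex_add]; ring
  simp only [e] at h2
  have h3 := (integrable_count_iff.1 h2).of_norm.hasSum
  rw [synth, integral_prod _ h1]
  simp only [e]
  rw [integral_countable h2]
  simpa using h3

/-- The derivative of the integrand of the Fourier synthesis. -/
noncomputable def synthDeriv (c c' : ℂ) (k : Mode) (η : E3) (q : ℝ × E3 × E3) :
    ℝ × E3 × E3 →L[ℝ] ℂ :=
  (ContinuousLinearMap.fst ℝ ℝ (E3 × E3)).smulRight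
      (ex (inner ℝ (freq k) q.2.1 + inner ℝ η q.2.2) * c') +
    ((innerSL ℝ (freq k)).comp ((ContinuousLinearMap.fst ℝ E3 E3).comp
        (ContinuousLinearMap.snd ℝ ℝ (E3 × E3))) +
      (innerSL ℝ η).comp ((ContinuousLinearMap.snd ℝ E3 E3).comp
        (ContinuousLinearMap.snd ℝ ℝ (E3 × E3)))).smulRight
      (2 * Real.pi * Complex.I * (ex (inner ℝ (freq k) q.2.1 + inner ℝ η q.2.2) * c))

theorem hasFDerivAt_synthDeriv {c : ℝ → ℂ} {c' : ℂ} (k : Mode) (η : E3) (q : ℝ × E3 × E3)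
    (hc : HasDerivAt c c' q.1) :
    HasFDerivAt (fun q : ℝ × E3 × E3 => ex (inner ℝ (freq k) q.2.1 + inner ℝ η q.2.2) * c q.1)
      (synthDeriv (c q.1) c' k η q) q := by
  set φ : ℝ × E3 × E3 →L[ℝ] ℝ := (innerSL ℝ (freq k)).comp ((ContinuousLinearMap.fst ℝ E3 E3).comp
        (ContinuousLinearMap.snd ℝ ℝ (E3 × E3))) +
      (innerSL ℝ η).comp ((ContinuousLinearMap.snd ℝ E3 E3).comp
        (ContinuousLinearMap.snd ℝ ℝ (E3 × E3))) with hφ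
  have h1 : HasFDerivAt (fun q : ℝ × E3 × E3 => inner ℝ (freq k) q.2.1 + inner ℝ η q.2.2) φ q :=
    φ.hasFDerivAt
  have h2 := (hasDerivAt_ex (inner ℝ (freq k) q.2.1 + inner ℝ η q.2.2)).hasFDerivAt.comp q h1
  have h3 := hc.hasFDerivAt.comp q (hasFDerivAt_fst (𝕜 := ℝ) (E := ℝ) (F := E3 × E3) (p := q))
  refine (h2.mul h3).congr_fderiv ?_
  ext z <;> simp [synthDeriv, hφ] <;> ring

theorem continuous_synthDeriv {X : Type*} [TopologicalSpace X] {c c' : X → ℂ} {η : X → E3}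
    {q : X → ℝ × E3 × E3} (hc : Continuous c) (hc' : Continuous c') (hη : Continuous η)
    (hq : Continuous q) (k : Mode) : Continuous fun x => synthDeriv (c x) (c' x) k (η x) (q x) := by
  have h1 : Continuous fun x => ex (inner ℝ (freq k) (q x).2.1 + inner ℝ (η x) (q x).2.2) :=
    continuous_ex.comp (by fun_prop)
  have h2 : Continuous fun x => innerSL ℝ (η x) := (innerSL ℝ).continuous.comp hη
  have h3 : ∀ {φ : X → (ℝ × E3 × E3 →L[ℝ] ℝ)} {g : X → ℂ}, Continuous φ → Continuous g →
      Continuous fun x => (φ x).smulRight (g x) := fun hφ hg =>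
    ((ContinuousLinearMap.smulRightL ℝ (ℝ × E3 × E3) ℂ).continuous.comp hφ).clm_apply hg
  unfold synthDeriv
  exact (h3 continuous_const (h1.mul hc')).add
    (h3 (continuous_const.add (h2.clm_comp continuous_const)) (continuous_const.mul (h1.mul hc)))

theorem norm_synthDeriv_le (c c' : ℂ) (k : Mode) (η : E3) (q : ℝ × E3 × E3) :
    ‖synthDeriv c c' k η q‖ ≤ ‖c'‖ + 2 * Real.pi * (‖freq k‖ + ‖η‖) * ‖c‖ := by
  refine ContinuousLinearMap.opNorm_le_bound _ (by positivity) fun z => ?_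
  have h1 : ‖z.1‖ ≤ ‖z‖ := norm_fst_le z
  have h2 : ‖z.2.1‖ ≤ ‖z‖ := (norm_fst_le z.2).trans (norm_snd_le z)
  have h3 : ‖z.2.2‖ ≤ ‖z‖ := (norm_snd_le z.2).trans (norm_snd_le z)
  have h4 := abs_real_inner_le_norm (freq k) z.2.1
  have h5 := abs_real_inner_le_norm η z.2.2
  have h6 := abs_add_le (inner ℝ (freq k) z.2.1) (inner ℝ η z.2.2)
  have e : synthDeriv c c' k η q z = (z.1 : ℂ) * (ex (inner ℝ (freq k) q.2.1 + inner ℝ η q.2.2) * c') +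
      ((inner ℝ (freq k) z.2.1 + inner ℝ η z.2.2 : ℝ) : ℂ) *
      (2 * Real.pi * Complex.I * (ex (inner ℝ (freq k) q.2.1 + inner ℝ η q.2.2) * c)) := by
    simp [synthDeriv]
  rw [e]
  refine (norm_add_le _ _).trans ?_
  simp only [norm_mul, norm_ex, Complex.norm_real, Complex.norm_I, Real.norm_eq_abs,
    abs_of_pos Real.pi_pos, Complex.norm_ofNat, mul_one, one_mul]
  rw [add_mul]
  have h7 : |inner ℝ (freq k) z.2.1 + inner ℝ η z.2.2| ≤ (‖freq k‖ + ‖η‖) * ‖z‖ := by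
    refine h6.trans ?_
    have h8 := mul_le_mul_of_nonneg_left h2 (norm_nonneg (freq k))
    have h9 := mul_le_mul_of_nonneg_left h3 (norm_nonneg η)
    linarith
  rw [Real.norm_eq_abs] at h1
  have hpi := Real.pi_pos
  refine add_le_add ?_ ?_
  · rw [mul_comm]; gcongr
  · calc _ ≤ ((‖freq k‖ + ‖η‖) * ‖z‖) * (2 * Real.pi * ‖c‖) := by gcongr
      _ = _ := by ring

theorem exists_add_mul_exp_le {θ κ : ℝ} (hθ : 0 < θ) (hκ : 0 < κ) : ∃ C : ℝ, 0 ≤ C ∧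
    ∀ (k : Mode) (η : E3), (‖freq k‖ + ‖η‖) * Real.exp (-(θ * ‖η‖ + κ * ‖freq k‖)) ≤
      C * Real.exp (-(θ / 2 * ‖η‖ + κ / 2 * ‖freq k‖)) := by
  obtain ⟨C₁, hC₁, h1⟩ := pow_le_exp (half_pos hθ) 1
  obtain ⟨C₂, hC₂, h2⟩ := pow_le_exp (half_pos hκ) 1
  refine ⟨C₁ + C₂, by positivity, fun k η => ?_⟩
  have e1 := h1 ‖η‖ (norm_nonneg _)
  have e2 := h2 ‖freq k‖ (norm_nonneg _)
  rw [pow_one] at e1 e2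
  have e3 : Real.exp (θ / 2 * ‖η‖) ≤ Real.exp (θ / 2 * ‖η‖ + κ / 2 * ‖freq k‖) :=
    Real.exp_le_exp.2 (le_add_of_nonneg_right (by positivity))
  have e4 : Real.exp (κ / 2 * ‖freq k‖) ≤ Real.exp (θ / 2 * ‖η‖ + κ / 2 * ‖freq k‖) :=
    Real.exp_le_exp.2 (le_add_of_nonneg_left (by positivity))
  have e5 : Real.exp (-(θ / 2 * ‖η‖ + κ / 2 * ‖freq k‖)) =
      Real.exp (θ / 2 * ‖η‖ + κ / 2 * ‖freq k‖) * Real.exp (-(θ * ‖η‖ + κ * ‖freq k‖)) := by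
    rw [← Real.exp_add]; congr 1; ring
  rw [e5, ← mul_assoc]
  refine mul_le_mul_of_nonneg_right ?_ (Real.exp_pos _).le
  have e6 := mul_le_mul_of_nonneg_left e3 hC₁.le
  have e7 := mul_le_mul_of_nonneg_left e4 hC₂.le
  linarith

/-- Fourier synthesis of a time-dependent family is continuously differentiable. -/
theorem exists_hasFDerivAt_synth {θ κ B : ℝ} (hθ : 0 < θ) (hκ : 0 < κ) {c c' : ℝ → Mode → E3 → ℂ}
    (hc : ∀ k, Continuous fun z : ℝ × E3 => c z.1 k z.2)
    (hc' : ∀ k, Continuous fun z : ℝ × E3 => c' z.1 k z.2)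
    (hd : ∀ t k η, HasDerivAt (fun t => c t k η) (c' t k η) t)
    (hb : ∀ t k η, ‖c t k η‖ ≤ B * Real.exp (-(θ * ‖η‖ + κ * ‖freq k‖)))
    (hb' : ∀ t k η, ‖c' t k η‖ ≤ B * Real.exp (-(θ * ‖η‖ + κ * ‖freq k‖))) :
    ∃ S' : ℝ × E3 × E3 → (ℝ × E3 × E3 →L[ℝ] ℂ), Continuous S' ∧
      (∀ q, HasFDerivAt (fun q : ℝ × E3 × E3 => synth (c q.1) q.2.1 q.2.2) (S' q) q) ∧
      ∀ q, S' q (1, 0) = synth (c' q.1) q.2.1 q.2.2 := by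
  have hpi := Real.pi_pos
  have hB : 0 ≤ B := by
    have := (norm_nonneg _).trans (hb 0 0 0)
    exact nonneg_of_mul_nonneg_left this (Real.exp_pos _)
  obtain ⟨C, hC, hCb⟩ := exists_add_mul_exp_le hθ hκ
  have hck : ∀ t k, Continuous (c t k) := fun t k =>
    (hc k).comp (by fun_prop : Continuous fun η : E3 => (t, η))
  have hck' : ∀ t k, Continuous (c' t k) := fun t k =>
    (hc' k).comp (by fun_prop : Continuous fun η : E3 => (t, η))
  have hexz : ∀ q : ℝ × E3 × E3, ∀ k, Continuous fun η : E3 =>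
      ex (inner ℝ (freq k) q.2.1 + inner ℝ η q.2.2) := fun q k => continuous_ex.comp (by fun_prop)
  have hbd : ∀ (q : ℝ × E3 × E3) (z : Mode × E3),
      ‖synthDeriv (c q.1 z.1 z.2) (c' q.1 z.1 z.2) z.1 z.2 q‖ ≤
      (B + 2 * Real.pi * B * C) * Real.exp (-(θ / 2 * ‖z.2‖ + κ / 2 * ‖freq z.1‖)) := fun q z => by
    refine (norm_synthDeriv_le _ _ _ _ _).trans ?_
    have h1 : Real.exp (-(θ * ‖z.2‖ + κ * ‖freq z.1‖)) ≤
        Real.exp (-(θ / 2 * ‖z.2‖ + κ / 2 * ‖freq z.1‖)) := Real.exp_le_exp.2 (by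
      have : 0 ≤ θ * ‖z.2‖ := by positivity
      have : 0 ≤ κ * ‖freq z.1‖ := by positivity
      linarith)
    have h2 := hCb z.1 z.2
    calc _ ≤ B * Real.exp (-(θ * ‖z.2‖ + κ * ‖freq z.1‖)) + 2 * Real.pi * (‖freq z.1‖ + ‖z.2‖) *
          (B * Real.exp (-(θ * ‖z.2‖ + κ * ‖freq z.1‖))) := by
          gcongr
          · exact hb' _ _ _
          · exact hb _ _ _
      _ = B * Real.exp (-(θ * ‖z.2‖ + κ * ‖freq z.1‖)) + 2 * Real.pi * B * ((‖freq z.1‖ + ‖z.2‖) *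
          Real.exp (-(θ * ‖z.2‖ + κ * ‖freq z.1‖))) := by ring
      _ ≤ B * Real.exp (-(θ / 2 * ‖z.2‖ + κ / 2 * ‖freq z.1‖)) + 2 * Real.pi * B *
          (C * Real.exp (-(θ / 2 * ‖z.2‖ + κ / 2 * ‖freq z.1‖))) := by gcongr
      _ = _ := by ring
  have hbi : Integrable (fun z : Mode × E3 => (B + 2 * Real.pi * B * C) *
      Real.exp (-(θ / 2 * ‖z.2‖ + κ / 2 * ‖freq z.1‖))) modeMeasure :=
    (integrable_mode_exp (half_pos hθ) (half_pos hκ)).const_mul _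
  have hmeas : ∀ q : ℝ × E3 × E3, Continuous fun z : Mode × E3 =>
      synthDeriv (c q.1 z.1 z.2) (c' q.1 z.1 z.2) z.1 z.2 q := fun q => continuous_mode fun k => by
    exact continuous_synthDeriv (hck q.1 k) (hck' q.1 k) continuous_id continuous_const k
  have hintD : ∀ q : ℝ × E3 × E3, Integrable (fun z : Mode × E3 =>
      synthDeriv (c q.1 z.1 z.2) (c' q.1 z.1 z.2) z.1 z.2 q) modeMeasure := fun q =>
    hbi.mono' (hmeas q).aestronglyMeasurable (Filter.Eventually.of_forall (hbd q))
  refine ⟨fun q => ∫ z : Mode × E3, synthDeriv (c q.1 z.1 z.2) (c' q.1 z.1 z.2) z.1 z.2 q ∂modeMeasure,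
    ?_, fun q => ?_, fun q => ?_⟩
  · refine continuous_of_dominated (fun q => (hmeas q).aestronglyMeasurable)
      (fun q => Filter.Eventually.of_forall (hbd q)) hbi (Filter.Eventually.of_forall fun z => ?_)
    have h1 : Continuous fun q : ℝ × E3 × E3 => c q.1 z.1 z.2 :=
      (hc z.1).comp (by fun_prop : Continuous fun q : ℝ × E3 × E3 => (q.1, z.2))
    have h2 : Continuous fun q : ℝ × E3 × E3 => c' q.1 z.1 z.2 :=
      (hc' z.1).comp (by fun_prop : Continuous fun q : ℝ × E3 × E3 => (q.1, z.2))
    exact continuous_synthDeriv h1 h2 continuous_const continuous_id z.1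
  · have hF : ∀ q : ℝ × E3 × E3, Integrable (fun z : Mode × E3 =>
        ex (inner ℝ (freq z.1) q.2.1 + inner ℝ z.2 q.2.2) * c q.1 z.1 z.2) modeMeasure := fun q =>
      (integrable_mode hθ hκ (hck q.1) (hb q.1)).bdd_mul (c := 1)
        (continuous_mode (f := fun z : Mode × E3 => ex (inner ℝ (freq z.1) q.2.1 + inner ℝ z.2 q.2.2))
          (hexz q)).aestronglyMeasurable (Filter.Eventually.of_forall fun z => by simp)
    exact hasFDerivAt_integral_of_dominated_of_fderiv_le (s := univ) Filter.univ_mem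
      (Filter.Eventually.of_forall fun q => (hF q).aestronglyMeasurable) (hF q)
      (hmeas q).aestronglyMeasurable (Filter.Eventually.of_forall fun z q _ => hbd q z) hbi
      (Filter.Eventually.of_forall fun z q _ => hasFDerivAt_synthDeriv z.1 z.2 q (hd q.1 z.1 z.2))
  · rw [ContinuousLinearMap.integral_apply (hintD q), synth]
    congr with z
    simp [synthDeriv]

end Synthesis

section SmoothSynthesis

theorem measurableEmbedding_freq_prod :
    MeasurableEmbedding fun z : Mode × E3 => ((freq z.1, z.2) : E3 × E3) := by
  refine Measurable.measurableEmbedding ?_ ?_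
  · exact (continuous_mode (f := fun z : Mode × E3 => ((freq z.1, z.2) : E3 × E3)) fun k => by
      fun_prop).measurable
  · rintro ⟨k, η⟩ ⟨l, ζ⟩ h
    simp only [Prod.mk.injEq] at h
    rw [freq_injective h.1, h.2]

/-- Fourier synthesis of an exponentially decaying family is smooth. -/
theorem contDiff_synth {θ κ B : ℝ} (hθ : 0 < θ) (hκ : 0 < κ) {c : Mode → E3 → ℂ}
    (hc : ∀ k, Continuous (c k)) (hb : ∀ k η, ‖c k η‖ ≤ B * Real.exp (-(θ * ‖η‖ + κ * ‖freq k‖))) :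
    ContDiff ℝ ∞ fun z : E3 × E3 => synth c z.1 z.2 := by
  have hB : 0 ≤ B := by
    have := (norm_nonneg _).trans (hb 0 0)
    exact nonneg_of_mul_nonneg_left this (Real.exp_pos _)
  set ι : Mode × E3 → E3 × E3 := fun z => (freq z.1, z.2) with hι
  have hem : MeasurableEmbedding ι := measurableEmbedding_freq_prod
  set g : E3 × E3 → ℂ := Function.extend ι (fun z => c z.1 z.2) 0 with hg
  have hgι : ∀ z, g (ι z) = c z.1 z.2 := fun z => hem.injective.extend_apply _ _ z
  set L₁ : E3 →L[ℝ] E3 →L[ℝ] ℝ := innerSL ℝ with hL₁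
  set L : (E3 × E3) →L[ℝ] (E3 × E3) →L[ℝ] ℝ :=
    -(L₁.bilinearComp (ContinuousLinearMap.fst ℝ E3 E3) (ContinuousLinearMap.fst ℝ E3 E3) +
      L₁.bilinearComp (ContinuousLinearMap.snd ℝ E3 E3) (ContinuousLinearMap.snd ℝ E3 E3)) with hL
  have h := VectorFourier.contDiff_fourierIntegral (N := ⊤) (μ := Measure.map ι modeMeasure) (f := g) L
    (fun n _ => by
      rw [hem.integrable_map_iff]
      set m := min (θ / 2) (κ / 2) with hm
      have hm0 : 0 < m := lt_min (half_pos hθ) (half_pos hκ)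
      obtain ⟨C, hC, hCb⟩ := pow_le_exp hm0 n
      have hcont : Continuous fun z : Mode × E3 => ‖ι z‖ ^ n * ‖c z.1 z.2‖ :=
        continuous_mode fun k => by
          have h1 := hc k
          have h2 : Continuous fun η : E3 => ι (k, η) := by
            simp only [hι]; fun_prop
          exact (h2.norm.pow n).mul h1.norm
      have e : ((fun v => ‖v‖ ^ n * ‖g v‖) ∘ ι) = fun z => ‖ι z‖ ^ n * ‖c z.1 z.2‖ := by
        funext z; simp only [Function.comp_apply, hgι]
      rw [e]
      refine ((integrable_mode_exp (half_pos hθ) (half_pos hκ)).const_mul (C * B)).mono'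
        hcont.aestronglyMeasurable (Filter.Eventually.of_forall fun z => ?_)
      rw [Real.norm_of_nonneg (by positivity)]
      have h1 : ‖ι z‖ ≤ ‖freq z.1‖ + ‖z.2‖ := by
        refine max_le ?_ ?_
        · exact le_add_of_nonneg_right (norm_nonneg _)
        · exact le_add_of_nonneg_left (norm_nonneg _)
      have h2 := hCb (‖freq z.1‖ + ‖z.2‖) (by positivity)
      have h3 : m * (‖freq z.1‖ + ‖z.2‖) ≤ θ / 2 * ‖z.2‖ + κ / 2 * ‖freq z.1‖ := by
        have := mul_le_mul_of_nonneg_right (min_le_left (θ / 2) (κ / 2)) (norm_nonneg z.2)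
        have := mul_le_mul_of_nonneg_right (min_le_right (θ / 2) (κ / 2)) (norm_nonneg (freq z.1))
        rw [hm]; linarith
      calc ‖ι z‖ ^ n * ‖c z.1 z.2‖ ≤ (C * Real.exp (θ / 2 * ‖z.2‖ + κ / 2 * ‖freq z.1‖)) *
            (B * Real.exp (-(θ * ‖z.2‖ + κ * ‖freq z.1‖))) := by
            refine mul_le_mul ?_ (hb _ _) (norm_nonneg _) (by positivity)
            refine (pow_le_pow_left₀ (norm_nonneg _) h1 n).trans (h2.trans ?_)
            gcongr
        _ = C * B * (Real.exp (θ / 2 * ‖z.2‖ + κ / 2 * ‖freq z.1‖) *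
            Real.exp (-(θ * ‖z.2‖ + κ * ‖freq z.1‖))) := by ring
        _ = _ := by rw [← Real.exp_add]; congr 2; ring)
  convert! h using 1
  funext w
  rw [VectorFourier.fourierIntegral, hem.integral_map, synth]
  congr with z
  rw [hgι, Circle.smul_def, Real.fourierChar_apply, smul_eq_mul]
  simp only [hL, hL₁, hι, ex]
  congr 2
  simp
  rfl

end SmoothSynthesis

section AnalyticNorm

theorem factorial_add_le (a b : ℕ) : (a + b).factorial ≤ 2 ^ (a + b) * (a.factorial * b.factorial) := by
  have h1 := Nat.add_choose_mul_factorial_mul_factorial a b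
  have h2 : (a + b).choose b ≤ 2 ^ (a + b) := Nat.choose_le_two_pow _ _
  rw [← h1, mul_assoc]
  exact Nat.mul_le_mul_right _ h2

theorem factorial_add_add_le (a b c : ℕ) :
    (a + b + c).factorial ≤ 4 ^ (a + b + c) * (a.factorial * b.factorial * c.factorial) := by
  calc _ ≤ 2 ^ (a + b + c) * ((a + b).factorial * c.factorial) := factorial_add_le _ _
    _ ≤ 2 ^ (a + b + c) * ((2 ^ (a + b) * (a.factorial * b.factorial)) * c.factorial) := by
        gcongr; exact factorial_add_le _ _
    _ ≤ 2 ^ (a + b + c) * ((2 ^ (a + b + c) * (a.factorial * b.factorial)) * c.factorial) := by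
        have : 2 ^ (a + b) ≤ 2 ^ (a + b + c) := Nat.pow_le_pow_right (by norm_num) (by omega)
        gcongr
    _ = _ := by
        have : 4 ^ (a + b + c) = 2 ^ (a + b + c) * 2 ^ (a + b + c) := by
          rw [← mul_pow]
          norm_num
        rw [this]; ring

theorem exists_mono_eq_dprod (n : Fin 3 → ℕ) : ∃ y : ℕ → E3, (∀ i, ‖y i‖ ≤ 1) ∧
    ∀ η, mono n η = dprod y (Finset.range (n 0 + n 1 + n 2)) η := by
  let e : Fin 3 → E3 := fun i => EuclideanSpace.single i 1
  refine ⟨fun i => if i < n 0 then e 0 else if i < n 0 + n 1 then e 1 else e 2, fun i => ?_, fun η => ?_⟩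
  · have he : ∀ j, ‖e j‖ ≤ 1 := fun j => by simp [e]
    simp only
    split_ifs <;> exact he _
  · have he : ∀ j, 2 * Real.pi * Complex.I * ((inner ℝ (e j) η : ℝ) : ℂ) = dsym j η := fun j => by
      simp [e, dsym, EuclideanSpace.inner_single_left]
    rw [mono_eq, dprod, Finset.prod_range_add, Finset.prod_range_add, mul_assoc]
    congr 1
    · rw [Finset.prod_congr rfl (g := fun _ => dsym 0 η), Finset.prod_const, Finset.card_range]
      intro i hi
      rw [if_pos (Finset.mem_range.1 hi), he]
    congr 1
    · rw [Finset.prod_congr rfl (g := fun _ => dsym 1 η), Finset.prod_const, Finset.card_range]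
      intro i hi
      rw [if_neg (by omega), if_pos (by have := Finset.mem_range.1 hi; omega), he]
    · rw [Finset.prod_congr rfl (g := fun _ => dsym 2 η), Finset.prod_const, Finset.card_range]
      intro i hi
      rw [if_neg (by omega), if_neg (by omega), he]

theorem tsum_half_pow_le : ∑' n : Fin 3 → ℕ, ENNReal.ofReal (∏ i, (1 / 2 : ℝ) ^ n i) ≤
    ENNReal.ofReal 8 := by
  rw [ENNReal.tsum_eq_iSup_sum]
  refine iSup_le fun s => ?_
  rw [← ENNReal.ofReal_sum_of_nonneg fun n _ => by positivity]
  refine ENNReal.ofReal_le_ofReal ?_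
  set N := s.sup (fun n => ∑ i, n i) + 1 with hN
  have hs : s ⊆ Fintype.piFinset fun _ : Fin 3 => Finset.range N := fun n hn => by
    rw [Fintype.mem_piFinset]
    intro i
    rw [Finset.mem_range, hN, Nat.lt_succ_iff]
    exact (Finset.single_le_sum (f := n) (fun _ _ => Nat.zero_le _) (Finset.mem_univ i)).trans
      (Finset.le_sup (f := fun n : Fin 3 → ℕ => ∑ i, n i) hn)
  refine (Finset.sum_le_sum_of_subset_of_nonneg hs fun n _ _ => by positivity).trans ?_
  rw [← Finset.prod_univ_sum (fun _ : Fin 3 => Finset.range N) (fun _ j => (1 / 2 : ℝ) ^ j),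
    Fin.prod_univ_three]
  have h1 : ∑ j ∈ Finset.range N, (1 / 2 : ℝ) ^ j ≤ 2 :=
    (summable_geometric_two.sum_le_tsum _ fun _ _ => by positivity).trans tsum_geometric_two.le
  have h0 : 0 ≤ ∑ j ∈ Finset.range N, (1 / 2 : ℝ) ^ j := Finset.sum_nonneg fun _ _ => by positivity
  calc _ ≤ (2 : ℝ) * 2 * 2 := by gcongr
    _ = 8 := by norm_num

theorem analyticL1Norm_velInv_le {σ w : ℝ} (hσ : 0 < σ) (hw : 0 ≤ w) {c : E3 → ℂ} (hd : ExpDecay c)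
    (h : AnBound σ (fun _ => w) c) : analyticL1Norm (σ / 8) (velInv c) ≤ ENNReal.ofReal (8 * w) := by
  have key : ∀ n : Fin 3 → ℕ, ENNReal.ofReal (weight (σ / 8) n) * ∫⁻ v, ‖mderiv n (velInv c) v‖ₑ ≤
      ENNReal.ofReal w * ENNReal.ofReal (∏ i, (1 / 2 : ℝ) ^ n i) := fun n => by
    obtain ⟨y, hy, hm⟩ := exists_mono_eq_dprod n
    have h1 := h y hy (Finset.range (n 0 + n 1 + n 2))
    have h2 := lintegral_velInv_le (hd.dprod_mul hy _) h1
    rw [hd.mderiv_velInv]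
    simp only [hm]
    refine (mul_le_mul_right h2 _).trans ?_
    rw [← ENNReal.ofReal_mul (weight_pos (by positivity) n).le, ← ENNReal.ofReal_mul hw]
    refine ENNReal.ofReal_le_ofReal ?_
    rw [Finset.card_range]
    have h3 : ((n 0 + n 1 + n 2).factorial : ℝ) ≤ 4 ^ (n 0 + n 1 + n 2) *
        ((n 0).factorial * (n 1).factorial * (n 2).factorial) := by
      exact_mod_cast factorial_add_add_le (n 0) (n 1) (n 2)
    calc weight (σ / 8) n * (w * ((n 0 + n 1 + n 2).factorial * σ⁻¹ ^ (n 0 + n 1 + n 2)))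
        ≤ weight (σ / 8) n * (w * ((4 ^ (n 0 + n 1 + n 2) *
          ((n 0).factorial * (n 1).factorial * (n 2).factorial)) * σ⁻¹ ^ (n 0 + n 1 + n 2))) := by
          have := (weight_pos (by positivity : 0 < σ / 8) n).le
          gcongr
      _ = w * ∏ i, (1 / 2 : ℝ) ^ n i := by
          have e0 : (σ / 8 : ℝ) * 4 * σ⁻¹ = 1 / 2 := by field_simp; norm_num
          rw [← e0]
          simp only [weight, Fin.prod_univ_three, mul_pow, pow_add]
          field_simp
  refine (ENNReal.tsum_le_tsum key).trans ?_
  rw [ENNReal.tsum_mul_left, mul_comm 8 w, ENNReal.ofReal_mul hw]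
  gcongr
  exact tsum_half_pow_le

end AnalyticNorm

section Reconstruction

theorem velInv_neg_conj {c d : E3 → ℂ} (h : ∀ η, d (-η) = (starRingEnd ℂ) (c η)) (v : E3) :
    velInv d v = (starRingEnd ℂ) (velInv c v) := by
  unfold velInv
  rw [← integral_conj, ← integral_neg_eq_self (fun η => ex (inner ℝ η v) * d η)]
  congr with η
  rw [h, map_mul, conj_ex, inner_neg_left]

/-- The Fourier coefficients of a slice: exponentially decaying, with an analytic inverse Fourier
transform. -/
structure ModeFamily (θ κ B σ κ' R : ℝ) (c : Mode → E3 → ℂ) : Prop where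
  θ_pos : 0 < θ
  κ_pos : 0 < κ
  σ_pos : 0 < σ
  κ'_pos : 0 < κ'
  R_nonneg : 0 ≤ R
  cont : ∀ k, Continuous (c k)
  bound : ∀ k η, ‖c k η‖ ≤ B * Real.exp (-(θ * ‖η‖ + κ * ‖freq k‖))
  symm : ∀ k η, c (-k) (-η) = (starRingEnd ℂ) (c k η)
  an : ∀ k, AnBound σ (fun _ => R * Real.exp (-(κ' * ‖freq k‖))) (c k)

/-- The real function on the phase space with prescribed Fourier transform. -/
noncomputable def phys (c : Mode → E3 → ℂ) (x v : E3) : ℝ := (synth c x v).re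

namespace ModeFamily

variable {θ κ B σ κ' R : ℝ} {c : Mode → E3 → ℂ}

theorem hasSum_synth (h : ModeFamily θ κ B σ κ' R c) (y v : E3) :
    HasSum (fun k => velInv (c k) v * ex (inner ℝ (freq k) y)) (synth c y v) :=
  WeakVP.hasSum_synth h.θ_pos h.κ_pos h.cont h.bound y v

theorem expDecay (h : ModeFamily θ κ B σ κ' R c) (k : Mode) : ExpDecay (c k) :=
  ⟨h.cont k, θ, h.θ_pos, B * Real.exp (-(κ * ‖freq k‖)), fun η => (h.bound k η).trans (le_of_eq (by
    rw [mul_assoc, ← Real.exp_add]; congr 2; ring))⟩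

theorem ofReal_phys (h : ModeFamily θ κ B σ κ' R c) (x v : E3) : (phys c x v : ℂ) = synth c x v := by
  have h1 := h.hasSum_synth x v
  have h2 : HasSum (fun k => (starRingEnd ℂ) (velInv (c k) v * ex (inner ℝ (freq k) x)))
      ((starRingEnd ℂ) (synth c x v)) := h1.map (starRingEnd ℂ) Complex.continuous_conj
  have h3 := (Equiv.neg Mode).hasSum_iff.2 h1
  have e : (fun k => velInv (c k) v * ex (inner ℝ (freq k) x)) ∘ (Equiv.neg Mode) =
      fun k => (starRingEnd ℂ) (velInv (c k) v * ex (inner ℝ (freq k) x)) := by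
    funext k
    simp only [Function.comp_apply, Equiv.neg_apply]
    rw [map_mul, conj_ex, velInv_neg_conj (h.symm k), freq_neg, inner_neg_left]
  rw [e] at h3
  exact Complex.conj_eq_iff_re.1 (h2.unique h3)

theorem hasSum_phys (h : ModeFamily θ κ B σ κ' R c) (x v : E3) :
    HasSum (fun k => velInv (c k) v * ex (inner ℝ (freq k) x)) (phys c x v : ℂ) := by
  rw [h.ofReal_phys]; exact h.hasSum_synth x v

theorem fmode_phys (h : ModeFamily θ κ B σ κ' R c) (k : Mode) (v : E3) :
    fmode (phys c) k v = velInv (c k) v := by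
  refine torusFourier_of_hasSum (c := fun k => velInv (c k) v) ?_ (fun x => h.hasSum_phys x v) k
  have := (h.hasSum_synth 0 v).summable
  simpa using this

theorem isSlice (h : ModeFamily θ κ B σ κ' R c) :
    IsSlice (min (σ / 8) (κ' / (4 * Real.pi)))
      (∑' k : Mode, 8 * R * Real.exp (-(κ' / 2 * ‖freq k‖))) (phys c) := by
  have hpi := Real.pi_pos
  have hR := h.R_nonneg
  have hσ := h.σ_pos
  have hκ := h.κ'_pos
  set s := min (σ / 8) (κ' / (4 * Real.pi)) with hs
  have hs0 : 0 < s := lt_min (by positivity) (by positivity)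
  have hsum : Summable fun k : Mode => 8 * R * Real.exp (-(κ' / 2 * ‖freq k‖)) :=
    (summable_exp_neg_freq (half_pos hκ)).mul_left _
  refine ⟨hs0, tsum_nonneg fun k => by positivity, fun x k => ?_, ?_, ?_⟩
  · funext v
    have h1 := h.hasSum_phys (x + freq k) v
    have e : (fun l => velInv (c l) v * ex (inner ℝ (freq l) (x + freq k))) =
        fun l => velInv (c l) v * ex (inner ℝ (freq l) x) := by
      funext l
      congr 1
      exact periodic_ex l x k
    rw [e] at h1
    exact_mod_cast h1.unique (h.hasSum_phys x v)
  · exact Complex.reCLM.contDiff.comp (contDiff_synth h.θ_pos h.κ_pos h.cont h.bound)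
  · unfold hybridNorm
    rw [ENNReal.ofReal_tsum_of_nonneg (fun k => by positivity) hsum]
    refine ENNReal.tsum_le_tsum fun k => ?_
    have h1 : (fun v => torusFourier (fun x => (phys c x v : ℂ)) k) = velInv (c k) :=
      funext fun v => h.fmode_phys k v
    rw [h1]
    have h8 : 8 * s ≤ σ := by
      have := min_le_left (σ / 8) (κ' / (4 * Real.pi))
      linarith
    have h2 := analyticL1Norm_velInv_le (σ := 8 * s) (by positivity)
      (w := R * Real.exp (-(κ' * ‖freq k‖))) (by positivity) (h.expDecay k)
      ((h.an k).mono_radius (by positivity) (by positivity) h8)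
    rw [mul_div_cancel_left₀ _ (by norm_num : (8 : ℝ) ≠ 0)] at h2
    refine (mul_le_mul_right h2 _).trans ?_
    rw [← ENNReal.ofReal_mul (Real.exp_pos _).le]
    refine ENNReal.ofReal_le_ofReal ?_
    have h3 : 2 * Real.pi * s ≤ κ' / 2 := by
      have := min_le_right (σ / 8) (κ' / (4 * Real.pi))
      rw [le_div_iff₀ (by positivity)] at this
      linarith
    calc _ = 8 * R * (Real.exp (2 * Real.pi * s * ‖freq k‖) * Real.exp (-(κ' * ‖freq k‖))) := by ring
      _ ≤ _ := by
        rw [← Real.exp_add]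
        have := mul_le_mul_of_nonneg_right h3 (norm_nonneg (freq k))
        gcongr
        linarith

theorem phaseFourier_phys (h : ModeFamily θ κ B σ κ' R c) (k : Mode) (η : E3) :
    phaseFourier (phys c) k η = c k η := by
  have e : fmode (phys c) k = velInv (c k) := funext fun v => h.fmode_phys k v
  rw [h.isSlice.phaseFourier_eq, e, velFourier_velInv (h.cont k) (h.expDecay k).integrable]
  rw [← e]
  exact h.isSlice.integrable_fmode k

end ModeFamily

end Reconstruction

section RightHandSide

variable {σ M γ : ℝ} {f : E3 → E3 → ℝ} {W p : E3 → ℝ}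

theorem continuous_ofReal_left {g : E3 → E3 → ℝ} (hg : Continuous fun z : E3 × E3 => g z.1 z.2)
    (v : E3) : Continuous fun x => (g x v : ℂ) :=
  Complex.continuous_ofReal.comp (hg.comp (by fun_prop : Continuous fun x : E3 => (x, v)))

namespace IsSlice

theorem continuous_physRhs (h : IsSlice σ M f) (hW : IsPotential γ W) (hγ : 1 < γ) (a ν : ℝ)
    (hp : Continuous p) : Continuous fun z : E3 × E3 => physRhs a ν W p f z.1 z.2 := by
  have hf' : ContDiff ℝ ∞ (fun z : E3 × E3 => fderiv ℝ (fun v => f z.1 v) z.2) :=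
    fderiv_partial_right (G := fun z => f z.1 z.2) (by simpa using h.smooth)
  have h1 : ∀ i, Continuous fun z : E3 × E3 => pderiv i (f z.1) z.2 := fun i =>
    hf'.continuous.clm_apply continuous_const
  have h2 : ∀ i, Continuous fun x => field W f x i := fun i =>
    Complex.continuous_re.comp (h.continuous_field hW hγ i)
  have h3 : Continuous fun x => density f x := Complex.continuous_re.comp h.continuous_density
  have h4 := h.smooth.continuous
  have h5 : Continuous fun z : E3 × E3 => ∑ i, field W f z.1 i * pderiv i (f z.1) z.2 :=
    continuous_finsetSum _ fun i _ => ((h2 i).comp continuous_fst).mul (h1 i)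
  have h6 : Continuous fun z : E3 × E3 => density f z.1 * p z.2 :=
    (h3.comp continuous_fst).mul (hp.comp continuous_snd)
  have e : (fun z : E3 × E3 => physRhs a ν W p f z.1 z.2) = fun z =>
      -(a * ∑ i, field W f z.1 i * pderiv i (f z.1) z.2) +
        ν * (density f z.1 * p z.2 - f z.1 z.2) := by
    funext z; rw [physRhs, inner_field_gradient]
  rw [e]
  exact (continuous_const.mul h5).neg.add (continuous_const.mul (h6.sub h4))

theorem periodic_physRhs (h : IsSlice σ M f) (hW : IsPotential γ W) (hγ : 1 < γ) (a ν : ℝ)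
    (p : E3 → ℝ) : TorusPeriodic (physRhs a ν W p f) := fun x k => by
  funext v
  have h1 : f (x + freq k) = f x := h.periodic x k
  have h2 : ∀ i, field W f (x + freq k) i = field W f x i := fun i => by
    have h3 := h.hasSum_field hW hγ i (x + freq k)
    have e : (fun l => fco W f i l * ex (inner ℝ (freq l) (x + freq k))) =
        fun l => fco W f i l * ex (inner ℝ (freq l) x) := by
      funext l; congr 1; exact periodic_ex l x k
    rw [e] at h3
    exact_mod_cast h3.unique (h.hasSum_field hW hγ i x)
  rw [physRhs, physRhs, inner_field_gradient, inner_field_gradient, density, density, h1]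
  simp only [h2]

/-- The right-hand side of the equation, synthesized from its Fourier transform. -/
theorem physRhs_eq_synth (h : IsSlice σ M f) (hW : IsPotential γ W) (hγ : 1 < γ) {a ν : ℝ}
    (hp : Continuous p) (hpi : Integrable p) {θ κ B : ℝ} (hθ : 0 < θ) (hκ : 0 < κ)
    {G : Mode → E3 → ℂ} (hG : ∀ k ζ, fourierRhs a ν W p f k ζ = G k ζ) (hc : ∀ k, Continuous (G k))
    (hb : ∀ k η, ‖G k η‖ ≤ B * Real.exp (-(θ * ‖η‖ + κ * ‖freq k‖))) (x v : E3) :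
    (physRhs a ν W p f x v : ℂ) = synth G x v := by
  have hcont := h.continuous_physRhs hW hγ a ν hp
  have h1 : ∀ k, velInv (G k) = fmode (physRhs a ν W p f) k := fun k => by
    obtain ⟨hi, -, hv⟩ := h.modeRhs_spec hW hγ a ν hpi k
    change Integrable (fmode (physRhs a ν W p f) k) at hi
    change ∀ ζ, velFourier (fmode (physRhs a ν W p f) k) ζ = _ at hv
    have e : velFourier (fmode (physRhs a ν W p f) k) = G k := funext fun ζ => (hv ζ).trans (hG k ζ)
    rw [← e]
    have hfc : Continuous (fmode (physRhs a ν W p f) k) :=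
      continuous_fmode (g := physRhs a ν W p f) hcont k
    refine WeakVP.velInv_velFourier hfc hi ?_
    rw [e]
    have hd : ExpDecay (G k) := ⟨hc k, θ, hθ, B * Real.exp (-(κ * ‖freq k‖)),
      fun η => (hb k η).trans (le_of_eq (by
        rw [mul_assoc, ← Real.exp_add]; congr 2; ring))⟩
    exact hd.integrable
  have h2 := hasSum_synth hθ hκ hc hb x v
  have h3 : Summable fun k => fmode (physRhs a ν W p f) k v := by
    have h4 := (hasSum_synth hθ hκ hc hb 0 v).summable
    simp only [h1, inner_zero_right, ex_zero, mul_one] at h4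
    exact h4
  set u : E3 → ℂ := fun x => (physRhs a ν W p f x v : ℂ) with hu
  have hper : TorusPeriodic u := fun x k => by
    have := congrFun (h.periodic_physRhs hW hγ a ν p x k) v
    rw [hu]
    simp only [this]
  have huc : Continuous u := continuous_ofReal_left (g := physRhs a ν W p f) hcont v
  have h5 : HasSum (fun k => fmode (physRhs a ν W p f) k v * ex (inner ℝ (freq k) x)) (u x) :=
    hasSum_torusFourier hper huc h3 x
  simp only [h1] at h2
  exact h5.unique h2

end IsSlice

end RightHandSide

section Extension

/-- A cutoff in time, equal to `1` on `[0,T]`. -/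
noncomputable def cutoff (T s : ℝ) : ℝ := max 0 (1 - |s - cl T s|)

theorem continuous_cutoff (T : ℝ) : Continuous (cutoff T) := by
  have := continuous_cl T
  unfold cutoff; fun_prop

theorem cutoff_of_mem {T s : ℝ} (hs : s ∈ Icc 0 T) : cutoff T s = 1 := by
  simp [cutoff, cl_of_mem hs]

theorem cutoff_nonneg (T s : ℝ) : 0 ≤ cutoff T s := le_max_left _ _

theorem cutoff_le_one (T s : ℝ) : cutoff T s ≤ 1 :=
  max_le zero_le_one (by linarith [abs_nonneg (s - cl T s)])

theorem integrable_cutoff {T : ℝ} (hT : 0 ≤ T) : Integrable (cutoff T) := by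
  refine (continuous_cutoff T).integrable_of_hasCompactSupport
    (HasCompactSupport.intro (isCompact_Icc (a := -1) (b := T + 1)) fun s hs => ?_)
  have h1 := cl_mem hT s
  refine max_eq_left ?_
  rw [mem_Icc, not_and_or, not_le, not_le] at hs
  rcases hs with hs | hs
  · have := neg_le_abs (s - cl T s)
    linarith [h1.1]
  · have := le_abs_self (s - cl T s)
    linarith [h1.2]

theorem norm_integral_cutoff_mul_le {T : ℝ} (hT : 0 ≤ T) {r : ℝ → ℂ} {X : ℝ}
    (hX : ∀ s, ‖r s‖ ≤ X) (t : ℝ) :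
    ‖∫ s in (0 : ℝ)..t, (cutoff T s : ℂ) * r s‖ ≤ (∫ s, cutoff T s) * X := by
  have hX0 : 0 ≤ X := (norm_nonneg _).trans (hX 0)
  have hi : Integrable fun s => cutoff T s * X := (integrable_cutoff hT).mul_const X
  refine intervalIntegral.norm_integral_le_integral_norm_uIoc.trans ?_
  calc _ ≤ ∫ s in uIoc 0 t, cutoff T s * X := by
        refine integral_mono_of_nonneg (Filter.Eventually.of_forall fun _ => norm_nonneg _)
          hi.integrableOn (Filter.Eventually.of_forall fun s => ?_)
        simp only [norm_mul, Complex.norm_real, Real.norm_of_nonneg (cutoff_nonneg T s)]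
        exact mul_le_mul_of_nonneg_left (hX s) (cutoff_nonneg T s)
    _ ≤ ∫ s, cutoff T s * X := setIntegral_le_integral hi
        (Filter.Eventually.of_forall fun s => mul_nonneg (cutoff_nonneg T s) hX0)
    _ = _ := integral_mul_const _ _

namespace FourierData

variable {D : FourierData}

/-- The extension of a solution to all times. -/
noncomputable def ext (D : FourierData) (F : ℝ → Mode → E3 → ℂ) (t : ℝ) (k : Mode) (η : E3) : ℂ :=
  D.F₀ k η + ∫ s in (0 : ℝ)..t, (cutoff D.T s : ℂ) * D.rhs F s k η

/-- The time derivative of the extension. -/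
noncomputable def extDeriv (D : FourierData) (F : ℝ → Mode → E3 → ℂ) (t : ℝ) (k : Mode) (η : E3) : ℂ :=
  (cutoff D.T t : ℂ) * D.rhs F t k η

variable {F : ℝ → Mode → E3 → ℂ}

theorem Adm.continuous_extDeriv (hF : D.Adm F) (k : Mode) :
    Continuous fun z : ℝ × E3 => D.extDeriv F z.1 k z.2 :=
  (Complex.continuous_ofReal.comp ((continuous_cutoff D.T).comp continuous_fst)).mul
    (hF.continuous_rhs k)

theorem Adm.continuous_ext (hF : D.Adm F) (k : Mode) :
    Continuous fun z : ℝ × E3 => D.ext F z.1 k z.2 :=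
  ((D.hFc k).comp continuous_snd).add (continuous_primitive (hF.continuous_extDeriv k))

theorem Adm.hasDerivAt_ext (hF : D.Adm F) (t : ℝ) (k : Mode) (η : E3) :
    HasDerivAt (fun t => D.ext F t k η) (D.extDeriv F t k η) t := by
  have hc : Continuous fun s => D.extDeriv F s k η :=
    (hF.continuous_extDeriv k).comp (by fun_prop : Continuous fun s : ℝ => (s, η))
  exact (intervalIntegral.integral_hasDerivAt_right (hc.intervalIntegrable _ _)
    (hc.stronglyMeasurableAtFilter _ _) hc.continuousAt).const_add _

theorem ext_of_mem (hfix : D.step F = F) {t : ℝ} (ht : t ∈ Icc 0 D.T) (k : Mode) (η : E3) :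
    D.ext F t k η = F t k η := by
  conv_rhs => rw [← hfix]
  unfold ext step
  congr 1
  refine intervalIntegral.integral_congr fun s hs => ?_
  rw [uIcc_of_le ht.1] at hs
  rw [cutoff_of_mem ⟨hs.1, hs.2.trans ht.2⟩]
  simp

theorem extDeriv_of_mem {t : ℝ} (ht : t ∈ Icc 0 D.T) (k : Mode) (η : E3) :
    D.extDeriv F t k η = nl D.a D.ν D.Wh D.P (F t) t k η := by
  rw [extDeriv, cutoff_of_mem ht, rhs, cl_of_mem ht]
  simp

/-- The uniform decay rates of admissible functions. -/
theorem rates_pos (D : FourierData) : 0 < D.θ - D.K * D.T ∧ 0 < D.κ - D.K * D.T := by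
  have h1 := D.KT_θ
  have h2 := D.KT_κB
  have h3 := D.κB_le
  have h4 := D.σ_pos
  have h5 : 0 < 2 * Real.pi * D.σ := by positivity
  exact ⟨by linarith, by linarith⟩

theorem env_le_exp_rates {t : ℝ} (ht : t ∈ Icc 0 D.T) (k : Mode) (η : E3) :
    env (D.θ - D.K * t) (D.κ - D.K * t) k η ≤
      Real.exp (-((D.θ - D.K * D.T) * ‖η‖ + (D.κ - D.K * D.T) * ‖freq k‖)) := by
  have h1 := mul_le_mul_of_nonneg_left ht.2 D.K_pos.le
  refine (env_anti (θ := D.θ - D.K * D.T) (κ := D.κ - D.K * D.T) (by linarith) (by linarith) k η).trans ?_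
  exact mul_le_of_le_one_right (Real.exp_pos _).le (inv_le_one_of_one_le₀ (one_le_om k))

theorem Adm.exists_norm_rhs_le (hF : D.Adm F) : ∃ B : ℝ, 0 ≤ B ∧ ∀ s k η, ‖D.rhs F s k η‖ ≤
    B * Real.exp (-((D.θ - D.K * D.T) / 2 * ‖η‖ + (D.κ - D.K * D.T) / 2 * ‖freq k‖)) := by
  obtain ⟨h1, h2⟩ := D.rates_pos
  obtain ⟨C, hC, hCb⟩ := exists_add_mul_exp_le h1 h2
  have hA := D.A_nonneg
  have hC₀ := D.C₀_nonneg
  have hbil := bilConst_nonneg (A := 2 * D.A) D.a (by positivity)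
  refine ⟨2 * D.A * (bilConst D.a (2 * D.A) * C + |D.ν| * (D.C₀ + 1)), by positivity, fun s k η => ?_⟩
  have hm := D.cl_mem' s
  have h3 := norm_nl_le (a := D.a) (ν := D.ν) D.hW (θ_pos hm).le (κ_nonneg hm) hm.1 (hm.2.trans D.T_le)
    (hP' hm) (hF.bound _ hm) k η
  have h4 := env_le_exp_rates hm k η
  have h5 := hCb k η
  have h6 : Real.exp (-((D.θ - D.K * D.T) * ‖η‖ + (D.κ - D.K * D.T) * ‖freq k‖)) ≤
      Real.exp (-((D.θ - D.K * D.T) / 2 * ‖η‖ + (D.κ - D.K * D.T) / 2 * ‖freq k‖)) :=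
    Real.exp_le_exp.2 (by
      have := mul_nonneg h1.le (norm_nonneg η)
      have := mul_nonneg h2.le (norm_nonneg (freq k))
      linarith)
  unfold rhs
  set E := Real.exp (-((D.θ - D.K * D.T) * ‖η‖ + (D.κ - D.K * D.T) * ‖freq k‖)) with hE
  set E2 := Real.exp (-((D.θ - D.K * D.T) / 2 * ‖η‖ + (D.κ - D.K * D.T) / 2 * ‖freq k‖)) with hE2
  calc _ ≤ (bilConst D.a (2 * D.A) * (‖η‖ + ‖freq k‖) + |D.ν| * (D.C₀ + 1)) * (2 * D.A * E) := by
        refine h3.trans ?_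
        gcongr
    _ = 2 * D.A * (bilConst D.a (2 * D.A) * ((‖freq k‖ + ‖η‖) * E) + |D.ν| * (D.C₀ + 1) * E) := by ring
    _ ≤ 2 * D.A * (bilConst D.a (2 * D.A) * (C * E2) + |D.ν| * (D.C₀ + 1) * E2) := by gcongr
    _ = _ := by ring

theorem Adm.exists_norm_ext_le (hF : D.Adm F) : ∃ B : ℝ, 0 ≤ B ∧
    (∀ s k η, ‖D.ext F s k η‖ ≤
      B * Real.exp (-((D.θ - D.K * D.T) / 2 * ‖η‖ + (D.κ - D.K * D.T) / 2 * ‖freq k‖))) ∧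
    ∀ s k η, ‖D.extDeriv F s k η‖ ≤
      B * Real.exp (-((D.θ - D.K * D.T) / 2 * ‖η‖ + (D.κ - D.K * D.T) / 2 * ‖freq k‖)) := by
  obtain ⟨h1, h2⟩ := D.rates_pos
  obtain ⟨B, hB, hb⟩ := hF.exists_norm_rhs_le
  have hA := D.A_nonneg
  set J := ∫ s, cutoff D.T s with hJ
  have hJ0 : 0 ≤ J := integral_nonneg fun s => cutoff_nonneg _ _
  refine ⟨D.A + J * B + B, by positivity, fun t k η => ?_, fun t k η => ?_⟩
  · have h3 := norm_integral_cutoff_mul_le D.T_pos.le (fun s => hb s k η) t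
    have h4 : ‖D.F₀ k η‖ ≤ D.A *
        Real.exp (-((D.θ - D.K * D.T) / 2 * ‖η‖ + (D.κ - D.K * D.T) / 2 * ‖freq k‖)) := by
      refine (D.hF k η).trans (mul_le_mul_of_nonneg_left ?_ hA)
      have h5 := env_le_exp_rates (D := D) (t := 0) ⟨le_rfl, D.T_pos.le⟩ k η
      simp only [mul_zero, sub_zero] at h5
      refine h5.trans (Real.exp_le_exp.2 ?_)
      have := mul_nonneg h1.le (norm_nonneg η)
      have := mul_nonneg h2.le (norm_nonneg (freq k))
      linarith
    have h6 := norm_add_le (D.F₀ k η) (∫ s in (0 : ℝ)..t, (cutoff D.T s : ℂ) * D.rhs F s k η)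
    have h7 : 0 ≤ B * Real.exp (-((D.θ - D.K * D.T) / 2 * ‖η‖ + (D.κ - D.K * D.T) / 2 * ‖freq k‖)) := by
      positivity
    refine h6.trans ((add_le_add h4 h3).trans ?_)
    linarith
  · have h3 : ‖D.extDeriv F t k η‖ ≤ ‖D.rhs F t k η‖ := by
      rw [extDeriv, norm_mul, Complex.norm_real, Real.norm_of_nonneg (cutoff_nonneg _ _)]
      exact mul_le_of_le_one_left (norm_nonneg _) (cutoff_le_one _ _)
    refine h3.trans ((hb t k η).trans ?_)
    gcongr
    have : 0 ≤ J * B := by positivity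
    linarith

end FourierData

end Extension

section Solution

/-- The shift from the frame of free transport to the phase space. -/
noncomputable def shift (t : ℝ) (c : Mode → E3 → ℂ) (k : Mode) (η : E3) : ℂ := c k (η + t • freq k)

theorem exp_shift_le {θ κ t : ℝ} (hκ : 0 ≤ κ) (ht : 0 ≤ t) (ht1 : t ≤ 1) (hθ : 0 ≤ θ) (k : Mode)
    (η : E3) : Real.exp (-(θ * ‖η + t • freq k‖ + κ * ‖freq k‖)) ≤
      Real.exp (-(min θ (κ / 2) * ‖η‖ + κ / 2 * ‖freq k‖)) := by
  refine Real.exp_le_exp.2 ?_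
  set m := min θ (κ / 2) with hm
  have hm0 : 0 ≤ m := le_min hθ (by linarith)
  have h1 : ‖η‖ ≤ ‖η + t • freq k‖ + ‖freq k‖ := by
    have h2 : ‖t • freq k‖ ≤ ‖freq k‖ := by
      rw [norm_smul, Real.norm_of_nonneg ht]
      exact mul_le_of_le_one_left (norm_nonneg _) ht1
    have h3 := norm_sub_le (η + t • freq k) (t • freq k)
    rw [add_sub_cancel_right] at h3
    linarith
  have h2 := mul_le_mul_of_nonneg_left h1 hm0
  have h3 := mul_le_mul_of_nonneg_right (min_le_left θ (κ / 2)) (norm_nonneg (η + t • freq k))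
  have h4 := mul_le_mul_of_nonneg_right (min_le_right θ (κ / 2)) (norm_nonneg (freq k))
  linarith

namespace FourierData

variable {D : FourierData} {F : ℝ → Mode → E3 → ℂ}

theorem Adm.exists_modeFamily (hF : D.Adm F) (hKT : D.K * D.T < D.κB) :
    ∃ θ κ B σ κ' R : ℝ, ∀ t ∈ Icc 0 D.T, ModeFamily θ κ B σ κ' R (shift t (F t)) := by
  have hpi := Real.pi_pos
  obtain ⟨h1, h2⟩ := D.rates_pos
  have hR := D.R_nonneg
  have hA := D.A_nonneg
  set d := D.κB - D.K * D.T with hd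
  have hd0 : 0 < d := by rw [hd]; linarith
  set σ := min (D.σ * Real.exp (-(D.K * D.T))) (d / (4 * Real.pi)) with hσ
  have hσ0 : 0 < σ := lt_min (radius_pos D _) (by positivity)
  refine ⟨min (D.θ - D.K * D.T) ((D.κ - D.K * D.T) / 2), (D.κ - D.K * D.T) / 2, 2 * D.A, σ, d / 2,
    2 * D.R, fun t ht => ?_⟩
  have hKt := mul_le_mul_of_nonneg_left ht.2 D.K_pos.le
  refine ⟨lt_min h1 (half_pos h2), half_pos h2, hσ0, half_pos hd0, by positivity, fun k => ?_,
    fun k η => ?_, fun k η => ?_, fun k => ?_⟩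
  · exact (hF.expDecay ht k).1.comp (by fun_prop : Continuous fun η : E3 => η + t • freq k)
  · refine (hF.bound t ht k _).trans (mul_le_mul_of_nonneg_left ?_ (by positivity))
    exact (env_le_exp_rates ht k _).trans (exp_shift_le h2.le ht.1 (ht.2.trans D.T_le) h1.le k η)
  · rw [shift, shift, ← hF.symm t ht, freq_neg, smul_neg, neg_add]
  · set c := 2 * D.R * (Real.exp (-((D.κB - D.K * t) * ‖freq k‖)) * (om k)⁻¹) with hc
    have hom := om_pos k
    have hc0 : 0 ≤ c := by positivity
    have h3 : σ ≤ D.σ * Real.exp (-(D.K * t)) := by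
      refine (min_le_left _ _).trans ?_
      have := D.σ_pos
      gcongr
    have h4 := ((hF.an t ht k).mono_radius hσ0 hc0 h3).comp_sub hσ0 (hF.expDecay ht k) (-(t • freq k))
    simp only [sub_neg_eq_add, norm_neg] at h4
    refine h4.mono hσ0 fun _ => ?_
    have h5 : ‖t • freq k‖ ≤ ‖freq k‖ := by
      rw [norm_smul, Real.norm_of_nonneg ht.1]
      exact mul_le_of_le_one_left (norm_nonneg _) (ht.2.trans D.T_le)
    have h6 : 2 * Real.pi * σ ≤ d / 2 := by
      have := min_le_right (D.σ * Real.exp (-(D.K * D.T))) (d / (4 * Real.pi))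
      rw [le_div_iff₀ (by positivity)] at this
      linarith
    have h7 : 2 * Real.pi * ‖t • freq k‖ * σ ≤ d / 2 * ‖freq k‖ := by
      calc _ ≤ 2 * Real.pi * ‖freq k‖ * σ := by gcongr
        _ = 2 * Real.pi * σ * ‖freq k‖ := by ring
        _ ≤ _ := by gcongr
    have h8 : c ≤ 2 * D.R * Real.exp (-(d * ‖freq k‖)) := by
      rw [hc]
      have h9 : Real.exp (-((D.κB - D.K * t) * ‖freq k‖)) * (om k)⁻¹ ≤ Real.exp (-(d * ‖freq k‖)) * 1 := by
        refine mul_le_mul (Real.exp_le_exp.2 ?_) (inv_le_one_of_one_le₀ (one_le_om k))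
          (inv_nonneg.2 hom.le) (Real.exp_pos _).le
        have := mul_le_mul_of_nonneg_right (by rw [hd]; linarith : d ≤ D.κB - D.K * t) (norm_nonneg (freq k))
        linarith
      rw [mul_one] at h9
      gcongr
    calc _ ≤ (2 * D.R * Real.exp (-(d * ‖freq k‖))) * Real.exp (d / 2 * ‖freq k‖) := by gcongr
      _ = 2 * D.R * (Real.exp (-(d * ‖freq k‖)) * Real.exp (d / 2 * ‖freq k‖)) := by ring
      _ = _ := by rw [← Real.exp_add]; congr 2; ring

/-- The solution on the phase space. -/
noncomputable def sol (D : FourierData) (F : ℝ → Mode → E3 → ℂ) (t : ℝ) (x v : E3) : ℝ :=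
  (synth (D.ext F t) (x - t • v) v).re

theorem sol_eq_phys (hF : D.Adm F) (hfix : D.step F = F) {θ κ B σ κ' R t : ℝ} (ht : t ∈ Icc 0 D.T)
    (hm : ModeFamily θ κ B σ κ' R (shift t (F t))) : D.sol F t = phys (shift t (F t)) := by
  obtain ⟨h1, h2⟩ := D.rates_pos
  obtain ⟨B', hB', hb, -⟩ := hF.exists_norm_ext_le
  funext x v
  have h3 := hasSum_synth (half_pos h1) (half_pos h2) (c := D.ext F t) (fun k =>
    (hF.continuous_ext k).comp (by fun_prop : Continuous fun η : E3 => (t, η))) (hb t) (x - t • v) v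
  have h4 := hm.hasSum_synth x v
  have e : (fun k => velInv (shift t (F t) k) v * ex (inner ℝ (freq k) x)) =
      fun k => velInv (D.ext F t k) v * ex (inner ℝ (freq k) (x - t • v)) := by
    funext k
    have e1 : D.ext F t k = F t k := funext fun η => ext_of_mem hfix ht k η
    have e2 : shift t (F t) k = fun η => F t k (η + t • freq k) := rfl
    rw [e1, e2, velInv_comp_add, mul_right_comm, ← ex_add, mul_comm, inner_smul_left, inner_sub_right,
      inner_smul_right]
    congr 2
    simp only [conj_trivial]
    ring
  rw [e] at h4
  rw [sol, phys, h3.unique h4]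

theorem exists_hasFDerivAt_sol (hF : D.Adm F) :
    ContDiff ℝ 1 (fun q : ℝ × E3 × E3 => D.sol F q.1 q.2.1 q.2.2) ∧
    ∀ t x v, HasDerivAt (fun s => D.sol F s (x + (s - t) • v) v)
      (synth (D.extDeriv F t) (x - t • v) v).re t := by
  obtain ⟨h1, h2⟩ := D.rates_pos
  obtain ⟨B, hB, hb, hb'⟩ := hF.exists_norm_ext_le
  obtain ⟨S', hS'c, hS', hS't⟩ := exists_hasFDerivAt_synth (half_pos h1) (half_pos h2)
    (c := D.ext F) (c' := D.extDeriv F) hF.continuous_ext hF.continuous_extDeriv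
    hF.hasDerivAt_ext hb hb'
  refine ⟨?_, fun t x v => ?_⟩
  · have hS : ContDiff ℝ 1 (fun q : ℝ × E3 × E3 => synth (D.ext F q.1) q.2.1 q.2.2) :=
      contDiff_one_iff_hasFDerivAt.2 ⟨S', hS'c, hS'⟩
    have hg : ContDiff ℝ 1 (fun q : ℝ × E3 × E3 => (q.1, q.2.1 - q.1 • q.2.2, q.2.2)) := by fun_prop
    have h3 := Complex.reCLM.contDiff.comp (hS.comp hg)
    have e : (fun q : ℝ × E3 × E3 => D.sol F q.1 q.2.1 q.2.2) = Complex.reCLM ∘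
        ((fun q : ℝ × E3 × E3 => synth (D.ext F q.1) q.2.1 q.2.2) ∘
          fun q : ℝ × E3 × E3 => (q.1, q.2.1 - q.1 • q.2.2, q.2.2)) := by
      funext q
      simp only [sol, Function.comp_apply, Complex.reCLM_apply]
    rw [e]
    exact h3
  · have h3 : HasDerivAt (fun s : ℝ => ((s, x - t • v, v) : ℝ × E3 × E3)) (1, 0) t :=
      (hasDerivAt_id t).prodMk (hasDerivAt_const _ _)
    have h4 := (hS' (t, x - t • v, v)).comp_hasDerivAt t h3
    rw [hS't] at h4
    have h5 := Complex.reCLM.hasFDerivAt.comp_hasDerivAt t h4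
    have e : (fun s => D.sol F s (x + (s - t) • v) v) =
        Complex.reCLM ∘ (fun q : ℝ × E3 × E3 => synth (D.ext F q.1) q.2.1 q.2.2) ∘
          fun s : ℝ => ((s, x - t • v, v) : ℝ × E3 × E3) := by
      funext s
      have : x + (s - t) • v - s • v = x - t • v := by rw [sub_smul]; abel
      simp only [sol, this, Function.comp_apply, Complex.reCLM_apply]
    rw [e]
    exact h5

end FourierData

theorem hasDerivAt_transport {f : ℝ → E3 → E3 → ℝ}
    (hf : ContDiff ℝ 1 (fun q : ℝ × E3 × E3 => f q.1 q.2.1 q.2.2)) (t : ℝ) (x v : E3) :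
    HasDerivAt (fun s => f s (x + (s - t) • v) v)
      (deriv (fun s => f s x v) t + inner ℝ v (gradient (fun y => f t y v) x)) t := by
  have h1 := ((hf.differentiable (by simp)) (t, x, v)).hasFDerivAt
  set L := fderiv ℝ (fun q : ℝ × E3 × E3 => f q.1 q.2.1 q.2.2) (t, x, v) with hL
  have h2 : HasDerivAt (fun s => f s x v) (L (1, 0)) t := by
    have h3 : HasDerivAt (fun s : ℝ => ((s, x, v) : ℝ × E3 × E3)) (1, 0) t :=
      (hasDerivAt_id t).prodMk (hasDerivAt_const _ _)
    have := h1.comp_hasDerivAt t h3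
    exact this
  have h4 : inner ℝ v (gradient (fun y => f t y v) x) = L (0, v, 0) := by
    have h5 : HasFDerivAt (fun y : E3 => ((t, y, v) : ℝ × E3 × E3))
        ((ContinuousLinearMap.inr ℝ ℝ (E3 × E3)).comp (ContinuousLinearMap.inl ℝ E3 E3)) x :=
      (hasFDerivAt_prodMk_right t (x, v)).comp x (hasFDerivAt_prodMk_left x v)
    have h6 : HasFDerivAt (fun y => f t y v) (L.comp ((ContinuousLinearMap.inr ℝ ℝ (E3 × E3)).comp
        (ContinuousLinearMap.inl ℝ E3 E3))) x := by
      have := h1.comp x h5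
      exact this
    rw [inner_gradient_right, h6.fderiv]
    simp
  rw [h2.deriv, h4, ← map_add]
  have h7 : HasDerivAt (fun s : ℝ => ((s, x + (s - t) • v, v) : ℝ × E3 × E3)) (1, v, 0) t := by
    refine (hasDerivAt_id t).prodMk (HasDerivAt.prodMk ?_ (hasDerivAt_const _ _))
    have := (((hasDerivAt_id t).sub_const t).smul_const v).const_add x
    simpa using this
  have h8 : HasFDerivAt (fun q : ℝ × E3 × E3 => f q.1 q.2.1 q.2.2) L (t, x + (t - t) • v, v) := by
    simpa using h1
  have h9 := h8.comp_hasDerivAt t h7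
  have e : ((1, 0) + (0, v, 0) : ℝ × E3 × E3) = (1, v, 0) := by simp
  rw [e]
  exact h9

namespace FourierData

variable {D : FourierData} {F : ℝ → Mode → E3 → ℂ}

/-- A fixed point in the frame of free transport gives an analytic solution. -/
theorem isAnalyticSolution_sol (hF : D.Adm F) (hfix : D.step F = F) (hKT : D.K * D.T < D.κB)
    {γ : ℝ} {W p : E3 → ℝ} {f₀ : E3 → E3 → ℝ} (hW : IsPotential γ W) (hγ : 1 < γ)
    (hp : Continuous p) (hpi : Integrable p) (hWh : D.Wh = Wc W)
    (hP : D.P = velFourier fun v => (p v : ℂ))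
    (hf₀ : ∀ x v, HasSum (fun k => velInv (D.F₀ k) v * ex (inner ℝ (freq k) x)) (f₀ x v : ℂ)) :
    IsAnalyticSolution D.a D.ν D.T W p f₀ (D.sol F) := by
  obtain ⟨θ, κ, B, σ, κ', R, hm⟩ := hF.exists_modeFamily hKT
  have hsol : ∀ t ∈ Icc 0 D.T, D.sol F t = phys (shift t (F t)) := fun t ht =>
    sol_eq_phys hF hfix ht (hm t ht)
  have hslice : ∀ t ∈ Icc 0 D.T, IsSlice (min (σ / 8) (κ' / (4 * Real.pi)))
      (∑' k : Mode, 8 * R * Real.exp (-(κ' / 2 * ‖freq k‖))) (D.sol F t) := fun t ht => by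
    rw [hsol t ht]; exact (hm t ht).isSlice
  have h0 : (0 : ℝ) ∈ Icc 0 D.T := ⟨le_rfl, D.T_pos.le⟩
  obtain ⟨hC1, hder⟩ := exists_hasFDerivAt_sol hF
  refine ⟨fun t ht => (hslice t ht).periodic, hC1.contDiffOn, fun t ht => (hslice t ht).smooth,
    ⟨_, (hslice 0 h0).pos, _, fun t ht => (hslice t ht).bound⟩, fun t ht x => (hslice t ht).integrable x,
    fun t ht => (hslice t ht).differentiable_potential hW hγ, fun t ht x v => ?_, fun x v => ?_⟩
  · have h1 := (hasDerivAt_transport hC1 t x v).unique (hder t x v)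
    have h2 : DifferentiableAt ℝ (fun s => D.sol F s x v) t := by
      have h3 : DifferentiableAt ℝ (fun s : ℝ => ((s, x, v) : ℝ × E3 × E3)) t := by fun_prop
      have h4 := ((hC1.differentiable (by simp)) (t, x, v)).comp t h3
      exact h4
    rw [h2.derivWithin (uniqueDiffOn_Icc D.T_pos t ht), h1]
    obtain ⟨r1, r2⟩ := D.rates_pos
    obtain ⟨B', hB', -, hb'⟩ := hF.exists_norm_ext_le
    have hphase : ∀ k ζ, phaseFourier (D.sol F t) k (ζ - t • freq k) = F t k ζ := fun k ζ => by
      rw [hsol t ht, (hm t ht).phaseFourier_phys, shift, sub_add_cancel]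
    have hG : ∀ k ζ, fourierRhs D.a D.ν W p (D.sol F t) k ζ = shift t (D.extDeriv F t) k ζ := by
      intro k ζ
      rw [shift, extDeriv_of_mem ht, hWh, hP]
      have h4 := nl_phaseFourier D.a D.ν W p (D.sol F t) t k (ζ + t • freq k)
      simp only [hphase, add_sub_cancel_right] at h4
      exact h4.symm
    have hGc : ∀ k, Continuous (shift t (D.extDeriv F t) k) := fun k =>
      (hF.continuous_extDeriv k).comp (by fun_prop : Continuous fun η : E3 => (t, η + t • freq k))
    have hGb : ∀ k η, ‖shift t (D.extDeriv F t) k η‖ ≤ B' * Real.exp (-(min ((D.θ - D.K * D.T) / 2)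
        ((D.κ - D.K * D.T) / 2 / 2) * ‖η‖ + (D.κ - D.K * D.T) / 2 / 2 * ‖freq k‖)) := fun k η =>
      (hb' t k _).trans (mul_le_mul_of_nonneg_left (exp_shift_le (half_pos r2).le ht.1
        (ht.2.trans D.T_le) (half_pos r1).le k η) hB')
    have h5 := (hslice t ht).physRhs_eq_synth hW hγ hp hpi
      (lt_min (half_pos r1) (half_pos (half_pos r2))) (half_pos (half_pos r2)) hG hGc hGb x v
    have h6 : synth (D.extDeriv F t) (x - t • v) v = synth (shift t (D.extDeriv F t)) x v := by
      have h7 := hasSum_synth (lt_min (half_pos r1) (half_pos (half_pos r2))) (half_pos (half_pos r2))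
        hGc hGb x v
      have h8 := hasSum_synth (half_pos r1) (half_pos r2) (c := D.extDeriv F t) (fun k =>
        (hF.continuous_extDeriv k).comp (by fun_prop : Continuous fun η : E3 => (t, η))) (hb' t)
        (x - t • v) v
      have e : (fun k => velInv (shift t (D.extDeriv F t) k) v * ex (inner ℝ (freq k) x)) =
          fun k => velInv (D.extDeriv F t k) v * ex (inner ℝ (freq k) (x - t • v)) := by
        funext k
        have e2 : shift t (D.extDeriv F t) k = fun η => D.extDeriv F t k (η + t • freq k) := rfl
        rw [e2, velInv_comp_add, mul_right_comm, ← ex_add, mul_comm, inner_smul_left,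
          inner_sub_right, inner_smul_right]
        congr 2
        simp only [conj_trivial]
        ring
      rw [e] at h7
      exact h8.unique h7
    rw [h6, ← h5, Complex.ofReal_re, physRhs]
    ring
  · have h1 := (hm 0 h0).hasSum_phys x v
    have e : (fun k => velInv (shift 0 (F 0) k) v * ex (inner ℝ (freq k) x)) =
        fun k => velInv (D.F₀ k) v * ex (inner ℝ (freq k) x) := by
      funext k
      have e1 : shift 0 (F 0) k = D.F₀ k := by
        funext η
        rw [shift, zero_smul, add_zero, ← hfix]
        simp [step]
      rw [e1]
    rw [e] at h1
    rw [hsol 0 h0]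
    exact_mod_cast h1.unique (hf₀ x v)

end FourierData

end Solution

section Assembly

theorem Wc_neg (W : E3 → ℝ) (l : Mode) : Wc W (-l) = (starRingEnd ℂ) (Wc W l) := by
  rw [Wc, Wc, torusFourier_eq, torusFourier_eq, ← integral_conj]
  congr with x
  rw [map_mul, Complex.conj_ofReal, conj_ex, freq_neg, inner_neg_left]

theorem exists_inv_om_ge {d : ℝ} (hd : 0 < d) : ∃ C : ℝ, 0 < C ∧
    ∀ k, Real.exp (-(d * ‖freq k‖)) ≤ C * (om k)⁻¹ := by
  obtain ⟨C, hC, h⟩ := om_le_exp hd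
  refine ⟨C, hC, fun k => ?_⟩
  rw [Real.exp_neg, ← div_eq_mul_inv, le_div_iff₀ (om_pos k), inv_mul_le_iff₀ (Real.exp_pos _)]
  linarith [h k]

/-- The choice of the life span and of the parameters of the fixed point argument. -/
theorem exists_lifespan {lam₀ mu₀ β lam mu C₀ ν₀ : ℝ} (hlam : 0 < lam) (hlam' : lam < lam₀)
    (hmu : 0 < mu) (hmu' : mu < mu₀) (hβ : 0 < β) (hC₀ : 0 < C₀) (a : ℝ) :
    ∃ T : ℝ, 0 < T ∧ lam₀ * T ≤ mu₀ - mu ∧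
    ∀ (γ δ ν : ℝ) (W p : E3 → ℝ) (f₀ : E3 → E3 → ℝ), 1 < γ → 0 ≤ δ → δ ≤ 1 → |ν| ≤ ν₀ →
      IsPotential γ W → IsProfile lam₀ C₀ p → IsDatum lam₀ mu₀ β δ p f₀ →
      ∃ D : FourierData, D.a = a ∧ D.ν = ν ∧ D.T = T ∧ D.Wh = Wc W ∧
        (D.P = velFourier fun v => (p v : ℂ)) ∧ D.F₀ = datumFourier p f₀ ∧ D.K * D.T < D.κB ∧
        2 * Real.pi * lam ≤ D.θ - D.K * D.T ∧ 2 * Real.pi * mu ≤ D.κ - D.K * D.T ∧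
        (bilConst D.a (2 * D.A) / D.K + |D.ν| * (D.C₀ + 1) * D.T) * (2 * D.A) ≤ 1 := by
  have hpi := Real.pi_pos
  have hlam₀ : 0 < lam₀ := hlam.trans hlam'
  have hmu₀ : 0 < mu₀ := hmu.trans hmu'
  have hcw := cwSum_nonneg
  obtain ⟨c, hc, hdat⟩ := exists_anBound_datumFourier hlam₀ hmu₀ hβ hC₀.le
  obtain ⟨C₁, hC₁, h1⟩ := exists_inv_om_ge (d := Real.pi * (mu₀ - mu)) (mul_pos hpi (sub_pos.2 hmu'))
  obtain ⟨C₂, hC₂, h2⟩ := exists_inv_om_ge (d := Real.pi * mu₀ / 2) (by positivity)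
  set A := (C₀ + 1) * C₁ with hA
  have hA0 : 0 < A := by positivity
  set R := c * C₂ with hR
  have hR0 : 0 < R := by positivity
  set σ := min (lam₀ / 12) (mu₀ / 4) with hσ
  have hσ0 : 0 < σ := lt_min (by positivity) (by positivity)
  set s := min (1 / 2) (1 / (2 * A)) with hs
  have hs0 : 0 < s := lt_min (by norm_num) (by positivity)
  set X₁ := bilConst a (2 * A) with hX₁
  have hX₁0 : 0 ≤ X₁ := bilConst_nonneg a (by positivity)
  set X₂ := 4 * Real.pi ^ 2 * |a| * (2 * A) * (2 * R) * cwSum * ((2 * Real.pi * σ)⁻¹ + 1) with hX₂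
  have hX₂0 : 0 ≤ X₂ := by positivity
  set K := 1 + 2 * X₁ / s + 6 * X₂ / R with hK
  have hK0 : 0 < K := by positivity
  have hKX₁ : X₁ / K ≤ s / 2 := by
    rw [div_le_iff₀ hK0, hK]
    have e : s / 2 * (1 + 2 * X₁ / s + 6 * X₂ / R) = s / 2 + X₁ + s / 2 * (6 * X₂ / R) := by
      field_simp
    rw [e]
    have : 0 ≤ s / 2 * (6 * X₂ / R) := by positivity
    linarith
  have hKX₂ : 3 * (X₂ / K) ≤ R / 2 := by
    rw [← mul_div_assoc, div_le_iff₀ hK0, hK]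
    have e : R / 2 * (1 + 2 * X₁ / s + 6 * X₂ / R) = R / 2 + R / 2 * (2 * X₁ / s) + 3 * X₂ := by
      field_simp
      ring
    rw [e]
    have : 0 ≤ R / 2 * (2 * X₁ / s) := by positivity
    linarith
  set b := min (min 1 (Real.pi * mu₀ / 4)) (min (2 * Real.pi * (lam₀ - lam)) (Real.pi * (mu₀ - mu))) with hb
  have hb0 : 0 < b := by
    have := sub_pos.2 hlam'
    have := sub_pos.2 hmu'
    refine lt_min (lt_min one_pos (by positivity)) (lt_min (by positivity) (by positivity))
  obtain ⟨T₁, hT₁0, hT₁⟩ := exists_pos_mul_lt hb0 K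
  obtain ⟨T₂, hT₂0, hT₂⟩ := exists_pos_mul_lt (half_pos hs0) (|ν₀| * (C₀ + 1))
  obtain ⟨T₃, hT₃0, hT₃⟩ := exists_pos_mul_lt (half_pos hR0) (3 * (|ν₀| * (2 * A * C₀ + 2 * R)))
  obtain ⟨T₄, hT₄0, hT₄⟩ := exists_pos_mul_lt (sub_pos.2 hmu') lam₀
  set T := min (min T₁ T₂) (min (min T₃ T₄) 1) with hT
  have hT0 : 0 < T := lt_min (lt_min hT₁0 hT₂0) (lt_min (lt_min hT₃0 hT₄0) one_pos)
  have e₁ : T ≤ T₁ := (min_le_left _ _).trans (min_le_left _ _)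
  have e₂ : T ≤ T₂ := (min_le_left _ _).trans (min_le_right _ _)
  have e₃ : T ≤ T₃ := (min_le_right _ _).trans ((min_le_left _ _).trans (min_le_left _ _))
  have e₄ : T ≤ T₄ := (min_le_right _ _).trans ((min_le_left _ _).trans (min_le_right _ _))
  have e₅ : T ≤ 1 := (min_le_right _ _).trans (min_le_right _ _)
  have hKT : K * T ≤ b := (mul_le_mul_of_nonneg_left e₁ hK0.le).trans hT₁.le
  have b₁ : b ≤ 1 := (min_le_left _ _).trans (min_le_left _ _)
  have b₂ : b ≤ Real.pi * mu₀ / 4 := (min_le_left _ _).trans (min_le_right _ _)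
  have b₃ : b ≤ 2 * Real.pi * (lam₀ - lam) := (min_le_right _ _).trans (min_le_left _ _)
  have b₄ : b ≤ Real.pi * (mu₀ - mu) := (min_le_right _ _).trans (min_le_right _ _)
  have hπlam : 0 < Real.pi * lam := by positivity
  have hπmu : 0 < Real.pi * mu := by positivity
  have hπmu₀ : 0 < Real.pi * mu₀ := by positivity
  refine ⟨T, hT0, (mul_le_mul_of_nonneg_left e₄ hlam₀.le).trans hT₄.le,
    fun γ δ ν W p f₀ hγ hδ hδ1 hν hW hp hd => ?_⟩
  have hν' : |ν| ≤ |ν₀| := hν.trans (le_abs_self _)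
  have hpc := hp.contDiff.continuous
  have hpi' := hp.integrable hlam₀
  have hsm : X₁ / K + |ν| * (C₀ + 1) * T ≤ s := by
    have : |ν| * (C₀ + 1) * T ≤ |ν₀| * (C₀ + 1) * T₂ := by gcongr
    linarith
  let D : FourierData :=
    { a := a, ν := ν, T := T, C₀ := C₀, A := A, K := K, θ := 2 * Real.pi * lam₀
      κ := Real.pi * (mu + mu₀), σ := σ, κB := Real.pi * mu₀ / 2, R := R, CP := C₀
      Wh := Wc W
      P := velFourier fun v => (p v : ℂ)
      F₀ := datumFourier p f₀
      T_pos := hT0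
      T_le := e₅
      K_pos := hK0
      KT_le := hKT.trans b₁
      KT_θ := by linarith
      KT_κB := by linarith
      σ_pos := hσ0
      κB_le := by
        have : σ ≤ mu₀ / 4 := min_le_right _ _
        have : 2 * Real.pi * σ ≤ 2 * Real.pi * (mu₀ / 4) := by gcongr
        linarith
      A_nonneg := hA0.le
      R_nonneg := hR0.le
      CP_nonneg := hC₀.le
      C₀_nonneg := hC₀.le
      hW := hW.norm_freq_mul_Wc_le hγ
      hWs := Wc_neg W
      hPc := continuous_velFourier hpi'.ofReal
      hP := hp.norm_velFourier_le
      hPs := velFourier_ofReal_neg p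
      hPan := (hp.anBound hlam₀ hC₀.le).mono_radius hσ0 hC₀.le
        ((min_le_left _ _).trans (by linarith))
      hFc := hd.continuous_datumFourier hβ hpc hpi'
      hF := fun k η => by
        refine (hd.norm_datumFourier_le hδ hβ hC₀.le hp k η).trans ?_
        have h3 : Real.exp (-(2 * Real.pi * mu₀ * ‖freq k‖)) =
            Real.exp (-(Real.pi * (mu + mu₀) * ‖freq k‖)) *
              Real.exp (-(Real.pi * (mu₀ - mu) * ‖freq k‖)) := by
          rw [← Real.exp_add]; congr 1; ring
        rw [h3, env, neg_add, Real.exp_add, hA]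
        have h4 := h1 k
        calc _ ≤ (C₀ + 1) * Real.exp (-(2 * Real.pi * lam₀ * ‖η‖)) *
              (Real.exp (-(Real.pi * (mu + mu₀) * ‖freq k‖)) * (C₁ * (om k)⁻¹)) := by
              gcongr
          _ = _ := by ring
      hFs := datumFourier_neg p f₀
      hFan := fun k => by
        have hom := (inv_pos.2 (om_pos k)).le
        refine ((hdat p f₀ δ hδ hδ1 hp hd k).mono_radius hσ0 (by positivity) (min_le_left _ _)).mono hσ0
          fun _ => ?_
        have h3 : Real.exp (-(Real.pi * mu₀ * ‖freq k‖)) =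
            Real.exp (-(Real.pi * mu₀ / 2 * ‖freq k‖)) *
              Real.exp (-(Real.pi * mu₀ / 2 * ‖freq k‖)) := by
          rw [← Real.exp_add]; congr 1; ring
        rw [h3, hR]
        have h4 := h2 k
        calc _ ≤ c * (Real.exp (-(Real.pi * mu₀ / 2 * ‖freq k‖)) * (C₂ * (om k)⁻¹)) := by gcongr
          _ = _ := by ring
      small₁ := hsm.trans (min_le_left _ _)
      small₂ := by
        have h3 : 3 * (|ν| * (2 * A * C₀ + 2 * R) * T) ≤ 3 * (|ν₀| * (2 * A * C₀ + 2 * R)) * T₃ := by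
          calc _ ≤ 3 * (|ν₀| * (2 * A * C₀ + 2 * R) * T₃) := by gcongr
            _ = _ := by ring
        rw [mul_add]
        linarith }
  refine ⟨D, rfl, rfl, rfl, rfl, rfl, rfl, ?_, ?_, ?_, ?_⟩
  · change K * T < Real.pi * mu₀ / 2
    linarith
  · change 2 * Real.pi * lam ≤ 2 * Real.pi * lam₀ - K * T
    linarith
  · change 2 * Real.pi * mu ≤ Real.pi * (mu + mu₀) - K * T
    linarith
  · change (X₁ / K + |ν| * (C₀ + 1) * T) * (2 * A) ≤ 1
    have h3 : s ≤ 1 / (2 * A) := min_le_right _ _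
    calc _ ≤ 1 / (2 * A) * (2 * A) := by gcongr; exact hsm.trans h3
      _ = 1 := by field_simp

namespace FourierData

variable {D : FourierData} {F : ℝ → Mode → E3 → ℂ}

theorem isFourierSol (hF : D.Adm F) (hfix : D.step F = F) :
    IsFourierSol D.a D.ν D.T D.Wh D.P D.F₀ F := by
  have h1 : ∀ s ∈ Icc 0 D.T, ∀ k η, D.rhs F s k η = nl D.a D.ν D.Wh D.P (F s) s k η :=
    fun s hs k η => by rw [rhs, cl_of_mem hs]
  refine ⟨fun k η => ?_, fun t ht k η => ?_⟩
  · refine (hF.intervalIntegrable_rhs k η 0 D.T).congr fun s hs => ?_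
    rw [uIoc_of_le D.T_pos.le] at hs
    exact h1 s ⟨hs.1.le, hs.2⟩ k η
  · conv_lhs => rw [← hfix]
    unfold step
    congr 1
    refine intervalIntegral.integral_congr fun s hs => ?_
    rw [uIcc_of_le ht.1] at hs
    exact h1 s ⟨hs.1, hs.2.trans ht.2⟩ k η

end FourierData

theorem IsSlice.norm_freeFourier_le {σ M t : ℝ} {f : ℝ → E3 → E3 → ℝ} (h : IsSlice σ M (f t))
    (ht : 0 ≤ t) (ht1 : t ≤ 1) (k : Mode) (η : E3) : ‖freeFourier f t k η‖ ≤
      M * Real.exp (-(Real.pi * σ * ‖η‖ + Real.pi * σ * ‖freq k‖)) := by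
  have hpos := h.two_pi_pos
  refine (h.norm_phaseFourier_le k _).trans ?_
  rw [mul_assoc, ← Real.exp_add]
  refine mul_le_mul_of_nonneg_left ?_ h.nonneg
  have h1 := exp_shift_le (θ := 2 * Real.pi * σ) (κ := 2 * Real.pi * σ) hpos.le ht ht1 hpos.le (-k) η
  have e : min (2 * Real.pi * σ) (2 * Real.pi * σ / 2) = Real.pi * σ := by
    rw [min_eq_right (by linarith)]; ring
  rw [e, freq_neg, smul_neg, norm_neg, ← sub_eq_add_neg] at h1
  have e1 : 2 * Real.pi * σ / 2 = Real.pi * σ := by ring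
  rw [e1] at h1
  refine le_trans (le_of_eq ?_) h1
  congr 1; ring

/-- Every analytic solution coincides with the fixed point, in the frame of free transport. -/
theorem freeFourier_eq_of_isAnalyticSolution {D : FourierData} {F : ℝ → Mode → E3 → ℂ}
    (hF : D.Adm F) (hfix : D.step F = F) {γ : ℝ} {W p : E3 → ℝ} {f₀ : E3 → E3 → ℝ}
    {f : ℝ → E3 → E3 → ℝ} (hf : IsAnalyticSolution D.a D.ν D.T W p f₀ f) (hW : IsPotential γ W)
    (hγ : 1 < γ) (hpi : Integrable p) (hWh : D.Wh = Wc W) (hP : D.P = velFourier fun v => (p v : ℂ))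
    (hf₀ : D.F₀ = phaseFourier f₀) {t : ℝ} (ht : t ∈ Icc 0 D.T) (k : Mode) (η : E3) :
    freeFourier f t k η = F t k η := by
  have hpp := Real.pi_pos
  obtain ⟨σ, M, hs⟩ := hf.exists_isSlice
  have hσ := (hs 0 ⟨le_rfl, D.T_pos.le⟩).pos
  have hM := (hs 0 ⟨le_rfl, D.T_pos.le⟩).nonneg
  obtain ⟨r1, r2⟩ := D.rates_pos
  have h1 := hf.isFourierSol D.T_pos hW hγ hpi
  rw [← hWh, ← hP, ← hf₀] at h1
  have h2 := FourierData.isFourierSol hF hfix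
  obtain ⟨C, hC, hCb⟩ := exists_inv_om_ge (d := Real.pi * σ / 2) (by positivity)
  set θ := min (Real.pi * σ) (D.θ - D.K * D.T) with hθ
  set κ := min (Real.pi * σ / 2) (D.κ - D.K * D.T) with hκ
  have hθ0 : 0 < θ := lt_min (by positivity) r1
  have hκ0 : 0 < κ := lt_min (by positivity) r2
  have hA := D.A_nonneg
  refine h1.unique h2 D.T_le D.hW (A := M * C + 2 * D.A) (C₀ := D.C₀) hθ0 hκ0 (fun η => ?_)
    (fun t ht k η => ?_) (fun t ht k η => ?_) t ht k η
  · refine (D.hP η).trans (mul_le_mul_of_nonneg_left (Real.exp_le_exp.2 ?_) D.C₀_nonneg)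
    have h3 : θ ≤ D.θ := (min_le_right _ _).trans (by
      have := mul_nonneg D.K_pos.le D.T_pos.le
      linarith)
    have := mul_le_mul_of_nonneg_right h3 (norm_nonneg η)
    linarith
  · refine ((hs t ht).norm_freeFourier_le ht.1 (ht.2.trans D.T_le) k η).trans ?_
    have h3 := hCb k
    have h4 : Real.exp (-(Real.pi * σ * ‖η‖ + Real.pi * σ * ‖freq k‖)) ≤
        C * env (Real.pi * σ) (Real.pi * σ / 2) k η := by
      have e : Real.exp (-(Real.pi * σ * ‖η‖ + Real.pi * σ * ‖freq k‖)) =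
          Real.exp (-(Real.pi * σ * ‖η‖ + Real.pi * σ / 2 * ‖freq k‖)) *
            Real.exp (-(Real.pi * σ / 2 * ‖freq k‖)) := by
        rw [← Real.exp_add]; congr 1; ring
      rw [e, env]
      calc _ ≤ Real.exp (-(Real.pi * σ * ‖η‖ + Real.pi * σ / 2 * ‖freq k‖)) * (C * (om k)⁻¹) := by
            gcongr
        _ = _ := by ring
    have h5 := env_anti (min_le_left _ _ : θ ≤ Real.pi * σ) (min_le_left _ _ : κ ≤ Real.pi * σ / 2) k η
    have h6 := (env_pos θ κ k η).le
    calc _ ≤ M * (C * env θ κ k η) := by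
          refine mul_le_mul_of_nonneg_left (h4.trans ?_) hM
          gcongr
      _ ≤ _ := by
          rw [add_mul, ← mul_assoc]
          exact le_add_of_nonneg_right (by positivity)
  · have hKt := mul_le_mul_of_nonneg_left ht.2 D.K_pos.le
    refine (hF.bound t ht k η).trans ?_
    have h5 := env_anti (θ := θ) (θ' := D.θ - D.K * t) (κ := κ) (κ' := D.κ - D.K * t)
      ((min_le_right _ _).trans (by linarith)) ((min_le_right _ _).trans (by linarith)) k η
    have h6 := (env_pos θ κ k η).le
    calc _ ≤ 2 * D.A * env θ κ k η := by gcongr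
      _ ≤ _ := by
          gcongr
          exact le_add_of_nonneg_left (by positivity)

theorem meanFourier_eq (f : E3 → E3 → ℝ) (k : Mode) :
    meanFourier f k = if k = 0 then phaseFourier f 0 0 else 0 := by
  rw [meanFourier, torusFourier_const]
  congr 1
  rw [phaseFourier, torusFourier_eq, ← integral_complex_ofReal]
  congr with x
  rw [velFourier_eq, density, ← integral_complex_ofReal, freq_zero]
  simp

theorem norm_le_sum_norm (z : EuclideanSpace ℂ (Fin 3)) : ‖z‖ ≤ ∑ i, ‖z i‖ := by
  have h : z = ∑ i, EuclideanSpace.single i (z i) := by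
    ext j
    simp [Finset.sum_apply, Pi.single_apply]
  conv_lhs => rw [h]
  refine (norm_sum_le _ _).trans (le_of_eq ?_)
  simp

end Assembly

section Estimates

variable {lam₀ mu₀ lam mu C₀ δ t T : ℝ}

theorem exp_mul_exp_shift_le (hlam : 0 < lam) (hlam' : lam < lam₀) (ht : 0 ≤ t)
    (h : lam₀ * t ≤ mu₀ - mu) (k : Mode) (η : E3) :
    Real.exp (-(2 * Real.pi * lam₀ * ‖η‖)) * Real.exp (-(2 * Real.pi * mu₀ * ‖freq k‖)) ≤
      Real.exp (-(2 * Real.pi * lam * ‖η + t • freq k‖)) *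
        Real.exp (-(2 * Real.pi * mu * ‖freq k‖)) := by
  rw [← Real.exp_add, ← Real.exp_add, Real.exp_le_exp]
  have h1 : ‖η + t • freq k‖ ≤ ‖η‖ + t * ‖freq k‖ := by
    refine (norm_add_le _ _).trans ?_
    rw [norm_smul, Real.norm_of_nonneg ht]
  have h2 : lam * ‖η + t • freq k‖ ≤ lam₀ * (‖η‖ + t * ‖freq k‖) :=
    mul_le_mul hlam'.le h1 (norm_nonneg _) (hlam.trans hlam').le
  have h3 := mul_le_mul_of_nonneg_right h (norm_nonneg (freq k))
  have h4 : lam * ‖η + t • freq k‖ + mu * ‖freq k‖ ≤ lam₀ * ‖η‖ + mu₀ * ‖freq k‖ := by linarith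
  have h5 := mul_le_mul_of_nonneg_left h4 Real.two_pi_pos.le
  linarith

/-- The distance of the fixed point to the transported datum. -/
theorem FourierData.norm_sub_F₀_le {D : FourierData} {F : ℝ → Mode → E3 → ℂ} (hF : D.Adm F)
    (hfix : D.step F = F) (h1 : 2 * Real.pi * lam ≤ D.θ - D.K * D.T)
    (h2 : 2 * Real.pi * mu ≤ D.κ - D.K * D.T)
    (h3 : (bilConst D.a (2 * D.A) / D.K + |D.ν| * (D.C₀ + 1) * D.T) * (2 * D.A) ≤ 1)
    (ht : t ∈ Icc 0 D.T) (k : Mode) (η : E3) : ‖F t k η - D.F₀ k η‖ ≤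
      Real.exp (-(2 * Real.pi * lam * ‖η‖)) * Real.exp (-(2 * Real.pi * mu * ‖freq k‖)) := by
  have e : F t k η - D.F₀ k η = ∫ s in (0 : ℝ)..t, D.rhs F s k η := by
    conv_lhs => rw [← hfix]
    unfold step
    rw [add_sub_cancel_left]
  rw [e]
  refine (norm_integral_rhs_le hF.bound ht k η).trans ?_
  refine (mul_le_of_le_one_left (env_pos _ _ _ _).le h3).trans ?_
  refine (env_le_exp_rates ht k η).trans ?_
  rw [← Real.exp_add, Real.exp_le_exp]
  have h4 := mul_le_mul_of_nonneg_right h1 (norm_nonneg η)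
  have h5 := mul_le_mul_of_nonneg_right h2 (norm_nonneg (freq k))
  linarith

end Estimates

end WeakVP

open WeakVP

theorem proposition3p2 :
    ∃ C : ℝ → ℝ → ℝ,
    ∀ lam₀ mu₀ β γ lam mu : ℝ, 0 < lam → lam < lam₀ → 0 < mu → mu < mu₀ → 0 < β → 1 < γ →
    ∃ ε : ℝ, 0 < ε ∧
    ∀ C₀ ν₀ q m : ℝ, 0 < C₀ → 0 < ν₀ → 0 < m →
    ∃ T : ℝ, 0 < T ∧
    ∀ (δ₀ ν : ℝ) (W p : WeakVP.E3 → ℝ) (f₀ : WeakVP.E3 → WeakVP.E3 → ℝ),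
      0 < δ₀ → δ₀ ≤ ε → 0 < ν → ν ≤ ν₀ →
      WeakVP.IsPotential γ W → WeakVP.IsProfile lam₀ C₀ p →
      WeakVP.IsDatum lam₀ mu₀ β δ₀ p f₀ →
      (∃ f : ℝ → WeakVP.E3 → WeakVP.E3 → ℝ,
        WeakVP.IsAnalyticSolution (q / m) ν T W p f₀ f) ∧
      ∀ f : ℝ → WeakVP.E3 → WeakVP.E3 → ℝ,
        WeakVP.IsAnalyticSolution (q / m) ν T W p f₀ f →
        ∀ t : ℝ, 0 < t → t ≤ T → ∀ k : Fin 3 → ℤ,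
          (∀ η : WeakVP.E3,
            ‖WeakVP.phaseFourier (f t) k η - WeakVP.phaseFourier f₀ k η‖ ≤
              C C₀ δ₀ * Real.exp (-(2 * Real.pi * lam * ‖η + t • WeakVP.freq k‖)) *
                Real.exp (-(2 * Real.pi * mu * ‖WeakVP.freq k‖))) ∧
          ‖WeakVP.torusFourier (fun x => (WeakVP.density (f t) x : ℂ)) k
              - WeakVP.meanFourier f₀ k‖ ≤
            C C₀ δ₀ * Real.exp (-(2 * Real.pi * (lam * t + mu) * ‖WeakVP.freq k‖)) ∧
          ‖WeakVP.fieldFourier (WeakVP.field W (f t)) k‖ ≤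
            C C₀ δ₀ * Real.exp (-(2 * Real.pi * lam * ‖WeakVP.freq k‖ * t)) *
              Real.exp (-(2 * Real.pi * mu * ‖WeakVP.freq k‖)) := by
  refine ⟨fun C₀ δ₀ => 20 * (C₀ + δ₀ + 1), fun lam₀ mu₀ β γ lam mu hlam hlam' hmu hmu' hβ hγ =>
    ⟨1, one_pos, fun C₀ ν₀ q m hC₀ hν₀ hm => ?_⟩⟩
  have hlam₀ : 0 < lam₀ := hlam.trans hlam'
  have hmu₀ : 0 < mu₀ := hmu.trans hmu'
  obtain ⟨T, hT, hlT, hD⟩ := exists_lifespan (ν₀ := ν₀) hlam hlam' hmu hmu' hβ hC₀ (q / m)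
  refine ⟨T, hT, fun δ₀ ν W p f₀ hδ hδ1 hν hν' hW hp hd => ?_⟩
  obtain ⟨D, ha, hDν, hDT, hWh, hP, hF₀, hKT, hθ, hκ, hsm⟩ :=
    hD γ δ₀ ν W p f₀ hγ hδ.le hδ1 (by rwa [abs_of_pos hν]) hW hp hd
  obtain ⟨F, hF, hfix⟩ := D.exists_fixedPoint
  have hpc := hp.contDiff.continuous
  have hpi := hp.integrable hlam₀
  have hF₀' : D.F₀ = phaseFourier f₀ := by
    funext k η
    rw [hF₀, hd.phaseFourier_eq hβ hpc hpi]
  rw [← ha, ← hDν, ← hDT]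
  refine ⟨⟨D.sol F, FourierData.isAnalyticSolution_sol hF hfix hKT hW hγ hpc hpi hWh hP fun x v => ?_⟩,
    fun f hf t ht0 htT k => ?_⟩
  · rw [hF₀]
    exact hd.hasSum hlam₀ hmu₀ hδ.le hβ hC₀.le hp x v
  have ht : t ∈ Icc 0 D.T := ⟨ht0.le, htT⟩
  obtain ⟨σ, M, hs⟩ := hf.exists_isSlice
  have hst := hs t ht
  have hlt : lam₀ * t ≤ mu₀ - mu :=
    (mul_le_mul_of_nonneg_left (htT.trans hDT.le) hlam₀.le).trans hlT
  have hfF : ∀ η, phaseFourier (f t) k η = F t k (η + t • freq k) := fun η => by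
    rw [← freeFourier_eq_of_isAnalyticSolution hF hfix hf hW hγ hpi hWh hP hF₀' ht, freeFourier,
      add_sub_cancel_right]
  have hsub : ∀ η, ‖phaseFourier (f t) k η - phaseFourier f₀ k (η + t • freq k)‖ ≤
      Real.exp (-(2 * Real.pi * lam * ‖η + t • freq k‖)) *
        Real.exp (-(2 * Real.pi * mu * ‖freq k‖)) := fun η => by
    rw [hfF, ← hF₀']
    exact FourierData.norm_sub_F₀_le hF hfix hθ hκ hsm ht k _
  have hdat : ∀ η, ‖phaseFourier f₀ k η‖ ≤ (C₀ + δ₀) *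
      (Real.exp (-(2 * Real.pi * lam₀ * ‖η‖)) * Real.exp (-(2 * Real.pi * mu₀ * ‖freq k‖))) :=
    fun η => by
      rw [hd.phaseFourier_eq hβ hpc hpi, ← mul_assoc]
      exact hd.norm_datumFourier_le hδ.le hβ hC₀.le hp k η
  have hdat₁ : ∀ η, ‖phaseFourier f₀ k η‖ ≤ (C₀ + δ₀) *
      (Real.exp (-(2 * Real.pi * lam * ‖η + t • freq k‖)) *
        Real.exp (-(2 * Real.pi * mu * ‖freq k‖))) := fun η =>
    (hdat η).trans (mul_le_mul_of_nonneg_left (exp_mul_exp_shift_le hlam hlam' ht0.le hlt k η)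
      (by positivity))
  have hdat₂ : ∀ η, ‖phaseFourier f₀ k (η + t • freq k)‖ ≤ (C₀ + δ₀) *
      (Real.exp (-(2 * Real.pi * lam * ‖η + t • freq k‖)) *
        Real.exp (-(2 * Real.pi * mu * ‖freq k‖))) := fun η => by
    refine (hdat _).trans (mul_le_mul_of_nonneg_left ?_ (by positivity))
    simpa using exp_mul_exp_shift_le hlam hlam' le_rfl
      (by simpa using hmu'.le : lam₀ * 0 ≤ mu₀ - mu) k (η + t • freq k)
  have hfirst : ∀ η, ‖phaseFourier (f t) k η - phaseFourier f₀ k η‖ ≤ 20 * (C₀ + δ₀ + 1) *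
      (Real.exp (-(2 * Real.pi * lam * ‖η + t • freq k‖)) *
        Real.exp (-(2 * Real.pi * mu * ‖freq k‖))) := fun η => by
    have e : phaseFourier (f t) k η - phaseFourier f₀ k η =
        phaseFourier (f t) k η - phaseFourier f₀ k (η + t • freq k) +
          (phaseFourier f₀ k (η + t • freq k) - phaseFourier f₀ k η) := by ring
    rw [e]
    refine ((norm_add_le _ _).trans (add_le_add (hsub η) ((norm_sub_le _ _).trans
      (add_le_add (hdat₂ η) (hdat₁ η))))).trans ?_
    set X := Real.exp (-(2 * Real.pi * lam * ‖η + t • freq k‖)) *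
        Real.exp (-(2 * Real.pi * mu * ‖freq k‖))
    have hX : 0 < X := by positivity
    nlinarith [mul_pos hC₀ hX, mul_pos hδ hX]
  have hsecond : ‖phaseFourier (f t) k 0‖ ≤ (C₀ + δ₀ + 1) *
      (Real.exp (-(2 * Real.pi * lam * ‖(0 : E3) + t • freq k‖)) *
        Real.exp (-(2 * Real.pi * mu * ‖freq k‖))) := by
    have e : phaseFourier (f t) k 0 = phaseFourier (f t) k 0 - phaseFourier f₀ k (0 + t • freq k) +
        phaseFourier f₀ k (0 + t • freq k) := by ring
    rw [e]
    refine ((norm_add_le _ _).trans (add_le_add (hsub 0) (hdat₂ 0))).trans (le_of_eq ?_)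
    ring
  have hn : ‖(0 : E3) + t • freq k‖ = t * ‖freq k‖ := by
    rw [zero_add, norm_smul, Real.norm_of_nonneg ht0.le]
  refine ⟨fun η => by rw [mul_assoc]; exact hfirst η, ?_, ?_⟩
  · have e : Real.exp (-(2 * Real.pi * (lam * t + mu) * ‖freq k‖)) =
        Real.exp (-(2 * Real.pi * lam * ‖(0 : E3) + t • freq k‖)) *
          Real.exp (-(2 * Real.pi * mu * ‖freq k‖)) := by
      rw [← Real.exp_add, hn]; congr 1; ring
    rw [hst.torusFourier_density, meanFourier_eq, e]
    split_ifs with hk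
    · have := hfirst 0
      subst hk
      exact this
    · rw [sub_zero]
      refine hsecond.trans (mul_le_mul_of_nonneg_right ?_ (by positivity))
      linarith
  · have e : Real.exp (-(2 * Real.pi * lam * ‖freq k‖ * t)) =
        Real.exp (-(2 * Real.pi * lam * ‖(0 : E3) + t • freq k‖)) := by
      rw [hn]; congr 1; ring
    rw [e]
    set X := Real.exp (-(2 * Real.pi * lam * ‖(0 : E3) + t • freq k‖)) *
        Real.exp (-(2 * Real.pi * mu * ‖freq k‖)) with hXd
    have hX : 0 < X := by positivity
    have h1 : ∀ i, ‖fieldFourier (field W (f t)) k i‖ ≤ 2 * Real.pi * ((C₀ + δ₀ + 1) * X) :=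
      fun i => by
        rw [hst.fieldFourier_apply hW hγ]
        exact (hW.norm_fco_le hγ (f t) i k).trans
          (mul_le_mul_of_nonneg_left hsecond Real.two_pi_pos.le)
    have h2 : 3 * (2 * Real.pi) ≤ 20 := by linarith [Real.pi_lt_d2]
    calc _ ≤ ∑ i, ‖fieldFourier (field W (f t)) k i‖ := norm_le_sum_norm _
      _ ≤ ∑ _i : Fin 3, 2 * Real.pi * ((C₀ + δ₀ + 1) * X) := Finset.sum_le_sum fun i _ => h1 i
      _ = 3 * (2 * Real.pi) * ((C₀ + δ₀ + 1) * X) := by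
        rw [Finset.sum_const, Finset.card_univ, Fintype.card_fin, nsmul_eq_mul]; push_cast; ring
      _ ≤ 20 * ((C₀ + δ₀ + 1) * X) := by gcongr
      _ = _ := by rw [hXd]; ring
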